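/- Let $G$ be a connected orientable Feynman graph of the non-commutative quartic interaction $\bar\phi\star\phi\star\bar\phi\star\phi$: a finite set of vertices $V$, each with four cyclically ordered corners numbered $1,\dots,4$ (corners $1,3$ carry $\bar\phi$, corners $2,4$ carry $\phi$), a finite set $E$ of internal lines, each joining a $\phi$-corner $x_\ell$ to a $\bar\phi$-corner $y_\ell$, every corner being used at most once, and external legs at the unused corners. Let $\Omega,\theta>0$, $\tilde\Omega=2\Omega/\theta$, and let $u\wedge v=u_1v_2-u_2v_1+u_3v_4-u_4v_3+\cdots$ on $\mathbb R^{2m}$, $m\in\mathbb N$. To a line with parameter $t_\ell\in(0,1)$, $u_\ell=(x_\ell-y_\ell)/\sqrt2$, $v_\ell=(x_\ell+y_\ell)/\sqrt2$, associate the exponent $$-\tfrac{\tilde\Omega}{2}\bigl(\tfrac1{t_\ell}u_\ell^2+t_\ell v_\ell^2\bigr)\ \text{(Grosse--Wulkenhaar)},\qquad -\tfrac{\tilde\Omega}2\,\tfrac{1+t_\ell^2}{2t_\ell}u_\ell^2+i\tilde\Omega\,u_\ell\wedge v_\ell\ \text{(Langmann--Szabo--Zarembo, LSZ)},$$ and to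 a vertex with corner positions $x_1,\dots,x_4$ and hypermomentum $p$ the exponent $$i\,p\wedge(x_1-x_2+x_3-x_4)+\tfrac{2i}{\theta}\sum_{1\le i<j\le4}(-1)^{i+j}x_i\wedge x_j .$$ Write the sum of all exponents as $-\sum_{a,b}\mathcal G_{ab}(t)\,(z_a\cdot z_b+i\,z_a\wedge z_b)$ with $\mathcal G(t)$ a real matrix indexed by all corner positions and hypermomenta. Choose a root vertex; the internal variables are the positions of the ends of internal lines and the hypermomenta of the other vertices, and the external variables are the positions of the external legs and the hypermomentum of the root. Let $Q(t)$ be the block of $\mathcal G(t)$ on the internal variables, $R(t)$ the Schur complement of $Q(t)$ on the external variables, and $$HU(t)=\det Q(t)\prod_\ell t_\ell,\qquad \frac{HV(t,s)}{HU(t)}=\sum_{a,b}R_{ab}(t)\,(s_{ab}+i\,s'_{ab}),$$ where the external invariants $s=(s_{ab},s'_{ab})$ of external vectors $x=(x_a)$ in $\mathbb R^{2m}$ are $s_{ab}=x_a\cdot x_b$, $s'_{ab}=x_a\wedge x_b$. For complex space-time dimension $D$ the Feynman amplitude is $$\mathcal A_D(s)=K(D)\int_{(0,1)^E}\prod_{\ell}dt_\ell\,(1-t_\ell^2)^{D/2-1}\;HU(t)^{-D/2}\,e^{-HV(t,s)/HU(t)},$$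 $$K(D)=\bigl(2\tilde\Omega^{D/2-1}(4\pi)^{-D/2}\bigr)^{|E|}(2\pi)^{-D(|V|-1)}\pi^{(2|E|+|V|-1)D/2}.$$ **Theorem.** For every such $G$ there is a closed discrete set $S\subset\mathbb Q\subset\mathbb C$, depending only on $G$, such that for both models, all $\Omega,\theta>0$ (with $\Omega\ne1$ for LSZ), every root and every $m$, the following holds. One has $HU>0$ on $(0,1)^E$, and for $0<\operatorname{Re}D<2$ the integral $\mathcal A_D(s)$ converges absolutely for the invariants $s=s(x)$ of all external vectors $x$ in $\mathbb R^{2m}$. The amplitude extends to a family $(T_D)_{D\in\mathbb C}$ of tempered distributions in the external vectors: for every Schwartz function $f$ of the external vectors, $T_D(f)=\int\mathcal A_D(s(x))f(x)\,dx$ (absolutely convergent) for $0<\operatorname{Re}D<2$, and $D\mapsto T_D(f)$ is meromorphic on all of $\mathbb C$ and analytic outside $S$. Likewise, as a tempered distribution in the external invariants: there is a family $(T'_D)_{D\in\mathbb C}$ of tempered distributions on the space of pairs of real matrices $(s_{ab}),(s'_{ab})$ such that for every Schwartz function $g$ on that space, $T'_D(g)=\int\mathcal A_D(s(x))\,g(s(x))\,dx$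 (absolutely convergent) for $0<\operatorname{Re}D<2$, and $D\mapsto T'_D(g)$ is meromorphic on $\mathbb C$ and analytic outside $S$. -/

import Mathlib

open scoped SchwartzMap

noncomputable section

namespace NCQFT

/-- An orientable Feynman (ribbon) graph of the quartic interaction `φ̄ ⋆ φ ⋆ φ̄ ⋆ φ`, with vertices
`V`, internal lines `E` and (amputated) external legs `X`. Each vertex has four cyclically ordered
corners `0, 1, 2, 3`; the even ones carry `φ̄` and the odd ones `φ`. Every corner is either the
start of exactly one line (a `φ`), or the end of exactly one line (a `φ̄`), or exactly one
external leg. -/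
structure FeynmanGraph (V E X : Type*) where
  corner : (E ⊕ E) ⊕ X ≃ V × Fin 4
  start_odd : ∀ e : E, Odd ((corner (Sum.inl (Sum.inl e))).2 : ℕ)
  end_even : ∀ e : E, Even ((corner (Sum.inl (Sum.inr e))).2 : ℕ)

namespace FeynmanGraph

variable {V E X : Type*}

/-- The corner at which the line `e` starts. -/
def lineStart (G : FeynmanGraph V E X) (e : E) : V × Fin 4 := G.corner (Sum.inl (Sum.inl e))

/-- The corner at which the line `e` ends. -/
def lineEnd (G : FeynmanGraph V E X) (e : E) : V × Fin 4 := G.corner (Sum.inl (Sum.inr e))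

/-- Connectedness of the graph (self-loops and multiple lines are allowed). -/
def Connected (G : FeynmanGraph V E X) : Prop :=
  (SimpleGraph.fromRel fun a b : V => ∃ e : E, (G.lineStart e).1 = a ∧ (G.lineEnd e).1 = b).Connected

end FeynmanGraph

/-- The two renormalizable models: Grosse-Wulkenhaar and Langmann-Szabo-Zarembo. -/
inductive Model
  | GW
  | LSZ

/-- The variables of a graph: a position for each corner and a hypermomentum for each vertex. -/
abbrev Var (V : Type*) := (V × Fin 4) ⊕ V

/-- The variables that are integrated out: the positions of both ends of every internal line and
the hypermomenta of all vertices except the root. -/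
abbrev IntVar {V : Type*} (E : Type*) (root : V) := (E ⊕ E) ⊕ {v : V // v ≠ root}

/-- The variables that are left: the external positions and the hypermomentum of the root. -/
abbrev ExtVar (X : Type*) := X ⊕ Unit

section Forms

variable {I : Type*}

/-- Real matrix `G` of a quadratic expression in vectors `x i` of `ℝ^{2m}`: it stands for
`∑ i j, G i j * (x i ⬝ x j + I * (x i ∧ x j))`; the symmetric part of `G` is the real part and
the antisymmetric part of `G` the imaginary part. `sqForm a` stands for `(∑ a i • x i)^2`. -/
def sqForm (a : I → ℝ) : Matrix I I ℝ := Matrix.vecMulVec a a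

/-- `wedgeForm a b` stands for `I * ((∑ a i • x i) ∧ (∑ b i • x i))`. -/
def wedgeForm (a b : I → ℝ) : Matrix I I ℝ :=
  (1 / 2 : ℝ) • (Matrix.vecMulVec a b - Matrix.vecMulVec b a)

end Forms

section Amplitude

variable {V E X : Type*} [Fintype V] [DecidableEq V] [Fintype E] [DecidableEq E] [Fintype X]

/-- `Ω̃ = 2 Ω / θ`. -/
def OmegaTilde (Ω θ : ℝ) : ℝ := 2 * Ω / θ

/-- Position at a corner, as a linear form in the variables. -/
def posVar (c : V × Fin 4) : Var V → ℝ := Pi.single (Sum.inl c) 1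

/-- Hypermomentum of a vertex, as a linear form in the variables. -/
def momVar (v : V) : Var V → ℝ := Pi.single (Sum.inr v) 1

/-- Short variable `u = (x - y) / √2` of a line from `x` to `y`. -/
def shortVar (G : FeynmanGraph V E X) (e : E) : Var V → ℝ :=
  (Real.sqrt 2)⁻¹ • (posVar (G.lineStart e) - posVar (G.lineEnd e))

/-- Long variable `v = (x + y) / √2` of a line from `x` to `y`. -/
def longVar (G : FeynmanGraph V E X) (e : E) : Var V → ℝ :=
  (Real.sqrt 2)⁻¹ • (posVar (G.lineStart e) + posVar (G.lineEnd e))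

/-- Minus the exponent of the propagator of the line `e`:
`- (Ω̃/2) (1/t) u² - (Ω̃/2) t v²` for Grosse-Wulkenhaar,
`- (Ω̃/2) ((1+t²)/(2t)) u² + i Ω̃ u ∧ v` for Langmann-Szabo-Zarembo. -/
def lineForm (M : Model) (Ω θ : ℝ) (G : FeynmanGraph V E X) (e : E) (t : ℝ) :
    Matrix (Var V) (Var V) ℝ :=
  match M with
  | Model.GW =>
      (OmegaTilde Ω θ / 2 * (1 / t)) • sqForm (shortVar G e)
        + (OmegaTilde Ω θ / 2 * t) • sqForm (longVar G e)
  | Model.LSZ =>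
      (OmegaTilde Ω θ / 2 * ((1 + t ^ 2) / (2 * t))) • sqForm (shortVar G e)
        - OmegaTilde Ω θ • wedgeForm (shortVar G e) (longVar G e)

/-- Minus the exponent of the vertex contribution
`δ(x₁ - x₂ + x₃ - x₄) exp (2 i ∑_{i<j} (-1)^{i+j+1} x_i Θ⁻¹ x_j)`, where
`x Θ⁻¹ y = - θ⁻¹ (x ∧ y)` and
`δ(y) = (2π)^{-D} ∫ exp (i p ∧ y) dp` with the hypermomentum `p`. -/
def vertexForm (θ : ℝ) (v : V) : Matrix (Var V) (Var V) ℝ :=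
  - (wedgeForm (momVar v) (∑ i : Fin 4, (-1 : ℝ) ^ (i : ℕ) • posVar (v, i))
      + ∑ i : Fin 4, ∑ j : Fin 4,
          if i < j then
            (2 * (-1 : ℝ) ^ ((i : ℕ) + (j : ℕ) + 1) * (-θ⁻¹)) •
              wedgeForm (posVar (v, i)) (posVar (v, j))
          else 0)

/-- Minus the total exponent of the Feynman integrand, as a form in all variables. -/
def totalForm (M : Model) (Ω θ : ℝ) (G : FeynmanGraph V E X) (t : E → ℝ) :
    Matrix (Var V) (Var V) ℝ :=
  ∑ e, lineForm M Ω θ G e (t e) + ∑ v, vertexForm θ v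

/-- Inclusion of the integrated variables into all variables. -/
def intIncl (G : FeynmanGraph V E X) (root : V) : IntVar E root → Var V :=
  Sum.map (fun h => G.corner (Sum.inl h)) Subtype.val

/-- Inclusion of the external variables into all variables. -/
def extIncl (G : FeynmanGraph V E X) (root : V) : ExtVar X → Var V :=
  Sum.map (fun x => G.corner (Sum.inr x)) (fun _ => root)

/-- The form in the integrated variables. -/
def Q (M : Model) (Ω θ : ℝ) (G : FeynmanGraph V E X) (root : V) (t : E → ℝ) :
    Matrix (IntVar E root) (IntVar E root) ℝ :=
  (totalForm M Ω θ G t).submatrix (intIncl G root) (intIncl G root)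

/-- The form in the external variables left by the Gaussian integration over the others: the
Schur complement of `Q`. -/
def extForm (M : Model) (Ω θ : ℝ) (G : FeynmanGraph V E X) (root : V) (t : E → ℝ) :
    Matrix (ExtVar X) (ExtVar X) ℝ :=
  (totalForm M Ω θ G t).submatrix (extIncl G root) (extIncl G root)
    - (totalForm M Ω θ G t).submatrix (extIncl G root) (intIncl G root)
      * (Q M Ω θ G root t)⁻¹
      * (totalForm M Ω θ G t).submatrix (intIncl G root) (extIncl G root)

/-- The first polynomial. Over `ℝ^{2m} = ℂ^m` the Gaussian integral of `exp (-z* Q z)` is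
`(π^{#IntVar} / det Q)^m`; the factors `t` of the propagators are included. -/
def HU (M : Model) (Ω θ : ℝ) (G : FeynmanGraph V E X) (root : V) (t : E → ℝ) : ℝ :=
  (∏ e, t e) * (Q M Ω θ G root t).det

/-- External invariants: the scalar products `x_a ⬝ x_b` and the symplectic products `x_a ∧ x_b`
of the external variables. -/
abbrev Invariants (X : Type*) := (ExtVar X → ExtVar X → ℝ) × (ExtVar X → ExtVar X → ℝ)

/-- The second polynomial, as a function of the external invariants. -/
def HV (M : Model) (Ω θ : ℝ) (G : FeynmanGraph V E X) (root : V) (t : E → ℝ)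
    (s : Invariants X) : ℂ :=
  (HU M Ω θ G root t : ℂ) *
    ∑ a, ∑ b, (extForm M Ω θ G root t a b : ℂ) * ((s.1 a b : ℂ) + Complex.I * (s.2 a b : ℂ))

/-- The constant in front of the parametric integral: the factor `2 Ω̃^{D/2-1} (4π)^{-D/2}` of each
propagator, the factor `(2π)^{-D}` of each integrated hypermomentum, and the factor `π^{D/2}` of
each integrated variable. -/
def prefactor (E : Type*) [Fintype E] (Ω θ : ℝ) (root : V) (D : ℂ) : ℂ :=
  (2 * (OmegaTilde Ω θ : ℂ) ^ (D / 2 - 1) * ((4 * Real.pi : ℝ) : ℂ) ^ (-(D / 2))) ^ Fintype.card E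
    * (((2 * Real.pi : ℝ) : ℂ) ^ (-D)) ^ Fintype.card {v : V // v ≠ root}
    * ((Real.pi : ℂ) ^ (D / 2)) ^ Fintype.card (IntVar E root)

/-- The domain `(0,1)^E` of the parameters `t`. -/
def paramDomain (E : Type*) : Set (E → ℝ) := Set.univ.pi fun _ => Set.Ioo 0 1

/-- The integrand of the parametric representation in space-time dimension `D`. -/
def paramIntegrand (M : Model) (Ω θ : ℝ) (G : FeynmanGraph V E X) (root : V) (D : ℂ)
    (s : Invariants X) (t : E → ℝ) : ℂ :=
  (∏ e, ((1 - t e ^ 2 : ℝ) : ℂ) ^ (D / 2 - 1))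
    * (HU M Ω θ G root t : ℂ) ^ (-(D / 2))
    * Complex.exp (-(HV M Ω θ G root t s / (HU M Ω θ G root t : ℂ)))

/-- The Feynman amplitude in space-time dimension `D`, where the integral converges, as a function
of the external invariants. -/
def amplitude (M : Model) (Ω θ : ℝ) (G : FeynmanGraph V E X) (root : V) (D : ℂ)
    (s : Invariants X) : ℂ :=
  prefactor E Ω θ root D * ∫ t in paramDomain E, paramIntegrand M Ω θ G root D s t

end Amplitude

/-- Vectors of `ℝ^{2m}`, with coordinates grouped in the `m` symplectic pairs of `Θ`. -/
abbrev Pos (m : ℕ) := EuclideanSpace ℝ (Fin m × Fin 2)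

/-- `u ∧ v = u₁ v₂ - u₂ v₁ + u₃ v₄ - u₄ v₃ + ⋯`. -/
def wedge {m : ℕ} (u v : Pos m) : ℝ := ∑ k : Fin m, (u (k, 0) * v (k, 1) - u (k, 1) * v (k, 0))

/-- The external invariants of a configuration of external vectors. -/
def invariants {X : Type*} {m : ℕ} (x : ExtVar X → Pos m) : Invariants X :=
  (fun a b => inner ℝ (x a) (x b), fun a b => wedge (x a) (x b))

/-- `T` is a tempered meromorphic distribution on the whole complex plane with singularities in
`S`: for each fixed test function `f`, `D ↦ T D f` is meromorphic on `ℂ` and analytic off `S`. -/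
def IsTemperedMeromorphic {F : Type*} [NormedAddCommGroup F] [NormedSpace ℝ F]
    (S : Set ℂ) (T : ℂ → 𝓢'(F, ℂ)) : Prop :=
  ∀ f : 𝓢(F, ℂ), MeromorphicOn (fun D => T D f) Set.univ ∧ AnalyticOnNhd ℂ (fun D => T D f) Sᶜ

end NCQFT

end

noncomputable section

open MeasureTheory
open scoped Matrix
set_option linter.unusedSectionVars false

namespace NCQFT

/-! ### Sector decomposition of the cube: monomial charts and corners -/

section Sectors

variable {ι : Type*} [Fintype ι]

/-! The parametric integrand degenerates on the boundary of the cube, through the powers of `HU` and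
of `1 - t ^ 2` and through the form `R = extForm`, which may be unbounded there. The cube is covered
by finitely many charts in which every ingredient is a monomial times a function smooth up to the
boundary. Integration by parts in each coordinate then continues the integral in `D`.

Algebra. In the short and long variables of the lines, `Q` is a nonnegative diagonal matrix of line
weights plus a constant antisymmetric matrix. Expanding the determinant in the diagonal weights
(`det_diagonal_add`) produces coefficients that are limits of determinants of accretive matrices,
hence nonnegative. So `HU` is a polynomial of degree at most two in each `t e` with nonnegative
coefficients. The same holds for `HU * det (1 + R)`, and the numerators of the entries of `(1 +
R)⁻¹` over it are dominated by it coefficient by coefficient, up to a factor two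
(`exists_boxPoly_representation`). A parity and propagation argument on the connected graph
(`FeynmanGraph.Connected.kernel_trivial`) shows that the constant part is nondegenerate on vectors
with vanishing short variables. This gives `HU ≥ κ * ∏ t`, and with it positivity and convergence
for `0 < Re D < 2`.

Geometry. Repeated blow-ups `t i = w i * w j` make any two monomials of partial degrees at most two
comparable by divisibility (`exists_monoCover`). In such a chart nonnegative coefficients rule out
cancellation, so each polynomial is its least monomial times a positive smooth function
(`exists_factor`). The charts know only the set of lines, not the model or its constants; this is
why the singular set depends on the graph alone.

Analysis. Although `R` may blow up, `S = (1 + R)⁻¹` is smooth up to the boundary in each chart. The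
normalized Gaussian integral `det (1 + R) ^ m * ∫ exp (-q_R) f` is bounded by a Schwartz seminorm of
`f` uniformly in accretive `R` (`norm_gaussInt_le`). Its derivative along a path is a combination,
with coefficients the entries of `S'`, of the same integrals for `weylOp a b f`
(`hasDerivAt_normGauss`). Hence the smeared integrand in a chart is `∏ w j ^ (κ j * D + l j - 1)`
times a function all of whose derivatives are bounded by seminorms of `f` (`BoxData.exists_leaf`),
and `mellinCube_raise` applies as often as needed.

The exponent of `w j` is `low + (high - α) * D / 2`, where `low` and `high` count the lines tending
to `0` and to `1` and `α ≤ low` is the exponent of `HU`. It has positive real part in the strip, and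
it meets a nonpositive integer only at multiples of `1 / N`, where `N` is divisible by all integers
up to the column sums of the charts. -/

/-- Lebesgue measure on the unit interval. -/
def unitMeasure : Measure ℝ := volume.restrict (Set.Ioo 0 1)

instance : IsProbabilityMeasure unitMeasure :=
  ⟨by simp [unitMeasure]⟩

/-- Lebesgue measure on the open unit cube. -/
def cubeMeasure (ι : Type*) [Fintype ι] : Measure (ι → ℝ) := Measure.pi fun _ => unitMeasure

instance : IsProbabilityMeasure (cubeMeasure ι) := by
  unfold cubeMeasure; infer_instance

theorem cubeMeasure_eq_restrict : cubeMeasure ι = volume.restrict (paramDomain ι) := by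
  rw [cubeMeasure, paramDomain, volume_pi, Measure.restrict_pi_pi]
  rfl

theorem measurableSet_paramDomain : MeasurableSet (paramDomain ι) :=
  MeasurableSet.univ_pi fun _ => measurableSet_Ioo

theorem isOpen_paramDomain : IsOpen (paramDomain ι) :=
  isOpen_set_pi Set.finite_univ fun _ _ => isOpen_Ioo

theorem ae_mem_paramDomain : ∀ᵐ w ∂(cubeMeasure ι), w ∈ paramDomain ι := by
  rw [cubeMeasure_eq_restrict]
  exact ae_restrict_mem measurableSet_paramDomain

theorem mem_paramDomain {w : ι → ℝ} : w ∈ paramDomain ι ↔ ∀ e, 0 < w e ∧ w e < 1 := by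
  simp [paramDomain]

/-- Resampling one coordinate preserves the measure of the cube. -/
theorem measurePreserving_update [DecidableEq ι] (j : ι) :
    MeasurePreserving (fun p : (ι → ℝ) × ℝ => Function.update p.1 j p.2)
      ((cubeMeasure ι).prod unitMeasure) (cubeMeasure ι) := by
  have hm : Measurable (fun p : (ι → ℝ) × ℝ => Function.update p.1 j p.2) := by
    refine measurable_pi_iff.2 fun e => ?_
    by_cases h : e = j
    · subst h; simpa using measurable_snd
    · simp only [Function.update_of_ne h]
      exact (measurable_pi_apply e).comp measurable_fst
  refine ⟨hm, ?_⟩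
  symm
  refine Measure.pi_eq fun s hs => ?_
  rw [Measure.map_apply hm (MeasurableSet.univ_pi hs)]
  have : (fun p : (ι → ℝ) × ℝ => Function.update p.1 j p.2) ⁻¹' (Set.univ.pi s) =
      (Set.univ.pi (Function.update s j Set.univ)) ×ˢ (s j) := by
    ext p
    simp only [Set.mem_preimage, Set.mem_univ_pi, Set.mem_prod]
    constructor
    · intro h
      refine ⟨fun e => ?_, by simpa using h j⟩
      by_cases he : e = j
      · subst he; simp
      · simpa [Function.update_of_ne he] using h e
    · rintro ⟨h1, h2⟩ e
      by_cases he : e = j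
      · subst he; simpa using h2
      · simpa [Function.update_of_ne he] using h1 e
  rw [this, Measure.prod_prod, cubeMeasure, Measure.pi_pi,
    ← Finset.mul_prod_erase _ _ (Finset.mem_univ j), ← Finset.mul_prod_erase _ _ (Finset.mem_univ j)]
  rw [mul_comm]
  simp only [Function.update_self, measure_univ, one_mul]
  congr 1
  refine Finset.prod_congr rfl fun e he => ?_
  rw [Function.update_of_ne (Finset.ne_of_mem_erase he)]

theorem lintegral_update [DecidableEq ι] (j : ι) {h : (ι → ℝ) → ENNReal} (hh : Measurable h) :
    ∫⁻ w, h w ∂(cubeMeasure ι) =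
      ∫⁻ w, ∫⁻ s, h (Function.update w j s) ∂unitMeasure ∂(cubeMeasure ι) := by
  rw [← (measurePreserving_update j).lintegral_comp hh, lintegral_prod]
  exact (hh.comp (measurePreserving_update j).measurable).aemeasurable

/-- The monomial map with exponent matrix `A`. -/
def mono (A : Matrix ι ι ℕ) (w : ι → ℝ) (e : ι) : ℝ := ∏ j, w j ^ A e j

/-- The Jacobian of a unimodular monomial map. -/
def monoJac (A : Matrix ι ι ℕ) (w : ι → ℝ) : ℝ := (∏ e, mono A w e) / ∏ j, w j

theorem measurable_mono (A : Matrix ι ι ℕ) : Measurable (mono A) :=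
  measurable_pi_iff.2 fun e => by unfold mono; fun_prop

theorem measurable_monoJac (A : Matrix ι ι ℕ) : Measurable (monoJac A) := by
  unfold monoJac mono; fun_prop

theorem mono_mul (A B : Matrix ι ι ℕ) (w : ι → ℝ) : mono (A * B) w = mono A (mono B w) := by
  ext e
  simp only [mono, Matrix.mul_apply, ← Finset.prod_pow, ← pow_mul]
  rw [Finset.prod_comm]
  refine Finset.prod_congr rfl fun l _ => ?_
  rw [Finset.prod_pow_eq_pow_sum]
  congr 1
  exact Finset.sum_congr rfl fun j _ => mul_comm _ _

theorem mono_pos (A : Matrix ι ι ℕ) {w : ι → ℝ} (hw : ∀ j, 0 < w j) (e : ι) : 0 < mono A w e :=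
  Finset.prod_pos fun j _ => pow_pos (hw j) _

/-- A finite family of monomial charts which covers the cube up to null sets. -/
def IsMonoCover {κ : Type} [Fintype κ] (A : κ → Matrix ι ι ℕ) : Prop :=
  ∀ h : (ι → ℝ) → ENNReal, Measurable h →
    ∫⁻ t, h t ∂(cubeMeasure ι) =
      ∑ k, ∫⁻ w, h (mono (A k) w) * ENNReal.ofReal (monoJac (A k) w) ∂(cubeMeasure ι)

/-- The Jacobian is multiplicative under composition: the product of the coordinates of `mono B w`
cancels between the two quotients. Since a cover is tested on all measurable functions, the second
one may be applied to the integrand of the first, Jacobian included. -/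
theorem IsMonoCover.comp {κ : Type} [Fintype κ] {A : κ → Matrix ι ι ℕ} (hA : IsMonoCover A)
    {l : κ → Type} [∀ k, Fintype (l k)] {B : ∀ k, l k → Matrix ι ι ℕ}
    (hB : ∀ k, IsMonoCover (B k)) :
    IsMonoCover (fun p : Σ k, l k => A p.1 * B p.1 p.2) := by
  intro h hh
  rw [hA h hh, Fintype.sum_sigma]
  refine Finset.sum_congr rfl fun k _ => ?_
  rw [hB k (fun w => h (mono (A k) w) * ENNReal.ofReal (monoJac (A k) w)) ((hh.comp (measurable_mono _)).mul (measurable_monoJac _).ennreal_ofReal)]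
  refine Finset.sum_congr rfl fun i _ => ?_
  refine lintegral_congr_ae ?_
  filter_upwards [ae_mem_paramDomain] with w hw
  have hw' : ∀ j, 0 < w j := fun j => (mem_paramDomain.1 hw j).1
  rw [mono_mul, mul_assoc, ← ENNReal.ofReal_mul]
  · congr 2
    unfold monoJac
    rw [mono_mul, div_mul_div_cancel₀]
    exact (Finset.prod_pos fun j _ => mono_pos _ hw' j).ne'
  · exact div_nonneg (Finset.prod_nonneg fun j _ => (mono_pos _ (mono_pos _ hw') j).le)
      (Finset.prod_nonneg fun j _ => (mono_pos _ hw' j).le)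

theorem isMonoCover_one [DecidableEq ι] : IsMonoCover (fun _ : Unit => (1 : Matrix ι ι ℕ)) := by
  intro h hh
  have h1 : ∀ w : ι → ℝ, mono (1 : Matrix ι ι ℕ) w = w := by
    intro w; ext e
    simp [mono, Matrix.one_apply]
  simp only [Finset.univ_unique, Finset.sum_singleton]
  refine lintegral_congr_ae ?_
  filter_upwards [ae_mem_paramDomain] with w hw
  have : monoJac (1 : Matrix ι ι ℕ) w = 1 := by
    rw [monoJac, h1]
    exact div_self (Finset.prod_pos fun j _ => (mem_paramDomain.1 hw j).1).ne'
  rw [h1, this]; simp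

variable [DecidableEq ι]

/-- The exponent matrix of the blow-up chart `t i = w i * w j`. -/
def blowMatrix (i j : ι) : Matrix ι ι ℕ := 1 + Matrix.single i j 1

theorem mono_blowMatrix (i j : ι) (w : ι → ℝ) :
    mono (blowMatrix i j) w = Function.update w i (w i * w j) := by
  ext e
  simp only [mono, blowMatrix, Matrix.add_apply, pow_add, Finset.prod_mul_distrib]
  have h1 : ∏ x, w x ^ (1 : Matrix ι ι ℕ) e x = w e := by simp [Matrix.one_apply]
  rw [h1]
  by_cases he : e = i
  · subst he
    simp [Matrix.single_apply]
  · have : ∀ x, ¬ (i = e ∧ j = x) := fun x h => he h.1.symm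
    simp [this, he]

theorem monoJac_blowMatrix (i j : ι) {w : ι → ℝ} (hw : w ∈ paramDomain ι) :
    monoJac (blowMatrix i j) w = w j := by
  have hw' : ∀ j, w j ≠ 0 := fun j => (mem_paramDomain.1 hw j).1.ne'
  rw [monoJac, mono_blowMatrix, div_eq_iff (Finset.prod_ne_zero_iff.2 fun j _ => hw' j),
    Finset.prod_update_of_mem (Finset.mem_univ i),
    ← Finset.mul_prod_erase _ w (Finset.mem_univ i), Finset.sdiff_singleton_eq_erase]
  ring

theorem lintegral_unit_scale {c : ℝ} (hc0 : 0 < c) (hc1 : c < 1) {g : ℝ → ENNReal}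
    (hg : Measurable g) :
    ∫⁻ s, g (s * c) * ENNReal.ofReal c ∂unitMeasure =
      ∫⁻ s, (Set.Iio c).indicator g s ∂unitMeasure := by
  have hgc : Measurable fun s => g (s * c) := hg.comp (measurable_id.mul_const c)
  rw [lintegral_mul_const _ hgc,
    lintegral_indicator measurableSet_Iio, unitMeasure, Measure.restrict_restrict measurableSet_Iio]
  have h1 : Set.Iio c ∩ Set.Ioo (0:ℝ) 1 = Set.Ioo 0 c := by
    ext x; simp only [Set.mem_inter_iff, Set.mem_Iio, Set.mem_Ioo]
    constructor
    · rintro ⟨a, b, _⟩; exact ⟨b, a⟩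
    · rintro ⟨a, b⟩; exact ⟨b, a, b.trans hc1⟩
  rw [h1]
  have h2 : Set.Ioo (0:ℝ) c = (fun s => s * c) '' Set.Ioo (0:ℝ) 1 := by
    rw [Set.image_mul_right_Ioo _ _ hc0]; simp
  rw [h2, lintegral_image_eq_lintegral_abs_deriv_mul measurableSet_Ioo
    (f' := fun _ => c) (fun x _ => by simpa using ((hasDerivAt_id x).mul_const c).hasDerivWithinAt)
    (fun x _ y _ h => mul_right_cancel₀ hc0.ne' h), lintegral_const_mul _ hgc, abs_of_pos hc0, mul_comm]

/-- Freeze the other coordinates and resample coordinate `i`: the substitution `s ↦ s * w j` carries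
`(0,1)` onto `(0, w j)` with Jacobian `w j`. The chart therefore sees exactly the half of the cube
below the diagonal. -/
theorem lintegral_blow {i j : ι} (hij : i ≠ j) {h : (ι → ℝ) → ENNReal} (hh : Measurable h) :
    ∫⁻ w, h (mono (blowMatrix i j) w) * ENNReal.ofReal (monoJac (blowMatrix i j) w)
        ∂(cubeMeasure ι) =
      ∫⁻ w, {w | w i < w j}.indicator h w ∂(cubeMeasure ι) := by
  have hS : MeasurableSet {w : ι → ℝ | w i < w j} :=
    measurableSet_lt (measurable_pi_apply i) (measurable_pi_apply j)
  rw [lintegral_update i (hh.indicator hS), lintegral_update i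
    (h := fun w => h (mono (blowMatrix i j) w) * ENNReal.ofReal (monoJac (blowMatrix i j) w))
    ((hh.comp (measurable_mono _)).mul (measurable_monoJac _).ennreal_ofReal)]
  refine lintegral_congr_ae ?_
  filter_upwards [ae_mem_paramDomain] with w hw
  have hj := mem_paramDomain.1 hw j
  have := lintegral_unit_scale hj.1 hj.2 (g := fun s => h (Function.update w i s))
    (hh.comp (measurable_update w))
  calc _ = ∫⁻ s, h (Function.update w i (s * w j)) * ENNReal.ofReal (w j) ∂unitMeasure := by
        refine lintegral_congr_ae ?_
        have h0 : ∀ᵐ s ∂unitMeasure, s ∈ Set.Ioo (0:ℝ) 1 := ae_restrict_mem measurableSet_Ioo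
        filter_upwards [h0] with s hs
        rw [monoJac_blowMatrix i j, mono_blowMatrix]
        · simp [Function.update_of_ne hij.symm]
        · refine mem_paramDomain.2 fun e => ?_
          by_cases he : e = i
          · subst he; simpa using hs
          · simpa [Function.update_of_ne he] using mem_paramDomain.1 hw e
    _ = _ := by
        rw [this]
        refine lintegral_congr fun s => ?_
        simp only [Set.indicator_apply, Set.mem_Iio, Set.mem_ofPred_eq, Function.update_self,
          Function.update_of_ne hij.symm]

theorem cubeMeasure_diagonal {i j : ι} (hij : i ≠ j) :
    ∀ᵐ w ∂(cubeMeasure ι), w i ≠ w j := by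
  have hS : MeasurableSet {w : ι → ℝ | w i = w j} :=
    measurableSet_eq_fun (measurable_pi_apply i) (measurable_pi_apply j)
  have : cubeMeasure ι {w : ι → ℝ | w i = w j} = 0 := by
    rw [← lintegral_indicator_one hS, lintegral_update i (measurable_one.indicator hS)]
    refine (lintegral_congr fun w => ?_).trans lintegral_zero
    have : (fun s => {w : ι → ℝ | w i = w j}.indicator (1 : (ι → ℝ) → ENNReal)
        (Function.update w i s)) = ({w j} : Set ℝ).indicator 1 := by
      ext s
      simp [Set.indicator_apply, Function.update_of_ne hij.symm]
    rw [this, lintegral_indicator_one (measurableSet_singleton _)]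
    exact le_antisymm ((Measure.restrict_apply_le _ _).trans (by simp)) zero_le
  simpa [ae_iff] using this

/-- The two charts fill the two sides of the diagonal, which is a null set. -/
theorem isMonoCover_blow {i j : ι} (hij : i ≠ j) :
    IsMonoCover (fun b : Bool => if b then blowMatrix i j else blowMatrix j i) := by
  intro h hh
  have hS : MeasurableSet {w : ι → ℝ | w i < w j} :=
    measurableSet_lt (measurable_pi_apply i) (measurable_pi_apply j)
  rw [Fintype.sum_bool]
  simp only [if_true, Bool.false_eq_true, if_false]
  rw [lintegral_blow hij hh, lintegral_blow hij.symm hh, ← lintegral_add_left (hh.indicator hS)]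
  refine lintegral_congr_ae ?_
  filter_upwards [cubeMeasure_diagonal hij] with w hw
  rcases lt_or_gt_of_ne hw with h1 | h1
  · simp [h1, not_lt.2 h1.le]
  · simp [h1, not_lt.2 h1.le]

/-- The exponents of a monomial after a monomial substitution. -/
def pullExp (d : ι → ℤ) (A : Matrix ι ι ℕ) (j : ι) : ℤ := ∑ e, d e * (A e j : ℤ)

theorem pullExp_mul (d : ι → ℤ) (A B : Matrix ι ι ℕ) :
    pullExp d (A * B) = pullExp (pullExp d A) B := by
  ext l
  simp only [pullExp, Matrix.mul_apply, Nat.cast_sum, Nat.cast_mul, Finset.mul_sum, Finset.sum_mul]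
  rw [Finset.sum_comm]
  exact Finset.sum_congr rfl fun j _ => Finset.sum_congr rfl fun e _ => by ring

theorem pullExp_one (d : ι → ℤ) : pullExp d 1 = d := by
  ext l
  simp [pullExp, Matrix.one_apply]

theorem pullExp_neg (d : ι → ℤ) (A : Matrix ι ι ℕ) (j : ι) :
    pullExp (fun e => - d e) A j = - pullExp d A j := by
  simp [pullExp, Finset.sum_neg_distrib]

/-- A blow-up acts on exponents like a step of the Euclidean algorithm: entries of opposite sign
partly cancel. This drives the termination argument below. -/
theorem pullExp_blow (d : ι → ℤ) (i j : ι) :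
    pullExp d (blowMatrix i j) = Function.update d j (d j + d i) := by
  ext l
  simp only [pullExp, blowMatrix, Matrix.add_apply, Nat.cast_add, mul_add, Finset.sum_add_distrib]
  have h1 : ∑ x, d x * ((1 : Matrix ι ι ℕ) x l : ℤ) = d l := by simp [Matrix.one_apply]
  rw [h1]
  by_cases hl : l = j
  · subst hl
    simp [Matrix.single_apply]
  · have : ∀ x, ¬ (i = x ∧ j = l) := fun x h => hl h.2.symm
    simp [this, hl]

theorem pullExp_nonneg {d : ι → ℤ} (hd : ∀ e, 0 ≤ d e) (A : Matrix ι ι ℕ) (j : ι) :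
    0 ≤ pullExp d A j :=
  Finset.sum_nonneg fun e _ => mul_nonneg (hd e) (by positivity)

/-- All entries of `d` have the same sign. -/
def OneSigned (d : ι → ℤ) : Prop := (∀ e, 0 ≤ d e) ∨ (∀ e, d e ≤ 0)

theorem OneSigned.pull {d : ι → ℤ} (hd : OneSigned d) (A : Matrix ι ι ℕ) :
    OneSigned (pullExp d A) := by
  rcases hd with h | h
  · exact Or.inl (pullExp_nonneg h A)
  · refine Or.inr fun j => ?_
    have := pullExp_nonneg (d := fun e => - d e) (fun e => by simpa using h e) A j
    rw [pullExp_neg] at this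
    linarith

/-- A monomial cover in whose charts `P` holds. -/
def Coverable (P : Matrix ι ι ℕ → Prop) : Prop :=
  ∃ (κ : Type) (_ : Fintype κ) (A : κ → Matrix ι ι ℕ), IsMonoCover A ∧
    (∀ k e, 0 < A k e e) ∧ ∀ k, P (A k)

/-- Positive diagonal entries are carried along because they keep the charts inside the open cube
and make every column sum positive; the location of the poles rests on the latter. -/
theorem diag_pos_mul {A B : Matrix ι ι ℕ} (hA : ∀ e, 0 < A e e) (hB : ∀ e, 0 < B e e) (e : ι) :
    0 < (A * B) e e := by
  rw [Matrix.mul_apply]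
  exact lt_of_lt_of_le (Nat.mul_pos (hA e) (hB e))
    (Finset.single_le_sum (f := fun x => A e x * B x e) (fun _ _ => Nat.zero_le _)
      (Finset.mem_univ e))

theorem coverable_one {P : Matrix ι ι ℕ → Prop} (h : P 1) : Coverable P :=
  ⟨Unit, inferInstance, fun _ => 1, isMonoCover_one, fun _ e => by simp, fun _ => h⟩

theorem Coverable.bind {P P' : Matrix ι ι ℕ → Prop} (h : Coverable P)
    (h' : ∀ A, P A → Coverable fun B => P' (A * B)) : Coverable P' := by
  obtain ⟨κ, _, A, hA, hd, hP⟩ := h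
  choose l il B hB hdB hPB using fun k => h' (A k) (hP k)
  exact ⟨Σ k, l k, inferInstance, fun p => A p.1 * B p.1 p.2, hA.comp hB,
    fun p e => diag_pos_mul (hd p.1) (hdB p.1 p.2) e, fun p => hPB p.1 p.2⟩

theorem coverable_of_blow {P : Matrix ι ι ℕ → Prop} {i j : ι} (hij : i ≠ j)
    (h1 : Coverable fun B => P (blowMatrix i j * B))
    (h2 : Coverable fun B => P (blowMatrix j i * B)) : Coverable P := by
  have h0 : Coverable fun A : Matrix ι ι ℕ => A = blowMatrix i j ∨ A = blowMatrix j i := by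
    refine ⟨Bool, inferInstance, _, isMonoCover_blow hij, fun k e => ?_, fun k => ?_⟩
    · cases k <;> simp [blowMatrix]
    · cases k <;> simp
  refine h0.bind ?_
  rintro A (rfl | rfl)
  · exact h1
  · exact h2

theorem coverable_oneSigned_of_neg {d : ι → ℤ}
    (h : Coverable fun A => OneSigned (pullExp (fun e => - d e) A)) :
    Coverable fun A => OneSigned (pullExp d A) := by
  obtain ⟨κ, i, A, hA, hd, hP⟩ := h
  refine ⟨κ, i, A, hA, hd, fun k => ?_⟩
  rcases hP k with h | h
  · exact Or.inr fun j => by have := h j; rw [pullExp_neg] at this; linarith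
  · exact Or.inl fun j => by have := h j; rw [pullExp_neg] at this; linarith

/-- Blow up the coordinates of the maximal entry `d i = M` and of a negative entry `d j`. In both
charts the changed entry becomes `d i + d j`, which lies in `[0, M - 1]`. In one chart a negative
entry disappears and the number of extremal entries does not grow; in the other an extremal entry
disappears and the outer induction `ih` applies. -/
theorem coverable_oneSigned_aux (M : ℕ) (hM : 0 < M) (k : ℕ)
    (ih : ∀ d : ι → ℤ, (∀ e, |d e| ≤ M) → (Finset.univ.filter fun e => |d e| = M).card ≤ k →
      Coverable fun A => OneSigned (pullExp d A)) (o : ℕ) :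
    ∀ (d : ι → ℤ) (i : ι), (∀ e, |d e| ≤ M) → d i = M →
      (Finset.univ.filter fun e => |d e| = M).card ≤ k + 1 →
      (Finset.univ.filter fun e => d e < 0).card ≤ o →
      Coverable fun A => OneSigned (pullExp d A) := by
  induction o with
  | zero =>
    intro d i _ _ _ ho
    refine coverable_one ?_
    rw [pullExp_one]
    refine Or.inl fun e => ?_
    by_contra hneg
    have : e ∈ Finset.univ.filter fun e => d e < 0 := by simpa using hneg
    rw [Finset.card_eq_zero.1 (Nat.le_zero.1 ho)] at this
    simp at this
  | succ o iho =>
    intro d i hb hi hk ho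
    by_cases hall : ∀ e, 0 ≤ d e
    · refine coverable_one ?_
      rw [pullExp_one]
      exact Or.inl hall
    push Not at hall
    obtain ⟨j, hj⟩ := hall
    have hij : i ≠ j := by rintro rfl; rw [hi] at hj; omega
    have hbj := abs_le.1 (hb j)
    refine coverable_of_blow hij ?_ ?_
    · simp only [pullExp_mul]
      rw [pullExp_blow]
      have hnew : ∀ e, e ≠ j → Function.update d j (d j + d i) e = d e := fun e he => by simp [he]
      refine iho _ i ?_ ?_ ?_ ?_
      · intro e
        by_cases he : e = j
        · subst he; rw [Function.update_self, abs_le]; constructor <;> omega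
        · rw [hnew e he]; exact hb e
      · rw [hnew i hij]; exact hi
      · refine le_trans (Finset.card_le_card ?_) hk
        intro e
        simp only [Finset.mem_filter, Finset.mem_univ, true_and]
        by_cases he : e = j
        · subst he; rw [Function.update_self, abs_of_nonneg (by omega)]; intro h; omega
        · rw [hnew e he]; exact id
      · have hmem : j ∈ Finset.univ.filter fun e => d e < 0 := by simpa using hj
        have hsub : (Finset.univ.filter fun e => Function.update d j (d j + d i) e < 0) ⊆
            (Finset.univ.filter fun e => d e < 0).erase j := by
          intro e
          simp only [Finset.mem_filter, Finset.mem_univ, true_and, Finset.mem_erase]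
          by_cases he : e = j
          · subst he; rw [Function.update_self]; intro h; omega
          · rw [hnew e he]; exact fun h => ⟨he, h⟩
        have := Finset.card_le_card hsub
        rw [Finset.card_erase_of_mem hmem] at this
        omega
    · simp only [pullExp_mul]
      rw [pullExp_blow]
      have hnew : ∀ e, e ≠ i → Function.update d i (d i + d j) e = d e := fun e he => by simp [he]
      refine ih _ ?_ ?_
      · intro e
        by_cases he : e = i
        · subst he; rw [Function.update_self, abs_le]; constructor <;> omega
        · rw [hnew e he]; exact hb e
      · have hmem : i ∈ Finset.univ.filter fun e => |d e| = M := by simp [hi]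
        have hsub : (Finset.univ.filter fun e => |Function.update d i (d i + d j) e| = M) ⊆
            (Finset.univ.filter fun e => |d e| = M).erase i := by
          intro e
          simp only [Finset.mem_filter, Finset.mem_univ, true_and, Finset.mem_erase]
          by_cases he : e = i
          · subst he; rw [Function.update_self, abs_of_nonneg (by omega)]; intro h; omega
          · rw [hnew e he]; exact fun h => ⟨he, h⟩
        have := Finset.card_le_card hsub
        rw [Finset.card_erase_of_mem hmem] at this
        omega

/-- Lexicographic induction on the bound `M`, the number of entries of absolute value `M`, and the
number of negative entries. If the extremal entry is negative, `d` is replaced by `-d`, for which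
the same charts work. -/
theorem coverable_oneSigned (d : ι → ℤ) : Coverable fun A => OneSigned (pullExp d A) := by
  suffices H : ∀ M : ℕ, ∀ d : ι → ℤ, (∀ e, |d e| ≤ M) →
      Coverable fun A => OneSigned (pullExp d A) by
    refine H (∑ e, (d e).natAbs) d fun e => ?_
    rw [Int.abs_eq_natAbs]
    exact_mod_cast Finset.single_le_sum (f := fun e => (d e).natAbs) (fun _ _ => Nat.zero_le _)
      (Finset.mem_univ e)
  intro M
  induction M with
  | zero =>
    intro d hd
    refine coverable_one ?_
    rw [pullExp_one]
    exact Or.inl fun e => le_of_eq (abs_eq_zero.1 (le_antisymm (by simpa using hd e)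
      (abs_nonneg _))).symm
  | succ M ihM =>
    suffices H : ∀ k : ℕ, ∀ d : ι → ℤ, (∀ e, |d e| ≤ (M + 1 : ℕ)) →
        (Finset.univ.filter fun e => |d e| = (M + 1 : ℕ)).card ≤ k →
        Coverable fun A => OneSigned (pullExp d A) from fun d hd => H _ d hd le_rfl
    intro k
    induction k with
    | zero =>
      intro d hd hk
      refine ihM d fun e => ?_
      have hne : |d e| ≠ (M + 1 : ℕ) := fun h => by
        have : e ∈ Finset.univ.filter fun e => |d e| = (M + 1 : ℕ) := by simpa using h
        rw [Finset.card_eq_zero.1 (Nat.le_zero.1 hk)] at this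
        simp at this
      have := hd e
      omega
    | succ k ihk =>
      intro d hd hk
      by_cases hex : ∃ i, |d i| = (M + 1 : ℕ)
      · obtain ⟨i, hi⟩ := hex
        rcases abs_eq (by positivity) |>.1 hi with h | h
        · exact coverable_oneSigned_aux (M + 1) (Nat.succ_pos _) k ihk _ d i hd h hk le_rfl
        · refine coverable_oneSigned_of_neg ?_
          exact coverable_oneSigned_aux (M + 1) (Nat.succ_pos _) k ihk _ (fun e => - d e) i
            (by simpa using hd) (by simp [h]) (by simpa using hk) le_rfl
      · push Not at hex
        exact ihM d fun e => by have := hd e; have := hex e; omega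

/-- A one-signed vector stays one-signed under every further substitution, because chart matrices
have nonnegative entries. So the vectors can be treated one after the other. -/
theorem coverable_oneSigned_finset (s : Finset (ι → ℤ)) :
    Coverable fun A => ∀ d ∈ s, OneSigned (pullExp d A) := by
  classical
  induction s using Finset.induction_on with
  | empty => exact coverable_one (by simp)
  | insert d s _ ih =>
    refine ih.bind fun A hA => ?_
    obtain ⟨κ, i, B, hB, hd, hP⟩ := coverable_oneSigned (pullExp d A)
    refine ⟨κ, i, B, hB, hd, fun k => ?_⟩
    intro d' hd'
    rw [pullExp_mul]
    rcases Finset.mem_insert.1 hd' with rfl | h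
    · exact hP k
    · exact (hA d' h).pull _

/-- The exponent vector of `∏ t e ^ a e` in the chart `A`. -/
def boxExp (a : ι → Fin 3) (A : Matrix ι ι ℕ) (j : ι) : ℕ := ∑ e, (a e : ℕ) * A e j

/-- There is a monomial cover in whose charts any two monomials of partial degrees at most two
are comparable by divisibility. -/
theorem exists_monoCover (ι : Type*) [Fintype ι] [DecidableEq ι] :
    Coverable fun A : Matrix ι ι ℕ => ∀ a b : ι → Fin 3,
      (∀ j, boxExp a A j ≤ boxExp b A j) ∨ (∀ j, boxExp b A j ≤ boxExp a A j) := by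
  classical
  -- Divisibility in one direction or the other means that the difference of the exponent vectors is
  -- one-signed after the substitution, and only finitely many differences occur.
  obtain ⟨κ, i, A, hA, hd, hP⟩ := coverable_oneSigned_finset (ι := ι)
    (Finset.univ.image fun p : (ι → Fin 3) × (ι → Fin 3) =>
      fun e => ((p.1 e : ℕ) : ℤ) - ((p.2 e : ℕ) : ℤ))
  refine ⟨κ, i, A, hA, hd, fun k a b => ?_⟩
  have key : ∀ j, pullExp (fun e => ((a e : ℕ) : ℤ) - ((b e : ℕ) : ℤ)) (A k) j =
      (boxExp a (A k) j : ℤ) - boxExp b (A k) j := fun j => by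
    simp [pullExp, boxExp, sub_mul, Finset.sum_sub_distrib]
  rcases hP k _ (Finset.mem_image_of_mem _ (Finset.mem_univ (a, b))) with h | h
  · exact Or.inr fun j => by have := h j; rw [key] at this; omega
  · exact Or.inl fun j => by have := h j; rw [key] at this; omega

/-- The affine chart of the cube near the corner selected by `T`. -/
def cornerMap (T : ι → Bool) (w : ι → ℝ) (e : ι) : ℝ := if T e then 1 - w e / 2 else w e / 2

theorem measurable_cornerMap (T : ι → Bool) : Measurable (cornerMap T) := by
  refine measurable_pi_iff.2 fun e => ?_
  unfold cornerMap
  split_ifs <;> fun_prop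

theorem lintegral_unit_reflect {g : ℝ → ENNReal} (hg : Measurable g) :
    ∫⁻ s, g (1 - s) ∂unitMeasure = ∫⁻ s, g s ∂unitMeasure := by
  have h := (Measure.measurePreserving_sub_left (volume : Measure ℝ) 1).restrict_preimage
    (s := Set.Ioo (0:ℝ) 1) measurableSet_Ioo
  have h2 : (fun x : ℝ => 1 - x) ⁻¹' Set.Ioo (0:ℝ) 1 = Set.Ioo 0 1 := by
    ext x; simp only [Set.mem_preimage, Set.mem_Ioo]; constructor <;> rintro ⟨a, b⟩ <;>
      constructor <;> linarith
  rw [h2] at h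
  exact h.lintegral_comp hg

/-- The left half is rescaled, the right half reflected and rescaled, so that both endpoints of the
interval become the origin of a chart. -/
theorem unitMeasure_split {s : Set ℝ} (hs : MeasurableSet s) :
    unitMeasure s = ∑ b : Bool, ENNReal.ofReal (1 / 2) *
      unitMeasure ((fun x : ℝ => if b then 1 - x / 2 else x / 2) ⁻¹' s) := by
  have hm : Measurable (s.indicator (1 : ℝ → ENNReal)) := measurable_one.indicator hs
  have h0 := lintegral_unit_scale (c := 1 / 2) (by norm_num) (by norm_num) hm
  have h1 := lintegral_unit_scale (c := 1 / 2) (by norm_num) (by norm_num)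
    (g := fun x => s.indicator (1 : ℝ → ENNReal) (1 - x)) (hm.comp (by fun_prop))
  have h2 := lintegral_unit_reflect (g := (Set.Ioi (1 / 2 : ℝ)).indicator
    (s.indicator (1 : ℝ → ENNReal))) (hm.indicator measurableSet_Ioi)
  have e0 : ∫⁻ x, s.indicator (1 : ℝ → ENNReal) (x * (1 / 2)) * ENNReal.ofReal (1 / 2)
      ∂unitMeasure = ENNReal.ofReal (1 / 2) * unitMeasure ((fun x : ℝ => x / 2) ⁻¹' s) := by
    have hm' : Measurable fun x : ℝ => s.indicator (1 : ℝ → ENNReal) (x * (1 / 2)) :=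
      hm.comp (measurable_id.mul_const _)
    rw [lintegral_mul_const _ hm', mul_comm,
      ← lintegral_indicator_one (s := (fun x : ℝ => x / 2) ⁻¹' s)
        (hs.preimage (measurable_id.div_const 2))]
    simp only [mul_one_div]; rfl
  have e1 : ∫⁻ x, s.indicator (1 : ℝ → ENNReal) (1 - x * (1 / 2)) * ENNReal.ofReal (1 / 2)
      ∂unitMeasure = ENNReal.ofReal (1 / 2) * unitMeasure ((fun x : ℝ => 1 - x / 2) ⁻¹' s) := by
    have hm' : Measurable fun x : ℝ => s.indicator (1 : ℝ → ENNReal) (1 - x * (1 / 2)) :=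
      hm.comp ((measurable_id.mul_const _).const_sub _)
    rw [lintegral_mul_const _ hm', mul_comm,
      ← lintegral_indicator_one (s := (fun x : ℝ => 1 - x / 2) ⁻¹' s)
        (hs.preimage ((measurable_id.div_const 2).const_sub 1))]
    simp only [mul_one_div]; rfl
  rw [Fintype.sum_bool]
  simp only [if_true, Bool.false_eq_true, if_false]
  rw [← e0, ← e1, h0, h1]
  have e2 : ∫⁻ x, (Set.Iio (1 / 2 : ℝ)).indicator
      (fun x => s.indicator (1 : ℝ → ENNReal) (1 - x)) x ∂unitMeasure =
      ∫⁻ x, (Set.Ioi (1 / 2 : ℝ)).indicator (s.indicator (1 : ℝ → ENNReal)) x ∂unitMeasure := by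
    rw [← h2]
    refine lintegral_congr fun x => ?_
    have : x < 1 / 2 ↔ 1 / 2 < 1 - x := by constructor <;> intro h <;> linarith
    simp only [Set.indicator_apply, Set.mem_Iio, Set.mem_Ioi, this]
  rw [e2, ← lintegral_add_left (hm.indicator measurableSet_Ioi), ← lintegral_indicator_one hs]
  refine lintegral_congr_ae ?_
  have hne : ∀ᵐ x ∂unitMeasure, x ≠ (1 / 2 : ℝ) := by
    refine ae_restrict_of_ae ?_
    simp [ae_iff]
  filter_upwards [hne] with x hx
  rcases lt_or_gt_of_ne hx with h | h
  · rw [Set.indicator_of_notMem (s := Set.Ioi (1 / 2 : ℝ)) (by simpa using h.le),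
      Set.indicator_of_mem (s := Set.Iio (1 / 2 : ℝ)) (by simpa using h), zero_add]
  · rw [Set.indicator_of_mem (s := Set.Ioi (1 / 2 : ℝ)) (by simpa using h),
      Set.indicator_of_notMem (s := Set.Iio (1 / 2 : ℝ)) (by simpa using h.le), add_zero]

/-- The product over the coordinates of the two-term splittings of the interval, expanded into a sum
over the choices `T` of an endpoint for each coordinate. -/
theorem cubeMeasure_eq_sum_corner :
    cubeMeasure ι = ∑ T : ι → Bool, (ENNReal.ofReal (1 / 2)) ^ Fintype.card ι •
      (cubeMeasure ι).map (cornerMap T) := by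
  refine Measure.pi_eq fun s hs => ?_
  rw [Finset.prod_congr rfl fun e _ => unitMeasure_split (hs e), Finset.prod_univ_sum,
    Fintype.piFinset_univ, Measure.finsetSum_apply]
  refine Finset.sum_congr rfl fun T _ => ?_
  rw [Measure.smul_apply, Measure.map_apply (measurable_cornerMap T) (MeasurableSet.univ_pi hs)]
  have : cornerMap T ⁻¹' Set.univ.pi s =
      Set.univ.pi fun e => (fun x : ℝ => if T e then 1 - x / 2 else x / 2) ⁻¹' s e := by
    ext w; simp [cornerMap]
  rw [this, cubeMeasure, Measure.pi_pi, Finset.prod_mul_distrib, Finset.prod_const,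
    Finset.card_univ, smul_eq_mul]

end Sectors

/-! ### Change of variables for integrable complex functions -/

section Charts

variable {ι : Type*} [Fintype ι] [DecidableEq ι]

/-- Turning the identity of lower integrals into one of measures yields both the Bochner integral
formula and integrability in each single chart. -/
theorem IsMonoCover.measure_eq {κ : Type} [Fintype κ] {A : κ → Matrix ι ι ℕ}
    (hA : IsMonoCover A) :
    cubeMeasure ι = ∑ k, ((cubeMeasure ι).withDensity
      fun w => ENNReal.ofReal (monoJac (A k) w)).map (mono (A k)) := by
  ext s hs
  rw [← lintegral_indicator_one hs, hA _ (measurable_one.indicator hs), Measure.finsetSum_apply]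
  refine Finset.sum_congr rfl fun k _ => ?_
  rw [Measure.map_apply (measurable_mono _) hs, withDensity_apply _ (measurable_mono (A k) hs),
    ← lintegral_indicator (measurable_mono (A k) hs)]
  refine lintegral_congr fun w => ?_
  by_cases hw : mono (A k) w ∈ s
  · rw [Set.indicator_of_mem hw, Set.indicator_of_mem (s := mono (A k) ⁻¹' s) hw, Pi.one_apply,
      one_mul]
  · rw [Set.indicator_of_notMem hw, Set.indicator_of_notMem (s := mono (A k) ⁻¹' s) hw, zero_mul]

theorem monoJac_nonneg (A : Matrix ι ι ℕ) {w : ι → ℝ} (hw : w ∈ paramDomain ι) :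
    0 ≤ monoJac A w :=
  div_nonneg (Finset.prod_nonneg fun j _ => (mono_pos _ (fun j => (mem_paramDomain.1 hw j).1) j).le)
    (Finset.prod_nonneg fun j _ => (mem_paramDomain.1 hw j).1.le)

theorem IsMonoCover.integral_eq {κ : Type} [Fintype κ] {A : κ → Matrix ι ι ℕ}
    (hA : IsMonoCover A) {h : (ι → ℝ) → ℂ} (hh : Integrable h (cubeMeasure ι)) :
    (∀ k, Integrable (fun w => (monoJac (A k) w : ℂ) * h (mono (A k) w)) (cubeMeasure ι)) ∧
    ∫ t, h t ∂(cubeMeasure ι) =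
      ∑ k, ∫ w, (monoJac (A k) w : ℂ) * h (mono (A k) w) ∂(cubeMeasure ι) := by
  have h0 : Integrable h (∑ k, ((cubeMeasure ι).withDensity
      fun w => ENNReal.ofReal (monoJac (A k) w)).map (mono (A k))) := by
    rw [← hA.measure_eq]; exact hh
  rw [integrable_finsetSum_measure] at h0
  have hJ : ∀ k, (fun w => (ENNReal.ofReal (monoJac (A k) w)).toReal • h (mono (A k) w))
      =ᵐ[cubeMeasure ι] fun w => (monoJac (A k) w : ℂ) * h (mono (A k) w) := fun k => by
    filter_upwards [ae_mem_paramDomain] with w hw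
    rw [ENNReal.toReal_ofReal (monoJac_nonneg _ hw), Complex.real_smul]
  have hm : ∀ k, Measurable fun w => ENNReal.ofReal (monoJac (A k) w) :=
    fun k => (measurable_monoJac _).ennreal_ofReal
  have hlt : ∀ k, ∀ᵐ w ∂(cubeMeasure ι), ENNReal.ofReal (monoJac (A k) w) < ⊤ :=
    fun k => Filter.Eventually.of_forall fun w => ENNReal.ofReal_lt_top
  constructor
  · intro k
    have h1 := (integrable_map_measure (h0 k (Finset.mem_univ k)).aestronglyMeasurable
      (measurable_mono (A k)).aemeasurable).1 (h0 k (Finset.mem_univ k))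
    rw [integrable_withDensity_iff_integrable_smul' (hm k) (hlt k)] at h1
    exact h1.congr (hJ k)
  · conv_lhs => rw [hA.measure_eq]
    rw [integral_finsetSum_measure h0]
    refine Finset.sum_congr rfl fun k hk => ?_
    rw [integral_map (measurable_mono (A k)).aemeasurable (h0 k hk).aestronglyMeasurable,
      integral_withDensity_eq_integral_toReal_smul (hm k) (hlt k)]
    exact integral_congr_ae (hJ k)

theorem integral_eq_sum_corner {h : (ι → ℝ) → ℂ} (hh : Integrable h (cubeMeasure ι)) :
    (∀ T, Integrable (fun w => h (cornerMap T w)) (cubeMeasure ι)) ∧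
    ∫ t, h t ∂(cubeMeasure ι) =
      ∑ T, (1 / 2 : ℂ) ^ Fintype.card ι * ∫ w, h (cornerMap T w) ∂(cubeMeasure ι) := by
  have h0 : Integrable h (∑ T : ι → Bool, (ENNReal.ofReal (1 / 2)) ^ Fintype.card ι •
      (cubeMeasure ι).map (cornerMap T)) := by
    rw [← cubeMeasure_eq_sum_corner]; exact hh
  rw [integrable_finsetSum_measure] at h0
  have hc : (ENNReal.ofReal (1 / 2)) ^ Fintype.card ι ≠ 0 :=
    pow_ne_zero _ (by simp)
  have hc' : (ENNReal.ofReal (1 / 2)) ^ Fintype.card ι ≠ ⊤ :=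
    ENNReal.pow_ne_top ENNReal.ofReal_ne_top
  have h1 : ∀ T, Integrable h ((cubeMeasure ι).map (cornerMap T)) := fun T =>
    (integrable_smul_measure hc hc').1 (h0 T (Finset.mem_univ T))
  constructor
  · intro T
    exact (integrable_map_measure (h1 T).aestronglyMeasurable
      (measurable_cornerMap T).aemeasurable).1 (h1 T)
  · conv_lhs => rw [cubeMeasure_eq_sum_corner]
    rw [integral_finsetSum_measure h0]
    refine Finset.sum_congr rfl fun T hT => ?_
    rw [integral_smul_measure, integral_map (measurable_cornerMap T).aemeasurable
      (h1 T).aestronglyMeasurable, Complex.real_smul, ENNReal.toReal_pow,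
      ENNReal.toReal_ofReal (by norm_num)]
    push_cast
    rfl

end Charts

/-! ### Functions on the open cube with bounded derivatives -/

section Tame

variable {ι : Type*} [Fintype ι] [DecidableEq ι] {𝓕 : Type*}

/-- A family of admissible bounds for functions of a parameter `f : 𝓕`. -/
structure IsBoundFamily (B : Set (𝓕 → ℝ)) : Prop where
  zero : 0 ∈ B
  add : ∀ p ∈ B, ∀ q ∈ B, p + q ∈ B
  smul : ∀ c : ℝ, 0 ≤ c → ∀ p ∈ B, c • p ∈ B

/-- With a one-point parameter this describes functions of `D` and `w` alone. The other family in
use consists of functionals of a test function dominated by continuous seminorms; one calculus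
serves both. -/
theorem isBoundFamily_univ : IsBoundFamily (Set.univ : Set (𝓕 → ℝ)) :=
  ⟨Set.mem_univ _, fun _ _ _ _ => Set.mem_univ _, fun _ _ _ _ => Set.mem_univ _⟩

/-- Functions on the open cube, entire in `D`, continuous in the point of the cube, and bounded
locally uniformly in `D` by one of the bounds `B` in the parameter. -/
structure TameZero (B : Set (𝓕 → ℝ)) (ψ : 𝓕 → ℂ → (ι → ℝ) → ℂ) : Prop where
  differentiable : ∀ f, ∀ w ∈ paramDomain ι, Differentiable ℂ fun D => ψ f D w
  continuousOn : ∀ f D, ContinuousOn (ψ f D) (paramDomain ι)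
  bound : ∀ r : ℝ, ∃ p ∈ B, ∀ f D w, ‖D‖ ≤ r → w ∈ paramDomain ι → ‖ψ f D w‖ ≤ p f

/-- `ψ` and all its partial derivatives up to order `k` on the open cube satisfy `TameZero`. -/
def Tame (B : Set (𝓕 → ℝ)) : ℕ → (𝓕 → ℂ → (ι → ℝ) → ℂ) → Prop
  | 0, ψ => TameZero B ψ
  | k + 1, ψ => TameZero B ψ ∧ ∀ j, ∃ ψ', Tame B k ψ' ∧ ∀ f D, ∀ w ∈ paramDomain ι,
      HasDerivAt (fun s => ψ f D (Function.update w j s)) (ψ' f D w) (w j)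

variable {B : Set (𝓕 → ℝ)}

theorem Tame.zero {k : ℕ} {ψ : 𝓕 → ℂ → (ι → ℝ) → ℂ} (h : Tame B k ψ) : TameZero B ψ := by
  cases k with
  | zero => exact h
  | succ k => exact h.1

theorem Tame.of_succ {k : ℕ} : ∀ {ψ : 𝓕 → ℂ → (ι → ℝ) → ℂ}, Tame B (k + 1) ψ → Tame B k ψ := by
  induction k with
  | zero => intro ψ h; exact h.1
  | succ k ih =>
    intro ψ h
    refine ⟨h.1, fun j => ?_⟩
    obtain ⟨ψ', h1, h2⟩ := h.2 j
    exact ⟨ψ', ih h1, h2⟩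

theorem TameZero.congr {ψ φ : 𝓕 → ℂ → (ι → ℝ) → ℂ} (h : TameZero B ψ)
    (he : ∀ f D, ∀ w ∈ paramDomain ι, φ f D w = ψ f D w) : TameZero B φ where
  differentiable f w hw := by simpa only [he f _ w hw] using h.differentiable f w hw
  continuousOn f D := (h.continuousOn f D).congr fun w hw => he f D w hw
  bound r := by
    obtain ⟨p, hp, hb⟩ := h.bound r
    exact ⟨p, hp, fun f D w hD hw => by rw [he f D w hw]; exact hb f D w hD hw⟩

theorem eventually_update_mem {w : ι → ℝ} (hw : w ∈ paramDomain ι) (j : ι) :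
    ∀ᶠ s in nhds (w j), Function.update w j s ∈ paramDomain ι := by
  have hc : ContinuousAt (fun s => Function.update w j s) (w j) :=
    (continuous_const.update j continuous_id).continuousAt
  exact hc.eventually_mem (by rw [Function.update_eq_self]; exact isOpen_paramDomain.mem_nhds hw)

theorem Tame.congr {k : ℕ} {ψ φ : 𝓕 → ℂ → (ι → ℝ) → ℂ} (h : Tame B k ψ)
    (he : ∀ f D, ∀ w ∈ paramDomain ι, φ f D w = ψ f D w) : Tame B k φ := by
  cases k with
  | zero => exact TameZero.congr h he
  | succ k =>
    refine ⟨h.1.congr he, fun j => ?_⟩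
    obtain ⟨ψ', h1, h2⟩ := h.2 j
    refine ⟨ψ', h1, fun f D w hw => (h2 f D w hw).congr_of_eventuallyEq ?_⟩
    filter_upwards [eventually_update_mem hw j] with s hs
    exact he f D _ hs

theorem TameZero.add (hB : IsBoundFamily B) {ψ φ : 𝓕 → ℂ → (ι → ℝ) → ℂ} (h : TameZero B ψ)
    (h' : TameZero B φ) : TameZero B fun f D w => ψ f D w + φ f D w where
  differentiable f w hw := (h.differentiable f w hw).add (h'.differentiable f w hw)
  continuousOn f D := (h.continuousOn f D).add (h'.continuousOn f D)
  bound r := by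
    obtain ⟨p, hp, hb⟩ := h.bound r
    obtain ⟨q, hq, hb'⟩ := h'.bound r
    exact ⟨p + q, hB.add p hp q hq, fun f D w hD hw =>
      (norm_add_le _ _).trans (add_le_add (hb f D w hD hw) (hb' f D w hD hw))⟩

theorem Tame.add (hB : IsBoundFamily B) {k : ℕ} : ∀ {ψ φ : 𝓕 → ℂ → (ι → ℝ) → ℂ}, Tame B k ψ →
    Tame B k φ → Tame B k fun f D w => ψ f D w + φ f D w := by
  induction k with
  | zero => intro ψ φ h h'; exact TameZero.add hB h h'
  | succ k ih =>
    intro ψ φ h h'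
    refine ⟨TameZero.add hB h.1 h'.1, fun j => ?_⟩
    obtain ⟨ψ', h1, h2⟩ := h.2 j
    obtain ⟨φ', h1', h2'⟩ := h'.2 j
    exact ⟨_, ih h1 h1', fun f D w hw => (h2 f D w hw).add (h2' f D w hw)⟩

theorem tame_zero_fun (hB : IsBoundFamily B) (k : ℕ) :
    Tame B k fun (_ : 𝓕) (_ : ℂ) (_ : ι → ℝ) => (0 : ℂ) := by
  have h0 : TameZero B fun (_ : 𝓕) (_ : ℂ) (_ : ι → ℝ) => (0 : ℂ) :=
    ⟨fun _ _ _ => differentiable_const _, fun _ _ => continuousOn_const,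
      fun _ => ⟨0, hB.zero, by simp⟩⟩
  induction k with
  | zero => exact h0
  | succ k ih => exact ⟨h0, fun j => ⟨_, ih, fun _ _ _ _ => hasDerivAt_const _ _⟩⟩

theorem Tame.sum (hB : IsBoundFamily B) {k : ℕ} {α : Type*} (s : Finset α)
    {ψ : α → 𝓕 → ℂ → (ι → ℝ) → ℂ} (h : ∀ a ∈ s, Tame B k (ψ a)) :
    Tame B k fun f D w => ∑ a ∈ s, ψ a f D w := by
  classical
  induction s using Finset.induction_on with
  | empty => simpa using tame_zero_fun hB k
  | insert a s ha ih =>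
    simp only [Finset.sum_insert ha]
    exact (h a (Finset.mem_insert_self a s)).add hB
      (ih fun b hb => h b (Finset.mem_insert_of_mem hb))

/-- Tame functions without a parameter. -/
abbrev Nice (k : ℕ) (χ : ℂ → (ι → ℝ) → ℂ) : Prop :=
  Tame (Set.univ : Set (Unit → ℝ)) k fun _ => χ

theorem TameZero.mul (hB : IsBoundFamily B) {χ : ℂ → (ι → ℝ) → ℂ} {ψ : 𝓕 → ℂ → (ι → ℝ) → ℂ}
    (h : TameZero (Set.univ : Set (Unit → ℝ)) fun _ => χ) (h' : TameZero B ψ) :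
    TameZero B fun f D w => χ D w * ψ f D w where
  differentiable f w hw := (h.differentiable () w hw).mul (h'.differentiable f w hw)
  continuousOn f D := (h.continuousOn () D).mul (h'.continuousOn f D)
  bound r := by
    obtain ⟨p, hp, hb⟩ := h.bound r
    obtain ⟨q, hq, hb'⟩ := h'.bound r
    refine ⟨|p ()| • q, hB.smul _ (abs_nonneg _) q hq, fun f D w hD hw => ?_⟩
    rw [norm_mul]
    exact mul_le_mul ((hb () D w hD hw).trans (le_abs_self _)) (hb' f D w hD hw) (norm_nonneg _)
      (abs_nonneg _)

/-- Leibniz rule. Only one factor may depend on the parameter, since bound families are closed under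
nonnegative multiples but not under products. -/
theorem Tame.mul (hB : IsBoundFamily B) {k : ℕ} : ∀ {χ : ℂ → (ι → ℝ) → ℂ}
    {ψ : 𝓕 → ℂ → (ι → ℝ) → ℂ}, Nice k χ → Tame B k ψ →
    Tame B k fun f D w => χ D w * ψ f D w := by
  induction k with
  | zero => intro χ ψ h h'; exact TameZero.mul hB h h'
  | succ k ih =>
    intro χ ψ h h'
    refine ⟨TameZero.mul hB h.1 h'.1, fun j => ?_⟩
    obtain ⟨χ', h1, h2⟩ := h.2 j
    obtain ⟨ψ', h1', h2'⟩ := h'.2 j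
    refine ⟨_, Tame.add hB (ih (χ := χ' ()) h1 h'.of_succ) (ih h.of_succ h1'), fun f D w hw => ?_⟩
    have := (h2 () D w hw).fun_mul (h2' f D w hw)
    simpa only [Function.update_eq_self] using this

theorem Tame.apply {k : ℕ} : ∀ {ψ : 𝓕 → ℂ → (ι → ℝ) → ℂ}, Tame B k ψ → ∀ f, Nice k (ψ f) := by
  have h0 : ∀ {ψ : 𝓕 → ℂ → (ι → ℝ) → ℂ}, TameZero B ψ → ∀ f,
      TameZero (Set.univ : Set (Unit → ℝ)) fun _ => ψ f := fun h f =>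
    ⟨fun _ => h.differentiable f, fun _ => h.continuousOn f, fun r => by
      obtain ⟨p, _, hb⟩ := h.bound r
      exact ⟨fun _ => p f, Set.mem_univ _, fun _ => hb f⟩⟩
  induction k with
  | zero => intro ψ h f; exact h0 h f
  | succ k ih =>
    intro ψ h f
    refine ⟨h0 h.1 f, fun j => ?_⟩
    obtain ⟨ψ', h1, h2⟩ := h.2 j
    exact ⟨fun _ => ψ' f, ih h1 f, fun _ => h2 f⟩

theorem nice_of_differentiable {g : ℂ → ℂ} (hg : Differentiable ℂ g) (k : ℕ) :
    Nice k fun D (_ : ι → ℝ) => g D := by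
  have h0 : TameZero (Set.univ : Set (Unit → ℝ)) fun _ D (_ : ι → ℝ) => g D := by
    refine ⟨fun _ _ _ => hg, fun _ _ => continuousOn_const, fun r => ?_⟩
    obtain ⟨C, hC⟩ := (isCompact_closedBall (0 : ℂ) r).exists_bound_of_continuousOn
      hg.continuous.continuousOn
    exact ⟨fun _ => C, Set.mem_univ _, fun _ D _ hD _ => hC D (by simpa using hD)⟩
  cases k with
  | zero => exact h0
  | succ k => exact ⟨h0, fun j => ⟨_, tame_zero_fun isBoundFamily_univ k,
      fun _ _ _ _ => hasDerivAt_const _ _⟩⟩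

theorem paramDomain_subset_Icc : paramDomain ι ⊆ Set.Icc (0 : ι → ℝ) 1 := fun w hw =>
  ⟨fun e => (mem_paramDomain.1 hw e).1.le, fun e => (mem_paramDomain.1 hw e).2.le⟩

/-- Smoothness is required at the boundary points too, so compactness of the closed cube bounds
every derivative. -/
theorem nice_of_contDiffAt (k : ℕ) : ∀ {v : (ι → ℝ) → ℂ},
    (∀ w ∈ Set.Icc (0 : ι → ℝ) 1, ContDiffAt ℝ (⊤ : ℕ∞) v w) → Nice k fun _ => v := by
  have h0 : ∀ {v : (ι → ℝ) → ℂ}, (∀ w ∈ Set.Icc (0 : ι → ℝ) 1, ContDiffAt ℝ (⊤ : ℕ∞) v w) →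
      TameZero (Set.univ : Set (Unit → ℝ)) fun _ (_ : ℂ) => v := by
    intro v hv
    have hc : ContinuousOn v (Set.Icc 0 1) := fun w hw => (hv w hw).continuousAt.continuousWithinAt
    refine ⟨fun _ _ _ => differentiable_const _, fun _ _ => hc.mono paramDomain_subset_Icc,
      fun r => ?_⟩
    obtain ⟨C, hC⟩ := isCompact_Icc.exists_bound_of_continuousOn hc
    exact ⟨fun _ => C, Set.mem_univ _, fun _ D w _ hw => hC w (paramDomain_subset_Icc hw)⟩
  induction k with
  | zero => intro v hv; exact h0 hv
  | succ k ih =>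
    intro v hv
    refine ⟨h0 hv, fun j => ⟨fun _ _ w => fderiv ℝ v w (Pi.single j 1), ih fun w hw => ?_, ?_⟩⟩
    · exact ((hv w hw).fderiv_right (m := (⊤ : ℕ∞)) (by norm_num)).clm_apply contDiffAt_const
    · intro _ _ w hw
      have hd : HasFDerivAt v (fderiv ℝ v w) (Function.update w j (w j)) := by
        rw [Function.update_eq_self]
        exact ((hv w (paramDomain_subset_Icc hw)).differentiableAt (by simp)).hasFDerivAt
      exact hd.comp_hasDerivAt (w j) (hasDerivAt_update w j (w j))

theorem Nice.cexp {k : ℕ} : ∀ {χ : ℂ → (ι → ℝ) → ℂ}, Nice k χ →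
    Nice k fun D w => Complex.exp (χ D w) := by
  have h0 : ∀ {χ : ℂ → (ι → ℝ) → ℂ}, TameZero (Set.univ : Set (Unit → ℝ)) (fun _ => χ) →
      TameZero (Set.univ : Set (Unit → ℝ)) fun _ D w => Complex.exp (χ D w) := by
    intro χ h
    refine ⟨fun _ w hw => (h.differentiable () w hw).cexp,
      fun _ D => (h.continuousOn () D).cexp, fun r => ?_⟩
    obtain ⟨p, _, hb⟩ := h.bound r
    exact ⟨fun _ => Real.exp (p ()), Set.mem_univ _, fun _ D w hD hw =>
      (Complex.norm_exp_le_exp_norm _).trans (Real.exp_le_exp.2 (hb () D w hD hw))⟩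
  induction k with
  | zero => intro χ h; exact h0 h
  | succ k ih =>
    intro χ h
    refine ⟨h0 h.1, fun j => ?_⟩
    obtain ⟨χ', h1, h2⟩ := h.2 j
    refine ⟨_, Tame.mul isBoundFamily_univ (ih h.of_succ) h1, fun f D w hw => ?_⟩
    have := (h2 f D w hw).cexp
    simpa only [Function.update_eq_self] using this

end Tame

/-- For holomorphic integrands a bound on the integrand suffices: Cauchy's estimate on discs of
radius `ε / 4` bounds the derivative on the disc of radius `ε / 2`, and dominated differentiation
applies. -/
theorem differentiableAt_integral_of_bound {α : Type*} [MeasurableSpace α] {μ : Measure α}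
    {F : ℂ → α → ℂ} {bound : α → ℝ} {D₀ : ℂ} {ε : ℝ} (hε : 0 < ε)
    (hm : ∀ D ∈ Metric.ball D₀ ε, AEStronglyMeasurable (F D) μ)
    (hd : ∀ᵐ a ∂μ, DifferentiableOn ℂ (F · a) (Metric.ball D₀ ε))
    (hb : ∀ᵐ a ∂μ, ∀ D ∈ Metric.ball D₀ ε, ‖F D a‖ ≤ bound a) (hi : Integrable bound μ) :
    DifferentiableAt ℂ (fun D => ∫ a, F D a ∂μ) D₀ := by
  have hmem : D₀ ∈ Metric.ball D₀ ε := Metric.mem_ball_self hε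
  have hhalf : Metric.ball D₀ (ε / 2) ∈ nhds D₀ := Metric.ball_mem_nhds _ (by positivity)
  have hdiff : ∀ᵐ a ∂μ, ∀ D ∈ Metric.ball D₀ (ε / 2),
      HasDerivAt (F · a) (deriv (F · a) D) D := by
    filter_upwards [hd] with a ha D hD
    exact (ha.differentiableAt (Metric.isOpen_ball.mem_nhds
      (Metric.ball_subset_ball (by linarith) hD))).hasDerivAt
  refine (hasDerivAt_integral_of_dominated_loc_of_deriv_le (μ := μ) (F := F)
    (bound := fun a => bound a / (ε / 4)) (F' := fun D a => deriv (F · a) D) hhalf ?_ ?_ ?_ ?_ ?_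
    hdiff).2.differentiableAt
  · filter_upwards [Metric.ball_mem_nhds D₀ hε] with D hD using hm D hD
  · exact hi.mono' (hm D₀ hmem) (hb.mono fun a h => h D₀ hmem)
  -- The derivative at `D₀` is measurable as an almost everywhere limit of difference quotients
  -- along a sequence.
  · have hseq : Filter.Tendsto (fun n : ℕ => D₀ + ((ε / 2 / (n + 1 : ℝ) : ℝ) : ℂ)) Filter.atTop
        (nhdsWithin D₀ {D₀}ᶜ) := by
      rw [tendsto_nhdsWithin_iff]
      constructor
      · have h1 : Filter.Tendsto (fun n : ℕ => ε / 2 / ((n : ℝ) + 1)) Filter.atTop (nhds 0) :=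
          tendsto_const_div_atTop_nhds_zero_nat (ε / 2) |>.comp (Filter.tendsto_add_atTop_nat 1)
            |>.congr fun n => by simp
        have h2 := (Complex.continuous_ofReal.tendsto 0).comp h1
        simpa using h2.const_add D₀
      · refine Filter.Eventually.of_forall fun n => ?_
        simp only [Set.mem_compl_iff, Set.mem_singleton_iff, add_eq_left, Complex.ofReal_eq_zero]
        positivity
    refine aestronglyMeasurable_of_tendsto_ae Filter.atTop
      (f := fun (n : ℕ) a => slope (F · a) D₀ (D₀ + ((ε / 2 / (n + 1 : ℝ) : ℝ) : ℂ))) ?_ ?_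
    · intro n
      have hin : D₀ + ((ε / 2 / (n + 1 : ℝ) : ℝ) : ℂ) ∈ Metric.ball D₀ ε := by
        rw [Metric.mem_ball, dist_eq_norm, add_sub_cancel_left, Complex.norm_real,
          Real.norm_of_nonneg (by positivity)]
        have : ε / 2 / (n + 1 : ℝ) ≤ ε / 2 := div_le_self (by positivity) (by simp)
        linarith
      simp only [slope_def_field, div_eq_mul_inv]
      exact ((hm _ hin).sub (hm _ hmem)).mul_const _
    · filter_upwards [hdiff] with a ha
      exact (hasDerivAt_iff_tendsto_slope.1 (ha D₀ (mem_of_mem_nhds hhalf))).comp hseq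
  · filter_upwards [hd, hb] with a ha hba D hD
    have hsub : Metric.closedBall D (ε / 4) ⊆ Metric.ball D₀ ε := by
      intro z hz
      rw [Metric.mem_closedBall] at hz
      rw [Metric.mem_ball] at hD ⊢
      linarith [dist_triangle z D D₀]
    refine Complex.norm_deriv_le_of_forall_mem_sphere_norm_le (by positivity) ?_
      fun z hz => hba z (hsub (Metric.sphere_subset_closedBall hz))
    refine DifferentiableOn.diffContOnCl (ha.mono ?_)
    rw [closure_ball _ (by positivity)]
    exact hsub
  · exact hi.div_const _

/-! ### Mellin integrals over the cube and their continuation in `D` -/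

section Mellin

variable {ι : Type*} [Fintype ι] [DecidableEq ι]

/-- The affine exponent `κ i * D + l i`. -/
def affExp (κ l : ι → ℝ) (i : ι) (D : ℂ) : ℂ := (κ i : ℂ) * D + (l i : ℂ)

theorem affExp_re (κ l : ι → ℝ) (i : ι) (D : ℂ) : (affExp κ l i D).re = κ i * D.re + l i := by
  simp [affExp]

/-- The power `∏ w i ^ (κ i * D + l i - 1)`. -/
def mellinKernel (κ l : ι → ℝ) (D : ℂ) (w : ι → ℝ) : ℂ := ∏ i, (w i : ℂ) ^ (affExp κ l i D - 1)

/-- The Mellin integral of a function on the cube. -/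
def mellinCube (κ l : ι → ℝ) (χ : ℂ → (ι → ℝ) → ℂ) (D : ℂ) : ℂ :=
  ∫ w, mellinKernel κ l D w * χ D w ∂(cubeMeasure ι)

theorem integrable_mellinKernel {κ l : ι → ℝ} {D : ℂ} (h : ∀ i, 0 < (affExp κ l i D).re) :
    Integrable (mellinKernel κ l D) (cubeMeasure ι) := by
  refine Integrable.fintype_prod (f := fun i (s : ℝ) => (s : ℂ) ^ (affExp κ l i D - 1))
    (μ := fun _ => unitMeasure) fun i => ?_
  have := intervalIntegral.intervalIntegrable_cpow' (a := 0) (b := 1) (r := affExp κ l i D - 1)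
    (by simpa using h i)
  rw [intervalIntegrable_iff_integrableOn_Ioo_of_le zero_le_one] at this
  exact this

theorem aestronglyMeasurable_of_continuousOn_cube {g : (ι → ℝ) → ℂ}
    (hg : ContinuousOn g (paramDomain ι)) : AEStronglyMeasurable g (cubeMeasure ι) := by
  rw [cubeMeasure_eq_restrict]
  exact hg.aestronglyMeasurable measurableSet_paramDomain

theorem integrable_mul_of_bounded {g h : (ι → ℝ) → ℂ} (hg : Integrable g (cubeMeasure ι))
    (hh : ContinuousOn h (paramDomain ι)) {C : ℝ} (hC : ∀ w ∈ paramDomain ι, ‖h w‖ ≤ C) :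
    Integrable (fun w => g w * h w) (cubeMeasure ι) := by
  refine (hg.norm.const_mul C).mono' (hg.aestronglyMeasurable.mul
    (aestronglyMeasurable_of_continuousOn_cube hh)) ?_
  filter_upwards [ae_mem_paramDomain] with w hw
  rw [norm_mul, mul_comm]
  exact mul_le_mul_of_nonneg_right (hC w hw) (norm_nonneg _)

theorem TameZero.integrable {κ l : ι → ℝ} {χ : ℂ → (ι → ℝ) → ℂ}
    (hχ : TameZero (Set.univ : Set (Unit → ℝ)) fun _ => χ) {D : ℂ}
    (h : ∀ i, 0 < (affExp κ l i D).re) :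
    Integrable (fun w => mellinKernel κ l D w * χ D w) (cubeMeasure ι) := by
  obtain ⟨p, _, hb⟩ := hχ.bound ‖D‖
  exact integrable_mul_of_bounded (integrable_mellinKernel h) (hχ.continuousOn () D)
    fun w hw => hb () D w le_rfl hw

/-- The partial derivative in the direction of a coordinate. -/
def partialDeriv (j : ι) (χ : ℂ → (ι → ℝ) → ℂ) (D : ℂ) (w : ι → ℝ) : ℂ :=
  deriv (fun s => χ D (Function.update w j s)) (w j)

/-- The function whose Mellin integral, with the exponent of `w j` raised by one, is
`κ j * D + l j` times the Mellin integral of `χ`. -/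
def raiseExp (κ l : ι → ℝ) (j : ι) (χ : ℂ → (ι → ℝ) → ℂ) (D : ℂ) (w : ι → ℝ) : ℂ :=
  (affExp κ l j D + 1) * χ D w + (w j - 1 : ℂ) * partialDeriv j χ D w

/-- The exponents with the one of `w j` raised by one. -/
def raiseVec (l : ι → ℝ) (j : ι) : ι → ℝ := Function.update l j (l j + 1)

theorem affExp_raiseVec (κ l : ι → ℝ) (j i : ι) (D : ℂ) :
    affExp κ (raiseVec l j) i D = affExp κ l i D + if i = j then 1 else 0 := by
  unfold affExp raiseVec
  by_cases h : i = j
  · subst h; simp [add_assoc]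
  · simp [h]

theorem mellinKernel_raiseVec (κ l : ι → ℝ) (j : ι) (D : ℂ) {w : ι → ℝ} (hw : w ∈ paramDomain ι) :
    mellinKernel κ (raiseVec l j) D w = w j * mellinKernel κ l D w := by
  unfold mellinKernel
  rw [← Finset.mul_prod_erase _ _ (Finset.mem_univ j),
    ← Finset.mul_prod_erase _ _ (Finset.mem_univ j), ← mul_assoc]
  congr 1
  · have h0 : (w j : ℂ) ≠ 0 := by exact_mod_cast (mem_paramDomain.1 hw j).1.ne'
    rw [affExp_raiseVec, if_pos rfl, add_sub_right_comm, Complex.cpow_add _ _ h0, Complex.cpow_one,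
      mul_comm]
  · refine Finset.prod_congr rfl fun i hi => ?_
    rw [affExp_raiseVec, if_neg (Finset.ne_of_mem_erase hi), add_zero]

theorem Tame.raise {𝓕 : Type*} {B : Set (𝓕 → ℝ)} (hB : IsBoundFamily B) {k : ℕ}
    {ψ : 𝓕 → ℂ → (ι → ℝ) → ℂ} (h : Tame B (k + 1) ψ) (κ l : ι → ℝ) (j : ι) :
    Tame B k fun f => raiseExp κ l j (ψ f) := by
  obtain ⟨ψ', h1, h2⟩ := h.2 j
  have hc : Nice k fun (_ : ℂ) (w : ι → ℝ) => (w j - 1 : ℂ) := by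
    refine nice_of_contDiffAt k fun w _ => ?_
    have : ContDiff ℝ (⊤ : ℕ∞) fun w : ι → ℝ => ((w j : ℝ) : ℂ) - 1 :=
      (Complex.ofRealCLM.contDiff.comp (contDiff_apply ℝ ℝ j)).sub contDiff_const
    exact this.contDiffAt
  have hl : Nice k fun D (_ : ι → ℝ) => affExp κ l j D + 1 := by
    refine nice_of_differentiable (g := fun D => affExp κ l j D + 1) ?_ k
    unfold affExp
    fun_prop
  refine (Tame.add hB (Tame.mul hB hl h.of_succ) (Tame.mul hB hc h1)).congr fun f D w hw => ?_
  rw [raiseExp, partialDeriv, (h2 f D w hw).deriv]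

theorem update_mem_paramDomain {w : ι → ℝ} (hw : w ∈ paramDomain ι) (j : ι) {s : ℝ}
    (hs : s ∈ Set.Ioo (0 : ℝ) 1) : Function.update w j s ∈ paramDomain ι := by
  refine mem_paramDomain.2 fun e => ?_
  by_cases he : e = j
  · subst he; simpa using hs
  · simpa [Function.update_of_ne he] using mem_paramDomain.1 hw e

theorem tendsto_zero_of_le {g : ℝ → ℂ} {b : ℝ → ℝ} {L : Filter ℝ}
    (h : ∀ᶠ s in L, ‖g s‖ ≤ b s) (hb : Filter.Tendsto b L (nhds 0)) :
    Filter.Tendsto g L (nhds 0) :=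
  squeeze_zero_norm' h hb

/-- Integration by parts in one coordinate of the cube, without boundary terms. -/
theorem mellinCube_raise {κ l : ι → ℝ} {χ : ℂ → (ι → ℝ) → ℂ} (hχ : Nice 1 χ) (j : ι) {D : ℂ}
    (h : ∀ i, 0 < (affExp κ l i D).re) :
    mellinCube κ l χ D =
      (affExp κ l j D)⁻¹ * mellinCube κ (raiseVec l j) (raiseExp κ l j χ) D := by
  have hj0 : affExp κ l j D ≠ 0 := fun h0 => by have := h j; rw [h0] at this; simp at this
  rw [eq_inv_mul_iff_mul_eq₀ hj0, ← sub_eq_zero]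
  have hr : ∀ i, 0 < (affExp κ (raiseVec l j) i D).re := fun i => by
    rw [affExp_raiseVec, Complex.add_re]
    have := h i
    split_ifs
    · simp only [Complex.one_re]; linarith
    · simpa using this
  have hraise : Nice 0 (raiseExp κ l j χ) := Tame.raise isBoundFamily_univ (ψ := fun _ => χ) hχ κ l j
  have i1 := (hχ.zero.integrable h).const_mul (affExp κ l j D)
  have i2 := TameZero.integrable (κ := κ) (l := raiseVec l j) hraise hr
  unfold mellinCube
  rw [← integral_const_mul, ← integral_sub i1 i2]
  set g : (ι → ℝ) → ℂ := fun w => affExp κ l j D * (mellinKernel κ l D w * χ D w) -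
    mellinKernel κ (raiseVec l j) D w * raiseExp κ l j χ D w with hg
  have ig : Integrable g (cubeMeasure ι) := i1.sub i2
  have mp := measurePreserving_update (ι := ι) j
  have ig2 : Integrable (fun p : (ι → ℝ) × ℝ => g (Function.update p.1 j p.2))
      ((cubeMeasure ι).prod unitMeasure) := mp.integrable_comp_of_integrable ig
  have e1 : ∫ w, g w ∂(cubeMeasure ι) =
      ∫ w, ∫ s, g (Function.update w j s) ∂unitMeasure ∂(cubeMeasure ι) := by
    rw [← integral_prod _ ig2]
    have : ∫ w, g w ∂(cubeMeasure ι) = ∫ w, g w ∂(Measure.map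
        (fun p : (ι → ℝ) × ℝ => Function.update p.1 j p.2)
          ((cubeMeasure ι).prod unitMeasure)) := by rw [mp.map_eq]
    rw [this, integral_map mp.measurable.aemeasurable]
    rw [mp.map_eq]; exact ig.aestronglyMeasurable
  rw [e1]
  refine integral_eq_zero_of_ae ?_
  filter_upwards [ae_mem_paramDomain, ig2.prod_right_ae] with w hw hinteg
  obtain ⟨χ', h1, h2⟩ := hχ.2 j
  set P : ℂ := ∏ i ∈ Finset.univ.erase j, (w i : ℂ) ^ (affExp κ l i D - 1) with hP
  have hker : ∀ s : ℝ, mellinKernel κ l D (Function.update w j s) =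
      (s : ℂ) ^ (affExp κ l j D - 1) * P := fun s => by
    unfold mellinKernel
    rw [← Finset.mul_prod_erase _ _ (Finset.mem_univ j), Function.update_self, hP]
    congr 1
    exact Finset.prod_congr rfl fun i hi => by
      rw [Function.update_of_ne (Finset.ne_of_mem_erase hi)]
  -- With exponent `a = affExp κ l j D`, the integrand `g` in the variable `s` is the derivative of
  -- `P * s ^ a * (1 - s) * χ`. The factor `1 - s` removes the boundary term at `1` and `Re a > 0`
  -- the one at `0`; this explains the form of `raiseExp`.
  set H : ℝ → ℂ := fun s =>
    P * ((s : ℂ) ^ (affExp κ l j D) * ((1 - s : ℂ) * χ D (Function.update w j s))) with hH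
  obtain ⟨p, _, hb⟩ := hχ.zero.bound ‖D‖
  have hbs : ∀ s ∈ Set.Ioo (0 : ℝ) 1, ‖χ D (Function.update w j s)‖ ≤ p () := fun s hs =>
    hb () D _ le_rfl (update_mem_paramDomain hw j hs)
  have hp0 : 0 ≤ p () := (norm_nonneg _).trans (hbs (1 / 2) (by constructor <;> norm_num))
  have hderiv : ∀ s ∈ Set.Ioo (0 : ℝ) 1, HasDerivAt H (g (Function.update w j s)) s := by
    intro s hs
    have hws := update_mem_paramDomain hw j hs
    have hs0 : (s : ℂ) ≠ 0 := by exact_mod_cast hs.1.ne'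
    have d1 : HasDerivAt (fun s : ℝ => (s : ℂ) ^ (affExp κ l j D))
        (affExp κ l j D * (s : ℂ) ^ (affExp κ l j D - 1)) s := by
      have := (hasDerivAt_id (s : ℂ)).cpow_const (c := affExp κ l j D)
        (Or.inl (by simpa using hs.1))
      simpa using this.comp_ofReal
    have d2 : HasDerivAt (fun s : ℝ => (1 - s : ℂ)) (-1) s := by
      simpa using ((hasDerivAt_id (s : ℂ)).const_sub 1).comp_ofReal
    have d3 : HasDerivAt (fun s => χ D (Function.update w j s))
        (χ' () D (Function.update w j s)) s := by
      have := h2 () D _ hws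
      simpa using this
    have := (d1.fun_mul (d2.fun_mul d3)).const_mul P
    refine this.congr_deriv ?_
    have hpd : partialDeriv j χ D (Function.update w j s) = χ' () D (Function.update w j s) := by
      rw [partialDeriv]; exact (h2 () D _ hws).deriv
    simp only [hg, mellinKernel_raiseVec κ l j D hws, hker, raiseExp, hpd, Function.update_self]
    have hpow : (s : ℂ) ^ (affExp κ l j D) = s * (s : ℂ) ^ (affExp κ l j D - 1) := by
      rw [Complex.cpow_sub _ _ hs0, Complex.cpow_one]; field_simp
    rw [hpow]
    ring
  have hnorm : ∀ s ∈ Set.Ioo (0 : ℝ) 1,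
      ‖H s‖ ≤ ‖P‖ * (s ^ (affExp κ l j D).re * ((1 - s) * p ())) := by
    intro s hs
    simp only [hH, norm_mul]
    have e2 : ‖(1 - s : ℂ)‖ = 1 - s := by
      rw [← Complex.ofReal_one, ← Complex.ofReal_sub, Complex.norm_real,
        Real.norm_of_nonneg (by linarith [hs.2])]
    rw [Complex.norm_cpow_eq_rpow_re_of_pos hs.1, e2]
    have := hbs s hs
    have h1s : 0 ≤ 1 - s := by linarith [hs.2]
    have := Real.rpow_nonneg hs.1.le (affExp κ l j D).re
    gcongr
  have hcont : Continuous fun s : ℝ => ‖P‖ * (s ^ (affExp κ l j D).re * ((1 - s) * p ())) :=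
    continuous_const.mul ((Real.continuous_rpow_const (h j).le).mul
      ((continuous_const.sub continuous_id).mul continuous_const))
  have ht0 : Filter.Tendsto H (nhdsWithin 0 (Set.Ioi 0)) (nhds 0) := by
    refine tendsto_zero_of_le (b := fun s => ‖P‖ * (s ^ (affExp κ l j D).re * ((1 - s) * p ()))) ?_ ?_
    · filter_upwards [Ioo_mem_nhdsGT (zero_lt_one (α := ℝ))] with s hs using hnorm s hs
    · have := hcont.tendsto 0
      simp only [Real.zero_rpow (h j).ne', zero_mul, mul_zero] at this
      exact this.mono_left nhdsWithin_le_nhds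
  have ht1 : Filter.Tendsto H (nhdsWithin 1 (Set.Iio 1)) (nhds 0) := by
    refine tendsto_zero_of_le (b := fun s => ‖P‖ * (s ^ (affExp κ l j D).re * ((1 - s) * p ()))) ?_ ?_
    · filter_upwards [Ioo_mem_nhdsLT (zero_lt_one (α := ℝ))] with s hs using hnorm s hs
    · have := hcont.tendsto 1
      simp only [sub_self, zero_mul, mul_zero] at this
      exact this.mono_left nhdsWithin_le_nhds
  have hii : IntervalIntegrable (fun s => g (Function.update w j s)) volume 0 1 := by
    rw [intervalIntegrable_iff_integrableOn_Ioo_of_le zero_le_one]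
    exact hinteg
  have := intervalIntegral.integral_eq_sub_of_hasDerivAt_of_tendsto zero_lt_one hderiv hii ht0 ht1
  rw [intervalIntegral.integral_of_le zero_le_one, integral_Ioc_eq_integral_Ioo, sub_self] at this
  exact this

theorem differentiableAt_mellinCube {κ l : ι → ℝ} {χ : ℂ → (ι → ℝ) → ℂ} (hχ : Nice 0 χ) {D₀ : ℂ}
    (h : ∀ i, 0 < (affExp κ l i D₀).re) : DifferentiableAt ℂ (mellinCube κ l χ) D₀ := by
  have haff : ∀ i, Differentiable ℂ (affExp κ l i) := fun i => by unfold affExp; fun_prop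
  have hev : ∀ i, ∀ᶠ D in nhds D₀, (affExp κ l i D₀).re / 2 < (affExp κ l i D).re := fun i =>
    ((Complex.continuous_re.comp (haff i).continuous).continuousAt).eventually_const_lt
      (by have := h i; simp only [Function.comp]; linarith)
  obtain ⟨ε, hε, hball⟩ := Metric.eventually_nhds_iff_ball.1 (Filter.eventually_all.2 hev)
  obtain ⟨p, _, hb⟩ := TameZero.bound hχ (‖D₀‖ + ε)
  have hbase : ∀ i, 0 < (affExp (fun _ => (0 : ℝ)) (fun i => (affExp κ l i D₀).re / 2) i 0).re :=
    fun i => by rw [affExp_re]; have := h i; simp only [zero_mul, zero_add]; linarith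
  -- Near `D₀` each exponent keeps more than half of its real part at `D₀`, and powers of numbers in
  -- `(0,1)` decrease in the exponent. So the kernel with the halved exponents, written with slope
  -- `0`, dominates and is still integrable.
  refine differentiableAt_integral_of_bound hε
    (bound := fun w => ‖mellinKernel (fun _ => (0 : ℝ)) (fun i => (affExp κ l i D₀).re / 2) 0 w‖ *
      p ()) ?_ ?_ ?_ ?_
  · intro D hD
    exact (TameZero.integrable hχ fun i =>
      lt_trans (by have := h i; linarith) (hball D hD i)).aestronglyMeasurable
  · filter_upwards [ae_mem_paramDomain] with w hw D _
    refine DifferentiableAt.differentiableWithinAt ?_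
    refine DifferentiableAt.mul ?_ (TameZero.differentiable hχ () w hw D)
    unfold mellinKernel
    refine DifferentiableAt.fun_finsetProd fun i _ => ?_
    have h0 : (w i : ℂ) ≠ 0 := by exact_mod_cast (mem_paramDomain.1 hw i).1.ne'
    exact ((haff i D).sub_const 1).const_cpow (Or.inl h0)
  · filter_upwards [ae_mem_paramDomain] with w hw D hD
    rw [norm_mul]
    have hDn : ‖D‖ ≤ ‖D₀‖ + ε := by
      have : ‖D - D₀‖ < ε := by simpa [dist_eq_norm] using hD
      calc ‖D‖ = ‖D₀ + (D - D₀)‖ := by ring_nf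
        _ ≤ _ := (norm_add_le _ _).trans (by linarith)
    refine mul_le_mul ?_ (hb () D w hDn hw) (norm_nonneg _) (norm_nonneg _)
    unfold mellinKernel
    rw [norm_prod, norm_prod]
    refine Finset.prod_le_prod (fun _ _ => norm_nonneg _) fun i _ => ?_
    have hwi := mem_paramDomain.1 hw i
    rw [Complex.norm_cpow_eq_rpow_re_of_pos hwi.1, Complex.norm_cpow_eq_rpow_re_of_pos hwi.1]
    refine Real.rpow_le_rpow_of_exponent_ge hwi.1 hwi.2.le ?_
    have := hball D hD i
    rw [Complex.sub_re, Complex.sub_re, affExp_re (fun _ => (0 : ℝ))]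
    simp only [zero_mul, zero_add]
    linarith
  · exact (integrable_mellinKernel hbase).norm.mul_const _

theorem analyticAt_mellinCube {κ l : ι → ℝ} {χ : ℂ → (ι → ℝ) → ℂ} (hχ : Nice 0 χ) {D₀ : ℂ}
    (h : ∀ i, 0 < (affExp κ l i D₀).re) : AnalyticAt ℂ (mellinCube κ l χ) D₀ := by
  have haff : ∀ i, Continuous fun D => (affExp κ l i D).re := fun i => by
    unfold affExp; fun_prop
  refine DifferentiableOn.analyticAt (s := {D | ∀ i, 0 < (affExp κ l i D).re})
    (fun D hD => (differentiableAt_mellinCube hχ hD).differentiableWithinAt) ?_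
  exact (isOpen_iff_mem_nhds.2 fun D hD => Filter.eventually_all.2 fun i =>
    (haff i).continuousAt.eventually_const_lt (hD i)).mem_nhds h

/-- Continuation of the Mellin integral, by raising the exponents along a list of coordinates. -/
def mellinCont (κ : ι → ℝ) : List ι → (ι → ℝ) → (ℂ → (ι → ℝ) → ℂ) → ℂ → ℂ
  | [], l, χ, D => mellinCube κ l χ D
  | j :: L, l, χ, D => (affExp κ l j D)⁻¹ * mellinCont κ L (raiseVec l j) (raiseExp κ l j χ) D

theorem affExp_raiseVec_re_add_count {κ l : ι → ℝ} {j : ι} {L : List ι} {D : ℂ}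
    (h : ∀ i, 0 < (affExp κ l i D).re + (j :: L).count i) (i : ι) :
    0 < (affExp κ (raiseVec l j) i D).re + L.count i := by
  have := h i
  rw [List.count_cons] at this
  rw [affExp_raiseVec, Complex.add_re]
  by_cases hij : i = j
  · subst hij
    simp only [beq_self_eq_true, if_true, Nat.cast_add, Nat.cast_one, Complex.one_re] at this ⊢
    linarith
  · have h' : (j == i) = false := by simpa using fun h => hij h.symm
    simpa [h', hij] using this

/-- Where the integral converges, every step is an exact integration by parts. -/
theorem mellinCont_eq_mellinCube {κ : ι → ℝ} {D : ℂ} (L : List ι) : ∀ {l : ι → ℝ}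
    {χ : ℂ → (ι → ℝ) → ℂ}, Nice L.length χ → (∀ i, 0 < (affExp κ l i D).re) →
    mellinCont κ L l χ D = mellinCube κ l χ D := by
  induction L with
  | nil => intro l χ _ _; rfl
  | cons j L ih =>
    intro l χ hχ h
    have h1 : Nice 1 χ := by
      have : ∀ k, Nice (k + 1) χ → Nice 1 χ := fun k => by
        induction k with
        | zero => exact id
        | succ k ihk => exact fun h => ihk h.of_succ
      exact this _ hχ
    rw [mellinCont, ih (Tame.raise isBoundFamily_univ (ψ := fun _ => χ) hχ κ l j), ← mellinCube_raise h1 j h]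
    intro i
    rw [affExp_raiseVec, Complex.add_re]
    have := h i
    split_ifs
    · simp only [Complex.one_re]; linarith
    · simpa using this

/-- Once enough exponents have been raised for convergence, further steps do not change the value.
Hence continuations with different numbers of steps agree. -/
theorem mellinCont_append {κ : ι → ℝ} {D : ℂ} (L L' : List ι) : ∀ {l : ι → ℝ}
    {χ : ℂ → (ι → ℝ) → ℂ}, Nice (L.length + L'.length) χ →
    (∀ i, 0 < (affExp κ l i D).re + L.count i) →
    mellinCont κ (L ++ L') l χ D = mellinCont κ L l χ D := by
  induction L with
  | nil =>
    intro l χ hχ h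
    exact mellinCont_eq_mellinCube L' (by simpa using hχ) (by simpa using h)
  | cons j L ih =>
    intro l χ hχ h
    rw [List.cons_append, mellinCont, mellinCont]
    congr 1
    refine ih (Tame.raise isBoundFamily_univ (ψ := fun _ => χ) ?_ κ l j)
      (affExp_raiseVec_re_add_count h)
    rw [List.length_cons, Nat.add_right_comm] at hχ
    exact hχ

theorem differentiable_affExp (κ l : ι → ℝ) (i : ι) : Differentiable ℂ (affExp κ l i) := by
  unfold affExp; fun_prop

theorem meromorphicAt_mellinCont {κ : ι → ℝ} {D : ℂ} (L : List ι) : ∀ {l : ι → ℝ}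
    {χ : ℂ → (ι → ℝ) → ℂ}, Nice L.length χ → (∀ i, 0 < (affExp κ l i D).re + L.count i) →
    MeromorphicAt (mellinCont κ L l χ) D := by
  induction L with
  | nil =>
    intro l χ hχ h
    exact (analyticAt_mellinCube hχ (by simpa using h)).meromorphicAt
  | cons j L ih =>
    intro l χ hχ h
    refine MeromorphicAt.mul (MeromorphicAt.inv (AnalyticAt.meromorphicAt ?_))
      (ih (Tame.raise isBoundFamily_univ (ψ := fun _ => χ) hχ κ l j)
        (affExp_raiseVec_re_add_count h))
    exact (differentiable_affExp κ l j).analyticAt D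

/-- Each step divides by an exponent already raised some number `r` of times, so poles come only
from zeros of `affExp κ l i + r` with natural `r`. -/
theorem analyticAt_mellinCont {κ : ι → ℝ} {D : ℂ} (L : List ι) : ∀ {l : ι → ℝ}
    {χ : ℂ → (ι → ℝ) → ℂ}, Nice L.length χ → (∀ i, 0 < (affExp κ l i D).re + L.count i) →
    (∀ i, ∀ r : ℕ, affExp κ l i D + r ≠ 0) → AnalyticAt ℂ (mellinCont κ L l χ) D := by
  induction L with
  | nil =>
    intro l χ hχ h _
    exact analyticAt_mellinCube hχ (by simpa using h)
  | cons j L ih =>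
    intro l χ hχ h hne
    refine AnalyticAt.mul (AnalyticAt.inv ?_ (by simpa using hne j 0))
      (ih (Tame.raise isBoundFamily_univ (ψ := fun _ => χ) hχ κ l j)
        (affExp_raiseVec_re_add_count h) fun i r => ?_)
    · exact (differentiable_affExp κ l j).analyticAt D
    · rw [affExp_raiseVec]
      split_ifs
      · have := hne i (r + 1)
        push_cast at this
        rwa [add_assoc, add_comm (1 : ℂ)]
      · simpa using hne i r

/-- A step costs one derivative and stays within the bound family. Applied to seminorm bounds, this
makes the continued functional continuous on test functions. -/
theorem mellinCont_bound {𝓕 : Type*} {B : Set (𝓕 → ℝ)} (hB : IsBoundFamily B) {κ : ι → ℝ} {D : ℂ}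
    (L : List ι) : ∀ {l : ι → ℝ} {ψ : 𝓕 → ℂ → (ι → ℝ) → ℂ}, Tame B L.length ψ →
    (∀ i, 0 < (affExp κ l i D).re + L.count i) →
    ∃ p ∈ B, ∀ f, ‖mellinCont κ L l (ψ f) D‖ ≤ p f := by
  induction L with
  | nil =>
    intro l ψ hψ h
    obtain ⟨p, hp, hb⟩ := hψ.zero.bound ‖D‖
    refine ⟨(∫ w, ‖mellinKernel κ l D w‖ ∂(cubeMeasure ι)) • p,
      hB.smul _ (integral_nonneg fun _ => norm_nonneg _) p hp, fun f => ?_⟩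
    rw [mellinCont, mellinCube, Pi.smul_apply, smul_eq_mul, ← integral_mul_const]
    refine norm_integral_le_of_norm_le
      ((integrable_mellinKernel (by simpa using h)).norm.mul_const _) ?_
    filter_upwards [ae_mem_paramDomain] with w hw
    rw [norm_mul]
    exact mul_le_mul_of_nonneg_left (hb f D w le_rfl hw) (norm_nonneg _)
  | cons j L ih =>
    intro l ψ hψ h
    obtain ⟨p, hp, hb⟩ := ih (Tame.raise hB hψ κ l j) (affExp_raiseVec_re_add_count h)
    refine ⟨‖(affExp κ l j D)⁻¹‖ • p, hB.smul _ (norm_nonneg _) p hp, fun f => ?_⟩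
    rw [mellinCont, norm_mul]
    exact mul_le_mul_of_nonneg_left (hb f) (norm_nonneg _)

/-- The relation is needed at the single point `D` only, because `raiseExp` differentiates in `w`
and not in `D`. -/
theorem mellinCont_linear {κ : ι → ℝ} {D : ℂ} (a b : ℂ) (L : List ι) : ∀ {l : ι → ℝ}
    {χ₁ χ₂ χ₃ : ℂ → (ι → ℝ) → ℂ}, Nice L.length χ₁ → Nice L.length χ₂ →
    (∀ w ∈ paramDomain ι, χ₃ D w = a * χ₁ D w + b * χ₂ D w) →
    (∀ i, 0 < (affExp κ l i D).re + L.count i) →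
    mellinCont κ L l χ₃ D = a * mellinCont κ L l χ₁ D + b * mellinCont κ L l χ₂ D := by
  induction L with
  | nil =>
    intro l χ₁ χ₂ χ₃ h1 h2 he h
    have h' : ∀ i, 0 < (affExp κ l i D).re := by simpa using h
    simp only [mellinCont, mellinCube]
    rw [← integral_const_mul, ← integral_const_mul, ← integral_add
      ((h1.zero.integrable h').const_mul a) ((h2.zero.integrable h').const_mul b)]
    refine integral_congr_ae ?_
    filter_upwards [ae_mem_paramDomain] with w hw
    rw [he w hw]
    ring
  | cons j L ih =>
    intro l χ₁ χ₂ χ₃ h1 h2 he h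
    simp only [mellinCont]
    rw [ih (Tame.raise isBoundFamily_univ (ψ := fun _ => χ₁) h1 κ l j)
      (Tame.raise isBoundFamily_univ (ψ := fun _ => χ₂) h2 κ l j) ?_
      (affExp_raiseVec_re_add_count h)]
    · ring
    · intro w hw
      obtain ⟨χ₁', _, d1⟩ := h1.2 j
      obtain ⟨χ₂', _, d2⟩ := h2.2 j
      have d3 : HasDerivAt (fun s => χ₃ D (Function.update w j s))
          (a * χ₁' () D w + b * χ₂' () D w) (w j) := by
        refine (((d1 () D w hw).const_mul a).fun_add
          ((d2 () D w hw).const_mul b)).congr_of_eventuallyEq ?_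
        filter_upwards [eventually_update_mem hw j] with s hs
        exact he _ hs
      simp only [raiseExp, partialDeriv, (d1 () D w hw).deriv, (d2 () D w hw).deriv, d3.deriv,
        he w hw]
      ring

/-- The list of all coordinates, repeated `n` times. -/
def repeatAll (ι : Type*) [Fintype ι] (n : ℕ) : List ι :=
  (List.replicate n (Finset.univ : Finset ι).toList).flatten

theorem count_repeatAll (n : ℕ) (i : ι) : (repeatAll ι n).count i = n := by
  induction n with
  | zero => simp [repeatAll]
  | succ n ih =>
    have : repeatAll ι (n + 1) = Finset.univ.toList ++ repeatAll ι n := by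
      simp [repeatAll, List.replicate_succ]
    rw [this, List.count_append, ih, List.count_eq_one_of_mem (Finset.nodup_toList _) (by simp),
      add_comm]

theorem repeatAll_add (n m : ℕ) : repeatAll ι (n + m) = repeatAll ι n ++ repeatAll ι m := by
  rw [repeatAll, List.replicate_add, List.flatten_append, repeatAll, repeatAll]

/-- A number of steps after which the Mellin integral converges at `D`. -/
def stepCount (κ l : ι → ℝ) (r : ℝ) : ℕ := ⌈∑ i, (|κ i| * r + |l i|)⌉₊ + 1

theorem stepCount_spec (κ l : ι → ℝ) {r : ℝ} {n : ℕ} (hn : stepCount κ l r ≤ n) {D : ℂ}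
    (hD : ‖D‖ ≤ r) (i : ι) : 0 < (affExp κ l i D).re + (repeatAll ι n).count i := by
  have hr : 0 ≤ r := (norm_nonneg _).trans hD
  rw [count_repeatAll]
  have h1 : ∑ i, (|κ i| * r + |l i|) ≤ (⌈∑ i, (|κ i| * r + |l i|)⌉₊ : ℝ) := Nat.le_ceil _
  have h2 : |κ i| * r + |l i| ≤ ∑ i, (|κ i| * r + |l i|) :=
    Finset.single_le_sum (f := fun i => |κ i| * r + |l i|) (fun i _ => by positivity)
      (Finset.mem_univ i)
  have h3 : |κ i * D.re| ≤ |κ i| * r := by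
    rw [abs_mul]
    exact mul_le_mul_of_nonneg_left ((Complex.abs_re_le_norm D).trans hD) (abs_nonneg _)
  have h4 : ((stepCount κ l r : ℕ) : ℝ) ≤ n := by exact_mod_cast hn
  rw [stepCount] at h4
  push_cast at h4
  rw [affExp_re]
  linarith [neg_abs_le (κ i * D.re), neg_abs_le (l i)]

/-- The continuation of the Mellin integral to all `D`. -/
def mellinExt (κ l : ι → ℝ) (χ : ℂ → (ι → ℝ) → ℂ) (D : ℂ) : ℂ :=
  mellinCont κ (repeatAll ι (stepCount κ l ‖D‖)) l χ D

theorem mellinExt_eq_mellinCube {κ l : ι → ℝ} {χ : ℂ → (ι → ℝ) → ℂ} (hχ : ∀ k, Nice k χ) {D : ℂ}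
    (h : ∀ i, 0 < (affExp κ l i D).re) : mellinExt κ l χ D = mellinCube κ l χ D :=
  mellinCont_eq_mellinCube _ (hχ _) h

/-- In `mellinExt` the number of steps varies with `D`. On a disc one number serves all points, so
local properties can be read off a single formula. -/
theorem mellinExt_eq {κ l : ι → ℝ} {χ : ℂ → (ι → ℝ) → ℂ} (hχ : ∀ k, Nice k χ) {D : ℂ} {r : ℝ}
    (hD : ‖D‖ ≤ r) : mellinExt κ l χ D = mellinCont κ (repeatAll ι (stepCount κ l r)) l χ D := by
  have hle : stepCount κ l ‖D‖ ≤ stepCount κ l r := by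
    unfold stepCount
    gcongr
  obtain ⟨m, hm⟩ := Nat.exists_eq_add_of_le hle
  rw [mellinExt, hm, repeatAll_add]
  exact (mellinCont_append _ _ (hχ _) (stepCount_spec κ l le_rfl le_rfl)).symm

theorem mellinExt_eventuallyEq {κ l : ι → ℝ} {χ : ℂ → (ι → ℝ) → ℂ} (hχ : ∀ k, Nice k χ) (D : ℂ) :
    mellinExt κ l χ =ᶠ[nhds D]
      mellinCont κ (repeatAll ι (stepCount κ l (‖D‖ + 1))) l χ := by
  have hn : ∀ᶠ D' in nhds D, ‖D'‖ < ‖D‖ + 1 :=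
    continuous_norm.continuousAt.eventually_lt_const (by linarith)
  filter_upwards [hn] with D' hD'
  exact mellinExt_eq hχ hD'.le

theorem meromorphicAt_mellinExt {κ l : ι → ℝ} {χ : ℂ → (ι → ℝ) → ℂ} (hχ : ∀ k, Nice k χ) (D : ℂ) :
    MeromorphicAt (mellinExt κ l χ) D :=
  (meromorphicAt_mellinCont _ (hχ _) (stepCount_spec κ l le_rfl (by linarith))).congr
    ((mellinExt_eventuallyEq hχ D).symm.filter_mono nhdsWithin_le_nhds)

theorem analyticAt_mellinExt {κ l : ι → ℝ} {χ : ℂ → (ι → ℝ) → ℂ} (hχ : ∀ k, Nice k χ) {D : ℂ}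
    (h : ∀ i, ∀ r : ℕ, affExp κ l i D + r ≠ 0) : AnalyticAt ℂ (mellinExt κ l χ) D :=
  (analyticAt_mellinCont _ (hχ _) (stepCount_spec κ l le_rfl (by linarith)) h).congr
    (mellinExt_eventuallyEq hχ D).symm

theorem mellinExt_bound {𝓕 : Type*} {B : Set (𝓕 → ℝ)} (hB : IsBoundFamily B) {κ l : ι → ℝ}
    {ψ : 𝓕 → ℂ → (ι → ℝ) → ℂ} (hψ : ∀ k, Tame B k ψ) (D : ℂ) :
    ∃ p ∈ B, ∀ f, ‖mellinExt κ l (ψ f) D‖ ≤ p f :=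
  mellinCont_bound hB _ (hψ _) (stepCount_spec κ l le_rfl le_rfl)

theorem mellinExt_linear {κ l : ι → ℝ} {D : ℂ} (a b : ℂ) {χ₁ χ₂ χ₃ : ℂ → (ι → ℝ) → ℂ}
    (h1 : ∀ k, Nice k χ₁) (h2 : ∀ k, Nice k χ₂)
    (he : ∀ w ∈ paramDomain ι, χ₃ D w = a * χ₁ D w + b * χ₂ D w) :
    mellinExt κ l χ₃ D = a * mellinExt κ l χ₁ D + b * mellinExt κ l χ₂ D :=
  mellinCont_linear a b _ (h1 _) (h2 _) he (stepCount_spec κ l le_rfl le_rfl)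

end Mellin

/-! ### Determinants and adjugates of accretive matrices -/

section Accretive

variable {n : Type*} [Fintype n] [DecidableEq n]

/-- Real matrices with positive semidefinite symmetric part. -/
def Accretive (M : Matrix n n ℝ) : Prop := ∀ x : n → ℝ, 0 ≤ x ⬝ᵥ M.mulVec x

theorem det_ne_zero_of_strict {M : Matrix n n ℝ} (h : ∀ x : n → ℝ, x ≠ 0 → 0 < x ⬝ᵥ M.mulVec x) :
    M.det ≠ 0 := by
  intro h0
  obtain ⟨v, hv, hMv⟩ := Matrix.exists_mulVec_eq_zero_iff.2 h0
  have := h v hv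
  rw [hMv] at this
  simp at this

theorem dotProduct_self_pos {x : n → ℝ} (hx : x ≠ 0) : 0 < x ⬝ᵥ x := by
  have h0 : 0 ≤ x ⬝ᵥ x := Finset.sum_nonneg fun i _ => mul_self_nonneg _
  exact lt_of_le_of_ne h0 fun h => hx (dotProduct_self_eq_zero.1 h.symm)

/-- Along the segment from the identity to `M` the quadratic form stays positive definite, so the
determinant never vanishes and keeps the sign it has at the identity. -/
theorem det_pos_of_strict {M : Matrix n n ℝ} (h : ∀ x : n → ℝ, x ≠ 0 → 0 < x ⬝ᵥ M.mulVec x) :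
    0 < M.det := by
  by_contra hneg
  have hc : Continuous fun s : ℝ => ((1 - s) • (1 : Matrix n n ℝ) + s • M).det :=
    Continuous.matrix_det (by fun_prop)
  have hmem : (0 : ℝ) ∈ Set.Icc (((1 - (1:ℝ)) • (1 : Matrix n n ℝ) + (1:ℝ) • M).det)
      (((1 - (0:ℝ)) • (1 : Matrix n n ℝ) + (0:ℝ) • M).det) := by
    simp [not_lt.1 hneg]
  obtain ⟨s, hs, h0⟩ := intermediate_value_Icc' zero_le_one hc.continuousOn hmem
  refine det_ne_zero_of_strict (M := (1 - s) • (1 : Matrix n n ℝ) + s • M) (fun x hx => ?_) h0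
  rw [Matrix.add_mulVec, Matrix.smul_mulVec, Matrix.smul_mulVec, Matrix.one_mulVec, dotProduct_add,
    dotProduct_smul, dotProduct_smul, smul_eq_mul, smul_eq_mul]
  have h1 := dotProduct_self_pos hx
  have h2 := h x hx
  rcases hs.1.eq_or_lt with rfl | h3
  · simpa using h1
  · have : 0 ≤ (1 - s) * (x ⬝ᵥ x) := mul_nonneg (by linarith [hs.2]) h1.le
    have := mul_pos h3 h2
    linarith

theorem Accretive.strict {M : Matrix n n ℝ} (h : Accretive M) {ε : ℝ} (hε : 0 < ε) {x : n → ℝ}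
    (hx : x ≠ 0) : 0 < x ⬝ᵥ (M + ε • (1 : Matrix n n ℝ)).mulVec x := by
  rw [Matrix.add_mulVec, Matrix.smul_mulVec, Matrix.one_mulVec, dotProduct_add, dotProduct_smul,
    smul_eq_mul]
  have := mul_pos hε (dotProduct_self_pos hx)
  have := h x
  linarith

theorem Accretive.det_nonneg {M : Matrix n n ℝ} (h : Accretive M) : 0 ≤ M.det := by
  have hc : Continuous fun ε : ℝ => (M + ε • (1 : Matrix n n ℝ)).det :=
    Continuous.matrix_det (by fun_prop)
  have ht : Filter.Tendsto (fun ε : ℝ => (M + ε • (1 : Matrix n n ℝ)).det)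
      (nhdsWithin 0 (Set.Ioi 0)) (nhds M.det) := by
    have := (hc.tendsto 0).mono_left (nhdsWithin_le_nhds (s := Set.Ioi 0))
    simpa using this
  refine ge_of_tendsto ht ?_
  filter_upwards [self_mem_nhdsWithin] with ε hε
  exact (det_pos_of_strict fun x hx => h.strict hε hx).le

theorem Accretive.diagonal_add {M : Matrix n n ℝ} (h : Accretive M) {d : n → ℝ}
    (hd : ∀ i, 0 ≤ d i) : Accretive (Matrix.diagonal d + M) := by
  intro x
  rw [Matrix.add_mulVec, dotProduct_add]
  refine add_nonneg (Finset.sum_nonneg fun i _ => ?_) (h x)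
  rw [Matrix.mulVec_diagonal]
  nlinarith [mul_nonneg (hd i) (mul_self_nonneg (x i))]

/-- After adding `ε` times the identity, let `y` solve `N y = e_b`. Then `y ⬝ N y = y b`, and the
hypothesis gives `y a ^ 2 ≤ y b - y b ^ 2 ≤ 1`; by Cramer's rule `y a` is the adjugate entry over
the determinant. Let `ε` tend to `0`. -/
theorem abs_adjugate_le_det {M : Matrix n n ℝ} {a b : n}
    (h : ∀ x : n → ℝ, x a ^ 2 + x b ^ 2 ≤ x ⬝ᵥ M.mulVec x) : |M.adjugate a b| ≤ M.det := by
  have hacc : Accretive M := fun x => le_trans (by positivity) (h x)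
  have key : ∀ ε : ℝ, 0 < ε → |(M + ε • (1 : Matrix n n ℝ)).adjugate a b| ≤
      (M + ε • (1 : Matrix n n ℝ)).det := by
    intro ε hε
    set N := M + ε • (1 : Matrix n n ℝ) with hN
    have hdet : 0 < N.det := det_pos_of_strict fun x hx => hacc.strict hε hx
    set y : n → ℝ := fun i => N.det⁻¹ * N.adjugate i b with hy
    have hNy : N.mulVec y = Pi.single b 1 := by
      have h1 : y = N.det⁻¹ • (N.adjugate.mulVec (Pi.single b 1)) := by
        ext i; simp [hy]
      rw [h1, Matrix.mulVec_smul, Matrix.mulVec_mulVec, Matrix.mul_adjugate, Matrix.smul_mulVec,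
        Matrix.one_mulVec, smul_smul, inv_mul_cancel₀ hdet.ne', one_smul]
    have h1 : y ⬝ᵥ N.mulVec y = y b := by rw [hNy]; simp
    have h2 : y a ^ 2 + y b ^ 2 ≤ y b := by
      have h3 := h y
      have h4 : y ⬝ᵥ N.mulVec y = y ⬝ᵥ M.mulVec y + ε * (y ⬝ᵥ y) := by
        rw [hN, Matrix.add_mulVec, Matrix.smul_mulVec, Matrix.one_mulVec, dotProduct_add,
          dotProduct_smul, smul_eq_mul]
      have h5 : 0 ≤ ε * (y ⬝ᵥ y) :=
        mul_nonneg hε.le (Finset.sum_nonneg fun i _ => mul_self_nonneg _)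
      linarith
    have h3 : |y a| ≤ 1 := abs_le_one_iff_mul_self_le_one.2 (by nlinarith [sq_nonneg (y b - 1)])
    have h4 : N.adjugate a b = N.det * y a := by
      rw [hy]; field_simp
    rw [h4, abs_mul, abs_of_pos hdet]
    exact mul_le_of_le_one_right hdet.le h3
  have hc : Continuous fun ε : ℝ => M + ε • (1 : Matrix n n ℝ) := by fun_prop
  have c1 : Continuous fun ε : ℝ => |(M + ε • (1 : Matrix n n ℝ)).adjugate a b| :=
    (hc.matrix_adjugate.matrix_elem a b).abs
  have c2 : Continuous fun ε : ℝ => (M + ε • (1 : Matrix n n ℝ)).det := hc.matrix_det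
  have t1 := (c1.tendsto 0).mono_left (nhdsWithin_le_nhds (s := Set.Ioi 0))
  have t2 := (c2.tendsto 0).mono_left (nhdsWithin_le_nhds (s := Set.Ioi 0))
  have := le_of_tendsto_of_tendsto t1 t2 (by
    filter_upwards [self_mem_nhdsWithin] with ε hε using key ε hε)
  simpa using this

/-- `B` with the rows in `S` replaced by those of the identity. -/
def unitRows (S : Finset n) (B : Matrix n n ℝ) : Matrix n n ℝ :=
  Matrix.of fun i => if i ∈ S then Pi.single i 1 else B i

/-- Each row is a multiple of a unit vector plus a row of `B`; multilinearity in the rows expands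
the determinant over the set `S` of rows taken from the diagonal part. -/
theorem det_diagonal_add (d : n → ℝ) (B : Matrix n n ℝ) :
    (Matrix.diagonal d + B).det = ∑ S : Finset n, (∏ i ∈ S, d i) * (unitRows S B).det := by
  have h := (Matrix.detRowAlternating (n := n) (R := ℝ)).toMultilinearMap.map_add_univ
    (fun i => d i • (Pi.single i 1 : n → ℝ)) (fun i => B i)
  have e1 : ((fun i => d i • (Pi.single i 1 : n → ℝ)) + fun i => B i) =
      (Matrix.diagonal d + B : Matrix n n ℝ) := by
    ext i j
    by_cases hij : i = j
    · subst hij; simp [Matrix.add_apply]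
    · simp [Matrix.add_apply, Matrix.diagonal_apply_ne _ hij, Ne.symm hij]
  rw [e1] at h
  refine h.trans (Finset.sum_congr rfl fun S _ => ?_)
  have h2 := (Matrix.detRowAlternating (n := n) (R := ℝ)).toMultilinearMap.map_piecewise_smul
    d (fun i => unitRows S B i) S
  have e2 : S.piecewise (fun i => d i • (Pi.single i 1 : n → ℝ)) (fun i => B i) =
      S.piecewise (fun i => d i • unitRows S B i) (fun i => unitRows S B i) := by
    ext i j
    by_cases hi : i ∈ S
    · simp [hi, unitRows]
    · simp [hi, unitRows]
  rw [e2, h2]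
  rfl

/-- Replacing rows by unit rows is the limit of infinite diagonal weights: weights `ε⁻¹` on `S`,
with those rows rescaled by `ε`. For accretive `B` the matrix on the right is a positive diagonal
matrix times an accretive one, so signs and inequalities pass to `unitRows S B` as `ε` tends to `0`.
-/
theorem unitRows_limit (S : Finset n) (B : Matrix n n ℝ) {ε : ℝ} (hε : 0 < ε) :
    (Matrix.of fun i => if i ∈ S then (Pi.single i 1 : n → ℝ) + ε • B i else B i) =
      Matrix.diagonal (fun i => if i ∈ S then ε else 1) *
        (Matrix.diagonal (fun i => if i ∈ S then ε⁻¹ else 0) + B) := by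
  ext i j
  rw [Matrix.diagonal_mul, Matrix.add_apply]
  by_cases hi : i ∈ S
  · by_cases hij : i = j
    · subst hij
      simp [hi, mul_add, hε.ne']
    · simp [hi, Matrix.diagonal_apply_ne _ hij, Ne.symm hij]
  · by_cases hij : i = j
    · subst hij
      simp [hi]
    · simp [hi, Matrix.diagonal_apply_ne _ hij]

theorem continuous_unitRows_limit (S : Finset n) (B : Matrix n n ℝ) :
    Continuous fun ε : ℝ =>
      (Matrix.of fun i => if i ∈ S then (Pi.single i 1 : n → ℝ) + ε • B i else B i :
        Matrix n n ℝ) := by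
  refine continuous_pi fun i => ?_
  change Continuous fun ε : ℝ => if i ∈ S then (Pi.single i 1 : n → ℝ) + ε • B i else B i
  split_ifs
  · exact continuous_const.add (continuous_id.smul continuous_const)
  · exact continuous_const

theorem unitRows_eq (S : Finset n) (B : Matrix n n ℝ) :
    (Matrix.of fun i => if i ∈ S then (Pi.single i 1 : n → ℝ) + (0 : ℝ) • B i else B i) =
      unitRows S B := by
  simp [unitRows]

theorem Accretive.det_unitRows_nonneg {B : Matrix n n ℝ} (h : Accretive B) (S : Finset n) :
    0 ≤ (unitRows S B).det := by
  have c := (continuous_unitRows_limit S B).matrix_det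
  have t := (c.tendsto 0).mono_left (nhdsWithin_le_nhds (s := Set.Ioi 0))
  rw [unitRows_eq] at t
  refine ge_of_tendsto t ?_
  filter_upwards [self_mem_nhdsWithin] with ε hε
  have hε' : 0 < ε := hε
  rw [unitRows_limit S B hε', Matrix.det_mul, Matrix.det_diagonal]
  refine mul_nonneg (Finset.prod_nonneg fun i _ => by split_ifs <;> positivity) ?_
  exact (h.diagonal_add fun i => by split_ifs <;> positivity).det_nonneg

theorem adjugate_diagonal_mul_of_eq_one {δ : n → ℝ} (M : Matrix n n ℝ) {a b : n} (hb : δ b = 1) :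
    (Matrix.diagonal δ * M).adjugate a b = (∏ i, δ i) * M.adjugate a b := by
  rw [Matrix.adjugate_mul_distrib, Matrix.adjugate_diagonal, Matrix.mul_diagonal, mul_comm,
    ← Finset.mul_prod_erase _ _ (Finset.mem_univ b), hb, one_mul]

theorem abs_adjugate_unitRows_le {B : Matrix n n ℝ} {a b : n}
    (h : ∀ x : n → ℝ, x a ^ 2 + x b ^ 2 ≤ x ⬝ᵥ B.mulVec x) {S : Finset n} (hb : b ∉ S) :
    |(unitRows S B).adjugate a b| ≤ (unitRows S B).det := by
  have c := continuous_unitRows_limit S B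
  have t1 := ((c.matrix_adjugate.matrix_elem a b).abs.tendsto 0).mono_left
    (nhdsWithin_le_nhds (s := Set.Ioi 0))
  have t2 := (c.matrix_det.tendsto 0).mono_left (nhdsWithin_le_nhds (s := Set.Ioi 0))
  rw [unitRows_eq] at t1 t2
  refine le_of_tendsto_of_tendsto t1 t2 ?_
  filter_upwards [self_mem_nhdsWithin] with ε hε
  have hε' : 0 < ε := hε
  rw [unitRows_limit S B hε', Matrix.det_mul, Matrix.det_diagonal,
    adjugate_diagonal_mul_of_eq_one _ (by simp [hb]), abs_mul,
    abs_of_nonneg (Finset.prod_nonneg fun i _ => by split_ifs <;> positivity)]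
  refine mul_le_mul_of_nonneg_left (abs_adjugate_le_det fun x => ?_)
    (Finset.prod_nonneg fun i _ => by split_ifs <;> positivity)
  refine (h x).trans ?_
  rw [Matrix.add_mulVec, dotProduct_add]
  refine le_add_of_nonneg_left (Finset.sum_nonneg fun i _ => ?_)
  rw [Matrix.mulVec_diagonal]
  have : (0 : ℝ) ≤ if i ∈ S then ε⁻¹ else 0 := by split_ifs <;> positivity
  nlinarith [mul_nonneg this (mul_self_nonneg (x i))]

/-- A cofactor is the determinant with row `b` replaced by a unit vector. As `d b = 0`, the replaced
matrix is still diagonal plus constant and the expansion of the determinant applies. -/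
theorem adjugate_diagonal_add (d : n → ℝ) (B : Matrix n n ℝ) {a b : n} (hd : d b = 0) :
    (Matrix.diagonal d + B).adjugate a b =
      ∑ S : Finset n, (∏ i ∈ S, d i) * (unitRows S B).adjugate a b := by
  have h1 : (Matrix.diagonal d + B).updateRow b (Pi.single a 1) =
      Matrix.diagonal d + B.updateRow b (Pi.single a 1) := by
    ext i j
    by_cases hi : i = b
    · subst hi
      rw [Matrix.updateRow_self, Matrix.add_apply, Matrix.updateRow_self]
      by_cases hij : i = j
      · subst hij; simp [hd]
      · simp [Matrix.diagonal_apply_ne _ hij]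
    · simp [Matrix.updateRow_ne hi, Matrix.add_apply]
  rw [Matrix.adjugate_apply, h1, det_diagonal_add]
  refine Finset.sum_congr rfl fun S _ => ?_
  by_cases hb : b ∈ S
  · rw [Finset.prod_eq_zero hb hd, zero_mul, zero_mul]
  · congr 1
    rw [Matrix.adjugate_apply]
    congr 1
    ext i j
    by_cases hi : i = b
    · subst hi
      simp [unitRows, hb]
    · simp [unitRows, Matrix.updateRow_ne hi]

/-- The determinant is a polynomial in the diagonal weights with nonnegative coefficients. -/
theorem Accretive.det_mono {B : Matrix n n ℝ} (h : Accretive B) {d d' : n → ℝ}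
    (hd : ∀ i, 0 ≤ d i) (hdd : ∀ i, d i ≤ d' i) :
    (Matrix.diagonal d + B).det ≤ (Matrix.diagonal d' + B).det := by
  rw [det_diagonal_add, det_diagonal_add]
  refine Finset.sum_le_sum fun S _ => mul_le_mul_of_nonneg_right ?_ (h.det_unitRows_nonneg S)
  exact Finset.prod_le_prod (fun i _ => hd i) fun i _ => hdd i

/-- Compare the expansions coefficientwise: `1 ≤ (1 + σ⁻¹ ^ n) * σ ^ |S|` for every `S`, by the
first summand if `σ ≥ 1` and by the second if `σ ≤ 1`. -/
theorem Accretive.det_one_add_le {R : Matrix n n ℝ} (h : Accretive R) {σ : ℝ} (hσ : 0 < σ) :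
    (1 + R).det ≤ (1 + σ⁻¹ ^ Fintype.card n) * (σ • (1 : Matrix n n ℝ) + R).det := by
  have e1 : (1 : Matrix n n ℝ) = Matrix.diagonal fun _ => (1 : ℝ) := Matrix.diagonal_one.symm
  have e2 : σ • (1 : Matrix n n ℝ) = Matrix.diagonal fun _ => σ := by
    rw [e1, ← Matrix.diagonal_smul]; simp [Pi.smul_def]
  rw [e2, e1, det_diagonal_add, det_diagonal_add, Finset.mul_sum]
  refine Finset.sum_le_sum fun S _ => ?_
  rw [← mul_assoc]
  refine mul_le_mul_of_nonneg_right ?_ (h.det_unitRows_nonneg S)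
  rw [Finset.prod_const_one, Finset.prod_const]
  have hpos : 0 < σ ^ S.card := pow_pos hσ _
  rcases le_total 1 σ with h1 | h1
  · have := one_le_pow₀ h1 (n := S.card)
    have h2 : 0 ≤ σ⁻¹ ^ Fintype.card n := by positivity
    nlinarith
  · have h3 : σ ^ Fintype.card n ≤ σ ^ S.card :=
      pow_le_pow_of_le_one hσ.le h1 (Finset.card_le_univ S)
    have h4 : σ⁻¹ ^ Fintype.card n * σ ^ Fintype.card n = 1 := by
      rw [← mul_pow, inv_mul_cancel₀ hσ.ne', one_pow]
    have h5 : 0 ≤ σ⁻¹ ^ Fintype.card n := by positivity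
    nlinarith

/-- Jacobi's formula along a path of matrices. -/
theorem hasDerivAt_det {M : ℝ → Matrix n n ℝ} {M' : Matrix n n ℝ} {s : ℝ}
    (hM : ∀ i j, HasDerivAt (fun s => M s i j) (M' i j) s) :
    HasDerivAt (fun s => (M s).det) (∑ i, ∑ j, (M s).adjugate j i * M' i j) s := by
  let f : ContinuousMultilinearMap ℝ (fun _ : n => n → ℝ) ℝ :=
    { (Matrix.detRowAlternating (n := n) (R := ℝ)).toMultilinearMap with
      cont := (continuous_id (X := Matrix n n ℝ)).matrix_det }
  have hM' : HasDerivAt (fun s => (fun i => M s i : n → n → ℝ)) (fun i => M' i) s :=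
    hasDerivAt_pi.2 fun i => hasDerivAt_pi.2 fun j => hM i j
  have h := (f.hasFDerivAt (fun i => M s i)).comp_hasDerivAt s hM'
  refine h.congr_deriv ?_
  rw [ContinuousMultilinearMap.linearDeriv_apply]
  refine Finset.sum_congr rfl fun i _ => ?_
  change ((M s).updateRow i (M' i)).det = _
  rw [← Matrix.cramer_transpose_apply, Matrix.cramer_eq_adjugate_mulVec,
    ← Matrix.adjugate_transpose]
  simp [Matrix.mulVec, dotProduct]

end Accretive

/-! ### Test functions, modulated Gaussians and integration by parts -/

section TestFunctions

variable {P : Type*} [NormedAddCommGroup P] [InnerProductSpace ℝ P] [FiniteDimensional ℝ P]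
  [MeasurableSpace P] [BorelSpace P]

/-- Continuously differentiable functions with integrable moments of all orders. -/
structure TestFn (f : P → ℂ) : Prop where
  smooth : ContDiff ℝ 1 f
  moment : ∀ j : ℕ, Integrable fun x => ‖x‖ ^ j * ‖f x‖
  moment_fderiv : ∀ (j : ℕ) (v : P), Integrable fun x => ‖x‖ ^ j * ‖fderiv ℝ f x v‖

theorem TestFn.differentiable {f : P → ℂ} (h : TestFn f) : Differentiable ℝ f :=
  h.smooth.differentiable (by norm_num)

theorem TestFn.continuous {f : P → ℂ} (h : TestFn f) : Continuous f := h.smooth.continuous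

theorem TestFn.continuous_fderiv {f : P → ℂ} (h : TestFn f) (v : P) :
    Continuous fun x => fderiv ℝ f x v :=
  (h.smooth.continuous_fderiv (by norm_num)).clm_apply continuous_const

theorem TestFn.integrable {f : P → ℂ} (h : TestFn f) : Integrable f :=
  (integrable_norm_iff h.continuous.aestronglyMeasurable).1 (by simpa using h.moment 0)

theorem TestFn.integrable_fderiv {f : P → ℂ} (h : TestFn f) (v : P) :
    Integrable fun x => fderiv ℝ f x v :=
  (integrable_norm_iff (h.continuous_fderiv v).aestronglyMeasurable).1
    (by simpa using h.moment_fderiv 0 v)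

/-- Multiplication by a linear form costs one moment; demanding all moments makes the class stable,
for Schwartz functions and Gaussians alike. -/
theorem TestFn.mul_clm {f : P → ℂ} (h : TestFn f) (L : P →L[ℝ] ℂ) :
    TestFn fun x => L x * f x := by
  have hd : ∀ x v, fderiv ℝ (fun x => L x * f x) x v = L v * f x + L x * fderiv ℝ f x v := by
    intro x v
    rw [fderiv_fun_mul L.differentiableAt h.differentiable.differentiableAt]
    simp [add_comm, mul_comm]
  refine ⟨L.contDiff.mul h.smooth, fun j => ?_, fun j v => ?_⟩
  · refine ((h.moment (j + 1)).const_mul ‖L‖).mono'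
      (by have := h.continuous; fun_prop) (Filter.Eventually.of_forall fun x => ?_)
    rw [norm_mul, norm_pow, norm_norm, norm_norm, norm_mul, pow_succ]
    calc ‖x‖ ^ j * (‖L x‖ * ‖f x‖) ≤ ‖x‖ ^ j * ((‖L‖ * ‖x‖) * ‖f x‖) := by
          gcongr; exact L.le_opNorm x
      _ = _ := by ring
  · simp only [hd]
    refine (((h.moment j).const_mul ‖L v‖).add ((h.moment_fderiv (j + 1) v).const_mul ‖L‖)).mono'
      (by have := h.continuous; have := h.continuous_fderiv v; fun_prop)
      (Filter.Eventually.of_forall fun x => ?_)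
    rw [norm_mul, norm_pow, norm_norm, norm_norm]
    calc ‖x‖ ^ j * ‖L v * f x + L x * fderiv ℝ f x v‖
        ≤ ‖x‖ ^ j * (‖L v‖ * ‖f x‖ + (‖L‖ * ‖x‖) * ‖fderiv ℝ f x v‖) := by
          gcongr
          refine (norm_add_le _ _).trans ?_
          rw [norm_mul, norm_mul]
          gcongr
          exact L.le_opNorm x
      _ = _ := by simp only [Pi.add_apply]; ring

theorem testFn_schwartz (f : 𝓢(P, ℂ)) : TestFn (f : P → ℂ) where
  smooth := f.smooth 1
  moment j := f.integrable_pow_mul volume j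
  moment_fderiv j v := by
    simpa using (SchwartzMap.evalCLM ℝ P ℂ v (SchwartzMap.fderivCLM ℝ P ℂ f)).integrable_pow_mul volume j

/-- Half of the Gaussian absorbs the power of the norm, the other half is integrable. -/
theorem integrable_pow_mul_exp_neg_sq {σ : ℝ} (hσ : 0 < σ) (j : ℕ) :
    Integrable fun x : P => ‖x‖ ^ j * Real.exp (-σ * ‖x‖ ^ 2) := by
  have h0 : Integrable fun x : P => Real.exp (-(σ / 2) * ‖x‖ ^ 2) := by
    have := (GaussianFourier.integrable_cexp_neg_mul_sq_norm_add (V := P) (b := ((σ / 2 : ℝ) : ℂ))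
      (by simpa using hσ) 0 0).norm
    refine this.congr (Filter.Eventually.of_forall fun x => ?_)
    simp only [Complex.norm_exp, zero_mul, add_zero]
    norm_cast
  obtain ⟨C, hC⟩ : ∃ C : ℝ, ∀ y : ℝ, 0 ≤ y → y ^ j * Real.exp (-(σ / 2) * y ^ 2) ≤ C := by
    refine ⟨(j.factorial : ℝ) * (σ / 2)⁻¹ ^ j + 1, fun y hy => ?_⟩
    have hs : 0 < σ / 2 := by positivity
    rcases le_total y 1 with h1 | h1
    · have a1 : y ^ j ≤ 1 := pow_le_one₀ hy h1
      have a2 : Real.exp (-(σ / 2) * y ^ 2) ≤ 1 := Real.exp_le_one_iff.2 (by nlinarith [sq_nonneg y])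
      have a3 : 0 ≤ (j.factorial : ℝ) * (σ / 2)⁻¹ ^ j := by positivity
      nlinarith [Real.exp_pos (-(σ / 2) * y ^ 2), pow_nonneg hy j]
    · have b1 : y ^ j ≤ (y ^ 2) ^ j := by
        gcongr; nlinarith
      have b2 := Real.pow_div_factorial_le_exp (x := σ / 2 * y ^ 2) (by positivity) j
      rw [div_le_iff₀ (by positivity), mul_pow] at b2
      have b3 : (y ^ 2) ^ j ≤ j.factorial * (σ / 2)⁻¹ ^ j * Real.exp (σ / 2 * y ^ 2) := by
        rw [inv_pow, mul_assoc, mul_comm _ (Real.exp _), ← mul_assoc, ← div_eq_mul_inv,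
          le_div_iff₀ (by positivity)]
        linarith
      calc y ^ j * Real.exp (-(σ / 2) * y ^ 2)
          ≤ (j.factorial * (σ / 2)⁻¹ ^ j * Real.exp (σ / 2 * y ^ 2)) * Real.exp (-(σ / 2) * y ^ 2) := by
            gcongr; exact b1.trans b3
        _ = j.factorial * (σ / 2)⁻¹ ^ j := by
            rw [mul_assoc, ← Real.exp_add]; simp
        _ ≤ _ := by linarith
  refine (h0.const_mul C).mono' (by fun_prop) (Filter.Eventually.of_forall fun x => ?_)
  rw [norm_mul, norm_pow, norm_norm, Real.norm_of_nonneg (Real.exp_pos _).le]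
  calc ‖x‖ ^ j * Real.exp (-σ * ‖x‖ ^ 2)
      = (‖x‖ ^ j * Real.exp (-(σ / 2) * ‖x‖ ^ 2)) * Real.exp (-(σ / 2) * ‖x‖ ^ 2) := by
        rw [mul_assoc, ← Real.exp_add]; ring_nf
    _ ≤ _ := by gcongr; exact hC _ (norm_nonneg x)

/-- A modulated Gaussian. -/
def gaussWave (σ : ℝ) (w : P) (x : P) : ℂ :=
  Complex.exp (-(σ : ℂ) * (‖x‖ ^ 2 : ℝ) + Complex.I * (inner ℝ w x : ℝ))

theorem norm_gaussWave (σ : ℝ) (w x : P) : ‖gaussWave σ w x‖ = Real.exp (-σ * ‖x‖ ^ 2) := by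
  rw [gaussWave, Complex.norm_exp]
  congr 1
  simp only [Complex.add_re, ← Complex.ofReal_neg, ← Complex.ofReal_mul, Complex.ofReal_re]
  simp

theorem hasFDerivAt_gaussWave (σ : ℝ) (w x : P) :
    ∃ L : P →L[ℝ] ℂ, HasFDerivAt (gaussWave σ w) L x ∧
      ∀ v, L v = gaussWave σ w x *
        (-(σ : ℂ) * (2 * inner ℝ x v : ℝ) + Complex.I * (inner ℝ w v : ℝ)) := by
  have h1 : HasFDerivAt (fun x : P => ‖x‖ ^ 2) (2 • innerSL ℝ x) x := by
    simpa using (hasStrictFDerivAt_norm_sq x).hasFDerivAt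
  have h2 := (Complex.ofRealCLM.hasFDerivAt.comp x h1).const_mul (-(σ : ℂ))
  have h3 := (Complex.ofRealCLM.hasFDerivAt.comp x (innerSL ℝ w).hasFDerivAt).const_mul Complex.I
  refine ⟨_, (h2.add h3).cexp, fun v => ?_⟩
  simp [gaussWave, two_mul]
  ring

theorem fderiv_gaussWave (σ : ℝ) (w x v : P) :
    fderiv ℝ (gaussWave σ w) x v = gaussWave σ w x *
        (-(σ : ℂ) * (2 * inner ℝ x v : ℝ) + Complex.I * (inner ℝ w v : ℝ)) := by
  obtain ⟨L, h, hL⟩ := hasFDerivAt_gaussWave σ w x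
  rw [h.fderiv, hL]

theorem contDiff_gaussWave (σ : ℝ) (w : P) : ContDiff ℝ 1 (gaussWave σ w) := by
  have h1 : ContDiff ℝ 1 fun x : P => ((‖x‖ ^ 2 : ℝ) : ℂ) :=
    Complex.ofRealCLM.contDiff.comp (contDiff_norm_sq ℝ)
  have h2 : ContDiff ℝ 1 fun x : P => ((inner ℝ w x : ℝ) : ℂ) :=
    Complex.ofRealCLM.contDiff.comp (innerSL ℝ w).contDiff
  exact ((contDiff_const.mul h1).add (contDiff_const.mul h2)).cexp

theorem testFn_gaussWave {σ : ℝ} (hσ : 0 < σ) (w : P) : TestFn (gaussWave σ w) where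
  smooth := contDiff_gaussWave σ w
  moment j := by simpa only [norm_gaussWave] using integrable_pow_mul_exp_neg_sq hσ j
  moment_fderiv j v := by
    have hc := (contDiff_gaussWave σ w).continuous
    simp only [fderiv_gaussWave]
    refine (((integrable_pow_mul_exp_neg_sq hσ (j + 1)).const_mul (2 * σ * ‖v‖)).add
      ((integrable_pow_mul_exp_neg_sq hσ j).const_mul (‖w‖ * ‖v‖))).mono'
      (by fun_prop) (Filter.Eventually.of_forall fun x => ?_)
    rw [norm_mul, norm_pow, norm_norm, norm_norm, norm_mul, norm_gaussWave]
    have h1 : ‖-(σ : ℂ) * (2 * inner ℝ x v : ℝ) + Complex.I * (inner ℝ w v : ℝ)‖ ≤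
        σ * (2 * (‖x‖ * ‖v‖)) + ‖w‖ * ‖v‖ := by
      refine (norm_add_le _ _).trans (add_le_add ?_ ?_)
      · rw [norm_mul, norm_neg, Complex.norm_real, Complex.norm_real, norm_mul,
          Real.norm_of_nonneg hσ.le, Real.norm_of_nonneg (by norm_num : (0:ℝ) ≤ 2)]
        gcongr
        exact abs_real_inner_le_norm x v
      · rw [norm_mul, Complex.norm_I, one_mul, Complex.norm_real]
        exact abs_real_inner_le_norm w v
    calc _ ≤ ‖x‖ ^ j * (Real.exp (-σ * ‖x‖ ^ 2) * (σ * (2 * (‖x‖ * ‖v‖)) + ‖w‖ * ‖v‖)) := by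
          gcongr
      _ = _ := by simp only [Pi.add_apply]; ring

/-- Integration by parts against a function bounded by one. -/
theorem TestFn.integral_cexp_fderiv {f : P → ℂ} (hf : TestFn f) {q : P → ℂ} {q' : P → P → ℂ}
    (hq : ∀ x v, ∃ L : P →L[ℝ] ℂ, HasFDerivAt q L x ∧ L v = q' x v) (hre : ∀ x, 0 ≤ (q x).re)
    (v : P) (hq' : Integrable fun x => q' x v * Complex.exp (-q x) * f x) :
    ∫ x, q' x v * Complex.exp (-q x) * f x = ∫ x, Complex.exp (-q x) * fderiv ℝ f x v := by
  have hdq : Differentiable ℝ q := fun x => (hq x v).choose_spec.1.differentiableAt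
  have hb : ∀ x, ‖Complex.exp (-q x)‖ ≤ 1 := fun x => by
    rw [Complex.norm_exp]; exact Real.exp_le_one_iff.2 (by simpa using hre x)
  have hE : ∀ x, fderiv ℝ (fun x => Complex.exp (-q x)) x v = -(q' x v * Complex.exp (-q x)) := by
    intro x
    obtain ⟨L, h, hL⟩ := hq x v
    have := h.neg.cexp.fderiv
    simp only [Pi.neg_apply] at this
    rw [this]
    simp [hL, mul_comm]
  have hc : Continuous fun x => Complex.exp (-q x) := by
    have := hdq.continuous; fun_prop
  rw [integral_mul_fderiv_eq_neg_fderiv_mul_of_integrable (𝕜 := ℂ)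
    (f := fun x => Complex.exp (-q x)) (g := f) (v := v)]
  · rw [← integral_neg]
    refine integral_congr_ae (Filter.Eventually.of_forall fun x => ?_)
    simp only [hE]
    ring
  · simp only [hE, neg_mul]; exact hq'.neg
  · exact (hf.integrable_fderiv v).bdd_mul hc.aestronglyMeasurable (c := 1)
      (Filter.Eventually.of_forall hb)
  · exact hf.integrable.bdd_mul hc.aestronglyMeasurable (c := 1) (Filter.Eventually.of_forall hb)
  · exact fun x _ => (hdq x).neg.cexp
  · exact fun x _ => hf.differentiable x

/-- Differentiation of Gaussian integrals with respect to a parameter of the exponent. -/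
theorem TestFn.hasDerivAt_integral_cexp {f : P → ℂ} (hf : TestFn f) {φ φ' : ℝ → P → ℂ} {s₀ C : ℝ}
    (h : ∀ᶠ s in nhds s₀, ∀ x, HasDerivAt (fun s => φ s x) (φ' s x) s ∧ 0 ≤ (φ s x).re ∧
      ‖φ' s x‖ ≤ C * (1 + ‖x‖ ^ 2)) (hc : ∀ s, Continuous (φ s)) (hc' : Continuous (φ' s₀)) :
    HasDerivAt (fun s => ∫ x, Complex.exp (-φ s x) * f x)
      (∫ x, -(φ' s₀ x * Complex.exp (-φ s₀ x) * f x)) s₀ := by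
  obtain ⟨U, hU, hU'⟩ := Filter.eventually_iff_exists_mem.1 h
  have hb : ∀ s ∈ U, ∀ x, ‖Complex.exp (-φ s x)‖ ≤ 1 := fun s hs x => by
    rw [Complex.norm_exp]; exact Real.exp_le_one_iff.2 (by simpa using (hU' s hs x).2.1)
  have hfc := hf.continuous
  refine (hasDerivAt_integral_of_dominated_loc_of_deriv_le (𝕜 := ℝ) (μ := volume) (s := U)
    (x₀ := s₀) (F := fun s x => Complex.exp (-φ s x) * f x)
    (F' := fun s x => -(φ' s x * Complex.exp (-φ s x) * f x))
    (bound := fun x => C * (‖x‖ ^ 0 * ‖f x‖ + ‖x‖ ^ 2 * ‖f x‖)) hU ?_ ?_ ?_ ?_ ?_ ?_).2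
  · refine Filter.Eventually.of_forall fun s => ?_
    have := hc s
    exact Continuous.aestronglyMeasurable (by fun_prop)
  · have := hc s₀
    exact hf.integrable.bdd_mul (c := 1) (Continuous.aestronglyMeasurable (by fun_prop))
      (Filter.Eventually.of_forall (hb s₀ (mem_of_mem_nhds hU)))
  · have := hc s₀
    exact Continuous.aestronglyMeasurable (by fun_prop)
  · refine Filter.Eventually.of_forall fun x s hs => ?_
    rw [norm_neg, norm_mul, norm_mul]
    calc ‖φ' s x‖ * ‖Complex.exp (-φ s x)‖ * ‖f x‖ ≤ C * (1 + ‖x‖ ^ 2) * 1 * ‖f x‖ := by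
          have := (hU' s hs x).2.2
          have h0 : 0 ≤ C * (1 + ‖x‖ ^ 2) := (norm_nonneg _).trans this
          gcongr
          exact hb s hs x
      _ = _ := by ring
  · exact ((hf.moment 0).add (hf.moment 2)).const_mul C
  · refine Filter.Eventually.of_forall fun x s hs => ?_
    have := ((hU' s hs x).1.neg.cexp).mul_const (f x)
    simp only [Pi.neg_apply] at this
    refine this.congr_deriv ?_
    ring

end TestFunctions

/-! ### The Gaussian exponent in complex coordinates -/

section HermitianForm

variable {Y : Type*} [Fintype Y] [DecidableEq Y] {m : ℕ}

/-- Configurations of vectors `x a` of `ℝ^{2m}`, as a Euclidean space. -/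
abbrev Phase (Y : Type*) (m : ℕ) := EuclideanSpace ℝ (Y × Fin m × Fin 2)

/-- Complex coordinates. -/
def zc (a : Y) (k : Fin m) : Phase Y m →L[ℝ] ℂ :=
  Complex.ofRealCLM.comp (EuclideanSpace.proj (𝕜 := ℝ) (a, k, (0 : Fin 2))) +
    Complex.I • Complex.ofRealCLM.comp (EuclideanSpace.proj (𝕜 := ℝ) (a, k, (1 : Fin 2)))

/-- Conjugate complex coordinates. -/
def zbar (a : Y) (k : Fin m) : Phase Y m →L[ℝ] ℂ :=
  Complex.ofRealCLM.comp (EuclideanSpace.proj (𝕜 := ℝ) (a, k, (0 : Fin 2))) -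
    Complex.I • Complex.ofRealCLM.comp (EuclideanSpace.proj (𝕜 := ℝ) (a, k, (1 : Fin 2)))

theorem zc_apply (a : Y) (k : Fin m) (x : Phase Y m) :
    zc a k x = (x (a, k, 0) : ℂ) + Complex.I * (x (a, k, 1) : ℂ) := rfl

theorem zbar_apply (a : Y) (k : Fin m) (x : Phase Y m) :
    zbar a k x = (x (a, k, 0) : ℂ) - Complex.I * (x (a, k, 1) : ℂ) := rfl

/-- The form `∑ R a b (x a ⬝ x b + I x a ∧ x b)`. -/
def qform (R : Matrix Y Y ℝ) (x : Phase Y m) : ℂ :=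
  ∑ k, ∑ a, ∑ b, (R a b : ℂ) * (zbar a k x * zc b k x)

/-- The antisymmetric part of `R` contributes only to the imaginary part, so the real part is the
form of `R` on each real coordinate separately. Accretivity of `R` is thus what makes the Gaussian
bounded by one. -/
theorem qform_re (R : Matrix Y Y ℝ) (x : Phase Y m) :
    (qform R x).re = ∑ k, ∑ i : Fin 2, (fun a => x (a, k, i)) ⬝ᵥ R.mulVec (fun a => x (a, k, i)) := by
  simp only [qform, Complex.re_sum, zc_apply, zbar_apply, dotProduct, Matrix.mulVec,
    Fin.sum_univ_two, Finset.mul_sum, ← Finset.sum_add_distrib]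
  refine Finset.sum_congr rfl fun k _ => Finset.sum_congr rfl fun a _ =>
    Finset.sum_congr rfl fun b _ => ?_
  simp
  ring

theorem qform_re_nonneg {R : Matrix Y Y ℝ} (hR : Accretive R) (x : Phase Y m) :
    0 ≤ (qform R x).re := by
  rw [qform_re]
  exact Finset.sum_nonneg fun k _ => Finset.sum_nonneg fun i _ => hR _

theorem norm_coord_le (x : Phase Y m) (i : Y × Fin m × Fin 2) : ‖(x i : ℂ)‖ ≤ ‖x‖ := by
  rw [Complex.norm_real]
  exact PiLp.norm_apply_le x i

theorem norm_zc_le (a : Y) (k : Fin m) (x : Phase Y m) : ‖zc a k x‖ ≤ 2 * ‖x‖ := by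
  rw [zc_apply]
  refine (norm_add_le _ _).trans ?_
  rw [norm_mul, Complex.norm_I, one_mul]
  linarith [norm_coord_le x (a, k, 0), norm_coord_le x (a, k, 1)]

theorem norm_zbar_le (a : Y) (k : Fin m) (x : Phase Y m) : ‖zbar a k x‖ ≤ 2 * ‖x‖ := by
  rw [zbar_apply]
  refine (norm_sub_le _ _).trans ?_
  rw [norm_mul, Complex.norm_I, one_mul]
  linarith [norm_coord_le x (a, k, 0), norm_coord_le x (a, k, 1)]

theorem norm_qform_le {R : Matrix Y Y ℝ} {C : ℝ} (hC : ∀ a b, |R a b| ≤ C) (x : Phase Y m) :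
    ‖qform R x‖ ≤ (m * Fintype.card Y * Fintype.card Y * C * 4) * ‖x‖ ^ 2 := by
  have h1 : ∀ (k : Fin m) a b, ‖(R a b : ℂ) * (zbar a k x * zc b k x)‖ ≤ C * 4 * ‖x‖ ^ 2 := by
    intro k a b
    rw [norm_mul, norm_mul, Complex.norm_real]
    have hC0 : 0 ≤ C := (abs_nonneg _).trans (hC a b)
    calc ‖R a b‖ * (‖zbar a k x‖ * ‖zc b k x‖) ≤ C * ((2 * ‖x‖) * (2 * ‖x‖)) := by
          gcongr
          · exact hC a b
          · exact norm_zbar_le a k x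
          · exact norm_zc_le b k x
      _ = _ := by ring
  calc ‖qform R x‖ ≤ ∑ _k : Fin m, ∑ _a : Y, ∑ _b : Y, C * 4 * ‖x‖ ^ 2 := by
        refine norm_sum_le_of_le _ fun k _ => norm_sum_le_of_le _ fun a _ =>
          norm_sum_le_of_le _ fun b _ => h1 k a b
    _ = _ := by simp; ring

theorem continuous_qform (R : Matrix Y Y ℝ) : Continuous (qform (m := m) R) := by
  unfold qform; fun_prop

theorem hasFDerivAt_qform (R : Matrix Y Y ℝ) (x v : Phase Y m) :
    ∃ L : Phase Y m →L[ℝ] ℂ, HasFDerivAt (qform R) L x ∧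
      L v = ∑ k, ∑ a, ∑ b, (R a b : ℂ) * (zbar a k v * zc b k x + zbar a k x * zc b k v) := by
  have h := HasFDerivAt.fun_sum (x := x) (u := Finset.univ) fun k (_ : k ∈ Finset.univ) =>
    HasFDerivAt.fun_sum (u := Finset.univ) fun a (_ : a ∈ Finset.univ) =>
    HasFDerivAt.fun_sum (u := Finset.univ) fun b (_ : b ∈ Finset.univ) =>
      ((((zbar a k).hasFDerivAt (x := x)).mul ((zc (m := m) b k).hasFDerivAt)).const_mul
        (R a b : ℂ))
  refine ⟨_, h, ?_⟩
  simp only [sum_apply]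
  refine Finset.sum_congr rfl fun k _ => Finset.sum_congr rfl fun a _ =>
    Finset.sum_congr rfl fun b _ => ?_
  simp
  ring

/-- Coordinate vectors. -/
def unitVec (b : Y) (k : Fin m) (i : Fin 2) : Phase Y m := EuclideanSpace.single (b, k, i) 1

theorem unitVec_apply (b : Y) (l : Fin m) (i : Fin 2) (p : Y × Fin m × Fin 2) :
    unitVec b l i p = if p = (b, l, i) then 1 else 0 := by
  simp [unitVec]

theorem zc_unitVec_zero (a b : Y) (k l : Fin m) :
    zc a k (unitVec b l 0) = if a = b ∧ k = l then 1 else 0 := by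
  simp only [zc_apply, unitVec_apply, Prod.mk.injEq]
  split_ifs <;> simp_all

theorem zc_unitVec_one (a b : Y) (k l : Fin m) :
    zc a k (unitVec b l 1) = Complex.I * if a = b ∧ k = l then 1 else 0 := by
  simp only [zc_apply, unitVec_apply, Prod.mk.injEq]
  split_ifs <;> simp_all

theorem zbar_unitVec_zero (a b : Y) (k l : Fin m) :
    zbar a k (unitVec b l 0) = if a = b ∧ k = l then 1 else 0 := by
  simp only [zbar_apply, unitVec_apply, Prod.mk.injEq]
  split_ifs <;> simp_all

theorem zbar_unitVec_one (a b : Y) (k l : Fin m) :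
    zbar a k (unitVec b l 1) = -(Complex.I * if a = b ∧ k = l then 1 else 0) := by
  simp only [zbar_apply, unitVec_apply, Prod.mk.injEq]
  split_ifs <;> simp_all

/-- The antiholomorphic derivative. -/
def dbar (b : Y) (k : Fin m) (f : Phase Y m → ℂ) (x : Phase Y m) : ℂ :=
  (1 / 2) * (fderiv ℝ f x (unitVec b k 0) + Complex.I * fderiv ℝ f x (unitVec b k 1))

/-- The holomorphic derivative. -/
def dz (a : Y) (k : Fin m) (f : Phase Y m → ℂ) (x : Phase Y m) : ℂ :=
  (1 / 2) * (fderiv ℝ f x (unitVec a k 0) - Complex.I * fderiv ℝ f x (unitVec a k 1))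

theorem norm_cexp_neg_qform_le {R : Matrix Y Y ℝ} (hR : Accretive R) (x : Phase Y m) :
    ‖Complex.exp (-qform R x)‖ ≤ 1 := by
  rw [Complex.norm_exp]
  exact Real.exp_le_one_iff.2 (by simpa using qform_re_nonneg hR x)

theorem integrable_cexp_mul {R : Matrix Y Y ℝ} (hR : Accretive R) {f : Phase Y m → ℂ}
    (hf : Integrable f) : Integrable fun x => Complex.exp (-qform R x) * f x := by
  have := continuous_qform (m := m) R
  exact hf.bdd_mul (c := 1) (Continuous.aestronglyMeasurable (by fun_prop))
    (Filter.Eventually.of_forall (norm_cexp_neg_qform_le hR))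

/-- The Gaussian integral of a test function. -/
def gaussInt (R : Matrix Y Y ℝ) (f : Phase Y m → ℂ) : ℂ := ∫ x, Complex.exp (-qform R x) * f x

theorem gaussInt_add {R : Matrix Y Y ℝ} (hR : Accretive R) {f g : Phase Y m → ℂ}
    (hf : Integrable f) (hg : Integrable g) :
    gaussInt R (fun x => f x + g x) = gaussInt R f + gaussInt R g := by
  simp only [gaussInt, mul_add]
  exact integral_add (integrable_cexp_mul hR hf) (integrable_cexp_mul hR hg)

theorem gaussInt_const_mul (R : Matrix Y Y ℝ) (c : ℂ) (f : Phase Y m → ℂ) :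
    gaussInt R (fun x => c * f x) = c * gaussInt R f := by
  simp only [gaussInt, ← integral_const_mul]
  congr 1; ext x; ring

theorem gaussInt_sum {R : Matrix Y Y ℝ} (hR : Accretive R) {α : Type*} (s : Finset α)
    {f : α → Phase Y m → ℂ} (hf : ∀ a ∈ s, Integrable (f a)) :
    gaussInt R (fun x => ∑ a ∈ s, f a x) = ∑ a ∈ s, gaussInt R (f a) := by
  simp only [gaussInt, Finset.mul_sum]
  exact integral_finsetSum s fun a ha => integrable_cexp_mul hR (hf a ha)

theorem TestFn.gaussInt_fderiv {R : Matrix Y Y ℝ} (hR : Accretive R) {f : Phase Y m → ℂ}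
    (hf : TestFn f) (v : Phase Y m) :
    gaussInt R (fun x => fderiv ℝ f x v) = ∑ k, ∑ a, ∑ b, (R a b : ℂ) *
      (zbar a k v * gaussInt R (fun x => zc b k x * f x) +
        zc b k v * gaussInt R (fun x => zbar a k x * f x)) := by
  have hz := fun b k => (hf.mul_clm (zc b k)).integrable
  have hzb := fun b k => (hf.mul_clm (zbar b k)).integrable
  have h1 : ∀ x, (∑ k, ∑ a, ∑ b, (R a b : ℂ) * (zbar a k v * zc b k x + zbar a k x * zc b k v))
      * Complex.exp (-qform R x) * f x = Complex.exp (-qform R x) * (∑ k, ∑ a, ∑ b, (R a b : ℂ) *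
        (zbar a k v * (zc b k x * f x) + zc b k v * (zbar a k x * f x))) := by
    intro x
    rw [mul_comm _ (Complex.exp _), mul_assoc]
    congr 1
    simp only [Finset.sum_mul]
    refine Finset.sum_congr rfl fun k _ => Finset.sum_congr rfl fun a _ =>
      Finset.sum_congr rfl fun b _ => ?_
    ring
  have hi : ∀ k a b, Integrable fun x => (R a b : ℂ) *
        (zbar a k v * (zc b k x * f x) + zc b k v * (zbar a k x * f x)) := fun k a b =>
    (((hz b k).const_mul _).add ((hzb a k).const_mul _)).const_mul _
  have h2 := hf.integral_cexp_fderiv (fun x v => hasFDerivAt_qform R x v)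
    (qform_re_nonneg hR) v (by
      simp only [h1]
      exact integrable_cexp_mul hR (integrable_finsetSum _ fun k _ => integrable_finsetSum _
        fun a _ => integrable_finsetSum _ fun b _ => hi k a b))
  simp only [h1] at h2
  rw [gaussInt, ← h2]
  change gaussInt R _ = _
  rw [gaussInt_sum hR _ fun k _ => integrable_finsetSum _
        fun a _ => integrable_finsetSum _ fun b _ => hi k a b]
  refine Finset.sum_congr rfl fun k _ => ?_
  rw [gaussInt_sum hR _ fun a _ => integrable_finsetSum _ fun b _ => hi k a b]
  refine Finset.sum_congr rfl fun a _ => ?_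
  rw [gaussInt_sum hR _ fun b _ => hi k a b]
  refine Finset.sum_congr rfl fun b _ => ?_
  rw [gaussInt_const_mul, gaussInt_add hR ((hz b k).const_mul _) ((hzb a k).const_mul _),
    gaussInt_const_mul, gaussInt_const_mul]

/-- The antiholomorphic derivative of the exponent is `∑ c, R b c * z_c`: of the two kinds of terms
produced by integration by parts, those with `z̄` cancel between the two real directions. -/
theorem TestFn.gaussInt_dbar {R : Matrix Y Y ℝ} (hR : Accretive R) {f : Phase Y m → ℂ}
    (hf : TestFn f) (b : Y) (k : Fin m) :
    gaussInt R (dbar b k f) = ∑ c, (R b c : ℂ) * gaussInt R (fun x => zc c k x * f x) := by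
  unfold dbar
  rw [gaussInt_const_mul, gaussInt_add hR (hf.integrable_fderiv _)
    ((hf.integrable_fderiv _).const_mul _), gaussInt_const_mul, hf.gaussInt_fderiv hR,
    hf.gaussInt_fderiv hR]
  simp only [zc_unitVec_zero, zc_unitVec_one, zbar_unitVec_zero, zbar_unitVec_one, Finset.mul_sum,
    ← Finset.sum_add_distrib]
  have key : ∀ r A B δ δ' : ℂ, 1 / 2 * (r * (δ * A + δ' * B) +
      Complex.I * (r * (-(Complex.I * δ) * A + Complex.I * δ' * B))) = δ * (r * A) := by
    intro r A B δ δ'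
    linear_combination (1 / 2 * (r * (δ' * B - δ * A))) * Complex.I_mul_I
  simp only [key]
  simp only [ite_and, ite_mul, one_mul, zero_mul]
  simp

/-- Mirror image of the antiholomorphic case, with the transpose of `R` acting on the `z̄` moments.
-/
theorem TestFn.gaussInt_dz {R : Matrix Y Y ℝ} (hR : Accretive R) {f : Phase Y m → ℂ}
    (hf : TestFn f) (a : Y) (k : Fin m) :
    gaussInt R (dz a k f) = ∑ c, (R c a : ℂ) * gaussInt R (fun x => zbar c k x * f x) := by
  unfold dz
  simp only [sub_eq_add_neg, ← neg_mul]
  rw [gaussInt_const_mul, gaussInt_add hR (hf.integrable_fderiv _)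
    ((hf.integrable_fderiv _).const_mul _), gaussInt_const_mul, hf.gaussInt_fderiv hR,
    hf.gaussInt_fderiv hR]
  simp only [zc_unitVec_zero, zc_unitVec_one, zbar_unitVec_zero, zbar_unitVec_one, Finset.mul_sum,
    ← Finset.sum_add_distrib]
  have key : ∀ r A B δ δ' : ℂ, 1 / 2 * (r * (δ * A + δ' * B) +
      -Complex.I * (r * (-(Complex.I * δ) * A + Complex.I * δ' * B))) = δ' * (r * B) := by
    intro r A B δ δ'
    linear_combination (1 / 2 * (r * (δ * A - δ' * B))) * Complex.I_mul_I
  simp only [key]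
  simp only [ite_and, ite_mul, one_mul, zero_mul]
  simp

end HermitianForm

/-! ### Paths of matrices, inverses and accretivity -/

section MatrixPaths

variable {n : Type*} [Fintype n] [DecidableEq n]

/-- Cramer's rule and Jacobi's formula give differentiability; the value follows by differentiating
`M * M⁻¹ = 1`, which holds near `s` because the determinant stays nonzero. -/
theorem hasDerivAt_matrix_inv {M : ℝ → Matrix n n ℝ} {M' : Matrix n n ℝ} {s : ℝ}
    (h : ∀ i j, HasDerivAt (fun s => M s i j) (M' i j) s) (hd : (M s).det ≠ 0) (i j : n) :
    HasDerivAt (fun s => (M s)⁻¹ i j) (-((M s)⁻¹ * M' * (M s)⁻¹) i j) s := by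
  have hdet := (hasDerivAt_det h).differentiableAt
  have hadj : ∀ i j, DifferentiableAt ℝ (fun s => (M s).adjugate i j) s := by
    intro i j
    simp only [Matrix.adjugate_apply]
    refine (hasDerivAt_det (M' := fun a b => if a = j then 0 else M' a b) fun a b => ?_).differentiableAt
    by_cases ha : a = j
    · simp only [ha, Matrix.updateRow_self, if_true]
      exact hasDerivAt_const _ _
    · simp only [Matrix.updateRow_ne ha, ha, if_false]
      exact h a b
  have hinv : ∀ i j, DifferentiableAt ℝ (fun s => (M s)⁻¹ i j) s := by
    intro i j
    simp only [Matrix.inv_def, Matrix.smul_apply, Ring.inverse_eq_inv', smul_eq_mul]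
    exact (hdet.inv hd).mul (hadj i j)
  let D : Matrix n n ℝ := fun i j => deriv (fun s => (M s)⁻¹ i j) s
  have hD : ∀ i j, HasDerivAt (fun s => (M s)⁻¹ i j) (D i j) s := fun i j => (hinv i j).hasDerivAt
  have hprod : M' * (M s)⁻¹ + M s * D = 0 := by
    ext a b
    have h1 : HasDerivAt (fun s => ∑ c, M s a c * (M s)⁻¹ c b)
        (∑ c, (M' a c * (M s)⁻¹ c b + M s a c * D c b)) s :=
      HasDerivAt.fun_sum fun c _ => (h a c).mul (hD c b)
    have h2 : (fun s => ∑ c, M s a c * (M s)⁻¹ c b) =ᶠ[nhds s] fun _ => (1 : Matrix n n ℝ) a b := by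
      filter_upwards [hdet.continuousAt.eventually_ne hd] with r hr
      rw [← Matrix.mul_apply, Matrix.mul_nonsing_inv _ (Ne.isUnit hr)]
    have h3 := (h1.congr_of_eventuallyEq h2.symm).unique (hasDerivAt_const s _)
    simpa [Matrix.add_apply, Matrix.mul_apply, Finset.sum_add_distrib] using h3
  have hDe : D = -((M s)⁻¹ * M' * (M s)⁻¹) := by
    have h1 : M s * D = -(M' * (M s)⁻¹) := by
      rw [add_comm] at hprod; exact eq_neg_of_add_eq_zero_left hprod
    calc D = (M s)⁻¹ * (M s * D) := by
          rw [← Matrix.mul_assoc, Matrix.nonsing_inv_mul _ (Ne.isUnit hd), Matrix.one_mul]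
      _ = _ := by rw [h1, Matrix.mul_neg, Matrix.mul_assoc]
  have := hD i j
  rw [hDe] at this
  exact this

theorem eq_inv_mulVec {M : Matrix n n ℝ} (hM : M.det ≠ 0) {v u : n → ℂ}
    (h : ∀ b, ∑ c, (M b c : ℂ) * v c = u b) (c : n) : v c = ∑ b, (M⁻¹ c b : ℂ) * u b := by
  simp only [← h, Finset.mul_sum, ← mul_assoc]
  rw [Finset.sum_comm]
  simp only [← Finset.sum_mul]
  have h1 : ∀ d, ∑ b, (M⁻¹ c b : ℂ) * (M b d : ℂ) = if c = d then 1 else 0 := by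
    intro d
    have := congrFun (congrFun (Matrix.nonsing_inv_mul M (Ne.isUnit hM)) c) d
    rw [Matrix.mul_apply, Matrix.one_apply] at this
    have h2 : ((∑ b, M⁻¹ c b * M b d : ℝ) : ℂ) = ((if c = d then 1 else 0 : ℝ) : ℂ) := by rw [this]
    rw [Complex.ofReal_sum] at h2
    simp only [Complex.ofReal_mul] at h2
    rw [h2]
    split_ifs <;> simp
  simp [h1]

/-- With `x = M y`, the form of `M⁻¹` at `x` is the form of `M` at `y`. -/
theorem Accretive.inv {M : Matrix n n ℝ} (h : Accretive M) (hM : M.det ≠ 0) : Accretive M⁻¹ := by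
  intro x
  have hx : x = M.mulVec (M⁻¹.mulVec x) := by
    rw [Matrix.mulVec_mulVec, Matrix.mul_nonsing_inv _ (Ne.isUnit hM), Matrix.one_mulVec]
  have := h (M⁻¹.mulVec x)
  rw [← hx, dotProduct_comm] at this
  exact this

theorem Accretive.smul {M : Matrix n n ℝ} (h : Accretive M) {c : ℝ} (hc : 0 ≤ c) :
    Accretive (c • M) := by
  intro x
  rw [Matrix.smul_mulVec, dotProduct_smul, smul_eq_mul]
  exact mul_nonneg hc (h x)

theorem Accretive.det_smul_one_add_pos {R : Matrix n n ℝ} (h : Accretive R) {σ : ℝ} (hσ : 0 < σ) :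
    0 < (σ • (1 : Matrix n n ℝ) + R).det := by
  refine det_pos_of_strict fun x hx => ?_
  rw [Matrix.add_mulVec, Matrix.smul_mulVec, Matrix.one_mulVec, dotProduct_add, dotProduct_smul,
    smul_eq_mul]
  have := mul_pos hσ (dotProduct_self_pos hx)
  linarith [h x]

theorem Accretive.smul_one_add {R : Matrix n n ℝ} (h : Accretive R) {σ : ℝ} (hσ : 0 < σ) :
    Accretive (σ • (1 : Matrix n n ℝ) + R) := by
  intro x
  rw [Matrix.add_mulVec, Matrix.smul_mulVec, Matrix.one_mulVec, dotProduct_add, dotProduct_smul,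
    smul_eq_mul]
  have : 0 ≤ x ⬝ᵥ x := by simpa using dotProduct_self_star_nonneg x
  have := mul_nonneg hσ.le this
  linarith [h x]

end MatrixPaths

/-! ### First and second moments of Gaussian waves -/

section Moments

variable {Y : Type*} [Fintype Y] [DecidableEq Y] {m : ℕ}

theorem TestFn.hasDerivAt_gaussInt {f : Phase Y m → ℂ} (hf : TestFn f) {R R' : ℝ → Matrix Y Y ℝ}
    {s₀ C : ℝ} (h : ∀ᶠ s in nhds s₀, Accretive (R s) ∧ ∀ a b,
      HasDerivAt (fun s => R s a b) (R' s a b) s ∧ |R' s a b| ≤ C) :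
    HasDerivAt (fun s => gaussInt (R s) f)
      (-∑ k, ∑ a, ∑ b, (R' s₀ a b : ℂ) *
        gaussInt (R s₀) (fun x => zbar a k x * (zc b k x * f x))) s₀ := by
  have hR := h.self_of_nhds.1
  have h1 := hf.hasDerivAt_integral_cexp (φ := fun s => qform (R s)) (φ' := fun s => qform (R' s))
    (s₀ := s₀) (C := |(m * Fintype.card Y * Fintype.card Y * C * 4)|) (by
      filter_upwards [h] with s hs x
      refine ⟨?_, qform_re_nonneg hs.1 x, ?_⟩
      · unfold qform
        exact HasDerivAt.fun_sum fun k _ => HasDerivAt.fun_sum fun a _ => HasDerivAt.fun_sum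
          fun b _ => (hs.2 a b).1.ofReal_comp.mul_const _
      · refine (norm_qform_le (fun a b => (hs.2 a b).2) x).trans ?_
        have h2 := le_abs_self (m * Fintype.card Y * Fintype.card Y * C * 4)
        have h3 := abs_nonneg (m * Fintype.card Y * Fintype.card Y * C * 4)
        nlinarith [sq_nonneg ‖x‖])
    (fun s => continuous_qform _) (continuous_qform _)
  refine h1.congr_deriv ?_
  have hi : ∀ k a b, Integrable fun x => (R' s₀ a b : ℂ) * (zbar a k x * (zc b k x * f x)) :=
    fun k a b => ((hf.mul_clm (zc b k)).mul_clm (zbar a k)).integrable.const_mul _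
  rw [integral_neg]
  congr 1
  have h2 : ∀ x, qform (R' s₀) x * Complex.exp (-qform (R s₀) x) * f x =
      Complex.exp (-qform (R s₀) x) * ∑ k, ∑ a, ∑ b, (R' s₀ a b : ℂ) *
        (zbar a k x * (zc b k x * f x)) := by
    intro x
    rw [mul_comm (qform _ x), mul_assoc]
    congr 1
    simp only [qform, Finset.sum_mul]
    refine Finset.sum_congr rfl fun k _ => Finset.sum_congr rfl fun a _ =>
      Finset.sum_congr rfl fun b _ => by ring
  simp only [h2]
  change gaussInt _ _ = _
  rw [gaussInt_sum hR _ fun k _ => integrable_finsetSum _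
        fun a _ => integrable_finsetSum _ fun b _ => hi k a b]
  refine Finset.sum_congr rfl fun k _ => ?_
  rw [gaussInt_sum hR _ fun a _ => integrable_finsetSum _ fun b _ => hi k a b]
  refine Finset.sum_congr rfl fun a _ => ?_
  rw [gaussInt_sum hR _ fun b _ => hi k a b]
  refine Finset.sum_congr rfl fun b _ => ?_
  rw [gaussInt_const_mul]

theorem fderiv_clm_mul {f : Phase Y m → ℂ} (hf : Differentiable ℝ f) (L : Phase Y m →L[ℝ] ℂ)
    (x v : Phase Y m) :
    fderiv ℝ (fun x => L x * f x) x v = L v * f x + L x * fderiv ℝ f x v := by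
  rw [fderiv_fun_mul L.differentiableAt hf.differentiableAt]
  simp [add_comm, mul_comm]

theorem dbar_zbar_mul {f : Phase Y m → ℂ} (hf : Differentiable ℝ f) (a b : Y) (k : Fin m)
    (x : Phase Y m) : dbar b k (fun x => zbar a k x * f x) x =
      (if a = b then 1 else 0) * f x + zbar a k x * dbar b k f x := by
  simp only [dbar, fderiv_clm_mul hf, zbar_unitVec_zero, zbar_unitVec_one, and_true]
  linear_combination (-(1 / 2) * (if a = b then 1 else 0) * f x) * Complex.I_mul_I

theorem dz_zc_mul {f : Phase Y m → ℂ} (hf : Differentiable ℝ f) (a b : Y) (k : Fin m)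
    (x : Phase Y m) : dz a k (fun x => zc b k x * f x) x =
      (if b = a then 1 else 0) * f x + zc b k x * dz a k f x := by
  simp only [dz, fderiv_clm_mul hf, zc_unitVec_zero, zc_unitVec_one, and_true]
  linear_combination (-(1 / 2) * (if b = a then 1 else 0) * f x) * Complex.I_mul_I

theorem inner_unitVec (x : Phase Y m) (b : Y) (k : Fin m) (i : Fin 2) :
    inner ℝ x (unitVec b k i) = x (b, k, i) := by
  simp [unitVec, EuclideanSpace.inner_single_right]

theorem dbar_gaussWave (σ : ℝ) (w x : Phase Y m) (b : Y) (k : Fin m) :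
    dbar b k (gaussWave σ w) x =
      -(σ : ℂ) * (zc b k x * gaussWave σ w x) + Complex.I / 2 * zc b k w * gaussWave σ w x := by
  simp only [dbar, fderiv_gaussWave, inner_unitVec, zc_apply]
  push_cast
  ring

theorem dz_gaussWave (σ : ℝ) (w x : Phase Y m) (a : Y) (k : Fin m) :
    dz a k (gaussWave σ w) x =
      -(σ : ℂ) * (zbar a k x * gaussWave σ w x) + Complex.I / 2 * zbar a k w * gaussWave σ w x := by
  simp only [dz, fderiv_gaussWave, inner_unitVec, zbar_apply]
  push_cast
  ring

theorem smul_one_add_sum (σ : ℝ) (R : Matrix Y Y ℝ) (b : Y) (v : Y → ℂ) :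
    ∑ c, ((σ • (1 : Matrix Y Y ℝ) + R) b c : ℂ) * v c = σ * v b + ∑ c, (R b c : ℂ) * v c := by
  simp only [Matrix.add_apply, Matrix.smul_apply, Matrix.one_apply, smul_eq_mul,
    Complex.ofReal_add, add_mul, Finset.sum_add_distrib]
  congr 1
  rw [Finset.sum_eq_single b] <;> simp +contextual [eq_comm]

/-- Integrating the antiholomorphic derivative of the wave by parts gives a linear system: `σ + R`
applied to the vector of first moments equals the source `(I / 2) * z w` times the integral. It is
solved by inversion. -/
theorem moment_zc {R : Matrix Y Y ℝ} (hR : Accretive R) {σ : ℝ} (hσ : 0 < σ) (w : Phase Y m)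
    (c : Y) (k : Fin m) : gaussInt R (fun x => zc c k x * gaussWave σ w x) =
      ∑ b, ((σ • (1 : Matrix Y Y ℝ) + R)⁻¹ c b : ℂ) *
        (Complex.I / 2 * zc b k w * gaussInt R (gaussWave σ w)) := by
  have hG := testFn_gaussWave hσ w
  refine eq_inv_mulVec (hR.det_smul_one_add_pos hσ).ne'
    (v := fun c => gaussInt R (fun x => zc c k x * gaussWave σ w x)) (fun b => ?_) c
  have h1 := hG.gaussInt_dbar hR b k
  have h2 : dbar b k (gaussWave σ w) = fun x => -(σ : ℂ) * (zc b k x * gaussWave σ w x) +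
      Complex.I / 2 * zc b k w * gaussWave σ w x := funext fun x => dbar_gaussWave σ w x b k
  rw [h2, gaussInt_add hR ((hG.mul_clm _).integrable.const_mul _) (hG.integrable.const_mul _),
    gaussInt_const_mul, gaussInt_const_mul] at h1
  rw [smul_one_add_sum, ← h1]
  ring

theorem moment_zbar {R : Matrix Y Y ℝ} (hR : Accretive R) {σ : ℝ} (hσ : 0 < σ) (w : Phase Y m)
    (c : Y) (k : Fin m) : gaussInt R (fun x => zbar c k x * gaussWave σ w x) =
      ∑ a, ((σ • (1 : Matrix Y Y ℝ) + R)⁻¹ a c : ℂ) *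
        (Complex.I / 2 * zbar a k w * gaussInt R (gaussWave σ w)) := by
  have hG := testFn_gaussWave hσ w
  have hT : (σ • (1 : Matrix Y Y ℝ) + Rᵀ) = (σ • (1 : Matrix Y Y ℝ) + R)ᵀ := by simp
  have h0 := eq_inv_mulVec (M := σ • (1 : Matrix Y Y ℝ) + Rᵀ)
    (v := fun c => gaussInt R (fun x => zbar c k x * gaussWave σ w x))
    (u := fun a => Complex.I / 2 * zbar a k w * gaussInt R (gaussWave σ w))
    (by rw [hT, Matrix.det_transpose]; exact (hR.det_smul_one_add_pos hσ).ne') (fun b => ?_) c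
  · rw [h0, hT, ← Matrix.transpose_nonsing_inv]
    rfl
  have h1 := hG.gaussInt_dz hR b k
  have h2 : dz b k (gaussWave σ w) = fun x => -(σ : ℂ) * (zbar b k x * gaussWave σ w x) +
      Complex.I / 2 * zbar b k w * gaussWave σ w x := funext fun x => dz_gaussWave σ w x b k
  rw [h2, gaussInt_add hR ((hG.mul_clm _).integrable.const_mul _) (hG.integrable.const_mul _),
    gaussInt_const_mul, gaussInt_const_mul] at h1
  rw [smul_one_add_sum]
  simp only [Matrix.transpose_apply]
  rw [← h1]
  ring

/-- The same system for `z̄ a` times the centred Gaussian. The source is now `∂ z̄ a / ∂ z̄ b`, so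
the covariance is the inverse of `σ + R`. -/
theorem moment_zbar_zc {R : Matrix Y Y ℝ} (hR : Accretive R) {σ : ℝ} (hσ : 0 < σ)
    (a c : Y) (k : Fin m) : gaussInt R (fun x => zbar a k x * (zc c k x * gaussWave σ 0 x)) =
      ((σ • (1 : Matrix Y Y ℝ) + R)⁻¹ c a : ℂ) * gaussInt R (gaussWave (P := Phase Y m) σ 0) := by
  have hG := testFn_gaussWave hσ (0 : Phase Y m)
  have h0 := eq_inv_mulVec (hR.det_smul_one_add_pos hσ).ne'
    (v := fun c => gaussInt R (fun x => zbar a k x * (zc c k x * gaussWave σ 0 x)))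
    (u := fun b => (if a = b then 1 else 0) * gaussInt R (gaussWave (P := Phase Y m) σ 0))
    (fun b => ?_) c
  · rw [h0]
    simp
  have h1 := (hG.mul_clm (zbar a k)).gaussInt_dbar hR b k
  have h2 : dbar b k (fun x => zbar a k x * gaussWave σ 0 x) = fun x =>
      (if a = b then 1 else 0) * gaussWave σ 0 x +
        -(σ : ℂ) * (zbar a k x * (zc b k x * gaussWave σ 0 x)) := by
    funext x
    rw [dbar_zbar_mul hG.differentiable, dbar_gaussWave]
    simp
    ring
  rw [h2, gaussInt_add hR (hG.integrable.const_mul _)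
    (((hG.mul_clm _).mul_clm _).integrable.const_mul _), gaussInt_const_mul,
    gaussInt_const_mul] at h1
  have h3 : ∀ c, (fun x => zc c k x * (zbar a k x * gaussWave σ 0 x)) =
      fun x => zbar a k x * (zc c k x * gaussWave σ 0 x) := fun c => by
    funext x; ring
  simp only [h3] at h1
  rw [smul_one_add_sum, ← h1]
  ring

end Moments

/-! ### Value of the Gaussian integral and the bound for modulated Gaussians -/

section GaussianValue

variable {Y : Type*} [Fintype Y] [DecidableEq Y] {m : ℕ}

theorem gaussInt_zero_gaussWave {σ : ℝ} (hσ : 0 < σ) :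
    gaussInt (0 : Matrix Y Y ℝ) (gaussWave (P := Phase Y m) σ 0) =
      ((Real.pi / σ : ℝ) : ℂ) ^ (Fintype.card Y * m) := by
  have h := GaussianFourier.integral_cexp_neg_mul_sq_norm_add (V := Phase Y m) (b := (σ : ℂ))
    (by simpa using hσ) 0 0
  have h1 : gaussInt (0 : Matrix Y Y ℝ) (gaussWave (P := Phase Y m) σ 0) =
      ∫ v : Phase Y m, Complex.exp (-(σ : ℂ) * ‖v‖ ^ 2 + 0 * ((inner ℝ (0 : Phase Y m) v : ℝ) : ℂ)) := by
    unfold gaussInt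
    congr 1
    ext x
    simp [qform, gaussWave]
  rw [h1, h]
  simp only [finrank_euclideanSpace, Fintype.card_prod, Fintype.card_fin]
  rw [show (((Fintype.card Y * (m * 2) : ℕ) : ℂ) / 2) = ((Fintype.card Y * m : ℕ) : ℂ) by
    push_cast; ring, Complex.cpow_natCast]
  simp

theorem sum_inv_mul_eq_sum_adjugate {M R' : Matrix Y Y ℝ} (hM : M.det ≠ 0) :
    ∑ a, ∑ b, M.adjugate b a * R' a b = M.det * ∑ a, ∑ b, R' a b * M⁻¹ b a := by
  simp only [Finset.mul_sum]
  refine Finset.sum_congr rfl fun a _ => Finset.sum_congr rfl fun b _ => ?_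
  rw [Matrix.inv_def, Ring.inverse_eq_inv', Matrix.smul_apply, smul_eq_mul]
  field_simp

/-- The Gaussian integral over `ℂ^{n m}`. -/
theorem det_pow_mul_gaussInt {R : Matrix Y Y ℝ} (hR : Accretive R) {σ : ℝ} (hσ : 0 < σ) :
    ((σ • (1 : Matrix Y Y ℝ) + R).det : ℂ) ^ m * gaussInt R (gaussWave (P := Phase Y m) σ 0) =
      (Real.pi : ℂ) ^ (Fintype.card Y * m) := by
  -- The product is constant along the path: Jacobi's formula for the determinant and the covariance
  -- formula for the integral give opposite logarithmic derivatives. The path is quadratic in `τ` so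
  -- that the form remains accretive for `τ` of either sign and `h` is differentiable on the whole
  -- line.
  let h : ℝ → ℂ := fun τ => ((σ • (1 : Matrix Y Y ℝ) + τ ^ 2 • R).det : ℂ) ^ m *
    gaussInt (τ ^ 2 • R) (gaussWave (P := Phase Y m) σ 0)
  have hacc : ∀ τ : ℝ, Accretive (τ ^ 2 • R) := fun τ => hR.smul (sq_nonneg τ)
  have hder : ∀ τ, HasDerivAt h 0 τ := by
    intro τ
    have hdetne := ((hacc τ).det_smul_one_add_pos hσ).ne'
    have hent : ∀ s : ℝ, ∀ a b, HasDerivAt (fun s => (s ^ 2 • R) a b) (((2 * s) • R) a b) s := by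
      intro s a b
      simp only [Matrix.smul_apply, smul_eq_mul]
      simpa using (hasDerivAt_pow 2 s).mul_const (R a b)
    obtain ⟨C, hC⟩ : ∃ C : ℝ, ∀ a b, |R a b| ≤ C := by
      refine ⟨∑ a, ∑ b, |R a b|, fun a b => ?_⟩
      exact (Finset.single_le_sum (f := fun b => |R a b|) (fun _ _ => abs_nonneg _)
        (Finset.mem_univ b)).trans (Finset.single_le_sum (f := fun a => ∑ b, |R a b|)
          (fun _ _ => Finset.sum_nonneg fun _ _ => abs_nonneg _) (Finset.mem_univ a))
    have h1 := (testFn_gaussWave hσ (0 : Phase Y m)).hasDerivAt_gaussInt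
      (R := fun τ => τ ^ 2 • R) (R' := fun s => (2 * s) • R) (s₀ := τ) (C := 2 * (|τ| + 1) * C) (by
        have : ∀ᶠ s in nhds τ, |s| < |τ| + 1 :=
          continuous_abs.continuousAt.eventually_lt continuousAt_const (by simp)
        filter_upwards [this] with s hs
        refine ⟨hacc s, fun a b => ⟨hent s a b, ?_⟩⟩
        rw [Matrix.smul_apply, smul_eq_mul, abs_mul, abs_mul, abs_two]
        have := hC a b
        gcongr)
    have h2 : HasDerivAt (fun τ : ℝ => (σ • (1 : Matrix Y Y ℝ) + τ ^ 2 • R).det) _ τ :=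
      hasDerivAt_det (M' := (2 * τ) • R) fun a b => by
        simpa only [Matrix.add_apply] using (hent τ a b).const_add ((σ • (1 : Matrix Y Y ℝ)) a b)
    rw [sum_inv_mul_eq_sum_adjugate hdetne] at h2
    refine ((h2.ofReal_comp.pow m).mul h1).congr_deriv ?_
    simp only [moment_zbar_zc (hacc τ) hσ]
    set J := gaussInt (τ ^ 2 • R) (gaussWave (P := Phase Y m) σ 0)
    set M := σ • (1 : Matrix Y Y ℝ) + τ ^ 2 • R with hMdef
    have h3 : ∑ _k : Fin m, ∑ a, ∑ b, (((2 * τ) • R) a b : ℂ) * ((M⁻¹ b a : ℂ) * J) =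
        m * (((∑ a, ∑ b, ((2 * τ) • R) a b * M⁻¹ b a : ℝ) : ℂ) * J) := by
      rw [Finset.sum_const, Finset.card_univ, Fintype.card_fin, nsmul_eq_mul]
      push_cast
      simp only [Finset.sum_mul, mul_assoc]
    rw [h3]
    generalize (∑ a, ∑ b, ((2 * τ) • R) a b * M⁻¹ b a) = T
    rcases m with _ | m
    · simp
    · simp only [Nat.add_sub_cancel, Pi.pow_apply]
      push_cast
      ring
  have hconst : h 1 = h 0 := is_const_of_deriv_eq_zero (fun τ => (hder τ).differentiableAt)
    (fun τ => (hder τ).deriv) 1 0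
  simp only [h, one_pow, one_smul, ne_eq, OfNat.ofNat_ne_zero, not_false_eq_true, zero_pow,
    zero_smul, add_zero, gaussInt_zero_gaussWave hσ, Matrix.det_smul, Matrix.det_one,
    mul_one] at hconst
  rw [hconst, pow_mul, ← mul_pow, Complex.ofReal_pow, ← mul_pow, pow_mul]
  have : (σ : ℂ) ≠ 0 := by exact_mod_cast hσ.ne'
  push_cast
  field_simp

theorem inner_eq_sum_zc (w x : Phase Y m) :
    ((inner ℝ w x : ℝ) : ℂ) =
      1 / 2 * ∑ k, ∑ a, (zbar a k w * zc a k x + zc a k w * zbar a k x) := by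
  rw [PiLp.inner_apply, Fintype.sum_prod_type]
  simp only [Fintype.sum_prod_type, Fin.sum_univ_two, zc_apply, zbar_apply]
  push_cast
  rw [Finset.sum_comm, Finset.mul_sum]
  refine Finset.sum_congr rfl fun k _ => ?_
  rw [Finset.mul_sum]
  refine Finset.sum_congr rfl fun a _ => ?_
  simp only [RCLike.inner_apply, conj_trivial]
  push_cast
  linear_combination ((x (a, k, 1) : ℂ) * (w (a, k, 1) : ℂ)) * Complex.I_mul_I

theorem integral_inner_gaussWave {R : Matrix Y Y ℝ} (hR : Accretive R) {σ : ℝ} (hσ : 0 < σ)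
    (w u : Phase Y m) : gaussInt R (fun x => ((inner ℝ w x : ℝ) : ℂ) * gaussWave σ u x) =
      Complex.I / 4 * (∑ k, ∑ a, ∑ b, ((σ • (1 : Matrix Y Y ℝ) + R)⁻¹ a b : ℂ) *
        (zbar a k w * zc b k u + zbar a k u * zc b k w)) * gaussInt R (gaussWave σ u) := by
  have hG := testFn_gaussWave hσ u
  have h1 : (fun x => ((inner ℝ w x : ℝ) : ℂ) * gaussWave σ u x) = fun x => 1 / 2 * ∑ k, ∑ a,
      (zbar a k w * (zc a k x * gaussWave σ u x) + zc a k w * (zbar a k x * gaussWave σ u x)) := by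
    funext x
    rw [inner_eq_sum_zc]
    simp only [mul_assoc, Finset.sum_mul, add_mul]
  have hi : ∀ (k : Fin m) a, Integrable fun x => (zbar a k w * (zc a k x * gaussWave σ u x) +
      zc a k w * (zbar a k x * gaussWave σ u x)) := fun k a =>
    ((hG.mul_clm _).integrable.const_mul _).add ((hG.mul_clm _).integrable.const_mul _)
  rw [h1, gaussInt_const_mul, gaussInt_sum hR _ fun k _ => integrable_finsetSum _ fun a _ => hi k a]
  have h2 : ∀ (k : Fin m), gaussInt R (fun x => ∑ a, (zbar a k w * (zc a k x * gaussWave σ u x) +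
      zc a k w * (zbar a k x * gaussWave σ u x))) = ∑ a, (zbar a k w *
        ∑ b, ((σ • (1 : Matrix Y Y ℝ) + R)⁻¹ a b : ℂ) *
          (Complex.I / 2 * zc b k u * gaussInt R (gaussWave σ u)) +
      zc a k w * ∑ b, ((σ • (1 : Matrix Y Y ℝ) + R)⁻¹ b a : ℂ) *
          (Complex.I / 2 * zbar b k u * gaussInt R (gaussWave σ u))) := by
    intro k
    rw [gaussInt_sum hR _ fun a _ => hi k a]
    refine Finset.sum_congr rfl fun a _ => ?_
    rw [gaussInt_add hR ((hG.mul_clm _).integrable.const_mul _)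
      ((hG.mul_clm _).integrable.const_mul _), gaussInt_const_mul, gaussInt_const_mul,
      moment_zc hR hσ, moment_zbar hR hσ]
  rw [Finset.sum_congr rfl fun k _ => h2 k]
  simp only [mul_add, Finset.mul_sum, Finset.sum_mul, Finset.sum_add_distrib, add_mul]
  congr 1
  · refine Finset.sum_congr rfl fun k _ => Finset.sum_congr rfl fun a _ =>
      Finset.sum_congr rfl fun b _ => ?_
    ring
  · refine Finset.sum_congr rfl fun k _ => ?_
    rw [Finset.sum_comm]
    refine Finset.sum_congr rfl fun a _ =>
      Finset.sum_congr rfl fun b _ => ?_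
    ring

/-- As a function of the frequency `s • w`, the integral satisfies `J' = -(s / 2) * q_S(w) * J` with
`S = (σ + R)⁻¹`, hence `J(1) = J(0) * exp (-q_S(w) / 4)`. The real part of `q_S` is nonnegative
because the inverse of an accretive matrix is accretive. -/
theorem norm_gaussInt_gaussWave_le_zero {R : Matrix Y Y ℝ} (hR : Accretive R) {σ : ℝ} (hσ : 0 < σ)
    (w : Phase Y m) : ‖gaussInt R (gaussWave σ w)‖ ≤ ‖gaussInt R (gaussWave (P := Phase Y m) σ 0)‖ := by
  set S := (σ • (1 : Matrix Y Y ℝ) + R)⁻¹ with hS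
  have hSacc : Accretive S := (hR.smul_one_add hσ).inv (hR.det_smul_one_add_pos hσ).ne'
  have hJ : ∀ s : ℝ, HasDerivAt (fun s : ℝ => gaussInt R (gaussWave σ (s • w)))
      (-(s / 2 : ℝ) * qform S w * gaussInt R (gaussWave σ (s • w))) s := by
    intro s
    have h1 := (testFn_gaussWave hσ (0 : Phase Y m)).hasDerivAt_integral_cexp
      (φ := fun s x => qform R x - Complex.I * ((s : ℂ) * ((inner ℝ w x : ℝ) : ℂ)))
      (φ' := fun s x => -(Complex.I * ((1 : ℝ) * ((inner ℝ w x : ℝ) : ℂ))))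
      (s₀ := s) (C := ‖w‖) (Filter.Eventually.of_forall fun r x => ⟨?_, ?_, ?_⟩) ?_ ?_
    · have e1 : ∀ (s : ℝ) x, Complex.exp (-(qform R x - Complex.I * ((s : ℂ) * ((inner ℝ w x : ℝ) : ℂ)))) *
          gaussWave σ 0 x = Complex.exp (-qform R x) * gaussWave σ (s • w) x := by
        intro s x
        simp only [gaussWave, ← Complex.exp_add]
        congr 1
        simp [real_inner_smul_left]
        ring
      simp only [e1] at h1
      have e2 : ∀ x, -(-(Complex.I * (((1 : ℝ) : ℂ) * ((inner ℝ w x : ℝ) : ℂ))) *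
          Complex.exp (-(qform R x - Complex.I * ((s : ℂ) * ((inner ℝ w x : ℝ) : ℂ)))) *
          gaussWave σ 0 x) = Complex.exp (-qform R x) *
            (Complex.I * (((inner ℝ w x : ℝ) : ℂ) * gaussWave σ (s • w) x)) := by
        intro x
        rw [mul_assoc, e1]
        push_cast
        ring
      simp only [e2] at h1
      refine h1.congr_deriv ?_
      change gaussInt R _ = _
      rw [gaussInt_const_mul, integral_inner_gaussWave hR hσ]
      have e3 : (∑ k, ∑ a, ∑ b, (S a b : ℂ) * (zbar a k w * zc b k (s • w) +
          zbar a k (s • w) * zc b k w)) = 2 * s * qform S w := by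
        simp only [qform, Finset.mul_sum, map_smul, Complex.real_smul]
        refine Finset.sum_congr rfl fun k _ => Finset.sum_congr rfl fun a _ =>
          Finset.sum_congr rfl fun b _ => ?_
        ring
      rw [← hS, e3]
      push_cast
      linear_combination (1 / 2 * s * qform S w * gaussInt R (gaussWave σ (s • w))) * Complex.I_mul_I
    · have := (((hasDerivAt_id r).ofReal_comp.mul_const ((inner ℝ w x : ℝ) : ℂ)).const_mul
        Complex.I).const_sub (qform R x)
      simpa using this
    · have := qform_re_nonneg hR x
      simpa using this
    · rw [norm_neg, norm_mul, Complex.norm_I, one_mul, Complex.ofReal_one, one_mul,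
        Complex.norm_real]
      refine (norm_inner_le_norm w x).trans ?_
      gcongr
      nlinarith [sq_nonneg (‖x‖ - 1)]
    · intro r
      have := continuous_qform (m := m) R
      fun_prop
    · fun_prop
  let h : ℝ → ℂ := fun s => gaussInt R (gaussWave σ (s • w)) * Complex.exp ((s ^ 2 / 4 : ℝ) * qform S w)
  have hder : ∀ s, HasDerivAt h 0 s := by
    intro s
    have h2 : HasDerivAt (fun s : ℝ => Complex.exp ((s ^ 2 / 4 : ℝ) * qform S w)) _ s :=
      ((((hasDerivAt_pow 2 s).div_const 4).ofReal_comp).mul_const (qform S w)).cexp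
    refine ((hJ s).mul h2).congr_deriv ?_
    push_cast
    ring
  have hconst : h 1 = h 0 := is_const_of_deriv_eq_zero (fun τ => (hder τ).differentiableAt)
    (fun τ => (hder τ).deriv) 1 0
  simp only [h, one_smul, zero_smul] at hconst
  rw [show ((0 : ℝ) ^ 2 / 4 : ℝ) = 0 by norm_num, Complex.ofReal_zero, zero_mul, Complex.exp_zero,
    mul_one] at hconst
  rw [← hconst, norm_mul]
  refine le_mul_of_one_le_right (norm_nonneg _) ?_
  rw [Complex.norm_exp, Complex.re_ofReal_mul]
  have := qform_re_nonneg hSacc w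
  exact Real.one_le_exp (by positivity)

theorem norm_gaussInt_gaussWave_le {R : Matrix Y Y ℝ} (hR : Accretive R) {σ : ℝ} (hσ : 0 < σ)
    (w : Phase Y m) : (σ • (1 : Matrix Y Y ℝ) + R).det ^ m * ‖gaussInt R (gaussWave σ w)‖ ≤
      Real.pi ^ (Fintype.card Y * m) := by
  have h1 := congrArg norm (det_pow_mul_gaussInt (m := m) hR hσ)
  have h0 := (hR.det_smul_one_add_pos hσ).le
  rw [norm_mul, norm_pow, Complex.norm_real, norm_pow, Complex.norm_real,
    Real.norm_of_nonneg h0, Real.norm_of_nonneg Real.pi_pos.le] at h1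
  rw [← h1]
  gcongr
  exact norm_gaussInt_gaussWave_le_zero hR hσ w

end GaussianValue

/-! ### Bound on Gaussian integrals of Schwartz functions, uniform in the form -/

section UniformBound

variable {Y : Type*} [Fintype Y] [DecidableEq Y] {m : ℕ}

-- Fourier inversion writes the integral as a superposition of integrals of Gaussian waves of
-- frequency `2 π ξ`; these are bounded uniformly in the frequency and are integrated against the
-- `L¹` function `𝓕 g`.
open scoped FourierTransform in
theorem norm_gaussInt_gaussWave_mul_le {R : Matrix Y Y ℝ} (hR : Accretive R) {σ : ℝ} (hσ : 0 < σ)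
    (g : 𝓢(Phase Y m, ℂ)) : (σ • (1 : Matrix Y Y ℝ) + R).det ^ m *
      ‖gaussInt R (fun x => gaussWave σ 0 x * g x)‖ ≤
      Real.pi ^ (Fintype.card Y * m) * ∫ ξ, ‖(𝓕 g) ξ‖ := by
  set h : Phase Y m → ℂ := fun x => Complex.exp (-qform R x) * gaussWave σ 0 x with hh
  have hhi : Integrable h := integrable_cexp_mul hR (testFn_gaussWave hσ 0).integrable
  have hgi : Integrable fun ξ => (𝓕 g) ξ := SchwartzMap.integrable (𝓕 g : 𝓢(Phase Y m, ℂ))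
  have hg : ∀ x, g x = ∫ ξ, Complex.exp (((2 * Real.pi * inner ℝ ξ x : ℝ) : ℂ) * Complex.I) * (𝓕 g) ξ := by
    intro x
    have h1 : (𝓕⁻ (𝓕 g)) x = g x := by rw [FourierTransform.fourierInv_fourier_eq]
    rw [← h1, SchwartzMap.fourierInv_coe, Real.fourierInv_eq']
    simp only [smul_eq_mul]
  have hprod : Integrable (fun p : Phase Y m × Phase Y m => Complex.exp
      (((2 * Real.pi * inner ℝ p.2 p.1 : ℝ) : ℂ) * Complex.I) * (h p.1 * (𝓕 g) p.2))
      (volume.prod volume) := by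
    refine (hhi.mul_prod hgi).bdd_mul (c := 1) (Continuous.aestronglyMeasurable (by fun_prop))
      (Filter.Eventually.of_forall fun p => ?_)
    rw [Complex.norm_exp_ofReal_mul_I]
  have h2 : gaussInt R (fun x => gaussWave σ 0 x * g x) =
      ∫ ξ, (𝓕 g) ξ * gaussInt R (gaussWave σ ((2 * Real.pi) • ξ)) := by
    have e1 : gaussInt R (fun x => gaussWave σ 0 x * g x) = ∫ x, ∫ ξ, Complex.exp
        (((2 * Real.pi * inner ℝ ξ x : ℝ) : ℂ) * Complex.I) * (h x * (𝓕 g) ξ) := by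
      unfold gaussInt
      congr 1
      ext x
      beta_reduce
      rw [hg x, ← mul_assoc, ← integral_const_mul]
      congr 1
      ext ξ
      simp only [hh]
      ring
    rw [e1, integral_integral_swap hprod]
    congr 1
    ext ξ
    rw [gaussInt, ← integral_const_mul]
    congr 1
    ext x
    have e2 : gaussWave σ ((2 * Real.pi) • ξ) x = gaussWave σ 0 x *
        Complex.exp (((2 * Real.pi * inner ℝ ξ x : ℝ) : ℂ) * Complex.I) := by
      simp only [gaussWave, ← Complex.exp_add, real_inner_smul_left, inner_zero_left]
      congr 1
      push_cast
      ring
    rw [e2]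
    simp only [hh]
    ring
  have hdet := (hR.det_smul_one_add_pos hσ)
  have h3 : ‖gaussInt R (fun x => gaussWave σ 0 x * g x)‖ ≤
      ∫ ξ, ‖(𝓕 g) ξ‖ * (Real.pi ^ (Fintype.card Y * m) / (σ • (1 : Matrix Y Y ℝ) + R).det ^ m) := by
    rw [h2]
    refine norm_integral_le_of_norm_le (hgi.norm.mul_const _)
      (Filter.Eventually.of_forall fun ξ => ?_)
    rw [norm_mul]
    gcongr
    rw [le_div_iff₀ (by positivity), mul_comm]
    exact norm_gaussInt_gaussWave_le hR hσ _
  rw [integral_mul_const] at h3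
  calc _ ≤ (σ • (1 : Matrix Y Y ℝ) + R).det ^ m * ((∫ ξ, ‖(𝓕 g) ξ‖) *
        (Real.pi ^ (Fintype.card Y * m) / (σ • (1 : Matrix Y Y ℝ) + R).det ^ m)) := by gcongr
    _ = _ := by field_simp

/-- The weight `(1 + ‖x‖²)^N`. -/
def weightCLM (Y : Type*) [Fintype Y] (m N : ℕ) : 𝓢(Phase Y m, ℂ) →L[ℝ] 𝓢(Phase Y m, ℂ) :=
  SchwartzMap.smulLeftCLM ℂ fun x : Phase Y m => (1 + ‖x‖ ^ 2) ^ (N : ℝ)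

theorem weightCLM_apply (N : ℕ) (f : 𝓢(Phase Y m, ℂ)) (x : Phase Y m) :
    weightCLM Y m N f x = ((1 + ‖x‖ ^ 2 : ℝ) : ℂ) ^ N * f x := by
  rw [weightCLM, SchwartzMap.smulLeftCLM_apply_apply
    (Function.hasTemperateGrowth_one_add_norm_sq_rpow _ _), Real.rpow_natCast, Complex.real_smul]
  push_cast
  ring

theorem integrableOn_pow_mul_exp_neg (N : ℕ) {r : ℝ} (hr : 0 < r) :
    IntegrableOn (fun σ : ℝ => σ ^ N * Real.exp (-(r * σ))) (Set.Ioi 0) := by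
  have := integrableOn_rpow_mul_exp_neg_mul_rpow (s := N) (p := 1) (b := r)
    (by have := N.cast_nonneg (α := ℝ); linarith) one_pos hr
  simpa [neg_mul] using this

theorem integral_pow_mul_exp_neg (N : ℕ) {r : ℝ} (hr : 0 < r) :
    ∫ σ in Set.Ioi (0 : ℝ), σ ^ N * Real.exp (-(r * σ)) = N.factorial / r ^ (N + 1) := by
  have := Real.integral_rpow_mul_exp_neg_mul_Ioi (a := N + 1) (r := r) (by positivity) hr
  rw [Real.Gamma_nat_eq_factorial] at this
  simp only [add_sub_cancel_right, Real.rpow_natCast] at this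
  rw [this]
  rw [show ((N : ℝ) + 1) = ((N + 1 : ℕ) : ℝ) by push_cast; ring, Real.rpow_natCast, one_div, inv_pow]
  ring

theorem integrableOn_add_one_pow_mul_exp_neg (n m : ℕ) :
    IntegrableOn (fun σ : ℝ => (σ ^ n + 1) ^ m * Real.exp (-σ)) (Set.Ioi 0) := by
  have h : (fun σ : ℝ => (σ ^ n + 1) ^ m * Real.exp (-σ)) = fun σ =>
      ∑ k ∈ Finset.range (m + 1), (m.choose k : ℝ) * (σ ^ (n * k) * Real.exp (-(1 * σ))) := by
    funext σ
    rw [add_pow, Finset.sum_mul]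
    refine Finset.sum_congr rfl fun k _ => ?_
    rw [one_pow, one_mul, pow_mul]
    ring
  rw [h]
  exact integrable_finsetSum _ fun k _ =>
    (integrableOn_pow_mul_exp_neg (n * k) one_pos).const_mul _

open scoped FourierTransform in
/-- Gaussian integrals of Schwartz functions decay like the determinant of the form. -/
theorem norm_gaussInt_le (Y : Type*) [Fintype Y] [DecidableEq Y] (m : ℕ) :
    ∃ C : ℝ, 0 ≤ C ∧ ∀ (R : Matrix Y Y ℝ), Accretive R → ∀ f : 𝓢(Phase Y m, ℂ),
      (1 + R).det ^ m * ‖gaussInt R f‖ ≤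
        C * ∫ ξ, ‖(𝓕 (weightCLM Y m (Fintype.card Y * m + 1) f)) ξ‖ := by
  set n := Fintype.card Y
  set K := ∫ σ in Set.Ioi (0 : ℝ), (σ ^ n + 1) ^ m * Real.exp (-σ)
  have hK : 0 ≤ K := setIntegral_nonneg measurableSet_Ioi fun σ hσ => by
    have : (0 : ℝ) < σ := hσ
    positivity
  refine ⟨K * Real.pi ^ (n * m) / (n * m).factorial, by positivity, fun R hR f => ?_⟩
  set g := weightCLM Y m (n * m + 1) f
  set L := ∫ ξ, ‖(𝓕 g) ξ‖
  have hdet1 : 0 < (1 + R).det := by simpa using hR.det_smul_one_add_pos one_pos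
  -- The Gaussian factor needed for the previous bound is produced by the Gamma integral `(1 + ‖x‖²)
  -- ^ (-(n m + 1)) = (1 / (n m)!) * ∫ σ ^ (n m) * exp (-σ (1 + ‖x‖²)) dσ`, which is why `f` is
  -- first multiplied by that weight. The power `σ ^ (n m)` compensates the `m`-th power of the
  -- factor `σ⁻¹ ^ n` lost when `det (σ + R)` is compared with `det (1 + R)` for small `σ`.
  let F : ℝ → Phase Y m → ℂ := fun σ x => ((σ ^ (n * m) * Real.exp (-σ) : ℝ) : ℂ) *
    (Complex.exp (-qform R x) * (gaussWave σ 0 x * g x))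
  have hq := continuous_qform (m := m) R
  have hFc : Continuous (Function.uncurry F) := by
    simp only [F, Function.uncurry_def, gaussWave]
    have := g.continuous
    fun_prop
  have hinteg : Integrable (Function.uncurry F) ((volume.restrict (Set.Ioi 0)).prod volume) := by
    have h0 := (integrableOn_pow_mul_exp_neg (n * m) one_pos).mul_prod g.integrable.norm
      (μ := volume.restrict (Set.Ioi 0)) (ν := volume)
    refine h0.mono hFc.aestronglyMeasurable ?_
    have hpos : ∀ᵐ p ∂((volume.restrict (Set.Ioi (0 : ℝ))).prod (volume : Measure (Phase Y m))),
        0 < p.1 := by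
      have : ∀ᵐ σ ∂(volume.restrict (Set.Ioi (0 : ℝ))), 0 < σ := ae_restrict_mem measurableSet_Ioi
      exact Measure.quasiMeasurePreserving_fst.ae this
    filter_upwards [hpos] with p hp
    simp only [Function.uncurry, F]
    rw [norm_mul, norm_mul, norm_mul, norm_mul, Complex.norm_real, norm_norm, norm_gaussWave,
      one_mul]
    refine mul_le_mul_of_nonneg_left ?_ (norm_nonneg _)
    calc ‖Complex.exp (-qform R p.2)‖ * (Real.exp (-p.1 * ‖p.2‖ ^ 2) * ‖g p.2‖)
        ≤ 1 * (1 * ‖g p.2‖) := by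
          gcongr
          · exact norm_cexp_neg_qform_le hR _
          · exact Real.exp_le_one_iff.2 (by nlinarith [sq_nonneg ‖p.2‖])
      _ = _ := by ring
  have hswap := integral_integral_swap hinteg
  have h1 : ∀ x, ∫ σ in Set.Ioi (0 : ℝ), F σ x =
      (n * m).factorial * (Complex.exp (-qform R x) * f x) := by
    intro x
    have hpos : 0 < 1 + ‖x‖ ^ 2 := by positivity
    have e1 : ∀ σ : ℝ, F σ x = ((σ ^ (n * m) * Real.exp (-((1 + ‖x‖ ^ 2) * σ)) : ℝ) : ℂ) *
        (Complex.exp (-qform R x) * g x) := by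
      intro σ
      simp only [F, gaussWave, inner_zero_left]
      have : Complex.exp (-(σ : ℂ) * ((‖x‖ ^ 2 : ℝ) : ℂ) + Complex.I * ((0 : ℝ) : ℂ)) =
          ((Real.exp (-σ * ‖x‖ ^ 2) : ℝ) : ℂ) := by push_cast; simp
      rw [this, show -((1 + ‖x‖ ^ 2) * σ) = -σ + -σ * ‖x‖ ^ 2 by ring, Real.exp_add]
      push_cast
      ring
    simp only [e1]
    rw [integral_mul_const, integral_complex_ofReal, integral_pow_mul_exp_neg _ hpos]
    have hg : g x = ((1 + ‖x‖ ^ 2 : ℝ) : ℂ) ^ (n * m + 1) * f x := weightCLM_apply _ f x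
    rw [hg]
    have : ((1 + ‖x‖ ^ 2 : ℝ) : ℂ) ^ (n * m + 1) ≠ 0 := by exact_mod_cast (pow_pos hpos _).ne'
    push_cast at this ⊢
    field_simp
  have h2 : ∀ σ : ℝ, ∫ x, F σ x = ((σ ^ (n * m) * Real.exp (-σ) : ℝ) : ℂ) *
      gaussInt R (fun x => gaussWave σ 0 x * g x) := fun σ => integral_const_mul _ _
  have h3 : ((n * m).factorial : ℂ) * gaussInt R f =
      ∫ σ in Set.Ioi (0 : ℝ), ((σ ^ (n * m) * Real.exp (-σ) : ℝ) : ℂ) *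
        gaussInt R (fun x => gaussWave σ 0 x * g x) := by
    simp only [h1, h2] at hswap
    rw [hswap, gaussInt, integral_const_mul]
  have h4 : ‖((n * m).factorial : ℂ) * gaussInt R f‖ ≤ ∫ σ in Set.Ioi (0 : ℝ),
      ((σ ^ n + 1) ^ m * Real.exp (-σ)) * (Real.pi ^ (n * m) * L / (1 + R).det ^ m) := by
    rw [h3]
    refine norm_integral_le_of_norm_le ((integrableOn_add_one_pow_mul_exp_neg n m).mul_const _) ?_
    filter_upwards [ae_restrict_mem measurableSet_Ioi] with σ hσ
    have hσ' : (0 : ℝ) < σ := hσ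
    have hd := hR.det_smul_one_add_pos hσ'
    rw [norm_mul, Complex.norm_real, Real.norm_of_nonneg (by positivity)]
    have k1 := norm_gaussInt_gaussWave_mul_le hR hσ' g
    have k2 := hR.det_one_add_le hσ'
    have k3 : σ ^ n * (1 + R).det ≤ (σ ^ n + 1) * (σ • (1 : Matrix Y Y ℝ) + R).det := by
      calc σ ^ n * (1 + R).det ≤ σ ^ n * ((1 + σ⁻¹ ^ n) * (σ • (1 : Matrix Y Y ℝ) + R).det) := by
            gcongr
        _ = _ := by rw [inv_pow]; field_simp
    have k4 : (σ ^ n * (1 + R).det) ^ m ≤ ((σ ^ n + 1) * (σ • (1 : Matrix Y Y ℝ) + R).det) ^ m := by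
      gcongr
    set z := ‖gaussInt R (fun x => gaussWave σ 0 x * g x)‖
    have hz : 0 ≤ z := norm_nonneg _
    have k5 : σ ^ (n * m) * (1 + R).det ^ m * z ≤ (σ ^ n + 1) ^ m * (Real.pi ^ (n * m) * L) := by
      calc σ ^ (n * m) * (1 + R).det ^ m * z = (σ ^ n * (1 + R).det) ^ m * z := by
            rw [mul_pow, pow_mul]
        _ ≤ ((σ ^ n + 1) * (σ • (1 : Matrix Y Y ℝ) + R).det) ^ m * z := by gcongr
        _ = (σ ^ n + 1) ^ m * ((σ • (1 : Matrix Y Y ℝ) + R).det ^ m * z) := by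
            rw [mul_pow]; ring
        _ ≤ _ := by gcongr
    rw [← mul_div_assoc, le_div_iff₀ (by positivity)]
    calc _ = Real.exp (-σ) * (σ ^ (n * m) * (1 + R).det ^ m * z) := by ring
      _ ≤ Real.exp (-σ) * ((σ ^ n + 1) ^ m * (Real.pi ^ (n * m) * L)) := by gcongr
      _ = _ := by ring
  rw [integral_mul_const, norm_mul, Complex.norm_natCast] at h4
  have hf : (0 : ℝ) < (n * m).factorial := by positivity
  have : (1 + R).det ^ m * ((n * m).factorial * ‖gaussInt R f‖) ≤ K * (Real.pi ^ (n * m) * L) := by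
    calc _ ≤ (1 + R).det ^ m * (K * (Real.pi ^ (n * m) * L / (1 + R).det ^ m)) := by gcongr
      _ = _ := by field_simp
  rw [div_mul_eq_mul_div, le_div_iff₀ hf]
  linarith

end UniformBound

/-! ### Differentiating the normalized Gaussian integral in the inverse form -/

section WeylOperators

variable {Y : Type*} [Fintype Y] [DecidableEq Y] {m : ℕ}

/-- Multiplication of Schwartz functions by a linear form. -/
def mulCLM (L : Phase Y m →L[ℝ] ℂ) : 𝓢(Phase Y m, ℂ) →L[ℂ] 𝓢(Phase Y m, ℂ) :=
  SchwartzMap.smulLeftCLM ℂ (L : Phase Y m → ℂ)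

theorem mulCLM_apply (L : Phase Y m →L[ℝ] ℂ) (f : 𝓢(Phase Y m, ℂ)) (x : Phase Y m) :
    mulCLM L f x = L x * f x := by
  rw [mulCLM, SchwartzMap.smulLeftCLM_apply_apply L.hasTemperateGrowth, smul_eq_mul]

/-- The operator `z̄ + ∂_z`. -/
def raiseCLM (a : Y) (k : Fin m) : 𝓢(Phase Y m, ℂ) →L[ℂ] 𝓢(Phase Y m, ℂ) :=
  mulCLM (zbar a k) + (1 / 2 : ℂ) • (LineDeriv.lineDerivOpCLM ℂ 𝓢(Phase Y m, ℂ) (unitVec a k 0) -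
    Complex.I • LineDeriv.lineDerivOpCLM ℂ 𝓢(Phase Y m, ℂ) (unitVec a k 1))

/-- The operator `z + ∂_z̄`. -/
def lowerCLM (b : Y) (k : Fin m) : 𝓢(Phase Y m, ℂ) →L[ℂ] 𝓢(Phase Y m, ℂ) :=
  mulCLM (zc b k) + (1 / 2 : ℂ) • (LineDeriv.lineDerivOpCLM ℂ 𝓢(Phase Y m, ℂ) (unitVec b k 0) +
    Complex.I • LineDeriv.lineDerivOpCLM ℂ 𝓢(Phase Y m, ℂ) (unitVec b k 1))

theorem raiseCLM_apply (a : Y) (k : Fin m) (f : 𝓢(Phase Y m, ℂ)) (x : Phase Y m) :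
    raiseCLM a k f x = zbar a k x * f x + dz a k f x := by
  simp [raiseCLM, mulCLM_apply, dz, SchwartzMap.lineDerivOp_apply_eq_fderiv]

theorem lowerCLM_apply (b : Y) (k : Fin m) (f : 𝓢(Phase Y m, ℂ)) (x : Phase Y m) :
    lowerCLM b k f x = zc b k x * f x + dbar b k f x := by
  simp [lowerCLM, mulCLM_apply, dbar, SchwartzMap.lineDerivOp_apply_eq_fderiv, mul_add]

/-- The second-order operator by which the entries of the form act on test functions. -/
def weylOp (a b : Y) : 𝓢(Phase Y m, ℂ) →L[ℂ] 𝓢(Phase Y m, ℂ) :=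
  ∑ k, (lowerCLM b k).comp (raiseCLM a k)

theorem one_add_sum (R : Matrix Y Y ℝ) (b : Y) (v : Y → ℂ) :
    ∑ c, ((1 + R) b c : ℂ) * v c = v b + ∑ c, (R b c : ℂ) * v c := by
  simpa using smul_one_add_sum 1 R b v

theorem one_add_sum' (R : Matrix Y Y ℝ) (b : Y) (v : Y → ℂ) :
    ∑ c, ((1 + R) c b : ℂ) * v c = v b + ∑ c, (R c b : ℂ) * v c := by
  have := one_add_sum Rᵀ b v
  simpa [Matrix.one_apply, eq_comm] using this

/-- Integration by parts turns the derivative in `lowerCLM` into `R`, and its multiplication term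
supplies the identity, so `1 + R` acts on the first moments. -/
theorem gaussInt_lower {R : Matrix Y Y ℝ} (hR : Accretive R) (f : 𝓢(Phase Y m, ℂ)) (b : Y)
    (k : Fin m) :
    gaussInt R (lowerCLM b k f) = ∑ c, ((1 + R) b c : ℂ) * gaussInt R (fun x => zc c k x * f x) := by
  have hf := testFn_schwartz f
  have hd : Integrable (dbar b k f) :=
    (((hf.integrable_fderiv _).add ((hf.integrable_fderiv _).const_mul _)).const_mul _)
  have h1 : (lowerCLM b k f : Phase Y m → ℂ) = fun x => zc b k x * f x + dbar b k f x :=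
    funext fun x => lowerCLM_apply b k f x
  rw [one_add_sum, h1, gaussInt_add hR (hf.mul_clm _).integrable hd, hf.gaussInt_dbar hR]

theorem gaussInt_zc_raise {R : Matrix Y Y ℝ} (hR : Accretive R) (f : 𝓢(Phase Y m, ℂ)) (a c : Y)
    (k : Fin m) :
    gaussInt R (fun x => zc c k x * raiseCLM a k f x) =
      ∑ d, ((1 + R) d a : ℂ) * gaussInt R (fun x => zbar d k x * (zc c k x * f x)) -
        (if c = a then 1 else 0) * gaussInt R f := by
  have hf := testFn_schwartz f
  have hz := hf.mul_clm (zc c k)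
  have hd : Integrable (dz a k fun x => zc c k x * f x) :=
    (((hz.integrable_fderiv _).sub ((hz.integrable_fderiv _).const_mul _)).const_mul _)
  have h1 : (fun x => zc c k x * raiseCLM a k f x) = fun x =>
      (zbar a k x * (zc c k x * f x) + dz a k (fun x => zc c k x * f x) x) +
        (-(if c = a then 1 else 0)) * f x := by
    funext x
    rw [raiseCLM_apply, dz_zc_mul hf.differentiable]
    ring
  have hsum : Integrable fun x => zbar a k x * (zc c k x * f x) +
      dz a k (fun x => zc c k x * f x) x := (hz.mul_clm _).integrable.add hd
  rw [h1, gaussInt_add hR hsum (hf.integrable.const_mul _),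
    gaussInt_add hR (hz.mul_clm _).integrable hd, gaussInt_const_mul, hz.gaussInt_dz hR,
    one_add_sum' R a fun d => gaussInt R (fun x => zbar d k x * (zc c k x * f x))]
  ring

/-- The two operators put a factor `1 + R` on either side of the matrix of second moments. Commuting
the derivative in `z` past multiplication by `z` leaves the term `(1 + R) b a`, once for each of the
`m` symplectic pairs. -/
theorem gaussInt_weylOp {R : Matrix Y Y ℝ} (hR : Accretive R) (f : 𝓢(Phase Y m, ℂ)) (a b : Y) :
    gaussInt R (weylOp a b f) =
      ∑ k, ∑ d, ∑ c, ((1 + R) d a : ℂ) * ((1 + R) b c : ℂ) *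
        gaussInt R (fun x => zbar d k x * (zc c k x * f x)) -
      m * ((1 + R) b a : ℂ) * gaussInt R f := by
  have h1 : (weylOp a b f : Phase Y m → ℂ) = fun x => ∑ k, lowerCLM b k (raiseCLM a k f) x := by
    funext x
    simp [weylOp, sum_apply]
  rw [h1, gaussInt_sum hR _ fun k _ => (lowerCLM b k (raiseCLM a k f)).integrable]
  have h2 : ∀ k : Fin m, gaussInt R (lowerCLM b k (raiseCLM a k f)) =
      ∑ d, ∑ c, ((1 + R) d a : ℂ) * ((1 + R) b c : ℂ) *
        gaussInt R (fun x => zbar d k x * (zc c k x * f x)) - ((1 + R) b a : ℂ) * gaussInt R f := by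
    intro k
    rw [gaussInt_lower hR]
    simp only [gaussInt_zc_raise hR, mul_sub, Finset.sum_sub_distrib, Finset.mul_sum]
    congr 1
    · rw [Finset.sum_comm]
      refine Finset.sum_congr rfl fun d _ => Finset.sum_congr rfl fun c _ => by ring
    · simp
  rw [Finset.sum_congr rfl fun k _ => h2 k, Finset.sum_sub_distrib]
  simp [mul_assoc]

/-- The Gaussian integral normalized by the determinant of the form. -/
def normGauss (R : Matrix Y Y ℝ) (f : 𝓢(Phase Y m, ℂ)) : ℂ := ((1 + R).det : ℂ) ^ m * gaussInt R f

/-- The hypothesis on `R'` says that `S'` is the derivative of `(1 + R)⁻¹`. Differentiating the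
integral gives second moments sandwiched between two factors `1 + R`, and differentiating `det ^ m`
gives the trace term; together they are the integral of `weylOp a b f`. No entry of `R` or `R'`
remains outside the integral, so the formula is harmless where `R` blows up. -/
theorem hasDerivAt_normGauss (f : 𝓢(Phase Y m, ℂ)) {R R' : ℝ → Matrix Y Y ℝ} {s₀ C : ℝ}
    (h : ∀ᶠ s in nhds s₀, Accretive (R s) ∧ ∀ a b,
      HasDerivAt (fun s => R s a b) (R' s a b) s ∧ |R' s a b| ≤ C)
    {S' : Matrix Y Y ℝ} (hS' : R' s₀ = -((1 + R s₀) * S' * (1 + R s₀))) :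
    HasDerivAt (fun s => normGauss (R s) f)
      (∑ a, ∑ b, (S' a b : ℂ) * normGauss (R s₀) (weylOp a b f)) s₀ := by
  have hR := h.self_of_nhds.1
  have hdet : 0 < (1 + R s₀).det := by simpa using hR.det_smul_one_add_pos one_pos
  have h1 := (testFn_schwartz f).hasDerivAt_gaussInt h
  have h2 : HasDerivAt (fun s => (1 + R s).det) _ s₀ := hasDerivAt_det (M' := R' s₀) fun a b => by
    simpa only [Matrix.add_apply] using (h.self_of_nhds.2 a b).1.const_add ((1 : Matrix Y Y ℝ) a b)
  rw [sum_inv_mul_eq_sum_adjugate hdet.ne'] at h2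
  refine ((h2.ofReal_comp.pow m).mul h1).congr_deriv ?_
  set M := 1 + R s₀ with hM
  have htr : ∑ a, ∑ b, R' s₀ a b * M⁻¹ b a = -∑ a, ∑ b, S' a b * M b a := by
    have e1 : ∑ a, ∑ b, R' s₀ a b * M⁻¹ b a = (R' s₀ * M⁻¹).trace := by
      simp [Matrix.trace, Matrix.mul_apply]
    have e2 : ∑ a, ∑ b, S' a b * M b a = (S' * M).trace := by
      simp [Matrix.trace, Matrix.mul_apply]
    rw [e1, e2, hS', Matrix.neg_mul, Matrix.trace_neg, Matrix.mul_assoc,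
      Matrix.mul_nonsing_inv _ (Ne.isUnit hdet.ne'), Matrix.mul_one, Matrix.trace_mul_comm]
  rw [htr]
  have hR'c : ∀ d c, (R' s₀ d c : ℂ) = -∑ a, ∑ b, (M d a : ℂ) * (S' a b : ℂ) * (M b c : ℂ) := by
    intro d c
    rw [hS', Matrix.neg_apply, Matrix.mul_apply]
    simp only [Matrix.mul_apply, Finset.sum_mul]
    push_cast
    rw [Finset.sum_comm]
  simp only [hR'c, normGauss, ← hM, gaussInt_weylOp hR]
  set J := gaussInt (R s₀) f
  set μ := fun (k : Fin m) d c => gaussInt (R s₀) (fun x => zbar d k x * (zc c k x * f x)) with hμ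
  have e3 : ∑ k, ∑ d, ∑ c, (-∑ a, ∑ b, (M d a : ℂ) * (S' a b : ℂ) * (M b c : ℂ)) * μ k d c =
      -∑ a, ∑ b, (S' a b : ℂ) * ∑ k, ∑ d, ∑ c, (M d a : ℂ) * (M b c : ℂ) * μ k d c := by
    simp only [neg_mul, Finset.sum_neg_distrib, Finset.sum_mul, Finset.mul_sum]
    congr 1
    rw [Finset.sum_congr rfl fun k _ => Finset.sum_congr rfl fun d _ => Finset.sum_comm,
      Finset.sum_congr rfl fun k _ => Finset.sum_comm, Finset.sum_comm]
    refine Finset.sum_congr rfl fun a _ => ?_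
    rw [Finset.sum_congr rfl fun k _ => Finset.sum_congr rfl fun d _ => Finset.sum_comm,
      Finset.sum_congr rfl fun k _ => Finset.sum_comm, Finset.sum_comm]
    refine Finset.sum_congr rfl fun b _ => Finset.sum_congr rfl fun k _ =>
      Finset.sum_congr rfl fun d _ => Finset.sum_congr rfl fun c _ => by ring
  rw [e3]
  have e4 : ∑ a, ∑ b, (S' a b : ℂ) * ((M.det : ℂ) ^ m * (∑ k, ∑ d, ∑ c,
      (M d a : ℂ) * (M b c : ℂ) * μ k d c - m * (M b a : ℂ) * J)) =
      (M.det : ℂ) ^ m * (∑ a, ∑ b, (S' a b : ℂ) * ∑ k, ∑ d, ∑ c, (M d a : ℂ) * (M b c : ℂ) * μ k d c)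
        - (M.det : ℂ) ^ m * m * J * ((∑ a, ∑ b, S' a b * M b a : ℝ) : ℂ) := by
    push_cast
    rw [Finset.mul_sum, Finset.mul_sum, ← Finset.sum_sub_distrib]
    refine Finset.sum_congr rfl fun a _ => ?_
    rw [Finset.mul_sum, Finset.mul_sum, ← Finset.sum_sub_distrib]
    refine Finset.sum_congr rfl fun b _ => ?_
    ring
  rw [e4]
  generalize (∑ a, ∑ b, S' a b * M b a) = T
  generalize (∑ a, ∑ b, (S' a b : ℂ) * ∑ k, ∑ d, ∑ c, (M d a : ℂ) * (M b c : ℂ) * μ k d c) = U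
  rcases m with _ | m
  · simp
  · simp only [Nat.add_sub_cancel, Pi.pow_apply]
    push_cast
    ring

end WeylOperators

/-! ### Bounds by Schwartz seminorms -/

section Bounds

variable {F : Type*} [NormedAddCommGroup F] [NormedSpace ℝ F]

/-- Functionals of test functions dominated by a continuous seminorm. -/
def schwartzBounds (F : Type*) [NormedAddCommGroup F] [NormedSpace ℝ F] : Set (𝓢(F, ℂ) → ℝ) :=
  {p | ∃ q : Seminorm ℝ 𝓢(F, ℂ), Continuous q ∧ ∀ f, p f ≤ q f}

theorem isBoundFamily_schwartzBounds : IsBoundFamily (schwartzBounds F) where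
  zero := ⟨0, continuous_const, fun f => le_rfl⟩
  add := by
    rintro p ⟨q, hq, h⟩ p' ⟨q', hq', h'⟩
    exact ⟨q + q', hq.add hq', fun f => add_le_add (h f) (h' f)⟩
  smul := by
    rintro c hc p ⟨q, hq, h⟩
    refine ⟨c.toNNReal • q, ?_, fun f => ?_⟩
    · change Continuous fun f => (c.toNNReal : ℝ) * q f
      exact continuous_const.mul hq
    · change c * p f ≤ (c.toNNReal : ℝ) * q f
      rw [Real.coe_toNNReal c hc]
      exact mul_le_mul_of_nonneg_left (h f) hc

theorem schwartzBounds_comp {p : 𝓢(F, ℂ) → ℝ} (hp : p ∈ schwartzBounds F)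
    (A : 𝓢(F, ℂ) →L[ℂ] 𝓢(F, ℂ)) : (fun f => p (A f)) ∈ schwartzBounds F := by
  obtain ⟨q, hq, h⟩ := hp
  exact ⟨q.comp (A.restrictScalars ℝ).toLinearMap, hq.comp A.continuous, fun f => h _⟩

theorem Tame.comp_parameter {ι 𝓕 𝓕' : Type*} [Fintype ι] [DecidableEq ι] {B : Set (𝓕 → ℝ)}
    {B' : Set (𝓕' → ℝ)} {A : 𝓕' → 𝓕} (hA : ∀ p ∈ B, p ∘ A ∈ B') {k : ℕ} :
    ∀ {ψ : 𝓕 → ℂ → (ι → ℝ) → ℂ}, Tame B k ψ → Tame B' k fun f => ψ (A f) := by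
  have h0 : ∀ {ψ : 𝓕 → ℂ → (ι → ℝ) → ℂ}, TameZero B ψ → TameZero B' fun f => ψ (A f) := fun h =>
    ⟨fun f => h.differentiable _, fun f => h.continuousOn _, fun r => by
      obtain ⟨p, hp, hb⟩ := h.bound r
      exact ⟨p ∘ A, hA p hp, fun f => hb _⟩⟩
  induction k with
  | zero => intro ψ h; exact h0 h
  | succ k ih =>
    intro ψ h
    refine ⟨h0 h.1, fun j => ?_⟩
    obtain ⟨ψ', h1, h2⟩ := h.2 j
    exact ⟨fun f => ψ' (A f), ih h1, fun f => h2 _⟩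

variable {Y : Type*} [Fintype Y] [DecidableEq Y] {m : ℕ}

-- The seminorm is a multiple of the `L¹` norm of the Fourier transform of the weighted test
-- function, continuous as a composition of continuous linear maps.
open scoped FourierTransform in
theorem normGauss_bound (Y : Type*) [Fintype Y] [DecidableEq Y] (m : ℕ) :
    ∃ p ∈ schwartzBounds (Phase Y m), ∀ (R : Matrix Y Y ℝ), Accretive R →
      ∀ f : 𝓢(Phase Y m, ℂ), ‖normGauss R f‖ ≤ p f := by
  obtain ⟨C, hC, h⟩ := norm_gaussInt_le Y m
  let A : 𝓢(Phase Y m, ℂ) →L[ℝ] Lp ℂ 1 (volume : Measure (Phase Y m)) :=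
    (SchwartzMap.toLpCLM ℝ ℂ 1 volume).comp
      (((FourierTransform.fourierCLM ℂ 𝓢(Phase Y m, ℂ)).restrictScalars ℝ).comp
        (weightCLM Y m (Fintype.card Y * m + 1)))
  let q : Seminorm ℝ 𝓢(Phase Y m, ℂ) := C.toNNReal •
    (normSeminorm ℝ (Lp ℂ 1 (volume : Measure (Phase Y m)))).comp A.toLinearMap
  have hq : ∀ f, q f = C * ∫ ξ, ‖(𝓕 (weightCLM Y m (Fintype.card Y * m + 1) f)) ξ‖ := by
    intro f
    rw [← SchwartzMap.norm_toLp_one]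
    change (C.toNNReal : ℝ) * _ = _
    rw [Real.coe_toNNReal C hC]
    rfl
  refine ⟨q, ⟨q, ?_, fun f => le_rfl⟩, fun R hR f => ?_⟩
  · change Continuous fun f => (C.toNNReal : ℝ) * ‖A f‖
    exact continuous_const.mul A.continuous.norm
  · rw [hq]
    refine le_trans (le_of_eq ?_) (h R hR f)
    have hdet : 0 < (1 + R).det := by simpa using hR.det_smul_one_add_pos one_pos
    rw [normGauss, norm_mul, norm_pow, Complex.norm_real, Real.norm_of_nonneg hdet.le]

end Bounds

/-! ### Tameness of the normalized Gaussian integral -/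

section TameGauss

variable {Y : Type*} [Fintype Y] [DecidableEq Y] {m : ℕ}

theorem continuousAt_inv_entry {X : Type*} [TopologicalSpace X] {S : X → Matrix Y Y ℝ} {w : X}
    (hS : ∀ a b, ContinuousAt (fun w => S w a b) w) (hd : (S w).det ≠ 0) (a b : Y) :
    ContinuousAt (fun w => (S w)⁻¹ a b) w := by
  have hS' : ContinuousAt S w := continuousAt_pi.2 fun a => continuousAt_pi.2 fun b => hS a b
  have h1 : ContinuousAt (fun w => (S w).det) w :=
    ((continuous_id (X := Matrix Y Y ℝ)).matrix_det.continuousAt).comp hS'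
  have h2 : ContinuousAt (fun w => (S w).adjugate a b) w :=
    ((continuous_id (X := Matrix Y Y ℝ)).matrix_adjugate.matrix_elem a b).continuousAt.comp hS'
  simp only [Matrix.inv_def, Matrix.smul_apply, Ring.inverse_eq_inv', smul_eq_mul]
  exact (h1.inv₀ hd).mul h2

theorem continuousAt_normGauss {X : Type*} [TopologicalSpace X] [FirstCountableTopology X]
    {R : X → Matrix Y Y ℝ} {w : X} (hR : ∀ᶠ w in nhds w, Accretive (R w))
    (hc : ∀ a b, ContinuousAt (fun w => R w a b) w) (f : 𝓢(Phase Y m, ℂ)) :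
    ContinuousAt (fun w => normGauss (R w) f) w := by
  have hS' : ContinuousAt R w := continuousAt_pi.2 fun a => continuousAt_pi.2 fun b => hc a b
  have h1 : ContinuousAt (fun w => (1 + R w).det) w :=
    ((continuous_const.add (continuous_id (X := Matrix Y Y ℝ))).matrix_det.continuousAt).comp hS'
  refine ((Complex.continuous_ofReal.continuousAt.comp h1).pow m).mul ?_
  refine continuousAt_of_dominated (bound := fun x => ‖f x‖) ?_ ?_ f.integrable.norm ?_
  · refine Filter.Eventually.of_forall fun v => Continuous.aestronglyMeasurable ?_
    have := continuous_qform (m := m) (R v)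
    have := f.continuous
    fun_prop
  · filter_upwards [hR] with v hv
    refine Filter.Eventually.of_forall fun x => ?_
    rw [norm_mul]
    exact mul_le_of_le_one_left (norm_nonneg _) (norm_cexp_neg_qform_le hv x)
  · refine Filter.Eventually.of_forall fun x => ?_
    have hq : ContinuousAt (fun w => qform (R w) x) w := by
      unfold qform
      refine tendsto_finsetSum _ fun k _ => tendsto_finsetSum _ fun a _ =>
        tendsto_finsetSum _ fun b _ => ?_
      exact (Complex.continuous_ofReal.continuousAt.comp (hc a b)).mul continuousAt_const
    exact (hq.neg.cexp).mul continuousAt_const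

variable {ι : Type*} [Fintype ι] [DecidableEq ι]

/-- Only `S = (1 + R)⁻¹` has to be smooth on the closed cube. A partial derivative is a combination,
with the bounded smooth derivatives of `S` as coefficients, of the same integral for the test
functions `weylOp a b f`, and precomposition with a continuous operator keeps seminorm bounds; so
the claim follows by induction on `k`. -/
theorem tame_normGauss {R S : (ι → ℝ) → Matrix Y Y ℝ}
    (hR : ∀ w ∈ paramDomain ι, Accretive (R w)) (hS : ∀ w ∈ paramDomain ι, (1 + R w)⁻¹ = S w)
    (hsm : ∀ a b, ∀ w ∈ Set.Icc (0 : ι → ℝ) 1, ContDiffAt ℝ (⊤ : ℕ∞) (fun w => S w a b) w)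
    (k : ℕ) : Tame (schwartzBounds (Phase Y m)) k fun f _ w => normGauss (R w) f := by
  have hdet : ∀ w ∈ paramDomain ι, (1 + R w).det ≠ 0 := fun w hw => by
    simpa using ((hR w hw).det_smul_one_add_pos one_pos).ne'
  have hinv : ∀ w ∈ paramDomain ι, (S w)⁻¹ = 1 + R w := fun w hw => by
    rw [← hS w hw, Matrix.nonsing_inv_nonsing_inv _ (Ne.isUnit (hdet w hw))]
  have hSdet : ∀ w ∈ paramDomain ι, (S w).det ≠ 0 := fun w hw => by
    rw [← hS w hw]
    exact (Matrix.isUnit_nonsing_inv_det _ (Ne.isUnit (hdet w hw))).ne_zero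
  have hRS : ∀ w ∈ paramDomain ι, ∀ a b, R w a b = (S w)⁻¹ a b - (1 : Matrix Y Y ℝ) a b := by
    intro w hw a b
    rw [hinv w hw, Matrix.add_apply]
    ring
  have hopen : ∀ w ∈ paramDomain ι, ∀ᶠ v in nhds w, v ∈ paramDomain ι := fun w hw =>
    isOpen_paramDomain.mem_nhds hw
  have hScont : ∀ w ∈ paramDomain ι, ∀ a b, ContinuousAt (fun w => S w a b) w := fun w hw a b =>
    (hsm a b w (paramDomain_subset_Icc hw)).continuousAt
  have hRcont : ∀ w ∈ paramDomain ι, ∀ a b, ContinuousAt (fun w => R w a b) w := by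
    intro w hw a b
    refine ((continuousAt_inv_entry (hScont w hw) (hSdet w hw) a b).sub
      (continuousAt_const (y := (1 : Matrix Y Y ℝ) a b))).congr ?_
    filter_upwards [hopen w hw] with v hv
    exact (hRS v hv a b).symm
  have h0 : TameZero (schwartzBounds (Phase Y m)) fun f (_ : ℂ) w => normGauss (R w) f := by
    refine ⟨fun f w _ => differentiable_const _, fun f D w hw => ?_, fun r => ?_⟩
    · refine ContinuousAt.continuousWithinAt (continuousAt_normGauss ?_ (hRcont w hw) f)
      filter_upwards [hopen w hw] with v hv using hR v hv
    · obtain ⟨p, hp, h⟩ := normGauss_bound Y m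
      exact ⟨p, hp, fun f D w _ hw => h (R w) (hR w hw) f⟩
  have hder : ∀ a b, ∀ w ∈ Set.Icc (0 : ι → ℝ) 1, ∀ j, ContDiffAt ℝ (⊤ : ℕ∞)
      (fun w => fderiv ℝ (fun w => S w a b) w (Pi.single j 1)) w := fun a b w hw j =>
    ((hsm a b w hw).fderiv_right (m := (⊤ : ℕ∞)) (by norm_num)).clm_apply contDiffAt_const
  have hpath : ∀ j, ∀ w ∈ paramDomain ι, ∀ f : 𝓢(Phase Y m, ℂ),
      HasDerivAt (fun s => normGauss (R (Function.update w j s)) f)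
        (∑ a, ∑ b, ((fderiv ℝ (fun w => S w a b) w (Pi.single j 1) : ℝ) : ℂ) *
          normGauss (R w) (weylOp a b f)) (w j) := by
    intro j w hw f
    let S' : ℝ → Matrix Y Y ℝ := fun s a b =>
      fderiv ℝ (fun w => S w a b) (Function.update w j s) (Pi.single j 1)
    have hupd : ContinuousAt (fun s => Function.update w j s) (w j) :=
      (continuous_const.update j continuous_id).continuousAt
    have hSd : ∀ s, Function.update w j s ∈ paramDomain ι → ∀ a b,
        HasDerivAt (fun s => S (Function.update w j s) a b) (S' s a b) s := by
      intro s hs a b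
      have hd := ((hsm a b _ (paramDomain_subset_Icc hs)).differentiableAt (by simp)).hasFDerivAt
      exact hd.comp_hasDerivAt s (hasDerivAt_update w j s)
    have hev := eventually_update_mem hw j
    let R' : ℝ → Matrix Y Y ℝ := fun s =>
      -((S (Function.update w j s))⁻¹ * S' s * (S (Function.update w j s))⁻¹)
    have hR'c : ∀ a b, ContinuousAt (fun s => R' s a b) (w j) := by
      intro a b
      have e1 : ∀ a b, ContinuousAt (fun s => (S (Function.update w j s))⁻¹ a b) (w j) := by
        intro a b
        refine continuousAt_inv_entry (fun a b => (hSd _ ?_ a b).continuousAt) ?_ a b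
        · rwa [Function.update_eq_self]
        · rw [Function.update_eq_self]; exact hSdet w hw
      have e2 : ∀ a b, ContinuousAt (fun s => S' s a b) (w j) := by
        intro a b
        have := (hder a b w (paramDomain_subset_Icc hw) j).continuousAt
        refine ContinuousAt.comp (g := fun w => fderiv ℝ (fun w => S w a b) w (Pi.single j 1)) ?_ hupd
        rwa [Function.update_eq_self]
      simp only [R', Matrix.neg_apply, Matrix.mul_apply]
      refine ContinuousAt.neg (tendsto_finsetSum _ fun c _ => ?_)
      exact ContinuousAt.mul (tendsto_finsetSum _ fun d _ => (e1 a d).mul (e2 d c)) (e1 c b)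
    -- This bound on `R'` serves only to differentiate under the integral at the given interior
    -- point. It need not be uniform up to the boundary, where `R'` may be unbounded.
    have hbd : ∀ᶠ s in nhds (w j), ∀ a b, |R' s a b| ≤ ∑ a, ∑ b, (|R' (w j) a b| + 1) := by
      refine Filter.eventually_all.2 fun a => Filter.eventually_all.2 fun b => ?_
      have : ∀ᶠ s in nhds (w j), |R' s a b| < |R' (w j) a b| + 1 :=
        (hR'c a b).abs.eventually_lt continuousAt_const (by simp)
      filter_upwards [this] with s hs
      refine hs.le.trans ?_
      exact (Finset.single_le_sum (f := fun b => |R' (w j) a b| + 1) (fun _ _ => by positivity)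
        (Finset.mem_univ b)).trans (Finset.single_le_sum
          (f := fun a => ∑ b, (|R' (w j) a b| + 1))
          (fun _ _ => Finset.sum_nonneg fun _ _ => by positivity) (Finset.mem_univ a))
    have hmain := hasDerivAt_normGauss f (R := fun s => R (Function.update w j s)) (R' := R')
      (s₀ := w j) (S' := S' (w j)) (by
        filter_upwards [hev, hbd, hev.eventually_nhds] with s hs hb hs'
        refine ⟨hR _ hs, fun a b => ⟨?_, hb a b⟩⟩
        refine ((hasDerivAt_matrix_inv (hSd s hs) (hSdet _ hs) a b).sub_const
          ((1 : Matrix Y Y ℝ) a b)).congr_of_eventuallyEq ?_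
        filter_upwards [hs'] with r hr
        exact hRS _ hr a b) (by
        simp only [R', Function.update_eq_self, hinv w hw])
    simpa only [S', Function.update_eq_self] using hmain
  induction k with
  | zero => exact h0
  | succ k ih =>
    refine ⟨h0, fun j => ⟨_, ?_, fun f D w hw => hpath j w hw f⟩⟩
    refine Tame.sum isBoundFamily_schwartzBounds _ fun a _ =>
      Tame.sum isBoundFamily_schwartzBounds _ fun b _ => ?_
    refine Tame.mul isBoundFamily_schwartzBounds (nice_of_contDiffAt k
      (v := fun w => ((fderiv ℝ (fun w => S w a b) w (Pi.single j 1) : ℝ) : ℂ)) fun w hw =>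
      Complex.ofRealCLM.contDiff.contDiffAt.comp w (hder a b w hw j)) ?_
    exact Tame.comp_parameter (A := fun f => weylOp a b f)
      (fun p hp => schwartzBounds_comp hp (weylOp a b)) ih

end TameGauss

/-! ### Polynomials of degree at most two in each line parameter -/

section BoxPolynomials

variable {E W : Type*} [Fintype E] [DecidableEq E] [Fintype W] [DecidableEq W]

/-- Polynomials of degree at most two in each variable. -/
def boxPoly (c : (E → Fin 3) → ℝ) (t : E → ℝ) : ℝ := ∑ a, c a * ∏ e, t e ^ (a e : ℕ)

/-- The coefficients of the squares of the short and the long variable of a line, as functions of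
its parameter; multiplied by the parameter, all their products are polynomials of degree at most
two with nonnegative coefficients. -/
structure Profile where
  α : ℝ → ℝ
  β : ℝ → ℝ
  τ : Bool → Bool → Fin 3 → ℝ
  lower : ℝ
  τ_nonneg : ∀ b b' r, 0 ≤ τ b b' r
  eq : ∀ b b' : Bool, ∀ t : ℝ, t ≠ 0 →
    t * (if b = true then α t else 1) * (if b' = true then β t else 1) =
      ∑ r, τ b b' r * t ^ (r : ℕ)
  lower_pos : 0 < lower
  lower_le : ∀ t : ℝ, 0 < t → t < 1 → lower ≤ α t
  β_nonneg : ∀ t : ℝ, 0 < t → t < 1 → 0 ≤ β t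

/-- The diagonal form given by the lines. -/
def lineWeights (P : Profile) (t : E → ℝ) : (E ⊕ E) ⊕ W → ℝ :=
  Sum.elim (Sum.elim (fun e => P.α (t e)) fun e => P.β (t e)) 0

/-- Coefficients of the polynomial obtained from a sum over sets of lines. -/
def expandCoeff (P : Profile) (g : Finset ((E ⊕ E) ⊕ W) → ℝ) (a : E → Fin 3) : ℝ :=
  ∑ S, g S * ((∏ w, if Sum.inr w ∈ S then 0 else 1) *
    ∏ e, P.τ (decide (Sum.inl (Sum.inl e) ∈ S)) (decide (Sum.inl (Sum.inr e) ∈ S)) (a e))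

/-- Collect the factors line by line: by the profile, `t e` times the selected weights of the line
`e` is a polynomial of degree at most two. Sets meeting `W` contribute zero because the weights
vanish there. -/
theorem prod_lineWeights (P : Profile) {t : E → ℝ} (ht : ∀ e, t e ≠ 0)
    (S : Finset ((E ⊕ E) ⊕ W)) :
    (∏ e, t e) * ∏ i ∈ S, lineWeights P t i = ∑ a : E → Fin 3,
      ((∏ w, if Sum.inr w ∈ S then (0 : ℝ) else 1) *
        ∏ e, P.τ (decide (Sum.inl (Sum.inl e) ∈ S)) (decide (Sum.inl (Sum.inr e) ∈ S)) (a e)) *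
      ∏ e, t e ^ (a e : ℕ) := by
  have h1 : ∏ i ∈ S, lineWeights P t i = ∏ i, if i ∈ S then lineWeights P t i else 1 := by
    rw [Finset.prod_ite_mem, Finset.univ_inter]
  rw [h1, Fintype.prod_sum_type, Fintype.prod_sum_type]
  simp only [lineWeights, Sum.elim_inl, Sum.elim_inr, Pi.zero_apply]
  rw [← mul_assoc, ← Finset.prod_mul_distrib, ← Finset.prod_mul_distrib, mul_comm]
  have h2 : ∀ e, t e * ((if Sum.inl (Sum.inl e) ∈ S then P.α (t e) else 1) *
      (if Sum.inl (Sum.inr e) ∈ S then P.β (t e) else 1)) =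
      ∑ r, P.τ (decide (Sum.inl (Sum.inl e) ∈ S)) (decide (Sum.inl (Sum.inr e) ∈ S)) r *
        t e ^ (r : ℕ) := by
    intro e
    rw [← P.eq _ _ (t e) (ht e)]
    simp only [decide_eq_true_eq]
    ring
  simp only [h2, mul_assoc] at *
  rw [Finset.prod_univ_sum, Finset.mul_sum, Fintype.piFinset_univ]
  refine Finset.sum_congr rfl fun a _ => ?_
  rw [Finset.prod_mul_distrib]

theorem prod_mul_sum_lineWeights (P : Profile) {t : E → ℝ} (ht : ∀ e, t e ≠ 0)
    (g : Finset ((E ⊕ E) ⊕ W) → ℝ) :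
    (∏ e, t e) * ∑ S, (∏ i ∈ S, lineWeights P t i) * g S = boxPoly (expandCoeff P g) t := by
  simp only [boxPoly, expandCoeff, Finset.mul_sum, Finset.sum_mul]
  rw [Finset.sum_comm]
  refine Finset.sum_congr rfl fun S _ => ?_
  rw [← mul_assoc, prod_lineWeights P ht S, Finset.sum_mul]
  refine Finset.sum_congr rfl fun a _ => ?_
  ring

/-- The factors multiplying `g S` are nonnegative and vanish unless `S` avoids `W`, so an inequality
for such `S` passes to every coefficient. -/
theorem abs_expandCoeff_le (P : Profile) {g h : Finset ((E ⊕ E) ⊕ W) → ℝ} {K : ℝ}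
    (hgh : ∀ S, (∀ w, Sum.inr w ∉ S) → |g S| ≤ K * h S) (a : E → Fin 3) :
    |expandCoeff P g a| ≤ K * expandCoeff P h a := by
  unfold expandCoeff
  rw [Finset.mul_sum]
  refine (Finset.abs_sum_le_sum_abs _ _).trans (Finset.sum_le_sum fun S _ => ?_)
  rw [abs_mul, ← mul_assoc]
  by_cases hS : ∀ w, Sum.inr w ∉ S
  · have : 0 ≤ (∏ w : W, if Sum.inr w ∈ S then (0 : ℝ) else 1) *
        ∏ e, P.τ (decide (Sum.inl (Sum.inl e) ∈ S)) (decide (Sum.inl (Sum.inr e) ∈ S)) (a e) :=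
      mul_nonneg (Finset.prod_nonneg fun w _ => by split_ifs <;> norm_num)
        (Finset.prod_nonneg fun e _ => P.τ_nonneg _ _ _)
    rw [abs_of_nonneg this]
    exact mul_le_mul_of_nonneg_right (hgh S hS) this
  · push Not at hS
    obtain ⟨w, hw⟩ := hS
    rw [Finset.prod_eq_zero (Finset.mem_univ w) (by rw [if_pos hw])]
    simp

theorem expandCoeff_nonneg (P : Profile) {g : Finset ((E ⊕ E) ⊕ W) → ℝ} (hg : ∀ S, 0 ≤ g S)
    (a : E → Fin 3) : 0 ≤ expandCoeff P g a :=
  Finset.sum_nonneg fun S _ => mul_nonneg (hg S)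
    (mul_nonneg (Finset.prod_nonneg fun w _ => by split_ifs <;> norm_num)
      (Finset.prod_nonneg fun e _ => P.τ_nonneg _ _ _))

/-- The coefficients of the determinant. -/
def detCoeff (P : Profile) (B : Matrix ((E ⊕ E) ⊕ W) ((E ⊕ E) ⊕ W) ℝ) : (E → Fin 3) → ℝ :=
  expandCoeff P fun S => (unitRows S B).det

/-- The coefficients of an entry of the adjugate. -/
def adjCoeff (P : Profile) (B : Matrix ((E ⊕ E) ⊕ W) ((E ⊕ E) ⊕ W) ℝ) (x y : W) :
    (E → Fin 3) → ℝ :=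
  expandCoeff P fun S => (unitRows S B).adjugate (Sum.inr x) (Sum.inr y)

theorem boxPoly_detCoeff (P : Profile) (B : Matrix ((E ⊕ E) ⊕ W) ((E ⊕ E) ⊕ W) ℝ) {t : E → ℝ}
    (ht : ∀ e, t e ≠ 0) :
    (∏ e, t e) * (Matrix.diagonal (lineWeights P t) + B).det = boxPoly (detCoeff P B) t := by
  rw [det_diagonal_add, detCoeff, prod_mul_sum_lineWeights P ht]

theorem boxPoly_adjCoeff (P : Profile) (B : Matrix ((E ⊕ E) ⊕ W) ((E ⊕ E) ⊕ W) ℝ) {t : E → ℝ}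
    (ht : ∀ e, t e ≠ 0) (x y : W) :
    (∏ e, t e) * (Matrix.diagonal (lineWeights P t) + B).adjugate (Sum.inr x) (Sum.inr y) =
      boxPoly (adjCoeff P B x y) t := by
  rw [adjugate_diagonal_add (lineWeights P t) B (show lineWeights P t (Sum.inr y) = 0 from rfl),
    adjCoeff, prod_mul_sum_lineWeights P ht]

theorem detCoeff_nonneg (P : Profile) {B : Matrix ((E ⊕ E) ⊕ W) ((E ⊕ E) ⊕ W) ℝ}
    (hB : Accretive B) (a : E → Fin 3) : 0 ≤ detCoeff P B a :=
  expandCoeff_nonneg P (fun S => hB.det_unitRows_nonneg S) a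

theorem unitRows_two_smul {n : Type*} [Fintype n] [DecidableEq n] (S : Finset n)
    (B : Matrix n n ℝ) : unitRows S ((2 : ℝ) • B) =
      Matrix.diagonal (fun i => if i ∈ S then 1 else 2) * unitRows S B := by
  ext i j
  rw [Matrix.diagonal_mul]
  by_cases hi : i ∈ S <;> simp [unitRows, hi]

/-- Apply the previous bound to `2 • B`; the doubled rows outside `S` cancel except for row `b`. The
factor two is wanted because for `a = b` a unit form on the external variables counts the coordinate
once where the hypothesis counts it twice. -/
theorem abs_adjugate_unitRows_le_two {n : Type*} [Fintype n] [DecidableEq n] {B : Matrix n n ℝ}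
    {a b : n} (h : ∀ x : n → ℝ, x a ^ 2 + x b ^ 2 ≤ 2 * (x ⬝ᵥ B.mulVec x)) {S : Finset n}
    (hb : b ∉ S) : |(unitRows S B).adjugate a b| ≤ 2 * (unitRows S B).det := by
  have h1 := abs_adjugate_unitRows_le (B := (2 : ℝ) • B) (a := a) (b := b) (S := S) (fun x => by
    rw [Matrix.smul_mulVec, dotProduct_smul, smul_eq_mul]; exact h x) hb
  rw [unitRows_two_smul, Matrix.adjugate_mul_distrib, Matrix.adjugate_diagonal,
    Matrix.mul_diagonal, Matrix.det_mul, Matrix.det_diagonal,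
    ← Finset.mul_prod_erase _ _ (Finset.mem_univ b), if_neg hb, abs_mul, mul_comm] at h1
  have hpos : 0 < ∏ i ∈ Finset.univ.erase b, (if i ∈ S then (1 : ℝ) else 2) :=
    Finset.prod_pos fun i _ => by split_ifs <;> norm_num
  rw [abs_of_pos hpos] at h1
  nlinarith

/-- Every monomial of an adjugate entry occurs in the determinant. Hence both are divisible by the
same monomial in a chart and their quotient extends smoothly to the boundary. -/
theorem abs_adjCoeff_le (P : Profile) {B : Matrix ((E ⊕ E) ⊕ W) ((E ⊕ E) ⊕ W) ℝ} {x y : W}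
    (h : ∀ v : (E ⊕ E) ⊕ W → ℝ, v (Sum.inr x) ^ 2 + v (Sum.inr y) ^ 2 ≤ 2 * (v ⬝ᵥ B.mulVec v))
    (a : E → Fin 3) : |adjCoeff P B x y a| ≤ 2 * detCoeff P B a :=
  abs_expandCoeff_le P (fun _ hS => abs_adjugate_unitRows_le_two h (hS y)) a

end BoxPolynomials

/-! ### Schur complements -/

section Schur

variable {I Y : Type*} [Fintype I] [DecidableEq I] [Fintype Y] [DecidableEq Y]

/-- The identity on the second block. -/
def extOne (I Y : Type*) [DecidableEq Y] : Matrix (I ⊕ Y) (I ⊕ Y) ℝ :=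
  Matrix.fromBlocks 0 0 0 1

/-- Adding the identity to the external block adds it to the Schur complement. Thus `det (1 + R)`
and `(1 + R)⁻¹` are obtained from the full form plus the external unit form, without inverting `Q`.
-/
theorem det_fromBlocks_add_extOne {A : Matrix I I ℝ} (hA : A.det ≠ 0) (B : Matrix I Y ℝ)
    (C : Matrix Y I ℝ) (D : Matrix Y Y ℝ) :
    (Matrix.fromBlocks A B C D + extOne I Y).det = A.det * (1 + (D - C * A⁻¹ * B)).det := by
  let := Matrix.invertibleOfIsUnitDet A (Ne.isUnit hA)
  rw [extOne, Matrix.fromBlocks_add, add_zero, add_zero, add_zero, Matrix.det_fromBlocks₁₁,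
    Matrix.invOf_eq_nonsing_inv]
  congr 2
  abel

theorem inv_fromBlocks_add_extOne {A : Matrix I I ℝ} (hA : A.det ≠ 0) {B : Matrix I Y ℝ}
    {C : Matrix Y I ℝ} {D : Matrix Y Y ℝ} (hd : (1 + (D - C * A⁻¹ * B)).det ≠ 0) (x y : Y) :
    (Matrix.fromBlocks A B C D + extOne I Y)⁻¹ (Sum.inr x) (Sum.inr y) =
      ((1 + (D - C * A⁻¹ * B))⁻¹ : Matrix Y Y ℝ) x y := by
  let := Matrix.invertibleOfIsUnitDet A (Ne.isUnit hA)
  have e : D + 1 - C * ⅟A * B = 1 + (D - C * A⁻¹ * B) := by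
    rw [Matrix.invOf_eq_nonsing_inv]; abel
  let : Invertible (D + 1 - C * ⅟A * B) :=
    Matrix.invertibleOfIsUnitDet _ (by rw [e]; exact Ne.isUnit hd)
  let := Matrix.fromBlocks₁₁Invertible A B C (D + 1)
  rw [extOne, Matrix.fromBlocks_add, add_zero, add_zero, add_zero, ← Matrix.invOf_eq_nonsing_inv,
    Matrix.invOf_fromBlocks₁₁_eq, Matrix.fromBlocks_apply₂₂, Matrix.invOf_eq_nonsing_inv, e]

/-- The full matrix sends `(-A⁻¹ B x, x)` to `(0, (D - C A⁻¹ B) x)`, so the form of the complement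
at `x` is a value of the full form. -/
theorem accretive_schur {A : Matrix I I ℝ} (hA : A.det ≠ 0) {B : Matrix I Y ℝ}
    {C : Matrix Y I ℝ} {D : Matrix Y Y ℝ} (h : Accretive (Matrix.fromBlocks A B C D)) :
    Accretive (D - C * A⁻¹ * B) := by
  intro x
  have h1 := h (Sum.elim (-(A⁻¹ * B).mulVec x) x)
  have e1 : (Matrix.fromBlocks A B C D).mulVec (Sum.elim (-(A⁻¹ * B).mulVec x) x) =
      Sum.elim (0 : I → ℝ) ((D - C * A⁻¹ * B).mulVec x) := by
    rw [Matrix.fromBlocks_mulVec]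
    congr 1
    · simp only [Sum.elim_comp_inl, Sum.elim_comp_inr, Matrix.mulVec_neg, Matrix.mulVec_mulVec]
      rw [← Matrix.mul_assoc, Matrix.mul_nonsing_inv _ (Ne.isUnit hA), Matrix.one_mul]
      simp
    · simp only [Sum.elim_comp_inl, Sum.elim_comp_inr, Matrix.mulVec_neg, Matrix.mulVec_mulVec,
        Matrix.sub_mulVec, Matrix.mul_assoc]
      abel
  rw [e1] at h1
  simpa [dotProduct, Fintype.sum_sum_type] using h1

end Schur

/-! ### The linear relations around one vertex -/

section Kernel

/-- The ratio of successive partial sums around a vertex. -/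
def cornerRatio (ρ : ℝ) (b : Bool) (i : Fin 4) : ℝ :=
  if b = true then (if i = 0 ∨ i = 2 then -ρ else -ρ⁻¹) else 1

theorem cornerRatio_ne_zero {ρ : ℝ} (hρ : ρ ≠ 0) (b : Bool) (i : Fin 4) :
    cornerRatio ρ b i ≠ 0 := by
  unfold cornerRatio
  split_ifs <;> simp [hρ]

theorem cornerRatio_ne_one {ρ : ℝ} (hρ' : ρ ≠ -1) (i : Fin 4) : cornerRatio ρ true i ≠ 1 := by
  unfold cornerRatio
  simp only [if_true]
  split_ifs
  · intro h; exact hρ' (by linarith)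
  · intro h
    apply hρ'
    have : ρ⁻¹ = -1 := by linarith
    rw [← inv_inv ρ, this]; norm_num

/-- The linear relation at an internal corner of a vertex. -/
def CornerRel (ω p : ℝ) (a : Fin 4 → ℝ) (i : Fin 4) : Prop :=
  p = ∑ j, (if i < j then a j else 0) - ∑ j, (if j < i then a j else 0) - ω * (-1) ^ (i : ℕ) * a i

/-- Let `η i` be the sum of the first `i` entries, shifted by `-(∑ a - p) / 2`. The corner relation
becomes `2 * η i = -(1 + ω (-1)^i) * a i`, hence `η (i + 1) = η i + a i` equals `-ρ * η i` at even
and `-ρ⁻¹ * η i` at odd internal corners, with `ρ = (1 - ω) / (1 + ω)`; at external corners `a i =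
0`. The hypothesis `ω ≠ 1` is what makes `ρ` nonzero. -/
theorem vertex_partial_sums {ω p : ℝ} (hω : 0 ≤ ω) (hω1 : ω ≠ 1) {a : Fin 4 → ℝ} {b : Fin 4 → Bool}
    (hext : ∀ i, b i = false → a i = 0) (hinteg : ∀ i, b i = true → CornerRel ω p a i) :
    ∃ ρ : ℝ, ρ ≠ 0 ∧ ρ ≠ -1 ∧ ∃ η : ℕ → ℝ, η 0 = -(∑ i, a i - p) / 2 ∧
      (∀ i : Fin 4, η (i + 1) = η i + a i) ∧
      (∀ i : Fin 4, η (i + 1) = cornerRatio ρ (b i) i * η i) := by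
  have h1 : (1 + ω) ≠ 0 := by positivity
  have h2 : (1 - ω) ≠ 0 := sub_ne_zero.2 (Ne.symm hω1)
  refine ⟨(1 - ω) / (1 + ω), div_ne_zero h2 h1, ?_,
    fun n => -(∑ i, a i - p) / 2 + ∑ j : Fin 4, if (j : ℕ) < n then a j else 0, by simp, ?_, ?_⟩
  · intro h
    rw [div_eq_iff h1] at h
    linarith
  · intro i
    fin_cases i <;> simp [Fin.sum_univ_four] <;> ring
  · intro i
    cases hb : b i
    · have := hext i hb
      fin_cases i <;> simp [Fin.sum_univ_four, cornerRatio] at this ⊢ <;> linarith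
    · have := hinteg i hb
      unfold CornerRel at this
      fin_cases i <;> simp [Fin.sum_univ_four, cornerRatio] at this ⊢ <;> field_simp <;> nlinarith

/-- The condition says `η 0 = 0`, and the ratios carry this to all partial sums and so to all
entries. -/
theorem vertex_zero {ω p : ℝ} (hω : 0 ≤ ω) (hω1 : ω ≠ 1) {a : Fin 4 → ℝ} {b : Fin 4 → Bool}
    (hext : ∀ i, b i = false → a i = 0) (hinteg : ∀ i, b i = true → CornerRel ω p a i)
    (hq : ∑ i, a i = p) (i : Fin 4) : a i = 0 := by
  obtain ⟨ρ, hρ, hρ1, η, h0, hs, hr⟩ := vertex_partial_sums hω hω1 hext hinteg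
  have e0 : η 0 = 0 := by rw [h0, hq]; simp
  have e1 : η 1 = 0 := by have := hr 0; simp [e0] at this; exact this
  have e2 : η 2 = 0 := by have := hr 1; simp [e1] at this; exact this
  have e3 : η 3 = 0 := by have := hr 2; simp [e2] at this; exact this
  have e4 : η 4 = 0 := by have := hr 3; simp [e3] at this; exact this
  have := hs i
  fin_cases i <;> simp [e0, e1, e2, e3, e4] at this ⊢ <;> linarith

/-- At an internal corner the ratio is not `1`, so `a i = 0` forces `η i = 0`; the ratios being
nonzero, this goes back to `η 0 = 0`. -/
theorem vertex_of_corner_zero {ω p : ℝ} (hω : 0 ≤ ω) (hω1 : ω ≠ 1) {a : Fin 4 → ℝ}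
    {b : Fin 4 → Bool}
    (hext : ∀ i, b i = false → a i = 0) (hinteg : ∀ i, b i = true → CornerRel ω p a i)
    {i : Fin 4} (hi : b i = true) (ha : a i = 0) : ∑ i, a i = p := by
  obtain ⟨ρ, hρ, hρ1, η, h0, hs, hr⟩ := vertex_partial_sums hω hω1 hext hinteg
  have hne := fun i => cornerRatio_ne_zero hρ (b i) i
  have hi0 : η i = 0 := by
    have e1 := hs i
    rw [hr i, ha, add_zero, hi] at e1
    have : (cornerRatio ρ true i - 1) * η i = 0 := by rw [sub_mul, e1]; ring
    exact (mul_eq_zero.1 this).resolve_left (sub_ne_zero.2 (cornerRatio_ne_one hρ1 i))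
  have back : ∀ i : Fin 4, η (i + 1) = 0 → η i = 0 := fun i h => by
    rw [hr i] at h
    exact (mul_eq_zero.1 h).resolve_left (hne i)
  have e0 : η 0 = 0 := by
    fin_cases i
    · exact hi0
    · exact back 0 hi0
    · exact back 0 (back 1 hi0)
    · exact back 0 (back 1 (back 2 hi0))
  rw [h0] at e0
  linarith

/-- Going once around the vertex multiplies `η 0` by the product of the ratios. If `∑ a = 0` the
product would have to be `1` unless `η 0 = 0`, but for an odd number of internal corners it is `-ρ`
or `-ρ⁻¹`. If `p = 0` it would have to be `-1`, but for an even number it is positive. -/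
theorem vertex_of_parity {ω p : ℝ} (hω : 0 ≤ ω) (hω1 : ω ≠ 1) {a : Fin 4 → ℝ}
    {b : Fin 4 → Bool}
    (hext : ∀ i, b i = false → a i = 0) (hinteg : ∀ i, b i = true → CornerRel ω p a i)
    (h : (∑ i, a i = 0 ∧ Odd (∑ i, if b i = true then 1 else 0)) ∨
      (p = 0 ∧ Even (∑ i, if b i = true then 1 else 0))) : ∑ i, a i = p := by
  obtain ⟨ρ, hρ, hρ1, η, h0, hs, hr⟩ := vertex_partial_sums hω hω1 hext hinteg
  have e4 : η 4 = cornerRatio ρ (b 3) 3 * (cornerRatio ρ (b 2) 2 * (cornerRatio ρ (b 1) 1 *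
      (cornerRatio ρ (b 0) 0 * η 0))) := by
    have r0 := hr 0
    have r1 := hr 1
    have r2 := hr 2
    have r3 := hr 3
    simp only [Fin.val_zero, Fin.val_one, Fin.val_two, zero_add, one_add_one_eq_two] at r0 r1 r2 r3
    norm_num at r2 r3
    rw [r3, r2, r1, r0]
  have s4 : η 4 = η 0 + ∑ i, a i := by
    have r0 := hs 0
    have r1 := hs 1
    have r2 := hs 2
    have r3 := hs 3
    simp only [Fin.val_zero, Fin.val_one, Fin.val_two, zero_add, one_add_one_eq_two] at r0 r1 r2 r3
    norm_num at r2 r3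
    rw [Fin.sum_univ_four]
    linarith
  suffices hz : η 0 = 0 by rw [h0] at hz; linarith
  rw [e4] at s4
  have hρ2 : 0 < ρ ^ 2 := by positivity
  have hρ3 : 1 + ρ ≠ 0 := fun h => hρ1 (by linarith)
  rw [Fin.sum_univ_four (fun i => if b i = true then 1 else 0)] at h
  rcases h with ⟨hsum, hodd⟩ | ⟨hp, heven⟩
  · rw [hsum, add_zero] at s4
    have key1 : -ρ * η 0 = η 0 → η 0 = 0 := fun h => by
      have : (1 + ρ) * η 0 = 0 := by linarith
      exact (mul_eq_zero.1 this).resolve_left hρ3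
    have key2 : -ρ⁻¹ * η 0 = η 0 → η 0 = 0 := fun h => by
      have : (1 + ρ) * η 0 = 0 := by field_simp at h; linarith
      exact (mul_eq_zero.1 this).resolve_left hρ3
    cases h0 : b 0 <;> cases h1 : b 1 <;> cases h2 : b 2 <;> cases h3 : b 3 <;>
      simp [h0, h1, h2, h3, Nat.odd_iff] at hodd <;>
      simp [h0, h1, h2, h3, cornerRatio, hρ] at s4 <;>
      first
        | exact key1 (by simpa using s4)
        | exact key2 (by simpa using s4)
  · have hsum : ∑ i, a i = -2 * η 0 := by rw [h0, hp]; ring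
    rw [hsum] at s4
    have key0 : η 0 = η 0 + -2 * η 0 → η 0 = 0 := fun h => by linarith
    have key1 : ρ * (ρ * η 0) = η 0 + -2 * η 0 → η 0 = 0 := fun h => by
      have : (1 + ρ ^ 2) * η 0 = 0 := by linarith
      exact (mul_eq_zero.1 this).resolve_left (by positivity)
    have key2 : ρ⁻¹ * (ρ⁻¹ * η 0) = η 0 + -2 * η 0 → η 0 = 0 := fun h => by
      have : (1 + ρ⁻¹ ^ 2) * η 0 = 0 := by linarith
      exact (mul_eq_zero.1 this).resolve_left (by positivity)
    cases h0 : b 0 <;> cases h1 : b 1 <;> cases h2 : b 2 <;> cases h3 : b 3 <;>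
      simp [h0, h1, h2, h3, Nat.even_iff] at heven <;>
      simp [h0, h1, h2, h3, cornerRatio, hρ] at s4 <;>
      first
        | exact s4
        | exact key0 (by linarith)
        | exact key1 (by linarith)
        | exact key2 (by linarith)

end Kernel

/-! ### Propagation of the relations through a connected graph -/

section KernelGraph

variable {V E X : Type*} [Fintype V] [DecidableEq V] [Fintype E] [DecidableEq E] [Fintype X]

/-- Whether a corner is an end of an internal line. -/
def FeynmanGraph.isInternal (G : FeynmanGraph V E X) (c : V × Fin 4) : Bool :=
  (G.corner.symm c).isLeft

theorem FeynmanGraph.isInternal_inl (G : FeynmanGraph V E X) (h : E ⊕ E) :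
    G.isInternal (G.corner (Sum.inl h)) = true := by
  simp [FeynmanGraph.isInternal]

theorem FeynmanGraph.exists_of_isInternal (G : FeynmanGraph V E X) {c : V × Fin 4}
    (hc : G.isInternal c = true) : ∃ h, G.corner (Sum.inl h) = c := by
  rcases hh : G.corner.symm c with h | x
  · exact ⟨h, by rw [← hh, Equiv.apply_symm_apply]⟩
  · simp [FeynmanGraph.isInternal, hh] at hc

theorem FeynmanGraph.exists_of_not_isInternal (G : FeynmanGraph V E X) {c : V × Fin 4}
    (hc : G.isInternal c = false) : ∃ x, G.corner (Sum.inr x) = c := by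
  rcases hh : G.corner.symm c with h | x
  · simp [FeynmanGraph.isInternal, hh] at hc
  · exact ⟨x, by rw [← hh, Equiv.apply_symm_apply]⟩

theorem FeynmanGraph.even_sum_isInternal (G : FeynmanGraph V E X) :
    Even (∑ v, ∑ i, if G.isInternal (v, i) = true then 1 else 0) := by
  have h1 : ∑ v, ∑ i, (if G.isInternal (v, i) = true then 1 else 0) =
      ∑ c : V × Fin 4, if G.isInternal c = true then 1 else 0 :=
    (Fintype.sum_prod_type fun c => if G.isInternal c = true then 1 else 0).symm
  rw [h1, ← Equiv.sum_comp G.corner]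
  simp only [FeynmanGraph.isInternal, Equiv.symm_apply_apply]
  rw [Fintype.sum_sum_type]
  simp

/-- The form of a connected graph is nondegenerate: the relations at the corners, together with
equality of the positions of the two ends of each line, only have the trivial solution. -/
theorem FeynmanGraph.Connected.kernel_trivial {G : FeynmanGraph V E X} (hG : G.Connected)
    (root : V) {ω : ℝ} (hω : 0 ≤ ω) (hω1 : ω ≠ 1) {x : V × Fin 4 → ℝ} {p : V → ℝ}
    (hext : ∀ y, x (G.corner (Sum.inr y)) = 0) (hroot : p root = 0)
    (hline : ∀ e, x (G.lineStart e) = x (G.lineEnd e))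
    (hvert : ∀ v, v ≠ root → ∑ i : Fin 4, (-1 : ℝ) ^ (i : ℕ) * x (v, i) = 0)
    (hcor : ∀ v i, G.isInternal (v, i) = true →
      CornerRel ω (p v) (fun j => (-1) ^ (j : ℕ) * x (v, j)) i) :
    (∀ c, x c = 0) ∧ ∀ v, p v = 0 := by
  set a : V → Fin 4 → ℝ := fun v j => (-1) ^ (j : ℕ) * x (v, j) with ha
  have haz : ∀ v i, a v i = 0 ↔ x (v, i) = 0 := fun v i => by simp [ha]
  have hext' : ∀ v i, G.isInternal (v, i) = false → a v i = 0 := by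
    intro v i hi
    obtain ⟨y, hy⟩ := G.exists_of_not_isInternal hi
    rw [haz, ← hy, hext]
  -- `q v` says that the shift `η 0` of the partial sums vanishes at `v`. It is equivalent to the
  -- vanishing of a position at any internal corner of `v`, and so travels along lines, whose ends
  -- have equal positions.
  let q : V → Prop := fun v => ∑ i, a v i = p v
  have hzero : ∀ v, q v → ∀ i, x (v, i) = 0 := fun v hv i =>
    (haz v i).1 (vertex_zero hω hω1 (b := fun i => G.isInternal (v, i)) (hext' v) (hcor v) hv i)
  have hback : ∀ v i, G.isInternal (v, i) = true → x (v, i) = 0 → q v := fun v i hi hx =>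
    vertex_of_corner_zero hω hω1 (b := fun i => G.isInternal (v, i)) (hext' v) (hcor v) hi
      ((haz v i).2 hx)
  have hstep : ∀ e, q (G.lineStart e).1 ↔ q (G.lineEnd e).1 := by
    intro e
    constructor
    · intro h
      refine hback _ (G.lineEnd e).2 (G.isInternal_inl (Sum.inr e)) ?_
      rw [Prod.mk.eta, ← hline e]
      exact hzero _ h (G.lineStart e).2
    · intro h
      refine hback _ (G.lineStart e).2 (G.isInternal_inl (Sum.inl e)) ?_
      rw [Prod.mk.eta, hline e]
      exact hzero _ h (G.lineEnd e).2
  have hall : ∀ v w, q v → q w := by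
    intro v w hv
    obtain ⟨walk⟩ := hG.preconnected v w
    induction walk with
    | nil => exact hv
    | cons h _ ih =>
      refine ih ?_
      rw [SimpleGraph.fromRel_adj] at h
      rcases h.2 with ⟨e, h1, h2⟩ | ⟨e, h1, h2⟩
      · rw [← h2]; exact (hstep e).1 (by rw [h1]; exact hv)
      · rw [← h1]; exact (hstep e).2 (by rw [h2]; exact hv)
  -- A starting vertex exists by parity. The root has `p = 0`, which suffices if it has an even
  -- number of internal corners. Otherwise, the total being even, some other vertex has an odd
  -- number, and there the alternating sum of positions vanishes.
  have hex : ∃ v, q v := by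
    rcases Nat.even_or_odd (∑ i, if G.isInternal (root, i) = true then 1 else 0) with he | ho
    · exact ⟨root, vertex_of_parity hω hω1 (b := fun i => G.isInternal (root, i)) (hext' root)
        (hcor root) (Or.inr ⟨hroot, he⟩)⟩
    · by_contra hno
      push Not at hno
      have h1 : ∀ v, v ≠ root → Even (∑ i, if G.isInternal (v, i) = true then 1 else 0) := by
        intro v hv
        by_contra hodd
        rw [Nat.not_even_iff_odd] at hodd
        exact hno v (vertex_of_parity hω hω1 (b := fun i => G.isInternal (v, i)) (hext' v)
          (hcor v) (Or.inl ⟨hvert v hv, hodd⟩))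
      have h2 := G.even_sum_isInternal
      rw [← Finset.add_sum_erase _ _ (Finset.mem_univ root)] at h2
      have h3 : Even (∑ v ∈ Finset.univ.erase root,
          ∑ i, if G.isInternal (v, i) = true then 1 else 0) :=
        Finset.even_sum _ fun v hv => h1 v (Finset.ne_of_mem_erase hv)
      exact (Nat.not_even_iff_odd.2 ho) ((Nat.even_add.1 h2).2 h3)
  obtain ⟨v₀, hv₀⟩ := hex
  have hq : ∀ v, q v := fun v => hall v₀ v hv₀
  refine ⟨fun c => hzero c.1 (hq c.1) c.2, fun v => ?_⟩
  have := hq v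
  simp only [q] at this
  rw [← this]
  exact Finset.sum_eq_zero fun i _ => (haz v i).2 (hzero v (hq v) i)

end KernelGraph

/-! ### The parameter-independent antisymmetric part of the form -/

section ConstForm

variable {V E X : Type*} [Fintype V] [DecidableEq V] [Fintype E] [DecidableEq E] [Fintype X]

/-- The part of the form of a line that does not depend on the parameter. -/
def lineConst (M : Model) (Ω θ : ℝ) (G : FeynmanGraph V E X) (e : E) : Matrix (Var V) (Var V) ℝ :=
  match M with
  | Model.GW => 0
  | Model.LSZ => -(OmegaTilde Ω θ • wedgeForm (shortVar G e) (longVar G e))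

/-- The part of the total form that does not depend on the parameters. -/
def constForm (M : Model) (Ω θ : ℝ) (G : FeynmanGraph V E X) : Matrix (Var V) (Var V) ℝ :=
  ∑ e, lineConst M Ω θ G e + ∑ v, vertexForm θ v

theorem wedgeForm_transpose {I : Type*} (a b : I → ℝ) : (wedgeForm a b)ᵀ = -wedgeForm a b := by
  simp [wedgeForm, Matrix.transpose_sub, Matrix.transpose_vecMulVec, ← smul_neg]

theorem wedgeForm_mulVec {I : Type*} [Fintype I] (a b y : I → ℝ) :
    (wedgeForm a b).mulVec y = (1 / 2 : ℝ) • ((b ⬝ᵥ y) • a - (a ⬝ᵥ y) • b) := by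
  simp [wedgeForm, Matrix.smul_mulVec, Matrix.sub_mulVec, Matrix.vecMulVec_mulVec]

theorem constForm_transpose (M : Model) (Ω θ : ℝ) (G : FeynmanGraph V E X) :
    (constForm M Ω θ G)ᵀ = -constForm M Ω θ G := by
  have h1 : ∀ e, (lineConst M Ω θ G e)ᵀ = -lineConst M Ω θ G e := by
    intro e
    cases M <;> simp [lineConst, wedgeForm_transpose]
  have h2 : ∀ v : V, (vertexForm θ v)ᵀ = -vertexForm θ v := by
    intro v
    simp only [vertexForm, Matrix.transpose_neg, Matrix.transpose_add, wedgeForm_transpose,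
      Matrix.transpose_sum, neg_add, neg_neg, ← Finset.sum_neg_distrib]
    congr 1
    refine Finset.sum_congr rfl fun i _ => Finset.sum_congr rfl fun j _ => ?_
    split_ifs <;> simp [wedgeForm_transpose]
  simp only [constForm, Matrix.transpose_add, Matrix.transpose_sum, h1, h2,
    Finset.sum_neg_distrib, neg_add]

theorem posVar_dotProduct (c : V × Fin 4) (y : Var V → ℝ) : posVar c ⬝ᵥ y = y (Sum.inl c) := by
  simp [posVar]

theorem momVar_dotProduct (v : V) (y : Var V → ℝ) : momVar v ⬝ᵥ y = y (Sum.inr v) := by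
  simp [momVar]

theorem wedge_short_long (G : FeynmanGraph V E X) (e : E) :
    wedgeForm (shortVar G e) (longVar G e) =
      wedgeForm (posVar (G.lineStart e)) (posVar (G.lineEnd e)) := by
  ext i j
  have h2 : (Real.sqrt 2)⁻¹ * (Real.sqrt 2)⁻¹ = 1 / 2 := by
    rw [← mul_inv, Real.mul_self_sqrt (by norm_num)]; norm_num
  simp only [wedgeForm, Matrix.smul_apply, Matrix.sub_apply, Matrix.vecMulVec_apply, shortVar,
    longVar, Pi.smul_apply, Pi.sub_apply, Pi.add_apply, smul_eq_mul]
  linear_combination (posVar (G.lineStart e) i * posVar (G.lineEnd e) j -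
    posVar (G.lineEnd e) i * posVar (G.lineStart e) j) * h2

/-- The rows of the hypermomenta yield the vanishing alternating sums required at the vertices other
than the root. -/
theorem vertexForm_mulVec_mom (θ : ℝ) (w v : V) (y : Var V → ℝ) :
    (vertexForm θ w).mulVec y (Sum.inr v) = if w = v then
      -(1 / 2) * ∑ i : Fin 4, (-1 : ℝ) ^ (i : ℕ) * y (Sum.inl (v, i)) else 0 := by
  have hpos : ∀ c : V × Fin 4, posVar c (Sum.inr v) = 0 := fun c => by simp [posVar]
  have hmom : momVar w (Sum.inr v) = if w = v then (1 : ℝ) else 0 := by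
    simp [momVar, Pi.single_apply, eq_comm]
  simp only [vertexForm, Matrix.neg_mulVec, Matrix.add_mulVec, wedgeForm_mulVec,
    Matrix.sum_mulVec]
  have hz : ∀ i j : Fin 4, ((if i < j then (2 * (-1 : ℝ) ^ ((i : ℕ) + (j : ℕ) + 1) * (-θ⁻¹)) •
      wedgeForm (posVar (w, i)) (posVar (w, j)) else 0).mulVec y) (Sum.inr v) = 0 := by
    intro i j
    split_ifs
    · rw [Matrix.smul_mulVec, wedgeForm_mulVec]
      simp [hpos]
    · simp
  simp only [Pi.neg_apply, Pi.add_apply, Finset.sum_apply, hz, Finset.sum_const_zero, add_zero,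
    Pi.smul_apply, Pi.sub_apply, smul_eq_mul, hmom, hpos, mul_zero, sub_zero]
  by_cases hw : w = v
  · subst hw
    simp [sum_dotProduct, smul_dotProduct, posVar_dotProduct]
  · simp [hw]

/-- The rows of the positions yield, up to a sign and a scaling of the hypermomentum, the corner
relation without its `ω` term. -/
theorem vertexForm_mulVec_pos (θ : ℝ) (w v : V) (k : Fin 4) (y : Var V → ℝ) :
    (vertexForm θ w).mulVec y (Sum.inl (v, k)) = if w = v then (-1) ^ (k : ℕ) *
      (1 / 2 * y (Sum.inr v) - θ⁻¹ *
        (∑ j, (if k < j then (-1) ^ (j : ℕ) * y (Sum.inl (v, j)) else 0) -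
          ∑ j, (if j < k then (-1) ^ (j : ℕ) * y (Sum.inl (v, j)) else 0))) else 0 := by
  have hpos : ∀ i : Fin 4, posVar (w, i) (Sum.inl (v, k)) = if w = v ∧ i = k then (1 : ℝ) else 0 :=
    fun i => by
      simp only [posVar, Pi.single_apply, Sum.inl.injEq, Prod.mk.injEq]
      simp only [eq_comm]
  have hmom : momVar w (Sum.inl (v, k)) = (0 : ℝ) := by simp [momVar]
  simp only [vertexForm, Matrix.neg_mulVec, Matrix.add_mulVec, wedgeForm_mulVec,
    Matrix.sum_mulVec]
  have hz : ∀ i j : Fin 4, ((if i < j then (2 * (-1 : ℝ) ^ ((i : ℕ) + (j : ℕ) + 1) * (-θ⁻¹)) •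
      wedgeForm (posVar (w, i)) (posVar (w, j)) else 0).mulVec y) (Sum.inl (v, k)) =
      if i < j then (2 * (-1 : ℝ) ^ ((i : ℕ) + (j : ℕ) + 1) * (-θ⁻¹)) * (1 / 2 *
        (y (Sum.inl (w, j)) * (if w = v ∧ i = k then (1 : ℝ) else 0) -
          y (Sum.inl (w, i)) * (if w = v ∧ j = k then (1 : ℝ) else 0))) else 0 := by
    intro i j
    by_cases hij : i < j
    · rw [if_pos hij, if_pos hij, Matrix.smul_mulVec, wedgeForm_mulVec]
      simp only [Pi.smul_apply, Pi.sub_apply, smul_eq_mul, posVar_dotProduct, hpos]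
    · simp [hij]
  simp only [Pi.neg_apply, Pi.add_apply, Finset.sum_apply, hz,
    Pi.smul_apply, Pi.sub_apply, smul_eq_mul, hmom, hpos, mul_zero, zero_sub]
  by_cases hw : w = v
  · subst hw
    rw [momVar_dotProduct]
    fin_cases k <;> simp [Fin.sum_univ_four] <;> ring
  · simp [hw]

end ConstForm

/-! ### Nondegeneracy of the constant part on vanishing short variables -/

section ConstKernel

variable {V E X : Type*} [Fintype V] [DecidableEq V] [Fintype E] [DecidableEq E] [Fintype X]

/-- The strength of the oscillating part of the propagator. -/
def omegaEff (M : Model) (Ω : ℝ) : ℝ :=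
  match M with
  | Model.GW => 0
  | Model.LSZ => Ω

theorem sum_lineConst_mulVec_mom (M : Model) (Ω θ : ℝ) (G : FeynmanGraph V E X) (v : V)
    (y : Var V → ℝ) : ∑ e, (lineConst M Ω θ G e).mulVec y (Sum.inr v) = 0 := by
  refine Finset.sum_eq_zero fun e _ => ?_
  cases M
  · simp [lineConst]
  · simp only [lineConst, wedge_short_long, Matrix.neg_mulVec, Matrix.smul_mulVec,
      wedgeForm_mulVec]
    simp [posVar]

/-- When the two ends of a line coincide, its oscillating term acts as a multiple of the position,
with opposite signs at start and end. Orientability, starts being odd corners and ends even ones,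
makes these signs equal to `(-1) ^ c.2`, which is the `ω` term of the corner relation. -/
theorem sum_lineConst_mulVec_pos (M : Model) (Ω θ : ℝ) (G : FeynmanGraph V E X)
    (c : V × Fin 4) (hc : G.isInternal c = true) (y : Var V → ℝ)
    (hy : ∀ e, y (Sum.inl (G.lineStart e)) = y (Sum.inl (G.lineEnd e))) :
    ∑ e, (lineConst M Ω θ G e).mulVec y (Sum.inl c) =
      (-1) ^ (c.2 : ℕ) * (omegaEff M Ω * θ⁻¹ * y (Sum.inl c)) := by
  cases M
  · simp [lineConst, omegaEff]
  · have h1 : ∀ e, (lineConst Model.LSZ Ω θ G e).mulVec y (Sum.inl c) =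
        -(OmegaTilde Ω θ * (1 / 2 * (y (Sum.inl (G.lineEnd e)) *
          (if c = G.lineStart e then 1 else 0) - y (Sum.inl (G.lineStart e)) *
          (if c = G.lineEnd e then 1 else 0)))) := by
      intro e
      simp only [lineConst, wedge_short_long, Matrix.neg_mulVec, Matrix.smul_mulVec,
        wedgeForm_mulVec, posVar_dotProduct]
      simp [posVar, Pi.single_apply]
    simp only [h1, omegaEff, OmegaTilde]
    obtain ⟨h, rfl⟩ := G.exists_of_isInternal hc
    rcases h with e | e
    · have hs : (-1 : ℝ) ^ ((G.corner (Sum.inl (Sum.inl e))).2 : ℕ) = -1 :=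
        (G.start_odd e).neg_one_pow
      rw [Finset.sum_eq_single e, hs]
      · have := hy e
        simp only [FeynmanGraph.lineStart, FeynmanGraph.lineEnd] at this ⊢
        rw [← this]
        simp
        ring
      · intro e' _ he
        simp [FeynmanGraph.lineStart, FeynmanGraph.lineEnd, he.symm]
      · simp
    · have hs : (-1 : ℝ) ^ ((G.corner (Sum.inl (Sum.inr e))).2 : ℕ) = 1 :=
        (G.end_even e).neg_one_pow
      rw [Finset.sum_eq_single e, hs]
      · have := hy e
        simp only [FeynmanGraph.lineStart, FeynmanGraph.lineEnd] at this ⊢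
        rw [this]
        simp
        ring
      · intro e' _ he
        simp [FeynmanGraph.lineStart, FeynmanGraph.lineEnd, he.symm]
      · simp

theorem constForm_kernel {G : FeynmanGraph V E X} (hG : G.Connected) {M : Model} {Ω θ : ℝ}
    (hΩ : 0 < Ω) (hθ : 0 < θ) (hM : M = Model.LSZ → Ω ≠ 1) (root : V) {y : Var V → ℝ}
    (hext : ∀ x, y (extIncl G root x) = 0)
    (hline : ∀ e, y (Sum.inl (G.lineStart e)) = y (Sum.inl (G.lineEnd e)))
    (hker : ∀ i, (constForm M Ω θ G).mulVec y (intIncl G root i) = 0) : y = 0 := by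
  have hω : 0 ≤ omegaEff M Ω := by cases M <;> simp [omegaEff, hΩ.le]
  have hω1 : omegaEff M Ω ≠ 1 := by
    cases M
    · simp [omegaEff]
    · exact hM rfl
  have hsplit : ∀ c, (constForm M Ω θ G).mulVec y c =
      ∑ e, (lineConst M Ω θ G e).mulVec y c + ∑ v, (vertexForm θ v).mulVec y c := by
    intro c
    simp only [constForm, Matrix.add_mulVec, Matrix.sum_mulVec, Pi.add_apply, Finset.sum_apply]
  -- Hypermomenta enter the position rows with coefficient `1 / 2` and positions with `θ⁻¹`, hence
  -- the rescaling by `θ / 2`.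
  have h := hG.kernel_trivial root hω hω1 (x := fun c => y (Sum.inl c))
    (p := fun v => θ / 2 * y (Sum.inr v)) (fun x => hext (Sum.inl x))
    (by have := hext (Sum.inr ()); simp only [extIncl, Sum.map_inr] at this; rw [this, mul_zero])
    hline ?_ ?_
  · funext c
    rcases c with c | v
    · exact h.1 c
    · have := h.2 v
      simpa [hθ.ne'] using this
  · intro v hv
    have := hker (Sum.inr ⟨v, hv⟩)
    simp only [intIncl, Sum.map_inr, hsplit, sum_lineConst_mulVec_mom, vertexForm_mulVec_mom] at this
    simp at this
    simpa using this
  · intro v k hk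
    obtain ⟨h, hh⟩ := G.exists_of_isInternal hk
    have h1 := hker (Sum.inl h)
    simp only [intIncl, Sum.map_inl, hh, hsplit,
      sum_lineConst_mulVec_pos M Ω θ G (v, k) hk y hline, vertexForm_mulVec_pos,
      Finset.sum_ite_eq', Finset.mem_univ, if_true] at h1
    rw [← mul_add] at h1
    have h2 := (mul_eq_zero.1 h1).resolve_left (pow_ne_zero _ (by norm_num))
    have h3 : (-1 : ℝ) ^ (k : ℕ) * (-1) ^ (k : ℕ) = 1 := by
      rw [← mul_pow]; simp
    unfold CornerRel
    beta_reduce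
    rw [mul_assoc (omegaEff M Ω), ← mul_assoc ((-1 : ℝ) ^ (k : ℕ)), h3, one_mul]
    field_simp at h2
    linarith

end ConstKernel

/-! ### Orthogonal change to short and long variables -/

section Rotation

variable {E W : Type*} [Fintype E] [DecidableEq E] [Fintype W] [DecidableEq W]

/-- The rotation to the short and long variables. -/
def rotMat (E W : Type*) [DecidableEq E] [DecidableEq W] :
    Matrix ((E ⊕ E) ⊕ W) ((E ⊕ E) ⊕ W) ℝ :=
  Matrix.fromBlocks (Matrix.fromBlocks ((Real.sqrt 2)⁻¹ • 1) (-((Real.sqrt 2)⁻¹ • 1))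
    ((Real.sqrt 2)⁻¹ • 1) ((Real.sqrt 2)⁻¹ • 1)) 0 0 1

theorem rotMat_mul_transpose : rotMat E W * (rotMat E W)ᵀ = 1 := by
  have h2 : (Real.sqrt 2)⁻¹ * (Real.sqrt 2)⁻¹ = 1 / 2 := by
    rw [← mul_inv, Real.mul_self_sqrt (by norm_num)]; norm_num
  have h3 : ((Real.sqrt 2)⁻¹ * (Real.sqrt 2)⁻¹) • (1 : Matrix E E ℝ) +
      ((Real.sqrt 2)⁻¹ * (Real.sqrt 2)⁻¹) • (1 : Matrix E E ℝ) = 1 := by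
    rw [h2, ← add_smul]; norm_num
  simp only [rotMat, Matrix.fromBlocks_transpose, Matrix.fromBlocks_multiply]
  simp [smul_smul, h3]

theorem rotMat_transpose_mul : (rotMat E W)ᵀ * rotMat E W = 1 :=
  mul_eq_one_comm.1 rotMat_mul_transpose

theorem det_conj_rotMat (A : Matrix ((E ⊕ E) ⊕ W) ((E ⊕ E) ⊕ W) ℝ) :
    (rotMat E W * A * (rotMat E W)ᵀ).det = A.det := by
  rw [Matrix.det_mul, Matrix.det_mul, mul_comm, ← mul_assoc, ← Matrix.det_mul,
    rotMat_transpose_mul, Matrix.det_one, one_mul]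

theorem inv_conj_rotMat (A : Matrix ((E ⊕ E) ⊕ W) ((E ⊕ E) ⊕ W) ℝ) :
    (rotMat E W * A * (rotMat E W)ᵀ)⁻¹ = rotMat E W * A⁻¹ * (rotMat E W)ᵀ := by
  rw [Matrix.mul_inv_rev, Matrix.mul_inv_rev, Matrix.inv_eq_left_inv rotMat_mul_transpose,
    Matrix.inv_eq_left_inv rotMat_transpose_mul, Matrix.mul_assoc]

theorem conj_rotMat_apply_inr (A : Matrix ((E ⊕ E) ⊕ W) ((E ⊕ E) ⊕ W) ℝ) (x y : W) :
    (rotMat E W * A * (rotMat E W)ᵀ) (Sum.inr x) (Sum.inr y) = A (Sum.inr x) (Sum.inr y) := by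
  rw [Matrix.mul_apply]
  simp only [Matrix.mul_apply, Matrix.transpose_apply, Fintype.sum_sum_type, rotMat,
    Matrix.fromBlocks_apply₂₁, Matrix.fromBlocks_apply₂₂, Matrix.zero_apply, Matrix.one_apply]
  simp

theorem accretive_conj_rotMat {A : Matrix ((E ⊕ E) ⊕ W) ((E ⊕ E) ⊕ W) ℝ}
    (h : Accretive (rotMat E W * A * (rotMat E W)ᵀ)) : Accretive A := by
  intro x
  have h1 := h ((rotMat E W).mulVec x)
  rw [Matrix.mulVec_mulVec, Matrix.mul_assoc, rotMat_transpose_mul, Matrix.mul_one,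
    ← Matrix.mulVec_mulVec, Matrix.dotProduct_mulVec, Matrix.vecMul_mulVec,
    rotMat_transpose_mul, Matrix.vecMul_one] at h1
  exact h1

theorem rotMat_mulVec_row (i : (E ⊕ E) ⊕ W) :
    (rotMat E W).mulVec (rotMat E W i) = Pi.single i 1 := by
  funext j
  have := congrFun (congrFun (rotMat_mul_transpose (E := E) (W := W)) j) i
  rw [Matrix.mul_apply] at this
  simp only [Matrix.mulVec, dotProduct, Matrix.transpose_apply] at this ⊢
  rw [this, Matrix.one_apply, Pi.single_apply]

theorem conj_vecMulVec {n : Type*} [Fintype n] (R : Matrix n n ℝ) (a b : n → ℝ) :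
    R * Matrix.vecMulVec a b * Rᵀ = Matrix.vecMulVec (R.mulVec a) (R.mulVec b) := by
  rw [Matrix.mul_vecMulVec, Matrix.vecMulVec_mul, Matrix.vecMul_transpose]

theorem dotProduct_mulVec_of_antisymm {n : Type*} [Fintype n] {K : Matrix n n ℝ} (h : Kᵀ = -K)
    (x : n → ℝ) : x ⬝ᵥ K.mulVec x = 0 := by
  have h1 : x ⬝ᵥ K.mulVec x = x ⬝ᵥ Kᵀ.mulVec x := by
    rw [Matrix.mulVec_transpose, dotProduct_comm x (Matrix.vecMul x K), Matrix.dotProduct_mulVec]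
  rw [h, Matrix.neg_mulVec, dotProduct_neg] at h1
  linarith

theorem antisymm_conj {n : Type*} [Fintype n] {K : Matrix n n ℝ} (h : Kᵀ = -K)
    (R : Matrix n n ℝ) : (R * K * Rᵀ)ᵀ = -(R * K * Rᵀ) := by
  rw [Matrix.transpose_mul, Matrix.transpose_mul, Matrix.transpose_transpose, h, Matrix.neg_mul,
    Matrix.mul_neg, Matrix.mul_assoc]

end Rotation

/-! ### From the graph to polynomials with nonnegative coefficients -/

section Interface

/-- The dependence of the propagators on their parameters. -/
def profileOf (M : Model) {c : ℝ} (hc : 0 < c) : Profile :=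
  match M with
  | Model.GW =>
    { α := fun t => c * (1 / t)
      β := fun t => c * t
      τ := fun b b' => if b = true then (if b' = true then ![0, c ^ 2, 0] else ![c, 0, 0])
        else if b' = true then ![0, 0, c] else ![0, 1, 0]
      lower := c
      τ_nonneg := by
        intro b b' r
        cases b <;> cases b' <;> fin_cases r <;> simp <;> positivity
      eq := by
        intro b b' t ht
        cases b <;> cases b' <;> simp [Fin.sum_univ_three] <;> field_simp
      lower_pos := hc
      lower_le := fun t h0 h1 => le_mul_of_one_le_right hc.le (by
        rw [le_div_iff₀ h0]; linarith)
      β_nonneg := fun t h0 _ => (mul_pos hc h0).le }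
  | Model.LSZ =>
    { α := fun t => c * ((1 + t ^ 2) / (2 * t))
      β := fun _ => 0
      τ := fun b b' => if b' = true then 0
        else if b = true then ![c / 2, 0, c / 2] else ![0, 1, 0]
      lower := c
      τ_nonneg := by
        intro b b' r
        cases b <;> cases b' <;> fin_cases r <;> simp <;> positivity
      eq := by
        intro b b' t ht
        cases b <;> cases b' <;> simp [Fin.sum_univ_three] <;> field_simp
      lower_pos := hc
      lower_le := fun t h0 _ => le_mul_of_one_le_right hc.le (by
        rw [le_div_iff₀ (by positivity)]; nlinarith [sq_nonneg (t - 1)])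
      β_nonneg := fun t _ _ => le_rfl }

variable {V E X : Type*} [Fintype V] [DecidableEq V] [Fintype E] [DecidableEq E] [Fintype X]
  {W : Type*} [Fintype W] [DecidableEq W]

theorem omegaTilde_half_pos {Ω θ : ℝ} (hΩ : 0 < Ω) (hθ : 0 < θ) : 0 < OmegaTilde Ω θ / 2 := by
  unfold OmegaTilde
  positivity

theorem lineForm_eq (M : Model) {Ω θ : ℝ} (hc : 0 < OmegaTilde Ω θ / 2) (G : FeynmanGraph V E X)
    (e : E) (t : ℝ) :
    lineForm M Ω θ G e t = (profileOf M hc).α t • sqForm (shortVar G e) +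
      (profileOf M hc).β t • sqForm (longVar G e) + lineConst M Ω θ G e := by
  cases M <;> simp [lineForm, profileOf, lineConst, sub_eq_add_neg]

/-- The embedding is left general because it is used twice, for the integrated variables and for all
variables; it only matters that the remaining indices are not ends of lines. -/
theorem shortVar_comp (G : FeynmanGraph V E X) {ι : (E ⊕ E) ⊕ W → Var V}
    (h1 : ∀ h, ι (Sum.inl h) = Sum.inl (G.corner (Sum.inl h)))
    (h2 : ∀ w h, ι (Sum.inr w) ≠ Sum.inl (G.corner (Sum.inl h))) (e : E) :
    shortVar G e ∘ ι = rotMat E W (Sum.inl (Sum.inl e)) := by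
  funext i
  rcases i with (e' | e') | w
  · simp [shortVar, posVar, Pi.single_apply, h1, rotMat, FeynmanGraph.lineStart,
      FeynmanGraph.lineEnd, Matrix.one_apply, eq_comm]
  · simp [shortVar, posVar, Pi.single_apply, h1, rotMat, FeynmanGraph.lineStart,
      FeynmanGraph.lineEnd, Matrix.one_apply, eq_comm]
  · simp [shortVar, posVar, h2, rotMat, FeynmanGraph.lineStart,
      FeynmanGraph.lineEnd]

theorem longVar_comp (G : FeynmanGraph V E X) {ι : (E ⊕ E) ⊕ W → Var V}
    (h1 : ∀ h, ι (Sum.inl h) = Sum.inl (G.corner (Sum.inl h)))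
    (h2 : ∀ w h, ι (Sum.inr w) ≠ Sum.inl (G.corner (Sum.inl h))) (e : E) :
    longVar G e ∘ ι = rotMat E W (Sum.inl (Sum.inr e)) := by
  funext i
  rcases i with (e' | e') | w
  · simp [longVar, posVar, Pi.single_apply, h1, rotMat, FeynmanGraph.lineStart,
      FeynmanGraph.lineEnd, Matrix.one_apply, eq_comm]
  · simp [longVar, posVar, Pi.single_apply, h1, rotMat, FeynmanGraph.lineStart,
      FeynmanGraph.lineEnd, Matrix.one_apply, eq_comm]
  · simp [longVar, posVar, h2, rotMat, FeynmanGraph.lineStart,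
      FeynmanGraph.lineEnd]

theorem diagonal_lineWeights (P : Profile) (t : E → ℝ) :
    Matrix.diagonal (lineWeights P t : (E ⊕ E) ⊕ W → ℝ) = ∑ e,
      (P.α (t e) • Matrix.vecMulVec (Pi.single (Sum.inl (Sum.inl e)) 1)
          (Pi.single (Sum.inl (Sum.inl e)) 1) +
        P.β (t e) • Matrix.vecMulVec (Pi.single (Sum.inl (Sum.inr e)) 1)
          (Pi.single (Sum.inl (Sum.inr e)) 1)) := by
  ext i j
  rw [Matrix.sum_apply]
  rcases i with (e | e) | w <;> rcases j with (e' | e') | w' <;>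
    simp [Matrix.diagonal_apply, lineWeights, Matrix.vecMulVec_apply, Pi.single_apply] <;>
    grind

/-- In the short and long variables the lines give a diagonal form. -/
theorem conj_totalForm (M : Model) {Ω θ : ℝ} (hc : 0 < OmegaTilde Ω θ / 2)
    (G : FeynmanGraph V E X) {ι : (E ⊕ E) ⊕ W → Var V}
    (h1 : ∀ h, ι (Sum.inl h) = Sum.inl (G.corner (Sum.inl h)))
    (h2 : ∀ w h, ι (Sum.inr w) ≠ Sum.inl (G.corner (Sum.inl h))) (t : E → ℝ) :
    rotMat E W * (totalForm M Ω θ G t).submatrix ι ι * (rotMat E W)ᵀ =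
      Matrix.diagonal (lineWeights (profileOf M hc) t) +
        rotMat E W * (constForm M Ω θ G).submatrix ι ι * (rotMat E W)ᵀ := by
  have e : (totalForm M Ω θ G t).submatrix ι ι =
      ∑ e, ((profileOf M hc).α (t e) • Matrix.vecMulVec (rotMat E W (Sum.inl (Sum.inl e)))
          (rotMat E W (Sum.inl (Sum.inl e))) +
        (profileOf M hc).β (t e) • Matrix.vecMulVec (rotMat E W (Sum.inl (Sum.inr e)))
          (rotMat E W (Sum.inl (Sum.inr e)))) + (constForm M Ω θ G).submatrix ι ι := by
    simp only [← shortVar_comp G h1 h2, ← longVar_comp G h1 h2]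
    ext i j
    simp only [totalForm, constForm, lineForm_eq M hc, Matrix.submatrix_apply, Matrix.add_apply,
      Matrix.sum_apply, Finset.sum_add_distrib, Matrix.smul_apply, sqForm, Matrix.vecMulVec_apply,
      Function.comp_apply]
    ring
  rw [e, mul_add, add_mul, Finset.mul_sum, Finset.sum_mul, diagonal_lineWeights]
  congr 1
  refine Finset.sum_congr rfl fun e _ => ?_
  rw [mul_add, add_mul, Matrix.mul_smul, Matrix.mul_smul, Matrix.smul_mul, Matrix.smul_mul,
    conj_vecMulVec, conj_vecMulVec, rotMat_mulVec_row, rotMat_mulVec_row]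

theorem conj_constForm_antisymm (M : Model) (Ω θ : ℝ) (G : FeynmanGraph V E X)
    (ι : (E ⊕ E) ⊕ W → Var V) (v : (E ⊕ E) ⊕ W → ℝ) :
    v ⬝ᵥ (rotMat E W * (constForm M Ω θ G).submatrix ι ι * (rotMat E W)ᵀ).mulVec v = 0 := by
  refine dotProduct_mulVec_of_antisymm (antisymm_conj ?_ _) v
  rw [Matrix.transpose_submatrix, constForm_transpose]
  rfl

theorem lineWeights_nonneg (P : Profile) {t : E → ℝ} (ht : t ∈ paramDomain E) (i : (E ⊕ E) ⊕ W) :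
    0 ≤ lineWeights P t i := by
  rw [mem_paramDomain] at ht
  rcases i with (e | e) | w
  · exact P.lower_pos.le.trans (P.lower_le _ (ht e).1 (ht e).2)
  · exact P.β_nonneg _ (ht e).1 (ht e).2
  · exact le_rfl

theorem intIncl_injective (G : FeynmanGraph V E X) (root : V) :
    Function.Injective (intIncl G root) := by
  rintro (a | a) (b | b) h <;> simp [intIncl] at h ⊢
  · exact h
  · exact Subtype.ext h

theorem intIncl_ne_extIncl (G : FeynmanGraph V E X) (root : V) (i : IntVar E root) (x : ExtVar X) :
    intIncl G root i ≠ extIncl G root x := by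
  rcases i with i | i <;> rcases x with x | x <;> simp [intIncl, extIncl]
  exact i.2

/-- Even with the long weights dropped the form is nondegenerate. Antisymmetry of the constant part
makes the short variables of a kernel vector vanish; extended by zero to the external variables, the
vector then satisfies all the relations of `constForm_kernel`. -/
theorem det_conj_constForm_pos {G : FeynmanGraph V E X} (hG : G.Connected) {M : Model} {Ω θ : ℝ}
    (hΩ : 0 < Ω) (hθ : 0 < θ) (hM : M = Model.LSZ → Ω ≠ 1) (root : V) {c : ℝ} (hc : 0 < c) :
    0 < (Matrix.diagonal (Sum.elim (Sum.elim (fun _ : E => c) 0) 0) +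
      rotMat E {v : V // v ≠ root} *
        (constForm M Ω θ G).submatrix (intIncl G root) (intIncl G root) *
        (rotMat E {v : V // v ≠ root})ᵀ).det := by
  set K := (constForm M Ω θ G).submatrix (intIncl G root) (intIncl G root) with hK
  set r := rotMat E {v : V // v ≠ root} with hr
  have hanti : ∀ v, v ⬝ᵥ (r * K * rᵀ).mulVec v = 0 :=
    conj_constForm_antisymm M Ω θ G (intIncl G root)
  have hacc : Accretive (Matrix.diagonal (Sum.elim (Sum.elim (fun _ : E => c) 0) 0) +
      r * K * rᵀ) := by
    refine Accretive.diagonal_add (fun v => (hanti v).ge) ?_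
    rintro ((e | e) | w)
    · exact hc.le
    · exact le_rfl
    · exact le_rfl
  refine lt_of_le_of_ne hacc.det_nonneg fun h0 => ?_
  obtain ⟨v, hv0, hv⟩ := Matrix.exists_mulVec_eq_zero_iff.2 h0.symm
  refine hv0 ?_
  have hq : v ⬝ᵥ (Matrix.diagonal (Sum.elim (Sum.elim (fun _ : E => c) 0) 0) +
      r * K * rᵀ).mulVec v = ∑ e, c * v (Sum.inl (Sum.inl e)) ^ 2 := by
    rw [Matrix.add_mulVec, dotProduct_add, hanti, add_zero]
    simp only [dotProduct, Matrix.mulVec_diagonal, Fintype.sum_sum_type, Sum.elim_inl,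
      Sum.elim_inr, Pi.zero_apply, zero_mul, mul_zero, Finset.sum_const_zero, add_zero]
    exact Finset.sum_congr rfl fun e _ => by ring
  rw [hv, dotProduct_zero] at hq
  have hu : ∀ e, v (Sum.inl (Sum.inl e)) = 0 := fun e => by
    have := (Finset.sum_eq_zero_iff_of_nonneg (fun e _ => by positivity)).1 hq.symm e
      (Finset.mem_univ e)
    simpa [hc.ne'] using this
  have hd : (Matrix.diagonal (Sum.elim (Sum.elim (fun _ : E => c) 0) 0) :
      Matrix (IntVar E root) (IntVar E root) ℝ).mulVec v = 0 := by
    funext i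
    rcases i with (e | e) | w <;> simp [Matrix.mulVec_diagonal, hu]
  rw [Matrix.add_mulVec, hd, zero_add, ← Matrix.mulVec_mulVec] at hv
  set z := rᵀ.mulVec v with hz
  have hvz : v = r.mulVec z := by
    rw [hz, Matrix.mulVec_mulVec, rotMat_mul_transpose, Matrix.one_mulVec]
  have hKz : K.mulVec z = 0 := by
    have := congrArg rᵀ.mulVec hv
    rwa [← Matrix.mulVec_mulVec, Matrix.mulVec_mulVec, rotMat_transpose_mul, Matrix.one_mulVec,
      Matrix.mulVec_zero] at this
  have hinj := intIncl_injective G root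
  set y : Var V → ℝ := Function.extend (intIncl G root) z 0 with hy
  have hyi : ∀ i, y (intIncl G root i) = z i := fun i => hinj.extend_apply _ _ _
  have hye : ∀ c, (∀ i, intIncl G root i ≠ c) → y c = 0 := fun c h =>
    Function.extend_apply' _ _ _ (by rintro ⟨i, hi⟩; exact h i hi)
  have hy0 : y = 0 := by
    refine constForm_kernel hG hΩ hθ hM root
      (fun x => hye _ fun i => intIncl_ne_extIncl G root i x) (fun e => ?_) (fun i => ?_)
    · have h1 := hu e
      rw [hvz] at h1
      have h2 := hyi (Sum.inl (Sum.inl e))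
      have h3 := hyi (Sum.inl (Sum.inr e))
      simp only [intIncl, Sum.map_inl] at h2 h3
      rw [FeynmanGraph.lineStart, FeynmanGraph.lineEnd, h2, h3]
      simp only [hr, rotMat, Matrix.mulVec, dotProduct, Fintype.sum_sum_type, Matrix.fromBlocks_apply₁₁,
        Matrix.fromBlocks_apply₁₂, Matrix.smul_apply, Matrix.neg_apply, Matrix.one_apply,
        Matrix.zero_apply] at h1
      simp at h1
      rw [← sub_eq_add_neg, ← mul_sub] at h1
      simpa [sub_eq_zero] using h1
    · have h1 := congrFun hKz i
      rw [Pi.zero_apply] at h1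
      rw [← h1]
      simp only [Matrix.mulVec, dotProduct, hK, Matrix.submatrix_apply, ← hyi]
      symm
      refine Finset.sum_of_injOn (intIncl G root) hinj.injOn (by simp) ?_ (by simp)
      intro j _ hj
      rw [hye j, mul_zero]
      intro i hi
      exact hj (by simp [← hi])
  have hz0 : z = 0 := by
    funext i
    rw [← hyi, hy0]
    rfl
  rw [hvz, hz0, Matrix.mulVec_zero]

variable [DecidableEq X]

/-- All variables, with the ends of lines first. -/
def allIncl (G : FeynmanGraph V E X) (root : V) :
    (E ⊕ E) ⊕ ({v : V // v ≠ root} ⊕ ExtVar X) → Var V :=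
  Sum.elim (fun h => Sum.inl (G.corner (Sum.inl h)))
    (Sum.elim (fun v => Sum.inr v) (extIncl G root))

/-- The unit form of the external variables. -/
def extUnit (E W Y : Type*) [DecidableEq E] [DecidableEq W] [DecidableEq Y] :
    Matrix ((E ⊕ E) ⊕ (W ⊕ Y)) ((E ⊕ E) ⊕ (W ⊕ Y)) ℝ :=
  Matrix.diagonal (Sum.elim 0 (Sum.elim 0 1))

theorem conj_extUnit (W Y : Type*) [Fintype W] [DecidableEq W] [Fintype Y] [DecidableEq Y] :
    rotMat E (W ⊕ Y) * extUnit E W Y * (rotMat E (W ⊕ Y))ᵀ = extUnit E W Y := by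
  have e : extUnit E W Y = Matrix.fromBlocks 0 0 0 (Matrix.diagonal (Sum.elim 0 1)) := by
    rw [extUnit, ← Matrix.fromBlocks_diagonal]
    simp
  rw [e, rotMat, Matrix.fromBlocks_transpose, Matrix.fromBlocks_multiply,
    Matrix.fromBlocks_multiply]
  simp

theorem extUnit_dotProduct {W Y : Type*} [Fintype W] [DecidableEq W] [Fintype Y] [DecidableEq Y]
    (v : (E ⊕ E) ⊕ (W ⊕ Y) → ℝ) :
    v ⬝ᵥ (extUnit E W Y).mulVec v = ∑ y, v (Sum.inr (Sum.inr y)) ^ 2 := by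
  simp [extUnit, dotProduct, Matrix.mulVec_diagonal, Fintype.sum_sum_type, sq]

theorem sq_add_sq_le_two_sum {Y : Type*} [Fintype Y] (v : Y → ℝ) (x y : Y) :
    v x ^ 2 + v y ^ 2 ≤ 2 * ∑ z, v z ^ 2 := by
  have h : ∀ x, v x ^ 2 ≤ ∑ z, v z ^ 2 := fun x =>
    Finset.single_le_sum (f := fun z => v z ^ 2) (fun z _ => sq_nonneg _) (Finset.mem_univ x)
  linarith [h x, h y]

/-- Conjugated by the rotation, `Q` is the diagonal of line weights plus a constant antisymmetric
matrix. The full form plus the external unit form is the same diagonal plus an accretive constant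
matrix. The coefficient theorems for determinants and adjugates apply to both, and Schur's formula
translates the second into statements about `1 + extForm`. -/
theorem exists_boxPoly_representation {G : FeynmanGraph V E X} (hG : G.Connected) {M : Model}
    {Ω θ : ℝ} (hΩ : 0 < Ω) (hθ : 0 < θ) (hM : M = Model.LSZ → Ω ≠ 1) (root : V) :
    ∃ (κ : ℝ) (c d : (E → Fin 3) → ℝ) (n : ExtVar X → ExtVar X → (E → Fin 3) → ℝ),
      0 < κ ∧ (∀ a, 0 ≤ c a) ∧ (∀ a, 0 ≤ d a) ∧ (∀ x y a, |n x y a| ≤ 2 * d a) ∧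
      ∀ t ∈ paramDomain E, HU M Ω θ G root t = boxPoly c t ∧
        κ * ∏ e, t e ≤ HU M Ω θ G root t ∧
        HU M Ω θ G root t * (1 + extForm M Ω θ G root t).det = boxPoly d t ∧
        (∀ x y, ((1 + extForm M Ω θ G root t)⁻¹ : Matrix (ExtVar X) (ExtVar X) ℝ) x y *
          boxPoly d t = boxPoly (n x y) t) ∧
        Accretive (extForm M Ω θ G root t) := by
  have hc := omegaTilde_half_pos hΩ hθ
  set P := profileOf M hc with hP
  set W := {v : V // v ≠ root}
  set B := rotMat E W * (constForm M Ω θ G).submatrix (intIncl G root) (intIncl G root) *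
    (rotMat E W)ᵀ with hB
  set C := rotMat E (W ⊕ ExtVar X) *
    (constForm M Ω θ G).submatrix (allIncl G root) (allIncl G root) *
    (rotMat E (W ⊕ ExtVar X))ᵀ with hC
  have hB0 : ∀ v, v ⬝ᵥ B.mulVec v = 0 := conj_constForm_antisymm M Ω θ G (intIncl G root)
  have hC0 : ∀ v, v ⬝ᵥ C.mulVec v = 0 := conj_constForm_antisymm M Ω θ G (allIncl G root)
  have hBacc : Accretive B := fun v => (hB0 v).ge
  have hCacc : Accretive C := fun v => (hC0 v).ge
  have hCU : ∀ v, v ⬝ᵥ (C + extUnit E W (ExtVar X)).mulVec v =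
      ∑ y, v (Sum.inr (Sum.inr y)) ^ 2 := fun v => by
    rw [Matrix.add_mulVec, dotProduct_add, hC0, zero_add, extUnit_dotProduct]
  have hCUacc : Accretive (C + extUnit E W (ExtVar X)) := fun v => by
    rw [hCU]; positivity
  -- `κ` is the determinant with short weights lowered to their bound `P.lower` and long weights set
  -- to zero; monotonicity in the diagonal weights puts it below `det Q` on the whole open cube.
  refine ⟨(Matrix.diagonal (Sum.elim (Sum.elim (fun _ : E => P.lower) 0) 0) + B).det,
    detCoeff P B, detCoeff P (C + extUnit E W (ExtVar X)),
    fun x y => adjCoeff P (C + extUnit E W (ExtVar X)) (Sum.inr x) (Sum.inr y),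
    det_conj_constForm_pos hG hΩ hθ hM root P.lower_pos, detCoeff_nonneg P hBacc,
    detCoeff_nonneg P hCUacc, fun x y => abs_adjCoeff_le P (fun v => ?_), fun t ht => ?_⟩
  · rw [hCU]
    exact sq_add_sq_le_two_sum (fun z => v (Sum.inr (Sum.inr z))) x y
  have ht' := mem_paramDomain.1 ht
  have ht0 : ∀ e, t e ≠ 0 := fun e => (ht' e).1.ne'
  have hprod : 0 < ∏ e, t e := Finset.prod_pos fun e _ => (ht' e).1
  have hQ : (Q M Ω θ G root t).det = (Matrix.diagonal (lineWeights P t) + B).det := by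
    rw [hB, hP, ← conj_totalForm M hc G (ι := intIncl G root) (fun h => rfl)
      (fun w h => by simp [intIncl]) t, det_conj_rotMat, Q]
  have hκ : (Matrix.diagonal (Sum.elim (Sum.elim (fun _ : E => P.lower) 0) 0) + B).det ≤
      (Q M Ω θ G root t).det := by
    rw [hQ]
    refine hBacc.det_mono ?_ ?_
    · rintro ((e | e) | w)
      · exact P.lower_pos.le
      · exact le_rfl
      · exact le_rfl
    · rintro ((e | e) | w)
      · exact P.lower_le _ (ht' e).1 (ht' e).2
      · exact P.β_nonneg _ (ht' e).1 (ht' e).2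
      · exact le_rfl
  have hQpos : 0 < (Q M Ω θ G root t).det :=
    (det_conj_constForm_pos hG hΩ hθ hM root P.lower_pos).trans_le hκ
  have hall2 : ∀ w h, allIncl G root (Sum.inr w) ≠ Sum.inl (G.corner (Sum.inl h)) := by
    rintro (w | (w | w)) h <;> simp [allIncl, extIncl]
  have hfullC := conj_totalForm M hc G (ι := allIncl G root) (fun h => rfl) hall2 t
  rw [← hP, ← hC] at hfullC
  have hfull : Matrix.fromBlocks (Q M Ω θ G root t)
      ((totalForm M Ω θ G t).submatrix (intIncl G root) (extIncl G root))
      ((totalForm M Ω θ G t).submatrix (extIncl G root) (intIncl G root))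
      ((totalForm M Ω θ G t).submatrix (extIncl G root) (extIncl G root)) =
      ((totalForm M Ω θ G t).submatrix (allIncl G root) (allIncl G root)).submatrix
        (Equiv.sumAssoc (E ⊕ E) W (ExtVar X)) (Equiv.sumAssoc (E ⊕ E) W (ExtVar X)) := by
    ext i j
    rcases i with (i | i) | i <;> rcases j with (j | j) | j <;> rfl
  have hone : extOne (IntVar E root) (ExtVar X) = (extUnit E W (ExtVar X)).submatrix
        (Equiv.sumAssoc (E ⊕ E) W (ExtVar X)) (Equiv.sumAssoc (E ⊕ E) W (ExtVar X)) := by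
    ext i j
    rcases i with (i | i) | i <;> rcases j with (j | j) | j <;>
      simp [extOne, extUnit, Matrix.diagonal_apply, Matrix.one_apply]
  have hsub : ((totalForm M Ω θ G t).submatrix (allIncl G root) (allIncl G root)).submatrix
        (Equiv.sumAssoc (E ⊕ E) W (ExtVar X)) (Equiv.sumAssoc (E ⊕ E) W (ExtVar X)) +
      (extUnit E W (ExtVar X)).submatrix
        (Equiv.sumAssoc (E ⊕ E) W (ExtVar X)) (Equiv.sumAssoc (E ⊕ E) W (ExtVar X)) =
      ((totalForm M Ω θ G t).submatrix (allIncl G root) (allIncl G root) +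
        extUnit E W (ExtVar X)).submatrix
        (Equiv.sumAssoc (E ⊕ E) W (ExtVar X)) (Equiv.sumAssoc (E ⊕ E) W (ExtVar X)) := rfl
  have hsum : rotMat E (W ⊕ ExtVar X) *
      ((totalForm M Ω θ G t).submatrix (allIncl G root) (allIncl G root) +
        extUnit E W (ExtVar X)) * (rotMat E (W ⊕ ExtVar X))ᵀ =
      Matrix.diagonal (lineWeights P t) + (C + extUnit E W (ExtVar X)) := by
    rw [mul_add, add_mul, conj_extUnit, hfullC, add_assoc]
  have hacc : Accretive (extForm M Ω θ G root t) := by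
    refine accretive_schur hQpos.ne' ?_
    rw [hfull]
    have h1 : Accretive ((totalForm M Ω θ G t).submatrix (allIncl G root) (allIncl G root)) := by
      refine accretive_conj_rotMat ?_
      rw [hfullC]
      exact hCacc.diagonal_add (lineWeights_nonneg P ht)
    intro v
    have h2 := h1 (v ∘ (Equiv.sumAssoc (E ⊕ E) W (ExtVar X)).symm)
    rw [Matrix.submatrix_mulVec_equiv, ← comp_equiv_symm_dotProduct]
    exact h2
  have hdpos : 0 < (1 + extForm M Ω θ G root t).det := by
    have := hacc.det_smul_one_add_pos one_pos
    rwa [one_smul] at this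
  have hdet := det_fromBlocks_add_extOne hQpos.ne'
    ((totalForm M Ω θ G t).submatrix (intIncl G root) (extIncl G root))
    ((totalForm M Ω θ G t).submatrix (extIncl G root) (intIncl G root))
    ((totalForm M Ω θ G t).submatrix (extIncl G root) (extIncl G root))
  have hinv := inv_fromBlocks_add_extOne hQpos.ne' (hd := hdpos.ne')
  rw [hfull, hone, hsub, Matrix.det_submatrix_equiv_self, ← det_conj_rotMat,
    hsum] at hdet
  have hd1 : HU M Ω θ G root t * (1 + extForm M Ω θ G root t).det =
      boxPoly (detCoeff P (C + extUnit E W (ExtVar X))) t := by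
    rw [← boxPoly_detCoeff P _ ht0, hdet, HU, mul_assoc]
    rfl
  refine ⟨?_, ?_, hd1, fun x y => ?_, hacc⟩
  · rw [HU, hQ, boxPoly_detCoeff P B ht0]
  · rw [HU, mul_comm]
    exact mul_le_mul_of_nonneg_left hκ hprod.le
  · have h1 := hinv x y
    rw [hfull, hone, hsub, Matrix.inv_submatrix_equiv, Matrix.submatrix_apply] at h1
    have h2 := conj_rotMat_apply_inr ((totalForm M Ω θ G t).submatrix (allIncl G root)
      (allIncl G root) + extUnit E W (ExtVar X))⁻¹ (Sum.inr x) (Sum.inr y)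
    rw [← inv_conj_rotMat, hsum] at h2
    have h3 : ((1 + extForm M Ω θ G root t)⁻¹ : Matrix (ExtVar X) (ExtVar X) ℝ) x y =
        ((Matrix.diagonal (lineWeights P t) + (C + extUnit E W (ExtVar X)))⁻¹ :
          Matrix ((E ⊕ E) ⊕ (W ⊕ ExtVar X)) ((E ⊕ E) ⊕ (W ⊕ ExtVar X)) ℝ)
          (Sum.inr (Sum.inr x)) (Sum.inr (Sum.inr y)) := by
      rw [h2]; exact h1.symm
    rw [h3, Matrix.inv_def, Matrix.smul_apply, Ring.inverse_eq_inv', smul_eq_mul,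
      ← boxPoly_detCoeff P _ ht0, ← boxPoly_adjCoeff P _ ht0]
    have h4 : (Matrix.diagonal (lineWeights P t) + (C + extUnit E W (ExtVar X))).det ≠ 0 := by
      rw [hdet]
      exact (mul_pos hQpos hdpos).ne'
    field_simp

end Interface

/-! ### Polynomials in the charts: a monomial times a positive function -/

section Factorization

variable {E : Type*} [Fintype E] [DecidableEq E]

/-- The part of an exponent at the lines whose parameter tends to `0`. -/
def awayExp (T : E → Bool) (a : E → Fin 3) : E → Fin 3 := fun e => if T e then 0 else a e

/-- The factor of a monomial that is positive on the closed cube. -/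
def cornerUnit (T : E → Bool) (A : Matrix E E ℕ) (a : E → Fin 3) (w : E → ℝ) : ℝ :=
  ∏ e, (if T e then 1 - mono A w e / 2 else 1 / 2) ^ (a e : ℕ)

/-- A polynomial in a chart, divided by a monomial. -/
def reducedPoly (T : E → Bool) (A : Matrix E E ℕ) (α : E → ℕ) (c : (E → Fin 3) → ℝ)
    (w : E → ℝ) : ℝ :=
  ∑ a, c a * (cornerUnit T A a w * ∏ j, w j ^ (boxExp (awayExp T a) A j - α j))

theorem mono_mem_Icc (A : Matrix E E ℕ) {w : E → ℝ} (hw : w ∈ Set.Icc (0 : E → ℝ) 1) (e : E) :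
    0 ≤ mono A w e ∧ mono A w e ≤ 1 :=
  ⟨Finset.prod_nonneg fun j _ => pow_nonneg (hw.1 j) _,
    Finset.prod_le_one (fun j _ => pow_nonneg (hw.1 j) _)
      fun j _ => pow_le_one₀ (hw.1 j) (hw.2 j)⟩

theorem contDiff_mono (A : Matrix E E ℕ) (e : E) : ContDiff ℝ (⊤ : ℕ∞) fun w => mono A w e :=
  contDiff_prod fun j _ => (contDiff_apply ℝ ℝ j).pow _

theorem cornerUnit_pos (T : E → Bool) (A : Matrix E E ℕ) (a : E → Fin 3) {w : E → ℝ}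
    (hw : w ∈ Set.Icc (0 : E → ℝ) 1) : 0 < cornerUnit T A a w := by
  refine Finset.prod_pos fun e _ => pow_pos ?_ _
  split_ifs
  · linarith [(mono_mem_Icc A hw e).2]
  · norm_num

theorem contDiff_cornerUnit (T : E → Bool) (A : Matrix E E ℕ) (a : E → Fin 3) :
    ContDiff ℝ (⊤ : ℕ∞) (cornerUnit T A a) := by
  refine contDiff_prod fun e _ => ContDiff.pow ?_ _
  split_ifs
  · exact contDiff_const.sub ((contDiff_mono A e).div_const _)
  · exact contDiff_const

theorem contDiff_reducedPoly (T : E → Bool) (A : Matrix E E ℕ) (α : E → ℕ)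
    (c : (E → Fin 3) → ℝ) : ContDiff ℝ (⊤ : ℕ∞) (reducedPoly T A α c) :=
  ContDiff.sum fun a _ => contDiff_const.mul ((contDiff_cornerUnit T A a).mul
    (contDiff_prod fun j _ => (contDiff_apply ℝ ℝ j).pow _))

theorem prod_mono_pow (A : Matrix E E ℕ) (a : E → Fin 3) (w : E → ℝ) :
    ∏ e, mono A w e ^ (a e : ℕ) = ∏ j, w j ^ boxExp a A j := by
  simp only [mono, boxExp, ← Finset.prod_pow, ← pow_mul, ← Finset.prod_pow_eq_pow_sum]
  rw [Finset.prod_comm]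
  simp only [mul_comm]

theorem cornerMap_mono_monomial (T : E → Bool) (A : Matrix E E ℕ) (a : E → Fin 3) (w : E → ℝ) :
    ∏ e, cornerMap T (mono A w) e ^ (a e : ℕ) =
      cornerUnit T A a w * ∏ j, w j ^ boxExp (awayExp T a) A j := by
  rw [← prod_mono_pow, cornerUnit, ← Finset.prod_mul_distrib]
  refine Finset.prod_congr rfl fun e _ => ?_
  by_cases h : T e
  · simp [cornerMap, awayExp, h]
  · simp only [cornerMap, awayExp, h, if_false, Bool.false_eq_true, ← mul_pow]
    congr 1
    ring

/-- The truncated subtraction of exponents in `reducedPoly` is a true one wherever the coefficient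
is nonzero. The exponent `α` may therefore come from another polynomial with more monomials. -/
theorem boxPoly_cornerMap_mono (T : E → Bool) (A : Matrix E E ℕ) {α : E → ℕ}
    {c : (E → Fin 3) → ℝ} (hα : ∀ a, c a ≠ 0 → ∀ j, α j ≤ boxExp (awayExp T a) A j) (w : E → ℝ) :
    boxPoly c (cornerMap T (mono A w)) = (∏ j, w j ^ α j) * reducedPoly T A α c w := by
  rw [boxPoly, reducedPoly, Finset.mul_sum]
  refine Finset.sum_congr rfl fun a _ => ?_
  by_cases ha : c a = 0
  · simp [ha]
  rw [cornerMap_mono_monomial]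
  have : ∏ j, w j ^ boxExp (awayExp T a) A j =
      (∏ j, w j ^ α j) * ∏ j, w j ^ (boxExp (awayExp T a) A j - α j) := by
    rw [← Finset.prod_mul_distrib]
    refine Finset.prod_congr rfl fun j _ => ?_
    rw [← pow_add, Nat.add_sub_cancel' (hα a ha j)]
  rw [this]
  ring

/-- In a chart, a nonzero polynomial with nonnegative coefficients is a monomial times a positive
function. -/
theorem exists_factor {A : Matrix E E ℕ} (hA : ∀ a b : E → Fin 3,
      (∀ j, boxExp a A j ≤ boxExp b A j) ∨ (∀ j, boxExp b A j ≤ boxExp a A j))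
    {c : (E → Fin 3) → ℝ} (hc : ∀ a, 0 ≤ c a) (hc0 : ∃ a, c a ≠ 0) (T : E → Bool) :
    ∃ α : E → ℕ, (∀ a, c a ≠ 0 → ∀ j, α j ≤ boxExp (awayExp T a) A j) ∧
      ∀ w ∈ Set.Icc (0 : E → ℝ) 1, 0 < reducedPoly T A α c w := by
  classical
  obtain ⟨b, hb⟩ := hc0
  -- Comparability turns minimality of the total exponent into minimality in each coordinate. The
  -- term of `a₀` then reduces to a positive function, and the other terms are nonnegative.
  obtain ⟨a₀, h0, hmin⟩ := Finset.exists_min_image (Finset.univ.filter fun a => c a ≠ 0)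
    (fun a => ∑ j, boxExp (awayExp T a) A j) ⟨b, by simpa using hb⟩
  simp only [Finset.mem_filter, Finset.mem_univ, true_and] at h0 hmin
  refine ⟨boxExp (awayExp T a₀) A, fun a ha j => ?_, fun w hw => ?_⟩
  · rcases hA (awayExp T a₀) (awayExp T a) with h | h
    · exact h j
    · exact ((Finset.sum_eq_sum_iff_of_le fun i _ => h i).1
        (le_antisymm (Finset.sum_le_sum fun i _ => h i) (hmin a ha)) j (Finset.mem_univ j)).ge
  · refine Finset.sum_pos' (fun a _ => mul_nonneg (hc a) (mul_nonneg (cornerUnit_pos T A a hw).le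
      (Finset.prod_nonneg fun j _ => pow_nonneg (hw.1 j) _))) ⟨a₀, Finset.mem_univ _, ?_⟩
    refine mul_pos (lt_of_le_of_ne (hc a₀) h0.symm) (mul_pos (cornerUnit_pos T A a₀ hw) ?_)
    simp

/-- The sum of the exponents of a coordinate over the lines whose parameter tends to `0`. -/
def lowSum (T : E → Bool) (A : Matrix E E ℕ) (j : E) : ℕ := ∑ e, if T e then 0 else A e j

/-- The sum of the exponents of a coordinate over the lines whose parameter tends to `1`. -/
def highSum (T : E → Bool) (A : Matrix E E ℕ) (j : E) : ℕ := ∑ e, if T e then A e j else 0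

theorem lowSum_add_highSum (T : E → Bool) (A : Matrix E E ℕ) (j : E) :
    lowSum T A j + highSum T A j = ∑ e, A e j := by
  rw [lowSum, highSum, ← Finset.sum_add_distrib]
  refine Finset.sum_congr rfl fun e _ => ?_
  split_ifs <;> simp

theorem update_half_mem {j : E} {s : ℝ} (hs : 0 < s) (hs1 : s < 1) :
    Function.update (fun _ : E => (1 / 2 : ℝ)) j s ∈ paramDomain E := by
  rw [mem_paramDomain]
  intro e
  by_cases h : e = j
  · subst h; simpa using ⟨hs, hs1⟩
  · rw [Function.update_of_ne h]; norm_num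

theorem prod_update_pow (α : E → ℕ) (w : E → ℝ) (j : E) (s : ℝ) :
    ∏ i, Function.update w j s i ^ α i = s ^ α j * ∏ i ∈ Finset.univ.erase j, w i ^ α i := by
  rw [← Finset.mul_prod_erase _ _ (Finset.mem_univ j), Function.update_self]
  congr 1
  refine Finset.prod_congr rfl fun i hi => ?_
  rw [Function.update_of_ne (Finset.ne_of_mem_erase hi)]

/-- Let `w j` tend to `0` with the other coordinates at `1 / 2`. If `α j` exceeded `β j`, dividing
by the power `β j` would leave a positive limit on the left and zero on the right. -/
theorem exponent_le_of_le {α β : E → ℕ} {u v : (E → ℝ) → ℝ} (hu : Continuous u)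
    (hv : Continuous v) (hv0 : ∀ w ∈ Set.Icc (0 : E → ℝ) 1, 0 < v w)
    (h : ∀ w ∈ paramDomain E, (∏ j, w j ^ β j) * v w ≤ (∏ j, w j ^ α j) * u w) (j : E) :
    α j ≤ β j := by
  by_contra! hlt
  obtain ⟨k, hk⟩ := Nat.exists_eq_add_of_lt hlt
  set p : ℝ → E → ℝ := fun s => Function.update (fun _ : E => (1 / 2 : ℝ)) j s with hp
  have hpc : Continuous p := continuous_const.update j continuous_id
  set P : (E → ℕ) → ℝ := fun γ => ∏ i ∈ Finset.univ.erase j, (1 / 2 : ℝ) ^ γ i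
  have hP : ∀ γ, 0 < P γ := fun γ => Finset.prod_pos fun i _ => by positivity
  have hle : ∀ᶠ s in nhdsWithin (0 : ℝ) (Set.Ioi 0),
      P β * v (p s) ≤ s ^ (k + 1) * (P α * u (p s)) := by
    filter_upwards [Ioo_mem_nhdsGT (zero_lt_one (α := ℝ))] with s hs
    have h1 := h (p s) (update_half_mem hs.1 hs.2)
    simp only [hp, prod_update_pow] at h1
    rw [hk, add_assoc, pow_add, mul_assoc, mul_assoc, mul_assoc] at h1
    exact le_of_mul_le_mul_left h1 (pow_pos hs.1 _)
  have t1 : Filter.Tendsto (fun s => P β * v (p s)) (nhdsWithin (0 : ℝ) (Set.Ioi 0))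
      (nhds (P β * v (p 0))) :=
    ((continuous_const.mul (hv.comp hpc)).tendsto 0).mono_left nhdsWithin_le_nhds
  have t2 : Filter.Tendsto (fun s => s ^ (k + 1) * (P α * u (p s)))
      (nhdsWithin (0 : ℝ) (Set.Ioi 0)) (nhds ((0 : ℝ) ^ (k + 1) * (P α * u (p 0)))) :=
    (((continuous_pow _).mul (continuous_const.mul (hu.comp hpc))).tendsto 0).mono_left
      nhdsWithin_le_nhds
  have := le_of_tendsto_of_tendsto t1 t2 hle
  rw [zero_pow (Nat.succ_ne_zero k), zero_mul] at this
  refine absurd (mul_pos (hP β) (hv0 (p 0) ?_)) (not_lt.2 this)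
  refine ⟨fun i => ?_, fun i => ?_⟩ <;> by_cases hi : i = j
  · simp [hp, hi]
  · simp [hp, hi]
  · simp [hp, hi]
  · simp [hp, hi]; norm_num

theorem mono_mem_paramDomain {A : Matrix E E ℕ} (hA : ∀ e, 0 < A e e) {w : E → ℝ}
    (hw : w ∈ paramDomain E) : mono A w ∈ paramDomain E := by
  rw [mem_paramDomain] at hw ⊢
  refine fun e => ⟨mono_pos A (fun j => (hw j).1) e, ?_⟩
  rw [mono, ← Finset.mul_prod_erase _ _ (Finset.mem_univ e)]
  refine lt_of_le_of_lt (mul_le_of_le_one_right (pow_nonneg (hw e).1.le _)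
    (Finset.prod_le_one (fun j _ => pow_nonneg (hw j).1.le _)
      fun j _ => pow_le_one₀ (hw j).1.le (hw j).2.le)) ?_
  exact pow_lt_one₀ (hw e).1.le (hw e).2 (hA e).ne'

theorem cornerMap_mem_paramDomain (T : E → Bool) {w : E → ℝ} (hw : w ∈ paramDomain E) :
    cornerMap T w ∈ paramDomain E := by
  rw [mem_paramDomain] at hw ⊢
  intro e
  have := hw e
  unfold cornerMap
  split_ifs <;> constructor <;> linarith

/-- In a chart the monomial `∏ t e` has exponents `lowSum`, since lines near `1` contribute only
units. The lower bound `κ * ∏ t e` thus limits the order of vanishing of the polynomial. -/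
theorem exponent_le_lowSum {A : Matrix E E ℕ} (hd : ∀ e, 0 < A e e) (T : E → Bool) {α : E → ℕ}
    {c : (E → Fin 3) → ℝ} (hα : ∀ a, c a ≠ 0 → ∀ j, α j ≤ boxExp (awayExp T a) A j) {κ : ℝ}
    (hκ : 0 < κ) (h : ∀ t ∈ paramDomain E, κ * ∏ e, t e ≤ boxPoly c t) (j : E) :
    α j ≤ lowSum T A j := by
  have key := exponent_le_of_le (α := α) (β := boxExp (awayExp T fun _ => 1) A)
    (u := reducedPoly T A α c) (v := fun w => κ * cornerUnit T A (fun _ => 1) w)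
    (contDiff_reducedPoly T A α c).continuous
    (continuous_const.mul (contDiff_cornerUnit T A _).continuous)
    (fun w hw => mul_pos hκ (cornerUnit_pos T A _ hw)) (fun w hw => ?_) j
  · refine key.trans_eq ?_
    rw [boxExp, lowSum]
    refine Finset.sum_congr rfl fun e _ => ?_
    by_cases h : T e <;> simp [awayExp, h]
  · have h1 := h _ (cornerMap_mem_paramDomain T (mono_mem_paramDomain hd hw))
    rw [boxPoly_cornerMap_mono T A hα] at h1
    refine le_trans (le_of_eq ?_) h1
    have h2 := cornerMap_mono_monomial T A (fun _ => 1) w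
    simp only [Fin.val_one, pow_one] at h2
    rw [h2]
    ring

end Factorization

/-! ### The scalar part of the integrand in a chart -/

section Charts

variable {E : Type*} [Fintype E] [DecidableEq E]

/-- All bases are positive, so every power becomes the exponential of a real logarithm and products
of powers reduce to linear identities between logarithms, with no branch to choose. -/
theorem ofReal_cpow_eq_cexp {x : ℝ} (hx : 0 < x) (s : ℂ) :
    (x : ℂ) ^ s = Complex.exp (s * (Real.log x : ℂ)) := by
  rw [Complex.cpow_def_of_ne_zero (by exact_mod_cast hx.ne'), Complex.ofReal_log hx.le, mul_comm]

/-- The scalar part of the integrand of the parametric representation. -/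
def paramWeight (U : (E → ℝ) → ℝ) (D : ℂ) (t : E → ℝ) : ℂ :=
  (∏ e, ((1 - t e ^ 2 : ℝ) : ℂ) ^ (D / 2 - 1)) * (U t : ℂ) ^ (-(D / 2))

/-- The factor of `1 - t ^ 2` that is positive on the closed cube. -/
def edgeUnit (T : E → Bool) (A : Matrix E E ℕ) (e : E) (w : E → ℝ) : ℝ :=
  if T e then 1 - mono A w e / 4 else 1 - mono A w e ^ 2 / 4

theorem edgeUnit_pos (T : E → Bool) (A : Matrix E E ℕ) (e : E) {w : E → ℝ}
    (hw : w ∈ Set.Icc (0 : E → ℝ) 1) : 0 < edgeUnit T A e w := by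
  have h := mono_mem_Icc A hw e
  unfold edgeUnit
  split_ifs
  · linarith
  · nlinarith

theorem contDiff_edgeUnit (T : E → Bool) (A : Matrix E E ℕ) (e : E) :
    ContDiff ℝ (⊤ : ℕ∞) (edgeUnit T A e) := by
  unfold edgeUnit
  split_ifs
  · exact contDiff_const.sub ((contDiff_mono A e).div_const _)
  · exact contDiff_const.sub (((contDiff_mono A e).pow 2).div_const _)

theorem one_sub_cornerMap_sq (T : E → Bool) (A : Matrix E E ℕ) (w : E → ℝ) (e : E) :
    1 - cornerMap T (mono A w) e ^ 2 = (if T e then mono A w e else 1) * edgeUnit T A e w := by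
  unfold cornerMap edgeUnit
  split_ifs <;> ring

theorem log_mono (A : Matrix E E ℕ) {w : E → ℝ} (hw : w ∈ paramDomain E) (e : E) :
    Real.log (mono A w e) = ∑ j, (A e j : ℝ) * Real.log (w j) := by
  rw [mono, Real.log_prod fun j _ => pow_ne_zero _ (mem_paramDomain.1 hw j).1.ne']
  simp only [Real.log_pow]

theorem log_one_sub_cornerMap_sq (T : E → Bool) (A : Matrix E E ℕ) {w : E → ℝ}
    (hw : w ∈ paramDomain E) (e : E) :
    Real.log (1 - cornerMap T (mono A w) e ^ 2) =
      ∑ j, (if T e then (A e j : ℝ) else 0) * Real.log (w j) + Real.log (edgeUnit T A e w) := by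
  have hm := mono_pos A (fun j => (mem_paramDomain.1 hw j).1) e
  have hu := edgeUnit_pos T A e (paramDomain_subset_Icc hw)
  rw [one_sub_cornerMap_sq, Real.log_mul (by split_ifs <;> [exact hm.ne'; norm_num]) hu.ne']
  congr 1
  split_ifs
  · exact log_mono A hw e
  · simp

/-- The slopes of the exponents in a chart. -/
def chartSlope (T : E → Bool) (A : Matrix E E ℕ) (α : E → ℕ) (j : E) : ℝ :=
  ((highSum T A j : ℝ) - α j) / 2

/-- The exponents in a chart at `D = 0`. -/
def chartShift (T : E → Bool) (A : Matrix E E ℕ) (j : E) : ℝ := lowSum T A j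

/-- In a chart, the scalar part of the integrand is a product of powers of the coordinates times
the exponential of a smooth function. -/
theorem monoJac_mul_paramWeight (T : E → Bool) (A : Matrix E E ℕ) (hd : ∀ e, 0 < A e e)
    {α : E → ℕ} {U u : (E → ℝ) → ℝ} {w : E → ℝ} (hw : w ∈ paramDomain E) (hu : 0 < u w)
    (hU : U (cornerMap T (mono A w)) = (∏ j, w j ^ α j) * u w) (D : ℂ) :
    (monoJac A w : ℂ) * paramWeight U D (cornerMap T (mono A w)) =
      mellinKernel (chartSlope T A α) (chartShift T A) D w *
        Complex.exp (D * (((∑ e, Real.log (edgeUnit T A e w) - Real.log (u w)) / 2 : ℝ) : ℂ) +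
          ((-∑ e, Real.log (edgeUnit T A e w) : ℝ) : ℂ)) := by
  have hw' := mem_paramDomain.1 hw
  have hm := mono_pos A (fun j => (hw' j).1)
  have ht := mem_paramDomain.1 (cornerMap_mem_paramDomain T (mono_mem_paramDomain hd hw))
  have hp : 0 < ∏ j, w j := Finset.prod_pos fun j _ => (hw' j).1
  have hpm : 0 < ∏ e, mono A w e := Finset.prod_pos fun j _ => hm j
  have hpa : 0 < ∏ j, w j ^ α j := Finset.prod_pos fun j _ => pow_pos (hw' j).1 _
  have hJ : 0 < monoJac A w := div_pos hpm hp
  have e1 : (monoJac A w : ℂ) = Complex.exp (Real.log (monoJac A w) : ℂ) := by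
    rw [← Complex.ofReal_exp, Real.exp_log hJ]
  have e2 : Real.log (monoJac A w) =
      ∑ j, ((lowSum T A j : ℝ) + highSum T A j) * Real.log (w j) - ∑ j, Real.log (w j) := by
    rw [monoJac, Real.log_div hpm.ne' hp.ne', Real.log_prod fun e _ => (hm e).ne',
      Real.log_prod fun j _ => (hw' j).1.ne']
    congr 1
    simp only [log_mono A hw]
    rw [Finset.sum_comm]
    refine Finset.sum_congr rfl fun j _ => ?_
    rw [← Finset.sum_mul]
    congr 1
    exact_mod_cast (lowSum_add_highSum T A j).symm
  have e3 : ∑ e, Real.log (1 - cornerMap T (mono A w) e ^ 2) =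
      ∑ j, (highSum T A j : ℝ) * Real.log (w j) + ∑ e, Real.log (edgeUnit T A e w) := by
    simp only [log_one_sub_cornerMap_sq T A hw, Finset.sum_add_distrib]
    congr 1
    rw [Finset.sum_comm]
    refine Finset.sum_congr rfl fun j _ => ?_
    rw [← Finset.sum_mul]
    congr 1
    simp only [highSum, Nat.cast_sum]
    exact Finset.sum_congr rfl fun e _ => by split_ifs <;> simp
  have e4 : Real.log (U (cornerMap T (mono A w))) =
      ∑ j, (α j : ℝ) * Real.log (w j) + Real.log (u w) := by
    rw [hU, Real.log_mul hpa.ne' hu.ne',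
      Real.log_prod fun j _ => pow_ne_zero _ (hw' j).1.ne']
    simp only [Real.log_pow]
  have e5 : ∀ e, ((1 - cornerMap T (mono A w) e ^ 2 : ℝ) : ℂ) ^ (D / 2 - 1) =
      Complex.exp ((D / 2 - 1) * (Real.log (1 - cornerMap T (mono A w) e ^ 2) : ℂ)) := fun e =>
    ofReal_cpow_eq_cexp (by nlinarith [(ht e).1, (ht e).2]) _
  have e6 : ∀ j, (w j : ℂ) ^ (affExp (chartSlope T A α) (chartShift T A) j D - 1) =
      Complex.exp ((affExp (chartSlope T A α) (chartShift T A) j D - 1) *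
        (Real.log (w j) : ℂ)) := fun j => ofReal_cpow_eq_cexp (hw' j).1 _
  rw [paramWeight, mellinKernel, e1, ofReal_cpow_eq_cexp (by rw [hU]; positivity)]
  simp only [e5, e6]
  rw [← Complex.exp_sum, ← Complex.exp_sum, ← Complex.exp_add, ← Complex.exp_add,
    ← Complex.exp_add, ← Finset.mul_sum, ← Complex.ofReal_sum, e2, e3, e4]
  congr 1
  -- The exponent of `w j` collects `low + high - 1` from the Jacobian, `high * (D / 2 - 1)` from
  -- the factors `1 - t ^ 2` of lines near `1`, and `-α * D / 2` from the power of `U`, in total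
  -- `low + (high - α) * D / 2 - 1`.
  have e7 : ∑ j, (affExp (chartSlope T A α) (chartShift T A) j D - 1) * (Real.log (w j) : ℂ) =
      D / 2 * ∑ j, (highSum T A j : ℂ) * (Real.log (w j) : ℂ) -
        D / 2 * ∑ j, (α j : ℂ) * (Real.log (w j) : ℂ) +
        ∑ j, (lowSum T A j : ℂ) * (Real.log (w j) : ℂ) - ∑ j, (Real.log (w j) : ℂ) := by
    simp only [Finset.mul_sum, ← Finset.sum_add_distrib, ← Finset.sum_sub_distrib]
    refine Finset.sum_congr rfl fun j _ => ?_
    simp only [affExp, chartSlope, chartShift]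
    push_cast
    ring
  have e8 : ∑ j, ((lowSum T A j : ℂ) + highSum T A j) * (Real.log (w j) : ℂ) =
      ∑ j, (lowSum T A j : ℂ) * (Real.log (w j) : ℂ) +
        ∑ j, (highSum T A j : ℂ) * (Real.log (w j) : ℂ) := by
    simp only [add_mul, Finset.sum_add_distrib]
  rw [e7]
  push_cast
  rw [e8]
  ring

end Charts

/-! ### The smeared integrand in a chart -/

section Leaves

variable {E Y : Type*} [Fintype E] [DecidableEq E] [Fintype Y] [DecidableEq Y]

/-- A parametric integrand given by polynomials with nonnegative coefficients: `U` is the first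
polynomial and `R` the form in the external variables. -/
structure BoxData (U : (E → ℝ) → ℝ) (R : (E → ℝ) → Matrix Y Y ℝ) where
  κ : ℝ
  c : (E → Fin 3) → ℝ
  d : (E → Fin 3) → ℝ
  n : Y → Y → (E → Fin 3) → ℝ
  κ_pos : 0 < κ
  c_nonneg : ∀ a, 0 ≤ c a
  d_nonneg : ∀ a, 0 ≤ d a
  abs_n_le : ∀ x y a, |n x y a| ≤ 2 * d a
  U_eq : ∀ t ∈ paramDomain E, U t = boxPoly c t
  le_U : ∀ t ∈ paramDomain E, κ * ∏ e, t e ≤ U t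
  det_eq : ∀ t ∈ paramDomain E, U t * (1 + R t).det = boxPoly d t
  inv_eq : ∀ t ∈ paramDomain E, ∀ x y,
    ((1 + R t)⁻¹ : Matrix Y Y ℝ) x y * boxPoly d t = boxPoly (n x y) t
  accretive : ∀ t ∈ paramDomain E, Accretive (R t)

variable {U : (E → ℝ) → ℝ} {R : (E → ℝ) → Matrix Y Y ℝ}

theorem BoxData.U_pos (P : BoxData U R) {t : E → ℝ} (ht : t ∈ paramDomain E) : 0 < U t :=
  (mul_pos P.κ_pos (Finset.prod_pos fun e _ => (mem_paramDomain.1 ht e).1)).trans_le (P.le_U t ht)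

theorem BoxData.det_pos (P : BoxData U R) {t : E → ℝ} (ht : t ∈ paramDomain E) :
    0 < (1 + R t).det := by
  simpa using (P.accretive t ht).det_smul_one_add_pos one_pos

theorem exists_coeff_ne_zero {c : (E → Fin 3) → ℝ} {t : E → ℝ} (h : boxPoly c t ≠ 0) :
    ∃ a, c a ≠ 0 := by
  by_contra! h0
  exact h (by simp [boxPoly, h0])

theorem half_mem_paramDomain : (fun _ => 1 / 2 : E → ℝ) ∈ paramDomain E := by
  rw [mem_paramDomain]
  intro e
  norm_num

theorem Nice.mul {k : ℕ} {χ φ : ℂ → (E → ℝ) → ℂ} (h : Nice k χ) (h' : Nice k φ) :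
    Nice k fun D w => χ D w * φ D w :=
  Tame.mul isBoundFamily_univ h h'

theorem Nice.add {k : ℕ} {χ φ : ℂ → (E → ℝ) → ℂ} (h : Nice k χ) (h' : Nice k φ) :
    Nice k fun D w => χ D w + φ D w :=
  Tame.add isBoundFamily_univ h h'

theorem contDiffAt_ofReal {v : (E → ℝ) → ℝ} {w : E → ℝ} (hv : ContDiffAt ℝ (⊤ : ℕ∞) v w) :
    ContDiffAt ℝ (⊤ : ℕ∞) (fun w => (v w : ℂ)) w :=
  Complex.ofRealCLM.contDiff.contDiffAt.comp w hv

theorem contDiffAt_det {S : (E → ℝ) → Matrix Y Y ℝ} {w : E → ℝ}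
    (h : ∀ a b, ContDiffAt ℝ (⊤ : ℕ∞) (fun w => S w a b) w) :
    ContDiffAt ℝ (⊤ : ℕ∞) (fun w => (S w).det) w := by
  simp only [Matrix.det_apply]
  exact ContDiffAt.sum fun σ _ => (contDiffAt_prod fun i _ => h _ _).const_smul _

theorem normGauss_linear {m : ℕ} {M : Matrix Y Y ℝ} (hM : Accretive M) (a : ℂ)
    (f g : 𝓢(Phase Y m, ℂ)) :
    normGauss M (a • f + g) = a * normGauss M f + normGauss M g := by
  have h := gaussInt_add hM (f.integrable (μ := volume).const_mul a) (g.integrable (μ := volume))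
  rw [gaussInt_const_mul] at h
  have e : ((a • f + g : 𝓢(Phase Y m, ℂ)) : Phase Y m → ℂ) = fun x => a * f x + g x := by
    ext x; simp
  rw [normGauss, e, h, normGauss, normGauss]
  ring

/-- The smeared integrand in a chart. -/
theorem BoxData.exists_leaf (P : BoxData U R) {A : Matrix E E ℕ} (hd : ∀ e, 0 < A e e)
    (hA : ∀ a b : E → Fin 3,
      (∀ j, boxExp a A j ≤ boxExp b A j) ∨ (∀ j, boxExp b A j ≤ boxExp a A j))
    (T : E → Bool) (m : ℕ) :
    ∃ (α : E → ℕ) (ψ : 𝓢(Phase Y m, ℂ) → ℂ → (E → ℝ) → ℂ),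
      (∀ j, α j ≤ lowSum T A j) ∧
      (∀ k, Tame (schwartzBounds (Phase Y m)) k ψ) ∧
      (∀ (a : ℂ) (f g : 𝓢(Phase Y m, ℂ)) (D : ℂ), ∀ w ∈ paramDomain E,
        ψ (a • f + g) D w = a * ψ f D w + ψ g D w) ∧
      ∀ (f : 𝓢(Phase Y m, ℂ)) (D : ℂ), ∀ w ∈ paramDomain E,
        (monoJac A w : ℂ) * (paramWeight U D (cornerMap T (mono A w)) *
            gaussInt (R (cornerMap T (mono A w))) f) =
          mellinKernel (chartSlope T A α) (chartShift T A) D w * ψ f D w := by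
  have hh := half_mem_paramDomain (E := E)
  obtain ⟨α, hα, hαpos⟩ := exists_factor hA P.c_nonneg (exists_coeff_ne_zero (t := fun _ => 1 / 2)
    (by rw [← P.U_eq _ hh]; exact (P.U_pos hh).ne')) T
  obtain ⟨β, hβ, hβpos⟩ := exists_factor hA P.d_nonneg (exists_coeff_ne_zero (t := fun _ => 1 / 2)
    (by rw [← P.det_eq _ hh]; exact (mul_pos (P.U_pos hh) (P.det_pos hh)).ne')) T
  -- The numerators contain no monomial missing from the denominator, so the same monomial `β`
  -- divides both, and `S` below is a quotient of smooth functions with positive denominator on the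
  -- closed cube.
  have hn : ∀ x y a, P.n x y a ≠ 0 → ∀ j, β j ≤ boxExp (awayExp T a) A j := fun x y a ha =>
    hβ a fun h0 => ha (by have := P.abs_n_le x y a; rw [h0, mul_zero] at this; simpa using this)
  set t : (E → ℝ) → E → ℝ := fun w => cornerMap T (mono A w) with htdef
  have ht : ∀ w ∈ paramDomain E, t w ∈ paramDomain E := fun w hw =>
    cornerMap_mem_paramDomain T (mono_mem_paramDomain hd hw)
  set u := reducedPoly T A α P.c
  set S : (E → ℝ) → Matrix Y Y ℝ := fun w x y =>
    reducedPoly T A β (P.n x y) w / reducedPoly T A β P.d w with hS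
  have hSsm : ∀ a b, ∀ w ∈ Set.Icc (0 : E → ℝ) 1, ContDiffAt ℝ (⊤ : ℕ∞) (fun w => S w a b) w :=
    fun a b w hw => (contDiff_reducedPoly T A β (P.n a b)).contDiffAt.div
      (contDiff_reducedPoly T A β P.d).contDiffAt (hβpos w hw).ne'
  have hSinv : ∀ w ∈ paramDomain E, (1 + R (t w))⁻¹ = S w := by
    intro w hw
    ext x y
    have h1 := P.inv_eq (t w) (ht w hw) x y
    have hp : ∏ j, w j ^ β j ≠ 0 :=
      Finset.prod_ne_zero_iff.2 fun j _ => pow_ne_zero _ (mem_paramDomain.1 hw j).1.ne'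
    have hr := (hβpos w (paramDomain_subset_Icc hw)).ne'
    rw [htdef, boxPoly_cornerMap_mono T A hβ, boxPoly_cornerMap_mono T A (hn x y)] at h1
    simp only [hS]
    rw [eq_div_iff hr]
    refine mul_left_cancel₀ hp ?_
    rw [← h1]
    ring
  set v₀ : (E → ℝ) → ℝ := fun w => (∑ e, Real.log (edgeUnit T A e w) - Real.log (u w)) / 2 with hv₀
  set v₁ : (E → ℝ) → ℝ := fun w => -∑ e, Real.log (edgeUnit T A e w) with hv₁
  have hlog : ∀ w ∈ Set.Icc (0 : E → ℝ) 1,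
      ContDiffAt ℝ (⊤ : ℕ∞) (fun w => ∑ e, Real.log (edgeUnit T A e w)) w := fun w hw =>
    ContDiffAt.sum fun e _ => (contDiff_edgeUnit T A e).contDiffAt.log (edgeUnit_pos T A e hw).ne'
  have hv₀sm : ∀ w ∈ Set.Icc (0 : E → ℝ) 1, ContDiffAt ℝ (⊤ : ℕ∞) v₀ w := fun w hw =>
    ((hlog w hw).sub ((contDiff_reducedPoly T A α P.c).contDiffAt.log
      (hαpos w hw).ne')).div_const _
  have hv₁sm : ∀ w ∈ Set.Icc (0 : E → ℝ) 1, ContDiffAt ℝ (⊤ : ℕ∞) v₁ w := fun w hw =>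
    (hlog w hw).neg
  -- The exponential is the smooth part of the scalar weight. The factor `det S ^ m` undoes the
  -- normalization in `normGauss`, because `det S * det (1 + R) = 1`.
  refine ⟨α, fun f D w => (Complex.exp (D * (v₀ w : ℂ) + (v₁ w : ℂ)) * ((S w).det : ℂ) ^ m) *
    normGauss (R (t w)) f, exponent_le_lowSum hd T hα P.κ_pos
      (fun t ht => by rw [← P.U_eq t ht]; exact P.le_U t ht), fun k => ?_, ?_, ?_⟩
  · refine Tame.mul isBoundFamily_schwartzBounds (Nice.mul (Nice.cexp (Nice.add (Nice.mul
      (nice_of_differentiable differentiable_id k)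
      (nice_of_contDiffAt k fun w hw => contDiffAt_ofReal (hv₀sm w hw)))
      (nice_of_contDiffAt k fun w hw => contDiffAt_ofReal (hv₁sm w hw))))
      (nice_of_contDiffAt k fun w hw => ?_))
      (tame_normGauss (fun w hw => P.accretive _ (ht w hw)) hSinv hSsm k)
    exact (contDiffAt_ofReal (contDiffAt_det fun a b => hSsm a b w hw)).pow m
  · intro a f g D w hw
    beta_reduce
    rw [normGauss_linear (P.accretive _ (ht w hw))]
    ring
  · intro f D w hw
    have h1 := monoJac_mul_paramWeight T A hd (α := α) (U := U) (u := u) hw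
      (hαpos w (paramDomain_subset_Icc hw))
      (by rw [P.U_eq _ (ht w hw)]; exact boxPoly_cornerMap_mono T A hα w) D
    have hdet : ((S w).det : ℂ) * ((1 + R (t w)).det : ℂ) = 1 := by
      rw [← hSinv w hw, ← Complex.ofReal_mul, ← Matrix.det_mul,
        Matrix.nonsing_inv_mul _ (P.det_pos (ht w hw)).ne'.isUnit, Matrix.det_one,
        Complex.ofReal_one]
    beta_reduce
    rw [← mul_assoc, h1, normGauss, mul_assoc, mul_assoc, ← mul_assoc (((S w).det : ℂ) ^ m),
      ← mul_pow, hdet, one_pow, one_mul]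

end Leaves

/-! ### The singular set and the exponents of the charts -/

section Poles

/-- The multiples of `1 / N`. -/
def poleSet (N : ℕ) : Set ℂ := Set.range fun z : ℤ => (z : ℂ) / (N : ℂ)

theorem isClosedEmbedding_intCast_div {N : ℕ} (hN : 0 < N) :
    Topology.IsClosedEmbedding fun z : ℤ => (z : ℂ) / (N : ℂ) := by
  have h : ((N : ℂ)⁻¹) ≠ 0 := inv_ne_zero (by exact_mod_cast hN.ne')
  have := ((Homeomorph.mulRight₀ _ h).isClosedEmbedding.comp
    Complex.isometry_ofReal.isClosedEmbedding).comp Real.isClosedEmbedding_intCast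
  convert this using 1
  funext z
  simp [div_eq_mul_inv]

theorem isClosed_poleSet {N : ℕ} (hN : 0 < N) : IsClosed (poleSet N) :=
  (isClosedEmbedding_intCast_div hN).isClosed_range

theorem isDiscrete_poleSet {N : ℕ} (hN : 0 < N) : IsDiscrete (poleSet N) :=
  ⟨(isClosedEmbedding_intCast_div hN).isEmbedding.toHomeomorph.discreteTopology⟩

theorem poleSet_subset (N : ℕ) : poleSet N ⊆ Set.range (fun q : ℚ => (q : ℂ)) := by
  rintro _ ⟨z, rfl⟩
  exact ⟨z / N, by push_cast; rfl⟩

variable {E : Type*} [Fintype E] [DecidableEq E]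

/-- With `α ≤ low` the real part is at least `low * (1 - Re D / 2) + high * Re D / 2`; both weights
are positive in the strip and `low + high`, a column sum, is positive. -/
theorem affExp_chart_re_pos {T : E → Bool} {A : Matrix E E ℕ} (hd : ∀ e, 0 < A e e) {α : E → ℕ}
    (hα : ∀ j, α j ≤ lowSum T A j) {D : ℂ} (h0 : 0 < D.re) (h2 : D.re < 2) (j : E) :
    0 < (affExp (chartSlope T A α) (chartShift T A) j D).re := by
  rw [affExp_re, chartSlope, chartShift]
  have h1 : (α j : ℝ) ≤ lowSum T A j := by exact_mod_cast hα j
  have h3 : 0 < (lowSum T A j : ℝ) + highSum T A j := by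
    have := lowSum_add_highSum T A j
    have h4 : A j j ≤ ∑ e, A e j :=
      Finset.single_le_sum (f := fun e => A e j) (fun e _ => Nat.zero_le _) (Finset.mem_univ j)
    have := hd j
    exact_mod_cast (by omega : 0 < lowSum T A j + highSum T A j)
  have h5 : (0 : ℝ) ≤ lowSum T A j := Nat.cast_nonneg _
  have h6 : (0 : ℝ) ≤ highSum T A j := Nat.cast_nonneg _
  rcases eq_or_lt_of_le h6 with h | h
  · rw [← h] at h3 ⊢
    nlinarith [mul_nonneg h0.le (sub_nonneg.2 h1)]
  · nlinarith [mul_nonneg h0.le (sub_nonneg.2 h1), mul_pos h0 h, mul_nonneg h5 (sub_pos.2 h2).le]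

/-- A zero satisfies `D = -2 (low + r) / (high - α)`, and `|high - α|` is at most the column sum
because `0 ≤ α ≤ low`, so it divides `N`. The bound on `α` is all that is used about the polynomial,
whence `N` can be fixed in advance. -/
theorem affExp_chart_add_ne_zero {T : E → Bool} {A : Matrix E E ℕ} (hd : ∀ e, 0 < A e e)
    {α : E → ℕ} (hα : ∀ j, α j ≤ lowSum T A j) {N : ℕ} (hN : 0 < N)
    (hdvd : ∀ j, ∀ k : ℕ, 0 < k → k ≤ ∑ e, A e j → k ∣ N) {D : ℂ} (hD : D ∉ poleSet N) (j : E)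
    (r : ℕ) : affExp (chartSlope T A α) (chartShift T A) j D + r ≠ 0 := by
  intro h
  have hs := lowSum_add_highSum T A j
  have hpos : A j j ≤ ∑ e, A e j :=
    Finset.single_le_sum (f := fun e => A e j) (fun e _ => Nat.zero_le _) (Finset.mem_univ j)
  have hdj := hd j
  have hαj := hα j
  simp only [affExp, chartSlope, chartShift] at h
  push_cast at h
  -- With zero slope the shifted exponent is the constant `low + r`; if it vanished, then `α`, `low`
  -- and `high` would all be zero, against the positive column sum.
  by_cases hk : highSum T A j = α j
  · rw [hk, sub_self, zero_div, zero_mul, zero_add] at h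
    have : lowSum T A j + r = 0 := by exact_mod_cast h
    omega
  · obtain ⟨q, hq⟩ : ((highSum T A j : ℤ) - α j) ∣ N := by
      rw [← Int.natAbs_dvd_natAbs, Int.natAbs_natCast]
      refine hdvd j _ (by omega) (by omega)
    have hq' : (N : ℂ) = ((highSum T A j : ℂ) - α j) * q := by
      have := congrArg (Int.cast : ℤ → ℂ) hq
      push_cast at this
      exact this
    refine hD ⟨-2 * q * (lowSum T A j + r), ?_⟩
    have hN' : (N : ℂ) ≠ 0 := by exact_mod_cast hN.ne'
    simp only
    rw [div_eq_iff hN', hq']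
    push_cast
    linear_combination (-2 * (q : ℂ)) * h

end Poles

/-! ### Absolute convergence in the strip `0 < Re D < 2` -/

section Integrability

variable {E Y : Type*} [Fintype E] [DecidableEq E] [Fintype Y] [DecidableEq Y]
  {U : (E → ℝ) → ℝ} {R : (E → ℝ) → Matrix Y Y ℝ}

/-- A bound for the parametric integrand. -/
def betaBound (r : ℝ) (t : E → ℝ) : ℝ :=
  ∏ e, ‖(t e : ℂ) ^ (((1 - r : ℝ) : ℂ) - 1) * (1 - (t e : ℂ)) ^ ((r : ℂ) - 1)‖

/-- A product of integrands of the Beta integral `B(1 - r, r)`, which converges for `0 < r < 1`.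
With `r = Re D / 2` this is the strip of convergence. -/
theorem integrable_betaBound {r : ℝ} (h0 : 0 < r) (h1 : r < 1) :
    Integrable (betaBound r) (cubeMeasure E) := by
  refine Integrable.fintype_prod (f := fun _ (s : ℝ) =>
    ‖(s : ℂ) ^ (((1 - r : ℝ) : ℂ) - 1) * (1 - (s : ℂ)) ^ ((r : ℂ) - 1)‖)
    (μ := fun _ => unitMeasure) fun i => ?_
  have := Complex.betaIntegral_convergent (u := ((1 - r : ℝ) : ℂ)) (v := (r : ℂ))
    (by rw [Complex.ofReal_re]; linarith) (by simpa using h0)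
  rw [intervalIntegrable_iff_integrableOn_Ioo_of_le zero_le_one] at this
  exact this.norm

/-- Both real exponents are negative in the strip, so the lower bounds `U t ≥ κ * ∏ t e` and `1 - t
^ 2 ≥ 1 - t` turn into upper bounds. -/
theorem BoxData.norm_paramWeight_le (P : BoxData U R) {D : ℂ} (h0 : 0 < D.re) (h2 : D.re < 2)
    {t : E → ℝ} (ht : t ∈ paramDomain E) :
    ‖paramWeight U D t‖ ≤ P.κ ^ (-(D.re / 2)) * betaBound (D.re / 2) t := by
  have ht' := mem_paramDomain.1 ht
  have hp : 0 < ∏ e, t e := Finset.prod_pos fun e _ => (ht' e).1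
  rw [paramWeight, norm_mul, norm_prod, Complex.norm_cpow_eq_rpow_re_of_pos (P.U_pos ht)]
  have e1 : (-(D / 2)).re = -(D.re / 2) := by simp
  have e2 : (D / 2 - 1).re = D.re / 2 - 1 := by simp
  have h1 : U t ^ (-(D.re / 2)) ≤ P.κ ^ (-(D.re / 2)) * ∏ e, t e ^ (-(D.re / 2)) := by
    rw [Real.finsetProd_rpow _ _ fun e _ => (ht' e).1.le, ← Real.mul_rpow P.κ_pos.le hp.le]
    exact Real.rpow_le_rpow_of_nonpos (mul_pos P.κ_pos hp) (P.le_U t ht) (by linarith)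
  have h3 : ∀ e, ‖((1 - t e ^ 2 : ℝ) : ℂ) ^ (D / 2 - 1)‖ ≤ (1 - t e) ^ (D.re / 2 - 1) := by
    intro e
    have := ht' e
    rw [Complex.norm_cpow_eq_rpow_re_of_pos (by nlinarith), e2]
    exact Real.rpow_le_rpow_of_nonpos (by linarith) (by nlinarith) (by linarith)
  have h4 : betaBound (D.re / 2) t =
      (∏ e, (1 - t e) ^ (D.re / 2 - 1)) * ∏ e, t e ^ (-(D.re / 2)) := by
    rw [betaBound, ← Finset.prod_mul_distrib]
    refine Finset.prod_congr rfl fun e _ => ?_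
    have := ht' e
    have h5 : (1 - (t e : ℂ)) = ((1 - t e : ℝ) : ℂ) := by push_cast; rfl
    rw [norm_mul, h5, Complex.norm_cpow_eq_rpow_re_of_pos this.1,
      Complex.norm_cpow_eq_rpow_re_of_pos (by linarith), mul_comm]
    simp
  rw [h4, e1]
  calc _ ≤ (∏ e, (1 - t e) ^ (D.re / 2 - 1)) * (P.κ ^ (-(D.re / 2)) * ∏ e, t e ^ (-(D.re / 2))) := by
        refine mul_le_mul (Finset.prod_le_prod (fun e _ => norm_nonneg _) fun e _ => h3 e) h1
          (Real.rpow_nonneg (P.U_pos ht).le _) (Finset.prod_nonneg fun e _ => ?_)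
        exact Real.rpow_nonneg (by linarith [(ht' e).2]) _
    _ = _ := by ring

theorem continuous_boxPoly (c : (E → Fin 3) → ℝ) : Continuous (boxPoly c) := by
  unfold boxPoly
  fun_prop

theorem BoxData.continuousOn_paramWeight (P : BoxData U R) (D : ℂ) :
    ContinuousOn (paramWeight U D) (paramDomain E) := by
  have hU : ContinuousOn U (paramDomain E) :=
    (continuous_boxPoly P.c).continuousOn.congr P.U_eq
  refine ContinuousOn.mul (continuousOn_finsetProd _ fun e _ => ?_) ?_
  · refine ContinuousOn.cpow_const (by fun_prop) fun t ht => ?_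
    have := mem_paramDomain.1 ht e
    rw [Complex.ofReal_mem_slitPlane]
    nlinarith
  · refine ContinuousOn.cpow_const (Complex.continuous_ofReal.comp_continuousOn hU) fun t ht => ?_
    rw [Complex.ofReal_mem_slitPlane]
    exact P.U_pos ht

/-- `R` itself is not given by polynomials; it is recovered from `(1 + R)⁻¹`, whose entries are
quotients of polynomials, by inverting once more. -/
theorem BoxData.continuousOn_form (P : BoxData U R) : ContinuousOn R (paramDomain E) := by
  set S : (E → ℝ) → Matrix Y Y ℝ := fun t => (1 + R t)⁻¹ with hS
  have hd : ∀ t ∈ paramDomain E, boxPoly P.d t ≠ 0 := fun t ht => by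
    rw [← P.det_eq t ht]
    exact (mul_pos (P.U_pos ht) (P.det_pos ht)).ne'
  have hSc : ContinuousOn S (paramDomain E) := by
    refine continuousOn_pi.2 fun x => continuousOn_pi.2 fun y => ?_
    refine ContinuousOn.congr (f := fun t => boxPoly (P.n x y) t / boxPoly P.d t)
      ((continuous_boxPoly _).continuousOn.div (continuous_boxPoly _).continuousOn hd)
      fun t ht => ?_
    rw [eq_div_iff (hd t ht)]
    exact P.inv_eq t ht x y
  have hdet : ∀ t ∈ paramDomain E, (S t).det ≠ 0 := fun t ht => by
    rw [hS, Matrix.det_nonsing_inv, Ring.inverse_eq_inv']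
    exact inv_ne_zero (P.det_pos ht).ne'
  have hR : ∀ t ∈ paramDomain E, R t = ((S t).det)⁻¹ • (S t).adjugate - 1 := fun t ht => by
    have h1 : (S t)⁻¹ = 1 + R t := Matrix.nonsing_inv_nonsing_inv _ (P.det_pos ht).ne'.isUnit
    rw [Matrix.inv_def, Ring.inverse_eq_inv'] at h1
    rw [h1]
    abel
  refine ContinuousOn.congr (ContinuousOn.sub (ContinuousOn.smul (ContinuousOn.inv₀
    ((continuous_id.matrix_det).comp_continuousOn hSc) hdet)
    ((continuous_id.matrix_adjugate).comp_continuousOn hSc)) continuousOn_const) hR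

theorem BoxData.continuousOn_exp_qform (P : BoxData U R) (m : ℕ) :
    ContinuousOn (fun p : (E → ℝ) × Phase Y m => Complex.exp (-qform (R p.1) p.2))
      (paramDomain E ×ˢ Set.univ) := by
  have hR : ∀ a b, ContinuousOn (fun p : (E → ℝ) × Phase Y m => (R p.1 a b : ℂ))
      (paramDomain E ×ˢ Set.univ) := fun a b =>
    Complex.continuous_ofReal.comp_continuousOn
      ((((continuous_apply_apply a b).comp_continuousOn P.continuousOn_form)).comp
        continuousOn_fst fun p hp => hp.1)
  refine ContinuousOn.cexp (ContinuousOn.neg (continuousOn_finsetSum _ fun k _ =>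
    continuousOn_finsetSum _ fun a _ => continuousOn_finsetSum _ fun b _ =>
      (hR a b).mul (by fun_prop)))

theorem BoxData.integrable_point (P : BoxData U R) {m : ℕ} {D : ℂ} (h0 : 0 < D.re)
    (h2 : D.re < 2) (x : Phase Y m) :
    Integrable (fun t => paramWeight U D t * Complex.exp (-qform (R t) x)) (cubeMeasure E) := by
  refine ((integrable_betaBound (E := E) (r := D.re / 2) (by linarith) (by linarith)).const_mul
    (P.κ ^ (-(D.re / 2)))).mono' (aestronglyMeasurable_of_continuousOn_cube
      ((P.continuousOn_paramWeight D).mul ((P.continuousOn_exp_qform m).comp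
        (f := fun t => (t, x)) (by fun_prop) fun t ht => ⟨ht, Set.mem_univ _⟩))) ?_
  filter_upwards [ae_mem_paramDomain] with t ht
  rw [norm_mul]
  exact (mul_le_of_le_one_right (norm_nonneg _) (norm_cexp_neg_qform_le (P.accretive t ht) x)).trans
    (P.norm_paramWeight_le h0 h2 ht)

theorem BoxData.integrable_prod (P : BoxData U R) {m : ℕ} {D : ℂ} (h0 : 0 < D.re)
    (h2 : D.re < 2) {f : Phase Y m → ℂ} (hf : Integrable f) :
    Integrable (fun p : (E → ℝ) × Phase Y m =>
      paramWeight U D p.1 * (Complex.exp (-qform (R p.1) p.2) * f p.2))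
      ((cubeMeasure E).prod volume) := by
  have hm : (cubeMeasure E).prod (volume : Measure (Phase Y m)) =
      (volume.prod volume).restrict (paramDomain E ×ˢ Set.univ) := by
    rw [← Measure.prod_restrict, Measure.restrict_univ, cubeMeasure_eq_restrict]
  have hs : MeasurableSet (paramDomain E ×ˢ (Set.univ : Set (Phase Y m))) :=
    measurableSet_paramDomain.prod MeasurableSet.univ
  have hc : AEStronglyMeasurable (fun p : (E → ℝ) × Phase Y m =>
      paramWeight U D p.1 * Complex.exp (-qform (R p.1) p.2)) ((cubeMeasure E).prod volume) := by
    rw [hm]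
    exact (((P.continuousOn_paramWeight D).comp continuousOn_fst fun p hp => hp.1).mul
      (P.continuousOn_exp_qform m)).aestronglyMeasurable hs
  have hmem : ∀ᵐ p ∂((cubeMeasure E).prod (volume : Measure (Phase Y m))), p.1 ∈ paramDomain E := by
    rw [hm]
    filter_upwards [ae_restrict_mem hs] with p hp using hp.1
  refine (((integrable_betaBound (E := E) (r := D.re / 2) (by linarith) (by linarith)).const_mul
    (P.κ ^ (-(D.re / 2)))).mul_prod hf.norm).mono' ?_ ?_
  · exact (hc.mul hf.aestronglyMeasurable.comp_snd).congr
      (Filter.Eventually.of_forall fun p => mul_assoc _ _ _)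
  · filter_upwards [hmem] with p hp
    rw [norm_mul, norm_mul]
    exact mul_le_mul (P.norm_paramWeight_le h0 h2 hp)
      (mul_le_of_le_one_left (norm_nonneg _) (norm_cexp_neg_qform_le (P.accretive _ hp) _))
      (by positivity) ((norm_nonneg _).trans (P.norm_paramWeight_le h0 h2 hp))

theorem BoxData.integrable_smeared (P : BoxData U R) {m : ℕ} {D : ℂ} (h0 : 0 < D.re)
    (h2 : D.re < 2) {f : Phase Y m → ℂ} (hf : Integrable f) :
    Integrable (fun t => paramWeight U D t * gaussInt (R t) f) (cubeMeasure E) := by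
  have := (P.integrable_prod h0 h2 hf).integral_prod_left
  simpa only [integral_const_mul, gaussInt] using this

end Integrability

/-! ### Meromorphic continuation of the smeared integral -/

section Continuation

theorem exists_clm_of_bound {F : Type*} [NormedAddCommGroup F] [NormedSpace ℝ F]
    {L : 𝓢(F, ℂ) → ℂ} (hL : ∀ (a : ℂ) (f g : 𝓢(F, ℂ)), L (a • f + g) = a * L f + L g)
    (hb : ∃ p ∈ schwartzBounds F, ∀ f, ‖L f‖ ≤ p f) :
    ∃ T : 𝓢(F, ℂ) →L[ℂ] ℂ, ∀ f, T f = L f := by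
  have h0 : L 0 = 0 := by
    have := hL 1 0 0
    simpa using this
  let L' : 𝓢(F, ℂ) →ₗ[ℂ] ℂ :=
    { toFun := L
      map_add' := fun f g => by simpa using hL 1 f g
      map_smul' := fun a f => by simpa [h0] using hL a f 0 }
  refine ⟨⟨L', continuous_of_continuousAt_zero L' ?_⟩, fun f => rfl⟩
  obtain ⟨p, ⟨q, hq, hpq⟩, hp⟩ := hb
  rw [ContinuousAt, map_zero]
  refine squeeze_zero_norm (fun f => (hp f).trans (hpq f)) ?_
  simpa using hq.tendsto 0

/-- The smeared parametric integral has a meromorphic continuation, with poles among the multiples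
of `1 / N`, where `N` depends on the set of lines only. -/
theorem exists_meromorphic_continuation (E : Type*) [Fintype E] [DecidableEq E] :
    ∃ N : ℕ, 0 < N ∧ ∀ (Y : Type*) [Fintype Y] [DecidableEq Y] (U : (E → ℝ) → ℝ)
      (R : (E → ℝ) → Matrix Y Y ℝ) (_ : BoxData U R) (m : ℕ),
      ∃ T : ℂ → 𝓢(Phase Y m, ℂ) →L[ℂ] ℂ,
        (∀ D : ℂ, 0 < D.re → D.re < 2 → ∀ f,
          T D f = ∫ t, paramWeight U D t * gaussInt (R t) f ∂(cubeMeasure E)) ∧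
        ∀ f, (∀ D, MeromorphicAt (fun D => T D f) D) ∧
          ∀ D ∉ poleSet N, AnalyticAt ℂ (fun D => T D f) D := by
  obtain ⟨K, _, A, hcov, hd, hA⟩ := exists_monoCover E
  -- The factorials make every positive integer up to a column sum of a chart divide `N`. Only the
  -- cover enters, so `N` is chosen before the polynomials are known.
  refine ⟨∏ k, ∏ j, (∑ e, A k e j).factorial,
    Finset.prod_pos fun k _ => Finset.prod_pos fun j _ => Nat.factorial_pos _,
    fun Y _ _ U R P m => ?_⟩
  have hN : 0 < ∏ k, ∏ j, (∑ e, A k e j).factorial :=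
    Finset.prod_pos fun k _ => Finset.prod_pos fun j _ => Nat.factorial_pos _
  have hdvd : ∀ k j, ∀ q : ℕ, 0 < q → q ≤ ∑ e, A k e j →
      q ∣ ∏ k, ∏ j, (∑ e, A k e j).factorial := fun k j q hq hle =>
    (Nat.dvd_factorial hq hle).trans ((Finset.dvd_prod_of_mem
      (fun j => (∑ e, A k e j).factorial) (Finset.mem_univ j)).trans
      (Finset.dvd_prod_of_mem (fun k => ∏ j, (∑ e, A k e j).factorial) (Finset.mem_univ k)))
  choose α ψ hα hψ hlin hleaf using fun (T : E → Bool) (k : K) =>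
    P.exists_leaf (hd k) (hA k) T m
  set κ := fun T k => chartSlope T (A k) (α T k)
  set l := fun T k => chartShift T (A k)
  have hnice : ∀ T k f n, Nice n (ψ T k f) := fun T k f n => (hψ T k n).apply f
  -- The candidate is the sum of the continued Mellin integrals over corners and charts, with `(1 /
  -- 2) ^ |E|` the Jacobian of the corner maps. Linearity and the seminorm bound make it a
  -- distribution for every `D`, poles included, since inverses of zero are read as zero.
  set L : ℂ → 𝓢(Phase Y m, ℂ) → ℂ := fun D f =>
    ∑ T, (1 / 2 : ℂ) ^ Fintype.card E * ∑ k, mellinExt (κ T k) (l T k) (ψ T k f) D with hLdef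
  have hL : ∀ D (a : ℂ) f g, L D (a • f + g) = a * L D f + L D g := by
    intro D a f g
    simp only [hLdef, Finset.mul_sum, ← Finset.sum_add_distrib]
    refine Finset.sum_congr rfl fun T _ => Finset.sum_congr rfl fun k _ => ?_
    rw [mellinExt_linear a 1 (hnice T k f) (hnice T k g) fun w hw => by
      rw [hlin T k a f g D w hw, one_mul]]
    ring
  have hb : ∀ D, ∃ p ∈ schwartzBounds (Phase Y m), ∀ f, ‖L D f‖ ≤ p f := by
    intro D
    have hB := isBoundFamily_schwartzBounds (F := Phase Y m)
    choose p hp hle using fun T k => mellinExt_bound hB (κ := κ T k) (l := l T k) (hψ T k) D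
    have hsum : ∀ {β : Type _} (s : Finset β) (q : β → 𝓢(Phase Y m, ℂ) → ℝ),
        (∀ b, q b ∈ schwartzBounds (Phase Y m)) → ∑ b ∈ s, q b ∈ schwartzBounds (Phase Y m) := by
      intro β s q hq
      exact Finset.sum_induction _ (· ∈ schwartzBounds (Phase Y m))
        (fun a b ha hb => hB.add a ha b hb) hB.zero fun b _ => hq b
    refine ⟨∑ x : (E → Bool) × K, (1 / 2 : ℝ) ^ Fintype.card E • p x.1 x.2,
      hsum _ _ fun x => hB.smul _ (by positivity) _ (hp _ _), fun f => ?_⟩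
    rw [Fintype.sum_prod_type, Finset.sum_apply]
    refine (norm_sum_le _ _).trans (Finset.sum_le_sum fun T _ => ?_)
    rw [Finset.sum_apply, norm_mul, norm_pow]
    simp only [Pi.smul_apply, smul_eq_mul, ← Finset.mul_sum]
    rw [show ‖(1 / 2 : ℂ)‖ = 1 / 2 by norm_num]
    refine mul_le_mul_of_nonneg_left ?_ (by positivity)
    exact (norm_sum_le _ _).trans (Finset.sum_le_sum fun k _ => hle T k f)
  choose T hT using fun D => exists_clm_of_bound (hL D) (hb D)
  refine ⟨T, fun D h0 h2 f => ?_, fun f => ⟨fun D => ?_, fun D hD => ?_⟩⟩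
  · have hinteg := P.integrable_smeared h0 h2 (f.integrable (μ := volume))
    obtain ⟨hc1, hc2⟩ := integral_eq_sum_corner hinteg
    rw [hT, hc2]
    refine Finset.sum_congr rfl fun S _ => ?_
    congr 1
    rw [(hcov.integral_eq (hc1 S)).2]
    refine Finset.sum_congr rfl fun k _ => ?_
    rw [mellinExt_eq_mellinCube (hnice S k f) (affExp_chart_re_pos (hd k) (hα S k) h0 h2),
      mellinCube]
    refine integral_congr_ae ?_
    filter_upwards [ae_mem_paramDomain] with w hw
    exact (hleaf S k f D w hw).symm
  · simp only [hT, hLdef]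
    exact MeromorphicAt.fun_sum fun S _ => (MeromorphicAt.const _ _).fun_mul
      (MeromorphicAt.fun_sum fun k _ => meromorphicAt_mellinExt (hnice S k f) D)
  · simp only [hT, hLdef]
    exact Finset.analyticAt_fun_sum _ fun S _ => analyticAt_const.fun_mul
      (Finset.analyticAt_fun_sum _ fun k _ => analyticAt_mellinExt (hnice S k f)
        fun j r => affExp_chart_add_ne_zero (hd k) (hα S k) hN (hdvd k) hD j r)

end Continuation

/-! ### Families of vectors as points of a Euclidean space -/

section Coordinates

variable {Y : Type*} [Fintype Y] {m : ℕ}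

/-- The coordinates of a family of vectors. -/
def phaseEquiv (Y : Type*) [Fintype Y] (m : ℕ) : (Y → Pos m) ≃L[ℝ] Phase Y m :=
  LinearEquiv.toContinuousLinearEquiv
    { toFun := fun x => WithLp.toLp 2 fun q => x q.1 q.2
      invFun := fun x a => WithLp.toLp 2 fun p => x (a, p)
      map_add' := fun x y => by ext q; rfl
      map_smul' := fun c x => by ext q; rfl
      left_inv := fun x => rfl
      right_inv := fun x => rfl }

theorem phaseEquiv_apply (x : Y → Pos m) (a : Y) (p : Fin m × Fin 2) :
    phaseEquiv Y m x (a, p) = x a p := rfl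

theorem measurePreserving_uncurry (Y F : Type*) [Fintype Y] [Fintype F] :
    MeasurePreserving (fun x : Y → F → ℝ => fun q : Y × F => x q.1 q.2) where
  measurable := by fun_prop
  map_eq := by
    refine (Measure.pi_eq fun s hs => ?_).symm
    rw [Measure.map_apply (by fun_prop) (MeasurableSet.univ_pi hs)]
    have h : (fun x : Y → F → ℝ => fun q : Y × F => x q.1 q.2) ⁻¹' Set.univ.pi s =
        Set.univ.pi fun y => Set.univ.pi fun f => s (y, f) := by
      ext x
      simp
    rw [h, volume_pi_pi, Fintype.prod_prod_type]
    simp only [volume_pi_pi]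

theorem measurePreserving_phaseEquiv : MeasurePreserving (phaseEquiv Y m) :=
  ((PiLp.volume_preserving_toLp _).comp (measurePreserving_uncurry Y (Fin m × Fin 2))).comp
    (volume_preserving_pi fun _ => PiLp.volume_preserving_ofLp _)

theorem measurableEmbedding_phaseEquiv : MeasurableEmbedding (phaseEquiv Y m) :=
  (phaseEquiv Y m).toHomeomorph.measurableEmbedding

/-- Summed over the symplectic pairs, the product of `z̄ a` and `z b` has real part `x a ⬝ x b` and
imaginary part `x a ∧ x b`. -/
theorem sum_invariants_eq_qform {X : Type*} [Fintype X]
    (R : Matrix (ExtVar X) (ExtVar X) ℝ) (x : ExtVar X → Pos m) :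
    ∑ a, ∑ b, (R a b : ℂ) * (((invariants x).1 a b : ℂ) + Complex.I * ((invariants x).2 a b : ℂ)) =
      qform R (phaseEquiv _ m x) := by
  rw [qform, Finset.sum_comm (s := (Finset.univ : Finset (Fin m)))]
  refine Finset.sum_congr rfl fun a _ => ?_
  rw [Finset.sum_comm (s := (Finset.univ : Finset (Fin m)))]
  refine Finset.sum_congr rfl fun b _ => ?_
  rw [← Finset.mul_sum]
  congr 1
  simp only [invariants, wedge, PiLp.inner_apply, Fintype.sum_prod_type, Fin.sum_univ_two,
    zc_apply, zbar_apply, phaseEquiv_apply]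
  push_cast
  rw [Finset.mul_sum, ← Finset.sum_add_distrib]
  refine Finset.sum_congr rfl fun k _ => ?_
  simp only [RCLike.inner_apply, conj_trivial]
  push_cast
  ring_nf
  rw [Complex.I_sq]
  ring

end Coordinates

/-! ### Pull-back of test functions along the invariants -/

section Temperate

variable {F G : Type*} [NormedAddCommGroup F] [NormedSpace ℝ F] [NormedAddCommGroup G]
  [NormedSpace ℝ G]

theorem hasTemperateGrowth_pi {ι : Type*} [Fintype ι] {f : F → ι → G}
    (h : ∀ i, (fun x => f x i).HasTemperateGrowth) : f.HasTemperateGrowth := by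
  classical
  have e : f = fun x => ∑ i, ContinuousLinearMap.single ℝ (fun _ : ι => G) i (f x i) := by
    funext x j
    simp [Finset.sum_apply, Pi.single_apply]
  rw [e]
  exact Function.HasTemperateGrowth.sum fun i _ =>
    (ContinuousLinearMap.hasTemperateGrowth _).comp (h i)

theorem hasTemperateGrowth_prod {H : Type*} [NormedAddCommGroup H] [NormedSpace ℝ H] {f : F → G}
    {g : F → H} (hf : f.HasTemperateGrowth) (hg : g.HasTemperateGrowth) :
    (fun x => (f x, g x)).HasTemperateGrowth := by
  have e : (fun x => (f x, g x)) = fun x => ContinuousLinearMap.inl ℝ G H (f x) +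
      ContinuousLinearMap.inr ℝ G H (g x) := by
    funext x
    simp
  rw [e]
  exact ((ContinuousLinearMap.hasTemperateGrowth _).comp hf).add
    ((ContinuousLinearMap.hasTemperateGrowth _).comp hg)

variable {X : Type*} [Fintype X] {m : ℕ}

theorem hasTemperateGrowth_coord (a : ExtVar X) (p : Fin m × Fin 2) :
    (fun x : ExtVar X → Pos m => x a p).HasTemperateGrowth :=
  ((EuclideanSpace.proj p).comp
    (ContinuousLinearMap.proj (R := ℝ) (φ := fun _ : ExtVar X => Pos m) a)).hasTemperateGrowth

theorem hasTemperateGrowth_invariants :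
    (invariants : (ExtVar X → Pos m) → Invariants X).HasTemperateGrowth := by
  refine hasTemperateGrowth_prod (hasTemperateGrowth_pi fun a => hasTemperateGrowth_pi fun b => ?_)
    (hasTemperateGrowth_pi fun a => hasTemperateGrowth_pi fun b => ?_)
  · simp only [PiLp.inner_apply, RCLike.inner_apply, conj_trivial]
    exact Function.HasTemperateGrowth.sum fun p _ =>
      (hasTemperateGrowth_coord b p).mul (hasTemperateGrowth_coord a p)
  · simp only [wedge]
    exact Function.HasTemperateGrowth.sum fun k _ =>
      ((hasTemperateGrowth_coord a (k, 0)).mul (hasTemperateGrowth_coord b (k, 1))).sub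
        ((hasTemperateGrowth_coord a (k, 1)).mul (hasTemperateGrowth_coord b (k, 0)))

/-- The squared lengths `x a ⬝ x a` are among the invariants, so large vectors have large
invariants. Together with temperate growth this makes composition with the invariants map Schwartz
functions to Schwartz functions. -/
theorem norm_le_one_add_norm_invariants (x : ExtVar X → Pos m) :
    ‖x‖ ≤ 1 * (1 + ‖invariants x‖) ^ 1 := by
  rw [one_mul, pow_one, pi_norm_le_iff_of_nonneg (by positivity)]
  intro a
  have h1 : ‖x a‖ ^ 2 ≤ ‖invariants x‖ := by
    rw [← real_inner_self_eq_norm_sq]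
    calc inner ℝ (x a) (x a) ≤ ‖(invariants x).1 a a‖ := Real.le_norm_self _
      _ ≤ ‖(invariants x).1 a‖ := norm_le_pi_norm _ _
      _ ≤ ‖(invariants x).1‖ := norm_le_pi_norm _ _
      _ ≤ ‖invariants x‖ := norm_fst_le _
  nlinarith [sq_nonneg (‖x a‖ - 1), norm_nonneg (invariants x)]

end Temperate

/-! ### The amplitude in terms of the abstract parametric integral -/

section Assembly

variable {V E X : Type*} [Fintype V] [DecidableEq V] [Fintype E] [DecidableEq E] [Fintype X]

theorem differentiable_prefactor (E : Type*) [Fintype E] {Ω θ : ℝ} (hΩ : 0 < Ω) (hθ : 0 < θ)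
    (root : V) : Differentiable ℂ (prefactor E Ω θ root) := by
  have h : ∀ c : ℝ, 0 < c → ∀ g : ℂ → ℂ, Differentiable ℂ g →
      Differentiable ℂ fun D => (c : ℂ) ^ g D := fun c hc g hg =>
    hg.const_cpow (Or.inl (by exact_mod_cast hc.ne'))
  have h1 : 0 < OmegaTilde Ω θ := by unfold OmegaTilde; positivity
  unfold prefactor
  refine ((Differentiable.pow ((h _ h1 _ (by fun_prop)).const_mul 2 |>.mul
    (h _ (by positivity) _ (by fun_prop))) _).mul (Differentiable.pow
    (h _ (by positivity) _ (by fun_prop)) _)).mul (Differentiable.pow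
    (h _ Real.pi_pos _ (by fun_prop)) _)

theorem exists_boxData [DecidableEq X] {G : FeynmanGraph V E X} (hG : G.Connected) {M : Model}
    {Ω θ : ℝ} (hΩ : 0 < Ω) (hθ : 0 < θ) (hM : M = Model.LSZ → Ω ≠ 1) (root : V) :
    Nonempty (BoxData (HU M Ω θ G root) (extForm M Ω θ G root)) := by
  obtain ⟨κ, c, d, n, hκ, hc, hd, hn, h⟩ := exists_boxPoly_representation hG hΩ hθ hM root
  exact ⟨κ, c, d, n, hκ, hc, hd, hn, fun t ht => (h t ht).1, fun t ht => (h t ht).2.1,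
    fun t ht => (h t ht).2.2.1, fun t ht => (h t ht).2.2.2.1, fun t ht => (h t ht).2.2.2.2⟩

theorem paramIntegrand_eq {M : Model} {Ω θ : ℝ} {G : FeynmanGraph V E X} {root : V} {m : ℕ}
    {t : E → ℝ} (hU : 0 < HU M Ω θ G root t) (D : ℂ) (x : ExtVar X → Pos m) :
    paramIntegrand M Ω θ G root D (invariants x) t = paramWeight (HU M Ω θ G root) D t *
      Complex.exp (-qform (extForm M Ω θ G root t) (phaseEquiv _ m x)) := by
  have hU' : (HU M Ω θ G root t : ℂ) ≠ 0 := by exact_mod_cast hU.ne'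
  rw [paramIntegrand, paramWeight, HV, mul_div_cancel_left₀ _ hU', sum_invariants_eq_qform]

theorem amplitude_mul_eq [DecidableEq X] {M : Model} {Ω θ : ℝ} {G : FeynmanGraph V E X} {root : V}
    (P : BoxData (HU M Ω θ G root) (extForm M Ω θ G root)) {m : ℕ} (D : ℂ)
    (f : (ExtVar X → Pos m) → ℂ) (x : ExtVar X → Pos m) :
    amplitude M Ω θ G root D (invariants x) * f x = prefactor E Ω θ root D *
      ∫ t, paramWeight (HU M Ω θ G root) D t *
        (Complex.exp (-qform (extForm M Ω θ G root t) (phaseEquiv _ m x)) *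
          f ((phaseEquiv _ m).symm (phaseEquiv _ m x))) ∂(cubeMeasure E) := by
  rw [amplitude, mul_assoc, ← integral_mul_const, cubeMeasure_eq_restrict]
  congr 1
  refine setIntegral_congr_fun measurableSet_paramDomain fun t ht => ?_
  beta_reduce
  rw [paramIntegrand_eq (P.U_pos ht), ContinuousLinearEquiv.symm_apply_apply, mul_assoc]

end Assembly

end NCQFT

end

theorem mainTheorem2 {V E X : Type*} [Fintype V] [DecidableEq V] [Fintype E] [DecidableEq E]
    [Fintype X] (G : NCQFT.FeynmanGraph V E X) (hG : G.Connected) :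
    -- the set of possible singularities depends on the graph only
    ∃ S : Set ℂ, S ⊆ Set.range (fun q : ℚ => (q : ℂ)) ∧ IsClosed S ∧ IsDiscrete S ∧
      ∀ (M : NCQFT.Model) (Ω θ : ℝ), 0 < Ω → 0 < θ → (M = NCQFT.Model.LSZ → Ω ≠ 1) →
      ∀ (root : V) (m : ℕ),
        -- the first polynomial is positive, and for `0 < Re D < 2` the parametric integral converges for all invariants of
        -- external vectors in `ℝ^{2m}`
        (∀ t ∈ NCQFT.paramDomain E, 0 < NCQFT.HU M Ω θ G root t) ∧
        (∀ D : ℂ, 0 < D.re → D.re < 2 → ∀ x : NCQFT.ExtVar X → NCQFT.Pos m,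
          MeasureTheory.IntegrableOn
            (NCQFT.paramIntegrand M Ω θ G root D (NCQFT.invariants x)) (NCQFT.paramDomain E)) ∧
        -- the amplitude smeared against test functions of the external vectors
        (∃ T : ℂ → 𝓢'(NCQFT.ExtVar X → NCQFT.Pos m, ℂ),
          (∀ D : ℂ, 0 < D.re → D.re < 2 → ∀ f : 𝓢(NCQFT.ExtVar X → NCQFT.Pos m, ℂ),
            MeasureTheory.Integrable (fun x : NCQFT.ExtVar X → NCQFT.Pos m =>
              NCQFT.amplitude M Ω θ G root D (NCQFT.invariants x) * f x) ∧
            T D f = ∫ x : NCQFT.ExtVar X → NCQFT.Pos m,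
              NCQFT.amplitude M Ω θ G root D (NCQFT.invariants x) * f x) ∧
          NCQFT.IsTemperedMeromorphic S T) ∧
        -- the amplitude smeared against test functions of the external invariants
        (∃ T : ℂ → 𝓢'(NCQFT.Invariants X, ℂ),
          (∀ D : ℂ, 0 < D.re → D.re < 2 → ∀ g : 𝓢(NCQFT.Invariants X, ℂ),
            MeasureTheory.Integrable (fun x : NCQFT.ExtVar X → NCQFT.Pos m =>
              NCQFT.amplitude M Ω θ G root D (NCQFT.invariants x) * g (NCQFT.invariants x)) ∧
            T D g = ∫ x : NCQFT.ExtVar X → NCQFT.Pos m,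
              NCQFT.amplitude M Ω θ G root D (NCQFT.invariants x) * g (NCQFT.invariants x)) ∧
          NCQFT.IsTemperedMeromorphic S T) := by
  classical
  -- `N`, and with it the singular set, is fixed by the set of lines before the model, the
  -- constants, the root and the dimension are introduced.
  obtain ⟨N, hN, hcont⟩ := NCQFT.exists_meromorphic_continuation E
  refine ⟨NCQFT.poleSet N, NCQFT.poleSet_subset N, NCQFT.isClosed_poleSet hN,
    NCQFT.isDiscrete_poleSet hN, fun M Ω θ hΩ hθ hM root m => ?_⟩
  obtain ⟨P⟩ := NCQFT.exists_boxData hG hΩ hθ hM root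
  obtain ⟨T, hT, hmer⟩ := hcont _ _ _ P m
  have hpre : ∀ D, AnalyticAt ℂ (NCQFT.prefactor E Ω θ root) D :=
    fun D => (NCQFT.differentiable_prefactor E hΩ hθ root).analyticAt D
  let C : 𝓢(NCQFT.ExtVar X → NCQFT.Pos m, ℂ) →L[ℂ] 𝓢(NCQFT.Phase (NCQFT.ExtVar X) m, ℂ) :=
    SchwartzMap.compCLMOfContinuousLinearEquiv ℂ (NCQFT.phaseEquiv _ m).symm
  -- The distribution in the invariants is the one in the vectors, evaluated at the pulled-back test
  -- function; the whole second statement is the first one composed with `J`.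
  let J : 𝓢(NCQFT.Invariants X, ℂ) →L[ℂ] 𝓢(NCQFT.ExtVar X → NCQFT.Pos m, ℂ) :=
    SchwartzMap.compCLM ℂ NCQFT.hasTemperateGrowth_invariants
      ⟨1, 1, NCQFT.norm_le_one_add_norm_invariants⟩
  have hval : ∀ D : ℂ, 0 < D.re → D.re < 2 → ∀ f : 𝓢(NCQFT.ExtVar X → NCQFT.Pos m, ℂ),
      MeasureTheory.Integrable (fun x => NCQFT.amplitude M Ω θ G root D (NCQFT.invariants x) * f x) ∧
      NCQFT.prefactor E Ω θ root D * T D (C f) =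
        ∫ x, NCQFT.amplitude M Ω θ G root D (NCQFT.invariants x) * f x := by
    intro D h0 h2 f
    -- Joint integrability in parameters and vectors gives integrability of the smeared amplitude
    -- and, by Fubini, its equality with the parametric integral of the Gaussian integrals.
    have hinteg := P.integrable_prod h0 h2 ((C f).integrable (μ := MeasureTheory.volume))
    simp only [NCQFT.amplitude_mul_eq P D f]
    refine ⟨((NCQFT.measurePreserving_phaseEquiv.integrable_comp_emb
      NCQFT.measurableEmbedding_phaseEquiv).2 hinteg.integral_prod_right).const_mul _, ?_⟩
    rw [MeasureTheory.integral_const_mul, hT D h0 h2]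
    congr 1
    have hcomp := NCQFT.measurePreserving_phaseEquiv.integral_comp
      NCQFT.measurableEmbedding_phaseEquiv (fun y : NCQFT.Phase (NCQFT.ExtVar X) m =>
        ∫ t, NCQFT.paramWeight (NCQFT.HU M Ω θ G root) D t *
          (Complex.exp (-NCQFT.qform (NCQFT.extForm M Ω θ G root t) y) *
            C f y) ∂(NCQFT.cubeMeasure E))
    refine Eq.trans ?_ hcomp.symm
    rw [← MeasureTheory.integral_integral_swap hinteg]
    simp only [MeasureTheory.integral_const_mul, NCQFT.gaussInt]
  have hmero : ∀ f : 𝓢(NCQFT.ExtVar X → NCQFT.Pos m, ℂ),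
      MeromorphicOn (fun D => NCQFT.prefactor E Ω θ root D * T D (C f)) Set.univ ∧
      AnalyticOnNhd ℂ (fun D => NCQFT.prefactor E Ω θ root D * T D (C f)) (NCQFT.poleSet N)ᶜ :=
    fun f => ⟨fun D _ => (hpre D).meromorphicAt.fun_mul ((hmer (C f)).1 D),
      fun D hD => (hpre D).fun_mul ((hmer (C f)).2 D hD)⟩
  refine ⟨fun t ht => P.U_pos ht, fun D h0 h2 x => ?_, ?_, ?_⟩
  · rw [MeasureTheory.IntegrableOn, ← NCQFT.cubeMeasure_eq_restrict]
    refine (P.integrable_point h0 h2 (NCQFT.phaseEquiv _ m x)).congr ?_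
    filter_upwards [NCQFT.ae_mem_paramDomain] with t ht
    exact (NCQFT.paramIntegrand_eq (P.U_pos ht) D x).symm
  · exact ⟨fun D => ContinuousLinearMap.toPointwiseConvergenceCLM ℂ (RingHom.id ℂ) _ _
      (NCQFT.prefactor E Ω θ root D • (T D).comp C), hval, hmero⟩
  · exact ⟨fun D => ContinuousLinearMap.toPointwiseConvergenceCLM ℂ (RingHom.id ℂ) _ _
      (NCQFT.prefactor E Ω θ root D • (T D).comp (C.comp J)), fun D h0 h2 g => hval D h0 h2 (J g),
      fun g => hmero (J g)⟩
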